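/- Let $M$ be a smooth 4-manifold. A \emph{para-Kähler–Einstein (pKE) structure} $(g,K)$ on $M$ consists of a smooth non-degenerate symmetric bilinear form $g$ and a smooth endomorphism $K$ of $TM$ such that $K^2=\mathrm{id}$, the eigendistributions of $K$ for $\pm1$ have rank 2 and are integrable, $g(KX,KY)=-g(X,Y)$ (so $g$ has signature $(2,2)$), the 2-form $\rho(X,Y)=g(KX,Y)$ is closed, and the trace-free Ricci tensor of $g$ vanishes. An \emph{adapted null frame} at $x\in M$ is a basis $(e_1,e_2,\bar e_1,\bar e_2)$ of $T_xM$ with $g(e_i,e_j)=g(\bar e_i,\bar e_j)=0$, $g(e_i,\bar e_j)=\delta_{ij}$, $Ke_i=e_i$, $K\bar e_i=-\bar e_i$; $\mathbf{GL}_2(\mathbb R)$ acts on such frames from the right by $(e,\bar e)\mapsto (eA,\bar e(A^{T})^{-1})$. Orient $M$ by declaring the dual coframes $(\alpha^1,\alpha^2,\bar\alpha^1,\bar\alpha^2)$ positive. Let $C$ be the Weyl tensor of $g$, $Weyl^-$ its anti-self-dual part, and $\Psi_2'=C(e_1,e_2,\bar e_1,\bar e_2)$ in any adapted frame. Regard $\mathbf{GL}_2(\mathbb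 R)$ as a subgroup of $\mathbf{SL}_3(\mathbb R)$ by $A\mapsto(\det A)^{-1/3}\,\mathrm{diag}(A,1)$. A \emph{Cartan geometry of type $(\mathbf{SL}_3(\mathbb R),\mathbf{GL}_2(\mathbb R))$} over $M$ is a smooth principal $\mathbf{GL}_2(\mathbb R)$-bundle $P\to M$ with a smooth $\mathfrak{sl}_3(\mathbb R)$-valued 1-form $\mathcal A$ such that $\mathcal A_p:T_pP\to\mathfrak{sl}_3(\mathbb R)$ is a linear isomorphism for all $p$, $R_h^*\mathcal A=\mathrm{Ad}(h^{-1})\circ\mathcal A$ for $h\in\mathbf{GL}_2(\mathbb R)$, and $\mathcal A(X_v)=v$ for the fundamental vector field $X_v$ of each $v\in\mathfrak{gl}_2(\mathbb R)\subset\mathfrak{sl}_3(\mathbb R)$. Its curvature is $K_{\mathcal A}=d\mathcal A+\mathcal A\wedge\mathcal A$, and it is \emph{flat} if $K_{\mathcal A}=0$. \textbf{Theorem.} (1) Every pKE 4-manifold $(M,g,K)$ defines a Cartan geometry of type $(\mathbf{SL}_3(\mathbb R),\mathbf{GL}_2(\mathbb R))$ whose structure bundle $\mathbf{GL}_2(\mathbb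 R)\to\mathcal F^8\to M$ is the bundle of adapted null frames and whose Cartan connection is $$\mathcal A=\begin{pmatrix}\Gamma-\tfrac13\mathrm{Tr}(\Gamma)\,\mathrm{id}&\alpha\\ \bar\alpha&-\tfrac13\mathrm{Tr}(\Gamma)\end{pmatrix}.$$ Here $\alpha=(\alpha^1,\alpha^2)^T$ and $\bar\alpha=(\bar\alpha^1,\bar\alpha^2)$ are the tautological 1-forms on $\mathcal F^8$, and $\Gamma$ is the $\mathfrak{gl}_2(\mathbb R)$-valued Levi-Civita connection form, determined by $d\alpha^i=-\Gamma^i{}_j\wedge\alpha^j$ and $d\bar\alpha^j=\Gamma^i{}_j\wedge\bar\alpha^i$. (2) This Cartan geometry is flat if and only if $\Psi_2'=1$ and $Weyl^-=0$ on $M$; equivalently, if and only if $\mathrm{Ric}(g)=-3g$ and $Weyl^-=0$. (3) The dancing metric, that is, the structure $$g=\frac{2\,da\,\big((y-b)\,dx-x\,dy\big)+2\,db\,\big(a\,dx-dy\big)}{(b+ax-y)^2},\qquad K=\partial_a\otimes da+\partial_b\otimes db-\partial_x\otimes dx-\partial_y\otimes dy$$ on $\{(a,b,x,y)\in\mathbb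 R^4: b+ax-y\neq0\}$ (symmetric products, $\alpha\beta=\tfrac12(\alpha\otimes\beta+\beta\otimes\alpha)$), is pKE. The Cartan geometry of a pKE 4-manifold $(M,g,K)$ is flat if and only if $(M,g,K)$ is locally equivalent to it, i.e. every point of $M$ has an open neighbourhood diffeomorphic to an open subset of this domain by a diffeomorphism that preserves the metric and $K$. -/

import Mathlib

open scoped Manifold ContDiff Topology
open Bundle

universe u

noncomputable section

namespace PKE

/-- The model space of the base manifolds. -/
abbrev E4 : Type := EuclideanSpace ℝ (Fin 4)

/-- Real square matrices. -/
abbrev Mat (n : ℕ) : Type := Matrix (Fin n) (Fin n) ℝ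

/-- The group `GL₂(ℝ)` of invertible real `2 × 2` matrices. -/
abbrev GL2 : Type := (Mat 2)ˣ

/-- The vector space of real `2 × 2` matrices, as a normed space of families of entries. -/
abbrev E22 : Type := Fin 2 → Fin 2 → ℝ

/-- The entries of an invertible matrix. -/
def gl2Entries (a : GL2) : E22 := fun i j => (a : Mat 2) i j

section

open scoped Matrix.Norms.Operator

theorem isOpenEmbedding_gl2Entries : Topology.IsOpenEmbedding gl2Entries :=
  (Units.isOpenEmbedding_val : Topology.IsOpenEmbedding (Units.val : GL2 → Mat 2))

end

/-- The standard smooth structure of `GL₂(ℝ)`, as an open subset of the space of matrices. -/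
instance : ChartedSpace E22 GL2 := isOpenEmbedding_gl2Entries.singletonChartedSpace

instance : IsManifold 𝓘(ℝ, E22) ∞ GL2 := isOpenEmbedding_gl2Entries.isManifold_singleton

/-! ### Exterior derivatives on manifolds without boundary

The tangent space at `x` is identified with the model space through the preferred chart at `x`; the
exterior derivative at `x` is computed in that chart. The conventions are
`dθ(v, w) = v θ(w) - w θ(v) - θ([v, w])` and `(α ∧ β)(v, w) = α(v) β(w) - α(w) β(v)`. -/

section Forms

variable {E : Type*} [NormedAddCommGroup E] [NormedSpace ℝ E]
  {N : Type*} [TopologicalSpace N] [ChartedSpace E N] [IsManifold 𝓘(ℝ, E) ∞ N]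

/-- The differential of the inverse of the preferred chart at `x`, at the point `y` of its
target. -/
def chartInvDeriv (x : N) (y : E) :
    E →L[ℝ] TangentSpace 𝓘(ℝ, E) ((extChartAt 𝓘(ℝ, E) x).symm y) :=
  mfderiv 𝓘(ℝ, E) 𝓘(ℝ, E) (extChartAt 𝓘(ℝ, E) x).symm y

/-- A `1`-form written in the preferred chart at `x`. -/
def oneFormInChart (θ : ∀ p : N, TangentSpace 𝓘(ℝ, E) p →L[ℝ] ℝ) (x : N) (y : E) : E →L[ℝ] ℝ :=
  (θ ((extChartAt 𝓘(ℝ, E) x).symm y)).comp (chartInvDeriv x y)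

/-- A bilinear form (a metric or a `2`-form) written in the preferred chart at `x`. -/
def bilinInChart
    (B : ∀ p : N, TangentSpace 𝓘(ℝ, E) p →L[ℝ] TangentSpace 𝓘(ℝ, E) p →L[ℝ] ℝ)
    (x : N) (y : E) : E →L[ℝ] E →L[ℝ] ℝ :=
  ContinuousLinearMap.bilinearComp (E := E) (F := E) (G := ℝ) (E' := E) (F' := E)
    (B ((extChartAt 𝓘(ℝ, E) x).symm y)) (chartInvDeriv x y) (chartInvDeriv x y)

/-- The exterior derivative of a `1`-form. -/
def dOne (θ : ∀ p : N, TangentSpace 𝓘(ℝ, E) p →L[ℝ] ℝ) (x : N)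
    (v w : TangentSpace 𝓘(ℝ, E) x) : ℝ :=
  fderiv ℝ (oneFormInChart θ x) (extChartAt 𝓘(ℝ, E) x x) v w
    - fderiv ℝ (oneFormInChart θ x) (extChartAt 𝓘(ℝ, E) x x) w v

/-- The exterior derivative of a `2`-form. -/
def dTwo (ρ : ∀ p : N, TangentSpace 𝓘(ℝ, E) p →L[ℝ] TangentSpace 𝓘(ℝ, E) p →L[ℝ] ℝ) (x : N)
    (v₁ v₂ v₃ : TangentSpace 𝓘(ℝ, E) x) : ℝ :=
  fderiv ℝ (bilinInChart ρ x) (extChartAt 𝓘(ℝ, E) x x) v₁ v₂ v₃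
    - fderiv ℝ (bilinInChart ρ x) (extChartAt 𝓘(ℝ, E) x x) v₂ v₁ v₃
    + fderiv ℝ (bilinInChart ρ x) (extChartAt 𝓘(ℝ, E) x x) v₃ v₁ v₂

/-- A distribution is involutive (integrable) if the Lie bracket of two smooth local sections is
a section. -/
def IsInvolutive (D : ∀ p : N, Submodule ℝ (TangentSpace 𝓘(ℝ, E) p)) : Prop :=
  ∀ (U : Set N) (X Y : ∀ p : N, TangentSpace 𝓘(ℝ, E) p), IsOpen U →
    ContMDiffOn 𝓘(ℝ, E) 𝓘(ℝ, E).tangent ∞ (fun p => (⟨p, X p⟩ : TangentBundle 𝓘(ℝ, E) N)) U →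
    ContMDiffOn 𝓘(ℝ, E) 𝓘(ℝ, E).tangent ∞ (fun p => (⟨p, Y p⟩ : TangentBundle 𝓘(ℝ, E) N)) U →
    (∀ p ∈ U, X p ∈ D p ∧ Y p ∈ D p) →
    ∀ p ∈ U, VectorField.mlieBracket 𝓘(ℝ, E) X Y p ∈ D p

end Forms

/-! ### Levi-Civita connection and curvature of a metric in coordinates of `ℝ⁴` -/

section Coordinates

/-- The standard basis of the model space. -/
def basisVec (i : Fin 4) : E4 := EuclideanSpace.single i 1

variable (G : E4 → E4 →L[ℝ] E4 →L[ℝ] ℝ)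

/-- The coordinate components `g_{ij}` of a metric. -/
def gram (y : E4) : Mat 4 := Matrix.of fun i j => G y (basisVec i) (basisVec j)

/-- `∂ₖ g_{ij}`. -/
def dGram (y : E4) (k i j : Fin 4) : ℝ := fderiv ℝ (fun z => gram G z i j) y (basisVec k)

/-- Christoffel symbols of the Levi-Civita connection, `Γ^k_{ij}`. -/
def christoffel (y : E4) (k i j : Fin 4) : ℝ :=
  (1 / 2) * ∑ l, (gram G y)⁻¹ k l * (dGram G y i j l + dGram G y j i l - dGram G y l i j)

/-- Riemann curvature `R^a_{bcd}`. -/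
def riemann (y : E4) (a b c d : Fin 4) : ℝ :=
  fderiv ℝ (fun z => christoffel G z a d b) y (basisVec c)
    - fderiv ℝ (fun z => christoffel G z a c b) y (basisVec d)
    + ∑ e, (christoffel G y a c e * christoffel G y e d b
        - christoffel G y a d e * christoffel G y e c b)

/-- `R_{abcd} = g_{ae} R^e_{bcd}`. -/
def riemannLow (y : E4) (a b c d : Fin 4) : ℝ := ∑ e, gram G y a e * riemann G y e b c d

/-- Ricci curvature `R_{ab} = R^c_{acb}`. -/
def ricciCoord (y : E4) (a b : Fin 4) : ℝ := ∑ c, riemann G y c a c b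

/-- Scalar curvature `R = g^{ab} R_{ab}`. -/
def scalarCoord (y : E4) : ℝ := ∑ a, ∑ b, (gram G y)⁻¹ a b * ricciCoord G y a b

/-- Schouten tensor `P_{ab} = R_{ab} / 2 - R g_{ab} / 12` (dimension four). -/
def schoutenCoord (y : E4) (a b : Fin 4) : ℝ :=
  (1 / 2) * ricciCoord G y a b - (1 / 12) * scalarCoord G y * gram G y a b

/-- Weyl tensor `C_{abcd}`. -/
def weylCoord (y : E4) (a b c d : Fin 4) : ℝ :=
  riemannLow G y a b c d
    + gram G y a d * schoutenCoord G y c b - gram G y a c * schoutenCoord G y d b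
    + gram G y b c * schoutenCoord G y d a - gram G y b d * schoutenCoord G y c a

end Coordinates

/-! ### Para-Kähler-Einstein structures -/

section Structures

variable {M : Type*} [TopologicalSpace M] [ChartedSpace E4 M] [IsManifold 𝓘(ℝ, E4) ∞ M]

/-- A field of bilinear forms on the tangent spaces. -/
abbrev BilinField (M : Type*) [TopologicalSpace M] [ChartedSpace E4 M] :=
  ∀ x : M, TangentSpace 𝓘(ℝ, E4) x →L[ℝ] TangentSpace 𝓘(ℝ, E4) x →L[ℝ] ℝ

/-- A field of endomorphisms of the tangent spaces. -/
abbrev EndField (M : Type*) [TopologicalSpace M] [ChartedSpace E4 M] :=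
  ∀ x : M, TangentSpace 𝓘(ℝ, E4) x →L[ℝ] TangentSpace 𝓘(ℝ, E4) x

/-- The coordinates of a tangent vector at `x` in the preferred chart at `x`. -/
def tcoord {x : M} (v : TangentSpace 𝓘(ℝ, E4) x) (i : Fin 4) : ℝ := (show E4 from v) i

/-- The Ricci tensor of `g` at `x`. -/
def ricci (g : BilinField M) (x : M) (v w : TangentSpace 𝓘(ℝ, E4) x) : ℝ :=
  ∑ a, ∑ b, ricciCoord (bilinInChart g x) (extChartAt 𝓘(ℝ, E4) x x) a b * tcoord v a * tcoord w b

/-- The scalar curvature of `g` at `x`. -/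
def scalarCurv (g : BilinField M) (x : M) : ℝ :=
  scalarCoord (bilinInChart g x) (extChartAt 𝓘(ℝ, E4) x x)

/-- The Weyl tensor of `g` at `x`, with all indices down. -/
def weyl (g : BilinField M) (x : M) (v₁ v₂ v₃ v₄ : TangentSpace 𝓘(ℝ, E4) x) : ℝ :=
  ∑ a, ∑ b, ∑ c, ∑ d, weylCoord (bilinInChart g x) (extChartAt 𝓘(ℝ, E4) x x) a b c d
    * tcoord v₁ a * tcoord v₂ b * tcoord v₃ c * tcoord v₄ d

/-- The eigendistribution of `K` for the eigenvalue `ε`. -/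
def eigenDist (K : EndField M) (ε : ℝ) (x : M) : Submodule ℝ (TangentSpace 𝓘(ℝ, E4) x) :=
  Module.End.eigenspace (K x : TangentSpace 𝓘(ℝ, E4) x →ₗ[ℝ] TangentSpace 𝓘(ℝ, E4) x) ε

/-- Smooth almost para-Hermitian structures `(g, K)` on a `4`-manifold. The split signature of `g`
is forced by the compatibility condition together with non-degeneracy. -/
structure IsAlmostParaHermitian (g : BilinField M) (K : EndField M) : Prop where
  smooth_metric : ContMDiff 𝓘(ℝ, E4) (𝓘(ℝ, E4).prod 𝓘(ℝ, E4 →L[ℝ] E4 →L[ℝ] ℝ)) ∞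
    (fun x => TotalSpace.mk' (E4 →L[ℝ] E4 →L[ℝ] ℝ)
      (E := fun x : M => TangentSpace 𝓘(ℝ, E4) x →L[ℝ] TangentSpace 𝓘(ℝ, E4) x →L[ℝ] ℝ) x (g x))
  smooth_end : ContMDiff 𝓘(ℝ, E4).tangent 𝓘(ℝ, E4).tangent ∞
    (fun v : TangentBundle 𝓘(ℝ, E4) M => (⟨v.1, K v.1 v.2⟩ : TangentBundle 𝓘(ℝ, E4) M))
  symm : ∀ x v w, g x v w = g x w v
  nondegenerate : ∀ x v, (∀ w, g x v w = 0) → v = 0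
  sq_eq_id : ∀ x v, K x (K x v) = v
  rank_plus : ∀ x, Module.finrank ℝ (eigenDist K 1 x) = 2
  rank_minus : ∀ x, Module.finrank ℝ (eigenDist K (-1) x) = 2
  compatible : ∀ x v w, g x (K x v) (K x w) = - g x v w

/-- The `2`-form `ρ(X, Y) = g(K X, Y)`. -/
def fundForm (g : BilinField M) (K : EndField M) : BilinField M := fun x => (g x).comp (K x)

/-- Para-Kähler: both eigendistributions of `K` are integrable and `dρ = 0`. -/
structure IsParaKahler (g : BilinField M) (K : EndField M) : Prop
    extends IsAlmostParaHermitian g K where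
  involutive_plus : IsInvolutive (eigenDist K 1)
  involutive_minus : IsInvolutive (eigenDist K (-1))
  closed : ∀ x v₁ v₂ v₃, dTwo (fundForm g K) x v₁ v₂ v₃ = 0

/-- Para-Kähler-Einstein: moreover the trace-free Ricci tensor vanishes. -/
structure IsParaKahlerEinstein (g : BilinField M) (K : EndField M) : Prop
    extends IsParaKahler g K where
  einstein : ∀ x v w, ricci g x v w = (1 / 4) * scalarCurv g x * g x v w

/-! ### Adapted null frames -/

/-- A frame `(e₁, e₂, ē₁, ē₂)` of `T_x M` adapted to `(g, K)`: in the dual coframe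
`(α¹, α², ᾱ¹, ᾱ²)` one has `g = 2 α¹ ᾱ¹ + 2 α² ᾱ²` and
`K = α¹ ⊗ e₁ + α² ⊗ e₂ - ᾱ¹ ⊗ ē₁ - ᾱ² ⊗ ē₂`. -/
@[ext]
structure AdaptedFrame (g : BilinField M) (K : EndField M) (x : M) where
  e : Fin 2 → TangentSpace 𝓘(ℝ, E4) x
  ebar : Fin 2 → TangentSpace 𝓘(ℝ, E4) x
  g_e_e : ∀ i j, g x (e i) (e j) = 0
  g_ebar_ebar : ∀ i j, g x (ebar i) (ebar j) = 0
  g_e_ebar : ∀ i j, g x (e i) (ebar j) = if i = j then 1 else 0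
  g_ebar_e : ∀ i j, g x (ebar i) (e j) = if i = j then 1 else 0
  K_e : ∀ i, K x (e i) = e i
  K_ebar : ∀ i, K x (ebar i) = - ebar i

/-- The four vectors of an adapted frame, in the order `(e₁, e₂, ē₁, ē₂)`. -/
def AdaptedFrame.vec {g : BilinField M} {K : EndField M} {x : M} (f : AdaptedFrame g K x) :
    Fin 4 → TangentSpace 𝓘(ℝ, E4) x := ![f.e 0, f.e 1, f.ebar 0, f.ebar 1]

/-- The right action of `GL₂(ℝ)` on adapted frames: `e ↦ e a`, `ē ↦ ē (aᵀ)⁻¹`, so that the dual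
coframe transforms by `α ↦ a⁻¹ α`, `ᾱ ↦ aᵀ ᾱ`. -/
def AdaptedFrame.act {g : BilinField M} {K : EndField M} {x : M} (f : AdaptedFrame g K x)
    (a : GL2) : AdaptedFrame g K x where
  e j := ∑ i, (a : Mat 2) i j • f.e i
  ebar j := ∑ i, ((a⁻¹ : GL2) : Mat 2) j i • f.ebar i
  g_e_e i j := by simp [f.g_e_e]
  g_ebar_ebar i j := by simp [f.g_ebar_ebar]
  g_e_ebar i j := by
    have h : ((a⁻¹ : GL2) : Mat 2) * (a : Mat 2) = 1 := by simp
    have h' := congrFun (congrFun h j) i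
    rw [Matrix.mul_apply, Matrix.one_apply] at h'
    simp only [Fin.sum_univ_two] at h'
    have h2 : (if i = j then (1 : ℝ) else 0) = if j = i then 1 else 0 := by
      simp only [eq_comm]
    rw [h2, ← h']
    simp [f.g_e_ebar, Fin.sum_univ_two, -Matrix.coe_units_inv]
    ring
  g_ebar_e i j := by
    have h : ((a⁻¹ : GL2) : Mat 2) * (a : Mat 2) = 1 := by simp
    have h' := congrFun (congrFun h i) j
    rw [Matrix.mul_apply, Matrix.one_apply] at h'
    simp only [Fin.sum_univ_two] at h'
    rw [← h']
    simp [f.g_ebar_e, Fin.sum_univ_two, -Matrix.coe_units_inv]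
  K_e j := by simp [f.K_e]
  K_ebar j := by simp [f.K_ebar, add_comm]

/-- The set of all adapted null frames of `(g, K)`. -/
def AdaptedFrames (g : BilinField M) (K : EndField M) : Type _ := Σ x : M, AdaptedFrame g K x

/-! ### Components of the Weyl tensor -/

/-- `Ψ₂' = C₁₂₃₄` in an adapted frame. -/
def psi2' {g : BilinField M} {K : EndField M} {x : M} (f : AdaptedFrame g K x) : ℝ :=
  weyl g x (f.vec 0) (f.vec 1) (f.vec 2) (f.vec 3)

/-- The Hodge star of a `2`-form `β` on `T_x M`, defined by
`(⋆β)(X, Y) vol = β ∧ X♭ ∧ Y♭` with `vol = α¹ ∧ α² ∧ ᾱ¹ ∧ ᾱ²`: both sides are evaluated on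
`(e₁, e₂, ē₁, ē₂)`, where `vol` equals `1`. -/
def hodgeStar {g : BilinField M} {K : EndField M} {x : M} (f : AdaptedFrame g K x)
    (β : TangentSpace 𝓘(ℝ, E4) x → TangentSpace 𝓘(ℝ, E4) x → ℝ)
    (X Y : TangentSpace 𝓘(ℝ, E4) x) : ℝ :=
  (1 / 2) * ∑ σ : Equiv.Perm (Fin 4), ((Equiv.Perm.sign σ : ℤ) : ℝ) *
    (β (f.vec (σ 0)) (f.vec (σ 1)) * g x X (f.vec (σ 2)) * g x Y (f.vec (σ 3)))

/-- The anti-self-dual Weyl tensor: the component of the Weyl tensor in the `-1` eigenspace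
of the Hodge star. -/
def weylMinus {g : BilinField M} {K : EndField M} {x : M} (f : AdaptedFrame g K x)
    (X Y Z W : TangentSpace 𝓘(ℝ, E4) x) : ℝ :=
  (1 / 2) * (weyl g x X Y Z W - hodgeStar f (weyl g x X Y) Z W)

/-- `Ψ₂' = 1` everywhere. -/
def PsiTwoPrimeEqOne (g : BilinField M) (K : EndField M) : Prop :=
  ∀ (x : M) (f : AdaptedFrame g K x), psi2' f = 1

/-- `Weyl⁻ = 0` everywhere. -/
def WeylMinusVanishes (g : BilinField M) (K : EndField M) : Prop :=
  ∀ (x : M) (f : AdaptedFrame g K x) (X Y Z W : TangentSpace 𝓘(ℝ, E4) x),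
    weylMinus f X Y Z W = 0

/-- The Einstein constant of `g` is `Λ`, i.e. `Ric(g) = Λ g`. -/
def HasEinsteinConstant (g : BilinField M) (Λ : ℝ) : Prop :=
  ∀ x v w, ricci g x v w = Λ * g x v w

/-- `(M, g, K)` is locally equivalent to `(N, g', K')`: every point of `M` has an open
neighbourhood that a smooth diffeomorphism onto an open subset of `N` identifies with it,
together with the metric and the para-complex structure. -/
def IsLocallyEquivalent {N : Type*} [TopologicalSpace N] [ChartedSpace E4 N]
    (g : BilinField M) (K : EndField M) (g' : BilinField N) (K' : EndField N) : Prop :=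
  ∀ x : M, ∃ φ : OpenPartialHomeomorph M N, x ∈ φ.source ∧
    ContMDiffOn 𝓘(ℝ, E4) 𝓘(ℝ, E4) ∞ φ φ.source ∧
    ContMDiffOn 𝓘(ℝ, E4) 𝓘(ℝ, E4) ∞ φ.symm φ.target ∧
    ∀ y ∈ φ.source,
      (∀ v w : TangentSpace 𝓘(ℝ, E4) y,
        g' (φ y) (mfderiv 𝓘(ℝ, E4) 𝓘(ℝ, E4) φ y v) (mfderiv 𝓘(ℝ, E4) 𝓘(ℝ, E4) φ y w)
          = g y v w) ∧
      (∀ v : TangentSpace 𝓘(ℝ, E4) y,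
        mfderiv 𝓘(ℝ, E4) 𝓘(ℝ, E4) φ y (K y v)
          = K' (φ y) (mfderiv 𝓘(ℝ, E4) 𝓘(ℝ, E4) φ y v))

end Structures

/-! ### The embedding of `GL₂(ℝ)` in `SL₃(ℝ)` -/

/-- The real cube root. -/
def cbrt (t : ℝ) : ℝ := SignType.sign t * |t| ^ (1 / 3 : ℝ)

theorem cbrt_pow (t : ℝ) : cbrt t ^ 3 = t := by
  have h : (|t| ^ (1 / 3 : ℝ)) ^ 3 = |t| := by
    rw [← Real.rpow_natCast, ← Real.rpow_mul (abs_nonneg t)]; norm_num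
  unfold cbrt
  rw [mul_pow, h]
  rcases lt_trichotomy t 0 with h0 | h0 | h0
  · simp [sign_neg h0, abs_of_neg h0]; norm_num
  · simp [h0]
  · simp [sign_pos h0, abs_of_pos h0]

theorem cbrt_mul (s t : ℝ) : cbrt (s * t) = cbrt s * cbrt t := by
  have h : Function.Injective (fun x : ℝ => x ^ 3) :=
    (Odd.strictMono_pow (by decide : Odd 3)).injective
  apply h
  simp only [mul_pow, cbrt_pow]

/-- The block diagonal matrix `diag(A, 1)`. -/
def blockOne (A : Mat 2) : Mat 3 := !![A 0 0, A 0 1, 0; A 1 0, A 1 1, 0; 0, 0, 1]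

/-- The inclusion `GL₂(ℝ) → SL₃(ℝ)`, `A ↦ (det A)^(-1/3) diag(A, 1)`. Its differential at the
identity is `v ↦ diag(v - (tr v / 3) id, - tr v / 3)`, and it identifies `GL₂(ℝ)` with the
subgroup of all block diagonal matrices (blocks of size `2` and `1`) in `SL₃(ℝ)`. -/
def iota : GL2 →* Matrix.SpecialLinearGroup (Fin 3) ℝ where
  toFun A := ⟨(cbrt (Matrix.det (A : Mat 2)))⁻¹ • blockOne A, by
    have hA : Matrix.det (A : Mat 2) ≠ 0 :=
      ((Matrix.isUnit_iff_isUnit_det _).1 A.isUnit).ne_zero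
    have hb : Matrix.det (blockOne (A : Mat 2)) = Matrix.det (A : Mat 2) := by
      simp [blockOne, Matrix.det_fin_three, Matrix.det_fin_two]
    rw [Matrix.det_smul, hb, Fintype.card_fin, inv_pow, cbrt_pow, inv_mul_cancel₀ hA]⟩
  map_one' := by
    ext i j
    have h1 : cbrt 1 = 1 := by simp [cbrt]
    fin_cases i <;> fin_cases j <;> simp [blockOne, h1]
  map_mul' A B := by
    apply Subtype.ext
    have hm : blockOne ((A : Mat 2) * (B : Mat 2)) = blockOne A * blockOne B := by
      ext i j
      fin_cases i <;> fin_cases j <;>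
        simp [blockOne, Matrix.mul_apply, Fin.sum_univ_two, Fin.sum_univ_three]
    change (cbrt (Matrix.det ((A * B : GL2) : Mat 2)))⁻¹ • blockOne ((A * B : GL2) : Mat 2)
      = ((cbrt (Matrix.det (A : Mat 2)))⁻¹ • blockOne (A : Mat 2))
        * ((cbrt (Matrix.det (B : Mat 2)))⁻¹ • blockOne (B : Mat 2))
    simp only [Units.val_mul, Matrix.det_mul, hm, cbrt_mul,
      Matrix.smul_mul, Matrix.mul_smul, smul_smul, mul_inv]
    rw [mul_comm (cbrt _)⁻¹]

/-- The exponential `gl₂(ℝ) → GL₂(ℝ)`. -/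
def gexp (v : Mat 2) : GL2 where
  val := NormedSpace.exp v
  inv := NormedSpace.exp (-v)
  val_inv := by
    rw [← Matrix.exp_add_of_commute v (-v) (Commute.refl v).neg_right]; simp
  inv_val := by
    rw [← Matrix.exp_add_of_commute (-v) v (Commute.refl v).neg_left]; simp

/-! ### Cartan geometries of type `(SL₃(ℝ), GL₂(ℝ))` -/

/-- The model space of the `8`-dimensional total spaces. -/
abbrev E8 : Type := E4 × E22

/-- A smooth principal `GL₂(ℝ)`-bundle over the `4`-manifold `M`. -/
structure PrincipalGL2Bundle (M : Type u) [TopologicalSpace M] [ChartedSpace E4 M] where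
  P : Type u
  [top : TopologicalSpace P]
  [charted : ChartedSpace E8 P]
  [mfd : IsManifold 𝓘(ℝ, E8) ∞ P]
  proj : P → M
  smooth_proj : ContMDiff 𝓘(ℝ, E8) 𝓘(ℝ, E4) ∞ proj
  /-- the right action `p ↦ p · a` -/
  act : P → GL2 → P
  smooth_act : ContMDiff (𝓘(ℝ, E8).prod 𝓘(ℝ, E22)) 𝓘(ℝ, E8) ∞
    (fun q : P × GL2 => act q.1 q.2)
  act_one : ∀ p, act p 1 = p
  act_mul : ∀ p a b, act p (a * b) = act (act p a) b
  proj_act : ∀ p a, proj (act p a) = proj p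
  act_free : ∀ p a, act p a = p → a = 1
  /-- Over a neighbourhood `U` of each point there are a smooth section `s` and a smooth function
  `ψ` with `p = s(π p) · ψ(p)`, so that `p ↦ (π p, ψ p)` is a diffeomorphism from the bundle
  over `U` onto `U × GL₂(ℝ)`, with inverse `(y, a) ↦ s y · a`. -/
  locally_trivial : ∀ x : M, ∃ (U : Set M) (s : M → P) (ψ : P → GL2), IsOpen U ∧ x ∈ U ∧
    ContMDiffOn 𝓘(ℝ, E4) 𝓘(ℝ, E8) ∞ s U ∧
    ContMDiffOn 𝓘(ℝ, E8) 𝓘(ℝ, E22) ∞ ψ (proj ⁻¹' U) ∧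
    (∀ y ∈ U, proj (s y) = y) ∧
    ∀ p ∈ proj ⁻¹' U, act (s (proj p)) (ψ p) = p

attribute [instance] PrincipalGL2Bundle.top PrincipalGL2Bundle.charted PrincipalGL2Bundle.mfd

section Cartan

variable {M : Type u} [TopologicalSpace M] [ChartedSpace E4 M] [IsManifold 𝓘(ℝ, E4) ∞ M]

/-- The fundamental vector field of `v ∈ gl₂(ℝ)`, `X_v(p) = d/dt p · exp(t v)` at `t = 0`. -/
def PrincipalGL2Bundle.fundamental (Q : PrincipalGL2Bundle M) (v : Mat 2) (p : Q.P) :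
    TangentSpace 𝓘(ℝ, E8) (Q.act p (gexp ((0 : ℝ) • v))) :=
  mfderiv 𝓘(ℝ, ℝ) 𝓘(ℝ, E8) (fun t : ℝ => Q.act p (gexp (t • v))) 0 (1 : ℝ)

/-- A Cartan geometry of type `(SL₃(ℝ), GL₂(ℝ))` over `M`: a principal `GL₂(ℝ)`-bundle with an
`sl₃(ℝ)`-valued Cartan connection. -/
structure CartanGeometry (M : Type u) [TopologicalSpace M] [ChartedSpace E4 M]
    extends PrincipalGL2Bundle M where
  /-- the entries `A_{ij}` of the connection form, real-valued `1`-forms on `P` -/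
  conn : Fin 3 → Fin 3 → ∀ p : P, TangentSpace 𝓘(ℝ, E8) p →L[ℝ] ℝ
  smooth_conn : ∀ i j, ContMDiff 𝓘(ℝ, E8).tangent 𝓘(ℝ, ℝ) ∞
    (fun ξ : TangentBundle 𝓘(ℝ, E8) P => conn i j ξ.1 ξ.2)
  /-- `A` has values in `sl₃(ℝ)` -/
  trace_zero : ∀ p ξ, ∑ i, conn i i p ξ = 0
  /-- `A_p` is a linear isomorphism of `T_p P` onto `sl₃(ℝ)` -/
  iso : ∀ (p : P) (X : Mat 3), X.trace = 0 →
    ∃! ξ : TangentSpace 𝓘(ℝ, E8) p, ∀ i j, conn i j p ξ = X i j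
  /-- `R_a^* A = Ad(a⁻¹) ∘ A` -/
  equivariant : ∀ (a : GL2) (p : P) (ξ : TangentSpace 𝓘(ℝ, E8) p),
    Matrix.of (fun i j => conn i j (act p a)
        (mfderiv 𝓘(ℝ, E8) 𝓘(ℝ, E8) (fun q => act q a) p ξ))
      = ((iota a)⁻¹ : Matrix.SpecialLinearGroup (Fin 3) ℝ).1
        * Matrix.of (fun i j => conn i j p ξ) * (iota a).1
  /-- `A(X_v) = v`, where `v ∈ gl₂(ℝ)` is seen in `sl₃(ℝ)` through the differential of the
  inclusion of `GL₂(ℝ)` in `SL₃(ℝ)`, i.e. as the derivative of `exp(t v)` at `t = 0` -/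
  reproduces : ∀ (v : Mat 2) (p : P) (i j : Fin 3),
    HasDerivAt (fun t : ℝ => (iota (gexp (t • v))).1 i j)
      (conn i j _ (toPrincipalGL2Bundle.fundamental v p)) 0

/-- The connection form as a matrix-valued form. -/
def CartanGeometry.A (𝒢 : CartanGeometry M) (p : 𝒢.P) (ξ : TangentSpace 𝓘(ℝ, E8) p) : Mat 3 :=
  Matrix.of fun i j => 𝒢.conn i j p ξ

/-- The curvature `K_A = dA + A ∧ A`. -/
def CartanGeometry.curvature (𝒢 : CartanGeometry M) (p : 𝒢.P)
    (ξ η : TangentSpace 𝓘(ℝ, E8) p) : Mat 3 :=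
  Matrix.of (fun i j => dOne (𝒢.conn i j) p ξ η) + (𝒢.A p ξ * 𝒢.A p η - 𝒢.A p η * 𝒢.A p ξ)

/-- Flatness of a Cartan geometry: `K_A = 0`. -/
def CartanGeometry.IsFlat (𝒢 : CartanGeometry M) : Prop :=
  ∀ (p : 𝒢.P) (ξ η : TangentSpace 𝓘(ℝ, E8) p), 𝒢.curvature p ξ η = 0

/-- The `gl₂(ℝ)`-valued form `Γ` in
`A = [[Γ - (tr Γ / 3) id, α], [ᾱ, - tr Γ / 3]]`. -/
def CartanGeometry.Gam (𝒢 : CartanGeometry M) (p : 𝒢.P) (ξ : TangentSpace 𝓘(ℝ, E8) p)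
    (i j : Fin 2) : ℝ :=
  𝒢.conn i.castSucc j.castSucc p ξ - if i = j then 𝒢.conn 2 2 p ξ else 0

variable {g : BilinField M} {K : EndField M}

/-- The tautological form `αⁱ` on a bundle of adapted frames: `αⁱ_p(ξ)` is the component of
`dπ(ξ)` along `eᵢ`. -/
def tautForm (𝒢 : CartanGeometry M) (fr : ∀ p : 𝒢.P, AdaptedFrame g K (𝒢.proj p)) (i : Fin 2)
    (p : 𝒢.P) : TangentSpace 𝓘(ℝ, E8) p →L[ℝ] ℝ :=
  (g (𝒢.proj p) ((fr p).ebar i)).comp (mfderiv 𝓘(ℝ, E8) 𝓘(ℝ, E4) 𝒢.proj p)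

/-- The tautological form `ᾱⁱ` on a bundle of adapted frames: `ᾱⁱ_p(ξ)` is the component of
`dπ(ξ)` along `ēᵢ`. -/
def tautFormBar (𝒢 : CartanGeometry M) (fr : ∀ p : 𝒢.P, AdaptedFrame g K (𝒢.proj p)) (i : Fin 2)
    (p : 𝒢.P) : TangentSpace 𝓘(ℝ, E8) p →L[ℝ] ℝ :=
  (g (𝒢.proj p) ((fr p).e i)).comp (mfderiv 𝓘(ℝ, E8) 𝓘(ℝ, E4) 𝒢.proj p)

/-- `𝒢` is the Cartan geometry of `(M, g, K)`. Its structure bundle is the bundle of adapted null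
frames: `p ↦ fr p` is an equivariant bijection onto the set of adapted frames, and the frame
vectors depend smoothly on `p`. (For a principal bundle this determines the smooth structure: the
smooth local sections are the smooth local adapted frame fields.) Its connection is
`A = [[Γ - (tr Γ / 3) id, α], [ᾱ, - tr Γ / 3]]`, where `α, ᾱ` are the tautological forms and
`diag(Γ, -Γᵀ)` is the Levi-Civita connection form, the unique metric connection form on the bundle
that satisfies the first structure equations `dα = - Γ ∧ α`, `dᾱ = Γᵀ ∧ ᾱ`. -/
structure IsFrameGeometry (𝒢 : CartanGeometry M)
    (fr : ∀ p : 𝒢.P, AdaptedFrame g K (𝒢.proj p)) : Prop where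
  bijective : Function.Bijective (fun p => (⟨𝒢.proj p, fr p⟩ : AdaptedFrames g K))
  equivariant : ∀ p a, (⟨𝒢.proj (𝒢.act p a), fr (𝒢.act p a)⟩ : AdaptedFrames g K)
    = ⟨𝒢.proj p, (fr p).act a⟩
  smooth_e : ∀ i, ContMDiff 𝓘(ℝ, E8) 𝓘(ℝ, E4).tangent ∞
    (fun p => (⟨𝒢.proj p, (fr p).e i⟩ : TangentBundle 𝓘(ℝ, E4) M))
  smooth_ebar : ∀ i, ContMDiff 𝓘(ℝ, E8) 𝓘(ℝ, E4).tangent ∞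
    (fun p => (⟨𝒢.proj p, (fr p).ebar i⟩ : TangentBundle 𝓘(ℝ, E4) M))
  conn_alpha : ∀ p ξ (i : Fin 2), 𝒢.conn i.castSucc 2 p ξ = tautForm 𝒢 fr i p ξ
  conn_alphaBar : ∀ p ξ (i : Fin 2), 𝒢.conn 2 i.castSucc p ξ = tautFormBar 𝒢 fr i p ξ
  torsion_free : ∀ (i : Fin 2) p ξ η, dOne (tautForm 𝒢 fr i) p ξ η
    = - ∑ j, (𝒢.Gam p ξ i j * tautForm 𝒢 fr j p η - 𝒢.Gam p η i j * tautForm 𝒢 fr j p ξ)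
  torsion_free_bar : ∀ (i : Fin 2) p ξ η, dOne (tautFormBar 𝒢 fr i) p ξ η
    = ∑ j, (𝒢.Gam p ξ j i * tautFormBar 𝒢 fr j p η - 𝒢.Gam p η j i * tautFormBar 𝒢 fr j p ξ)

end Cartan

/-! ### The dancing metric -/

/-- The domain `b + a x - y ≠ 0` in `ℝ⁴` with coordinates `(a, b, x, y)`. -/
def dancingDomain : TopologicalSpace.Opens E4 where
  carrier := {p | p 1 + p 0 * p 2 - p 3 ≠ 0}
  is_open' := by
    apply IsOpen.preimage (t := {r : ℝ | r ≠ 0}) (f := fun p : E4 => p 1 + p 0 * p 2 - p 3)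
    · fun_prop
    · exact isOpen_ne

/-- The coordinate differentials `da, db, dx, dy`. -/
def dcoord (i : Fin 4) : E4 →L[ℝ] ℝ := EuclideanSpace.proj i

/-- `α ⊗ β + β ⊗ α`, that is, `2 α β` for the symmetric product of `1`-forms. -/
def symProd (α β : E4 →L[ℝ] ℝ) : E4 →L[ℝ] E4 →L[ℝ] ℝ := α.smulRight β + β.smulRight α

/-- The dancing metric, with para-Kähler potential `V = - log(b + a x - y)`:
`g = (2 da ((y - b) dx - x dy) + 2 db (a dx - dy)) / (b + a x - y)²`.
On an open subset of `ℝ⁴` every tangent space is `ℝ⁴`, through the inclusion. -/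
def dancingMetric : BilinField dancingDomain := fun p =>
  show E4 →L[ℝ] E4 →L[ℝ] ℝ from
    (((p : E4) 1 + (p : E4) 0 * (p : E4) 2 - (p : E4) 3) ^ 2)⁻¹ •
      (symProd (dcoord 0)
          (((p : E4) 3 - (p : E4) 1) • dcoord 2 - (p : E4) 2 • dcoord 3)
        + symProd (dcoord 1) ((p : E4) 0 • dcoord 2 - dcoord 3))

/-- The para-complex structure `∂_a ⊗ da + ∂_b ⊗ db - ∂_x ⊗ dx - ∂_y ⊗ dy`. -/
def dancingK : EndField dancingDomain := fun _ =>
  show E4 →L[ℝ] E4 from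
    (dcoord 0).smulRight (basisVec 0) + (dcoord 1).smulRight (basisVec 1)
      - (dcoord 2).smulRight (basisVec 2) - (dcoord 3).smulRight (basisVec 3)

end PKE

end

/-!
The adapted null frames of a para-Kähler–Einstein structure carry a Cartan geometry, whose flat
model is the space of non-incident pairs of a point and a line in the projective plane. The proof
works throughout with the first structure equations `dα = -Γ ∧ α`, `dᾱ = Γᵀ ∧ ᾱ` of an adapted
frame.

*Existence.* Bases of the two eigenspaces of `K` extend to smooth local adapted frames
(`exists_smoothFrameAt`). In such a frame the mixed components of the structure equations prescribe
the coefficients of a connection form `localConn`, and the remaining components hold because the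
eigendistributions are integrable and `ρ = Σ αᵏ ∧ ᾱₖ` is closed (`localConn_torsion`,
`localConn_torsion_bar`). The local frames also make the set of adapted frames a principal bundle
(`FrameAtlas.bundle`), on which `ψ⁻¹ (π^* Γ) ψ + ψ⁻¹ dψ` satisfies the structure equations; these
determine it by Cartan's lemma (`cartan_lemma`), so it does not depend on the local frame
(`FrameAtlas.gam_eq_gam`). It is equivariant, reproduces the generators of the fundamental vector
fields, and forms a coframe together with `α` and `ᾱ`, which gives `exists_isFrameGeometry`.

*Curvature.* By the structure equations the last row and column of the curvature of the Cartan
connection vanish, so that flatness says that `dΓ + Γ ∧ Γ` is the curvature form of the model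
(`isFlat_iff_curvForm`). The metric of an adapted frame identifies this form with the Riemann tensor
in coordinates (`split_frame_curvature`, `curvOp_frame`), which turns flatness into a pointwise
condition (`isFlat_iff_model`) on a curvature tensor that preserves two complementary null planes.
For such tensors the first Bianchi identity leaves few components: the Einstein condition leaves the
scalar curvature, which is `-12 Ψ₂'` (`psi2'_eq`), and the tensor is the model one if and only if
moreover `Ric = -3 g` and the anti-self-dual Weyl tensor vanishes
(`IsSplitCurvature.model_iff_weyl`).

*The dancing metric.* An explicit null coframe and connection form show that the dancing metric is
pKE with the curvature of the model (`danc_curvature`). Since curvature is natural, structures that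
are locally equivalent to it are flat (`isFlat_of_isLocallyEquivalent`). Conversely, a local section
pulls a flat Cartan connection back to a matrix of forms `A` with `dA + A ∧ A = 0`. Such a matrix is
`S⁻¹ dS` with the rows of `S` parallel for a flat linear connection (`exists_parallel`,
`exists_maurerCartan`); parallel transport along rays produces these rows. The last column of `S`
and the last row of `S⁻¹` are a point and a line that are not incident, and their affine coordinates
define a map to the dancing domain. It pulls the dancing metric and its para-complex structure back
to `g` and `K` (`exists_developing`), hence is a local diffeomorphism
(`isFlat_iff_isLocallyEquivalent`).
-/

noncomputable section

namespace PKE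

set_option linter.unusedSectionVars false
set_option synthInstance.maxHeartbeats 200000

/-! ### Moving frames in a normed space -/

section MovingFrame

variable {F V : Type*} [NormedAddCommGroup F] [NormedSpace ℝ F] [NormedAddCommGroup V]
  [NormedSpace ℝ V]

/-- The exterior derivative of a `1`-form on a normed space. -/
def dVec (θ : F → F →L[ℝ] ℝ) (p v w : F) : ℝ := fderiv ℝ θ p v w - fderiv ℝ θ p w v

/-- The curvature `R(u, v) w` of the linear connection with Christoffel map `C`, at `y`. -/
def curvOp (C : V → V →L[ℝ] V →L[ℝ] V) (y u v w : V) : V :=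
  fderiv ℝ C y u v w - fderiv ℝ C y v u w + C y u (C y v w) - C y v (C y u w)

/-- The exterior derivative of `ξ ↦ g(Z, dq ξ)` for a vector field `Z` along `q`, in terms of the
covariant derivative of `Z` for a torsion-free metric connection. -/
theorem dVec_coframe {G : V → V →L[ℝ] V →L[ℝ] ℝ} {C : V →L[ℝ] V →L[ℝ] V} {q : F → V} {Z : F → V}
    {p : F} (hq : ContDiffAt ℝ 2 q p) (hZ : DifferentiableAt ℝ Z p)
    (hG : DifferentiableAt ℝ G (q p)) (hCs : ∀ u v, C u v = C v u)
    (hC : ∀ u v w, fderiv ℝ G (q p) u v w = G (q p) (C u v) w + G (q p) v (C u w)) (ξ η : F) :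
    dVec (fun z => (G (q z) (Z z)).comp (fderiv ℝ q z)) p ξ η
      = G (q p) (fderiv ℝ Z p ξ + C (fderiv ℝ q p ξ) (Z p)) (fderiv ℝ q p η)
        - G (q p) (fderiv ℝ Z p η + C (fderiv ℝ q p η) (Z p)) (fderiv ℝ q p ξ) := by
  have hq1 : DifferentiableAt ℝ q p := hq.differentiableAt (by norm_num)
  have hq2 : DifferentiableAt ℝ (fderiv ℝ q) p :=
    (hq.fderiv_right (m := 1) (by norm_num)).differentiableAt (by norm_num)
  have hsymm : ∀ a b, fderiv ℝ (fderiv ℝ q) p a b = fderiv ℝ (fderiv ℝ q) p b a :=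
    fun a b => (hq.isSymmSndFDerivAt (by simp)).eq a b
  have hGq : HasFDerivAt (fun z => G (q z)) ((fderiv ℝ G (q p)).comp (fderiv ℝ q p)) p :=
    HasFDerivAt.comp (g := G) (f := q) p hG.hasFDerivAt hq1.hasFDerivAt
  have key := ((hGq.clm_apply hZ.hasFDerivAt).clm_comp hq2.hasFDerivAt).fderiv
  unfold dVec
  rw [key]
  simp only [add_apply, ContinuousLinearMap.comp_apply,
    ContinuousLinearMap.compL_apply, ContinuousLinearMap.flip_apply, hC, map_add]
  rw [hsymm η ξ, hCs (fderiv ℝ q p ξ) (fderiv ℝ q p η)]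
  ring

variable {ι : Type*} [Fintype ι] {τ : ι → ι}

/-- Cartan's lemma for metric connections: a family of `1`-forms that is skew in its two indices
and whose wedge product with a coframe vanishes is zero. -/
theorem cartan_lemma [DecidableEq ι] {F : Type*} [AddCommGroup F] [Module ℝ F]
    (hτ : ∀ a, τ (τ a) = a)
    {δ : ι → ι → F → ℝ} {θ : ι → F → ℝ} (x : ι → F)
    (hx : ∀ a b, θ a (x b) = if a = b then 1 else 0)
    (hskew : ∀ a b ξ, δ (τ a) b ξ + δ (τ b) a ξ = 0)
    (hw : ∀ a ξ η, ∑ b, (δ a b ξ * θ b η - δ a b η * θ b ξ) = 0) (a b : ι) (ξ : F) :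
    δ a b ξ = 0 := by
  -- the coefficients `δ a b (x c)` are symmetric in `b`, `c` and skew in `a`, `b`
  have h1 : ∀ a b ξ, δ a b ξ = ∑ c, δ a c (x b) * θ c ξ := by
    intro a b ξ
    have := hw a ξ (x b)
    simp only [hx, Finset.sum_sub_distrib, mul_ite, mul_one, mul_zero, Finset.sum_ite_eq',
      Finset.mem_univ, if_true] at this
    linarith
  have h2 : ∀ a b c, δ a b (x c) = δ a c (x b) := by
    intro a b c
    rw [h1 a b (x c)]
    simp [hx]
  have h3 : ∀ a b c, δ (τ a) b (x c) = 0 := by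
    intro a b c
    have e1 := hskew a b (x c)
    have e2 := hskew c b (x a)
    have e3 := hskew a c (x b)
    have e4 := h2 (τ a) b c
    have e5 := h2 (τ b) a c
    have e6 := h2 (τ c) a b
    linarith
  rw [h1]
  refine Finset.sum_eq_zero fun c _ => ?_
  have := h3 (τ a) c b
  rw [hτ] at this
  rw [this, zero_mul]

/-- A metric connection form that satisfies the first structure equation along a family of
frames is the Levi-Civita connection: `∇ E_b = om^a_b E_a`. -/
theorem moving_frame_connection [DecidableEq ι] (hτ : ∀ a, τ (τ a) = a)
    {G : V → V →L[ℝ] V →L[ℝ] ℝ} {C : V →L[ℝ] V →L[ℝ] V} {q : F → V} {E : ι → F → V}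
    {om : ι → ι → F → ℝ} {p : F} (hq : ContDiffAt ℝ 2 q p)
    (hE : ∀ a, DifferentiableAt ℝ (E a) p) (hG : DifferentiableAt ℝ G (q p))
    (hCs : ∀ u v, C u v = C v u)
    (hC : ∀ u v w, fderiv ℝ G (q p) u v w = G (q p) (C u v) w + G (q p) v (C u w))
    (hGs : ∀ u v, G (q p) u v = G (q p) v u)
    (horth : ∀ a b, ∀ᶠ z in 𝓝 p, G (q z) (E a z) (E b z) = if b = τ a then 1 else 0)
    (hcomp : ∀ v, v = ∑ a, G (q p) (E (τ a) p) v • E a p)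
    (hsurj : ∀ v, ∃ ξ, fderiv ℝ q p ξ = v)
    (hskew : ∀ a b ξ, om (τ a) b ξ + om (τ b) a ξ = 0)
    (hstr : ∀ a ξ η, dVec (fun z => (G (q z) (E (τ a) z)).comp (fderiv ℝ q z)) p ξ η
      = -∑ b, (om a b ξ * G (q p) (E (τ b) p) (fderiv ℝ q p η)
        - om a b η * G (q p) (E (τ b) p) (fderiv ℝ q p ξ))) (b : ι) (ξ : F) :
    fderiv ℝ (E b) p ξ + C (fderiv ℝ q p ξ) (E b p) = ∑ a, om a b ξ • E a p := by
  have hq1 : DifferentiableAt ℝ q p := hq.differentiableAt (by norm_num)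
  have horth' : ∀ a b, G (q p) (E a p) (E b p) = if b = τ a then 1 else 0 :=
    fun a b => (horth a b).self_of_nhds
  have hGq : HasFDerivAt (fun z => G (q z)) ((fderiv ℝ G (q p)).comp (fderiv ℝ q p)) p :=
    HasFDerivAt.comp (g := G) (f := q) p hG.hasFDerivAt hq1.hasFDerivAt
  set N : ι → F → V := fun b ξ => fderiv ℝ (E b) p ξ + C (fderiv ℝ q p ξ) (E b p) with hN
  -- the connection coefficients of the Levi-Civita connection in the frame
  set ν : ι → ι → F → ℝ := fun a b ξ => G (q p) (E (τ a) p) (N b ξ) with hν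
  -- the products of the frame vectors are constant, so `ν` is skew
  have hmet : ∀ a b ξ, ν (τ a) b ξ + ν (τ b) a ξ = 0 := by
    intro a b ξ
    have h0 : fderiv ℝ (fun z => G (q z) (E a z) (E b z)) p = 0 := by
      have h : (fun z => G (q z) (E a z) (E b z)) =ᶠ[𝓝 p] fun _ => if b = τ a then 1 else 0 :=
        horth a b
      rw [h.fderiv_eq]; simp
    rw [((hGq.clm_apply (hE a).hasFDerivAt).clm_apply (hE b).hasFDerivAt).fderiv] at h0
    have h1 := DFunLike.congr_fun h0 ξ
    simp only [add_apply, ContinuousLinearMap.comp_apply,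
      ContinuousLinearMap.flip_apply, hC, zero_apply] at h1
    simp only [hν, hN, hτ, map_add]
    rw [hGs (E b p) (fderiv ℝ (E a) p ξ), hGs (E b p) (C _ _)]
    linarith
  have hexp : ∀ c ξ η, G (q p) (N c ξ) (fderiv ℝ q p η)
      = ∑ b, ν (τ b) c ξ * G (q p) (E (τ b) p) (fderiv ℝ q p η) := by
    intro c ξ η
    conv_lhs => rw [hcomp (fderiv ℝ q p η)]
    rw [map_sum]
    refine Finset.sum_congr rfl fun b _ => ?_
    rw [map_smul, smul_eq_mul, mul_comm, hGs (N c ξ)]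
    simp only [hν, hτ]
  -- `om - ν` is skew and wedges to zero with the coframe dual to `E`
  have hdiff : ∀ a b ξ, om a b ξ - ν a b ξ = 0 := by
    choose x hx using hsurj
    refine cartan_lemma (F := F) hτ (δ := fun a b ξ => om a b ξ - ν a b ξ)
      (θ := fun a ξ => G (q p) (E (τ a) p) (fderiv ℝ q p ξ)) (fun b => x (E b p)) ?_ ?_ ?_
    · intro a b
      simp only [hx, horth', hτ, eq_comm]
    · intro a b ξ
      have := hmet a b ξ
      have := hskew a b ξ
      linarith
    · intro a ξ η
      have h1 := hstr a ξ η
      rw [dVec_coframe hq (hE _) hG hCs hC] at h1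
      have h2 := hexp (τ a) ξ η
      have h3 := hexp (τ a) η ξ
      simp only [hN] at h2 h3
      rw [h2, h3, ← Finset.sum_sub_distrib, ← Finset.sum_neg_distrib] at h1
      rw [← sub_eq_zero, ← Finset.sum_sub_distrib] at h1
      rw [← h1]
      refine Finset.sum_congr rfl fun b _ => ?_
      have e1 := hmet (τ a) b ξ
      have e2 := hmet (τ a) b η
      rw [hτ] at e1 e2
      have e1' : ν (τ b) (τ a) ξ = - ν a b ξ := by linarith
      have e2' : ν (τ b) (τ a) η = - ν a b η := by linarith
      rw [e1', e2']
      ring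
  rw [show fderiv ℝ (E b) p ξ + C (fderiv ℝ q p ξ) (E b p) = N b ξ from rfl, hcomp (N b ξ)]
  refine Finset.sum_congr rfl fun a _ => ?_
  rw [sub_eq_zero.1 (hdiff a b ξ)]

/-- The second structure equation: `R(·, ·) E_b = (dom + om ∧ om)^c_b E_c`. -/
theorem moving_frame_curvature
    {C : V → V →L[ℝ] V →L[ℝ] V} {q : F → V} {E : ι → F → V}
    {om : ι → ι → F → F →L[ℝ] ℝ} {p : F} (hq : ContDiffAt ℝ 2 q p)
    (hE : ∀ a, ContDiffAt ℝ 2 (E a) p) (hCd : DifferentiableAt ℝ C (q p))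
    (hom : ∀ a b, DifferentiableAt ℝ (om a b) p)
    (hconn : ∀ b, ∀ᶠ z in 𝓝 p, ∀ ξ, fderiv ℝ (E b) z ξ + C (q z) (fderiv ℝ q z ξ) (E b z)
      = ∑ a, om a b z ξ • E a z) (b : ι) (η ξ : F) :
    curvOp C (q p) (fderiv ℝ q p η) (fderiv ℝ q p ξ) (E b p)
      = ∑ c, (dVec (om c b) p η ξ
        + ∑ a, (om c a p η * om a b p ξ - om c a p ξ * om a b p η)) • E c p := by
  have hq1 : DifferentiableAt ℝ q p := hq.differentiableAt (by norm_num)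
  have hE1 : ∀ a, DifferentiableAt ℝ (E a) p := fun a => (hE a).differentiableAt (by norm_num)
  have hq2 : DifferentiableAt ℝ (fderiv ℝ q) p :=
    (hq.fderiv_right (m := 1) (by norm_num)).differentiableAt (by norm_num)
  have hE2 : ∀ a, DifferentiableAt ℝ (fderiv ℝ (E a)) p := fun a =>
    ((hE a).fderiv_right (m := 1) (by norm_num)).differentiableAt (by norm_num)
  have hqs : ∀ a b, fderiv ℝ (fderiv ℝ q) p a b = fderiv ℝ (fderiv ℝ q) p b a :=
    fun a b => (hq.isSymmSndFDerivAt (by simp)).eq a b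
  have hEs : ∀ c a b, fderiv ℝ (fderiv ℝ (E c)) p a b = fderiv ℝ (fderiv ℝ (E c)) p b a :=
    fun c a b => ((hE c).isSymmSndFDerivAt (by simp)).eq a b
  have hCq : HasFDerivAt (fun z => C (q z)) ((fderiv ℝ C (q p)).comp (fderiv ℝ q p)) p :=
    HasFDerivAt.comp (g := C) (f := q) p hCd.hasFDerivAt hq1.hasFDerivAt
  have hD : ∀ b ξ, fderiv ℝ (E b) p ξ
      = (∑ a, om a b p ξ • E a p) - C (q p) (fderiv ℝ q p ξ) (E b p) := by
    intro b ξ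
    rw [← (hconn b).self_of_nhds ξ]; abel
  -- the derivative of `∇_ξ E_b = om^a_b(ξ) E_a` in the direction `η`
  have key : ∀ η ξ, fderiv ℝ (fderiv ℝ (E b)) p η ξ
      + (fderiv ℝ C (q p) (fderiv ℝ q p η) (fderiv ℝ q p ξ) (E b p)
        + C (q p) (fderiv ℝ (fderiv ℝ q) p η ξ) (E b p)
        + C (q p) (fderiv ℝ q p ξ) (fderiv ℝ (E b) p η))
      = ∑ a, (fderiv ℝ (om a b) p η ξ • E a p + om a b p ξ • fderiv ℝ (E a) p η) := by
    intro η ξ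
    have hl : HasFDerivAt (fun z => fderiv ℝ (E b) z ξ + C (q z) (fderiv ℝ q z ξ) (E b z)) _ p :=
      ((hE2 b).hasFDerivAt.clm_apply (hasFDerivAt_const ξ p)).add
        ((hCq.clm_apply (hq2.hasFDerivAt.clm_apply (hasFDerivAt_const ξ p))).clm_apply
          (hE1 b).hasFDerivAt)
    have hr : HasFDerivAt (fun z => ∑ a, om a b z ξ • E a z) _ p :=
      HasFDerivAt.fun_sum (u := Finset.univ) fun a _ =>
        ((hom a b).hasFDerivAt.clm_apply (hasFDerivAt_const ξ p)).smul (hE1 a).hasFDerivAt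
    have he0 : (fun z => fderiv ℝ (E b) z ξ + C (q z) (fderiv ℝ q z ξ) (E b z))
        =ᶠ[𝓝 p] fun z => ∑ a, om a b z ξ • E a z := (hconn b).mono fun z hz => hz ξ
    have he := he0.fderiv_eq (𝕜 := ℝ)
    have h := DFunLike.congr_fun ((hl.fderiv.symm.trans he).trans hr.fderiv) η
    simp only [add_apply, ContinuousLinearMap.comp_apply,
      ContinuousLinearMap.flip_apply, zero_apply, map_zero, zero_add,
      sum_apply, smul_apply,
      ContinuousLinearMap.smulRight_apply] at h
    rw [← sub_eq_zero] at h ⊢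
    rw [← h]
    simp only [Finset.sum_add_distrib]
    abel
  -- antisymmetrizing in `η`, `ξ` removes the second derivatives of `q` and `E b`
  have h12 := congrArg₂ (· - ·) (key η ξ) (key ξ η)
  rw [hEs b ξ η, hqs ξ η, hD b ξ, hD b η, ← Finset.sum_sub_distrib] at h12
  have hR : ∑ c, (dVec (om c b) p η ξ
        + ∑ a, (om c a p η * om a b p ξ - om c a p ξ * om a b p η)) • E c p
      = (∑ a, (fderiv ℝ (om a b) p η ξ • E a p - fderiv ℝ (om a b) p ξ η • E a p))
        + ∑ a, (om a b p ξ • ∑ c, om c a p η • E c p - om a b p η • ∑ c, om c a p ξ • E c p) := by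
    simp only [add_smul, Finset.sum_add_distrib, dVec, sub_smul, Finset.sum_smul, Finset.smul_sum,
      smul_smul, Finset.sum_sub_distrib]
    congr 1
    rw [Finset.sum_comm, Finset.sum_comm (f := fun x x_1 => (om x x_1 p ξ * om x_1 b p η) • E x p)]
    simp only [mul_comm]
  rw [hR]
  simp only [hD, smul_sub] at h12 ⊢
  have h3 : ∀ ζ ζ' : F, C (q p) (fderiv ℝ q p ζ) (∑ a, om a b p ζ' • E a p)
      = ∑ a, om a b p ζ' • C (q p) (fderiv ℝ q p ζ) (E a p) := by
    intro ζ ζ'; rw [map_sum]; simp only [map_smul]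
  unfold curvOp
  simp only [map_sub, h3] at h12
  rw [← sub_eq_zero] at h12 ⊢
  rw [← h12]
  simp only [Finset.sum_sub_distrib, Finset.sum_add_distrib]
  abel

end MovingFrame

/-! ### The Levi-Civita connection in coordinates -/

section MatrixCalculus

variable {F : Type*} [NormedAddCommGroup F] [NormedSpace ℝ F] {m : Type*} [Fintype m]
  [DecidableEq m] {n : WithTop ℕ∞} {A : F → Matrix m m ℝ} {p : F}

theorem contDiffAt_det (h : ∀ i j, ContDiffAt ℝ n (fun z => A z i j) p) :
    ContDiffAt ℝ n (fun z => (A z).det) p := by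
  simp only [Matrix.det_apply']
  exact ContDiffAt.sum fun σ _ => contDiffAt_const.mul (contDiffAt_prod fun i _ => h _ _)

theorem contDiffAt_matrix_inv (h : ∀ i j, ContDiffAt ℝ n (fun z => A z i j) p)
    (h0 : (A p).det ≠ 0) (i j : m) : ContDiffAt ℝ n (fun z => (A z)⁻¹ i j) p := by
  simp only [Matrix.inv_def, Ring.inverse_eq_inv', Matrix.smul_apply, smul_eq_mul,
    Matrix.adjugate_apply]
  refine ((contDiffAt_det h).inv h0).mul (contDiffAt_det fun k l => ?_)
  by_cases hk : k = j
  · subst hk; simp only [Matrix.updateRow_self]; exact contDiffAt_const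
  · simp only [Matrix.updateRow_ne hk]; exact h k l

end MatrixCalculus

section Coordinates

variable {G : E4 → E4 →L[ℝ] E4 →L[ℝ] ℝ} {y : E4}

theorem sum_basisVec (v : E4) : ∑ i, v i • basisVec i = v := by
  ext k
  simp [basisVec, Finset.sum_apply, Pi.single_apply]

@[simp] theorem basisVec_apply (i j : Fin 4) : basisVec i j = if j = i then 1 else 0 := by
  simp [basisVec]

theorem eq_of_basisVec {f g : E4 → ℝ} (hf : IsLinearMap ℝ f) (hg : IsLinearMap ℝ g)
    (h : ∀ i, f (basisVec i) = g (basisVec i)) (v : E4) : f v = g v := by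
  change hf.mk' f v = hg.mk' g v
  rw [← sum_basisVec v, map_sum, map_sum]
  refine Finset.sum_congr rfl fun i _ => ?_
  rw [map_smul, map_smul]
  exact congrArg _ (h i)

theorem bilin_eq_gram (u v : E4) : G y u v = ∑ i, ∑ j, gram G y i j * u i * v j := by
  conv_lhs => rw [← sum_basisVec u, ← sum_basisVec v]
  simp only [map_sum, map_smul, sum_apply, smul_apply, smul_eq_mul, Finset.mul_sum, gram,
    Matrix.of_apply]
  rw [Finset.sum_comm]
  exact Finset.sum_congr rfl fun i _ => Finset.sum_congr rfl fun j _ => by ring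

/-- The Christoffel symbols as a bilinear map. -/
def christoffelMap (G : E4 → E4 →L[ℝ] E4 →L[ℝ] ℝ) (y : E4) : E4 →L[ℝ] E4 →L[ℝ] E4 :=
  ∑ k, ∑ i, ∑ j, christoffel G y k i j •
    (dcoord i).smulRight ((dcoord j).smulRight (basisVec k))

@[simp] theorem dcoord_apply (i : Fin 4) (v : E4) : dcoord i v = v i := rfl

theorem christoffelMap_apply (u v : E4) (k : Fin 4) :
    christoffelMap G y u v k = ∑ i, ∑ j, christoffel G y k i j * u i * v j := by
  simp only [christoffelMap, sum_apply, smul_apply, ContinuousLinearMap.smulRight_apply,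
    dcoord_apply, WithLp.ofLp_sum, WithLp.ofLp_smul, Finset.sum_apply, Pi.smul_apply,
    basisVec_apply, smul_eq_mul]
  simp only [mul_ite, mul_one, mul_zero, Finset.sum_ite_irrel, Finset.sum_const_zero,
    Finset.sum_ite_eq, Finset.mem_univ, if_true, mul_assoc]

theorem contDiffAt_gram {n : WithTop ℕ∞} (hG : ContDiffAt ℝ n G y) (i j : Fin 4) :
    ContDiffAt ℝ n (fun z => gram G z i j) y :=
  (hG.clm_apply contDiffAt_const).clm_apply contDiffAt_const

theorem dGram_eq (hG : DifferentiableAt ℝ G y) (k i j : Fin 4) :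
    dGram G y k i j = fderiv ℝ G y (basisVec k) (basisVec i) (basisVec j) := by
  have h := ((hG.hasFDerivAt.clm_apply (hasFDerivAt_const (basisVec i) y)).clm_apply
    (hasFDerivAt_const (basisVec j) y)).fderiv
  have h2 := DFunLike.congr_fun h (basisVec k)
  simp only [map_zero, zero_add, ContinuousLinearMap.flip_apply, add_apply,
    ContinuousLinearMap.comp_apply, zero_apply] at h2
  exact h2

theorem contDiffAt_christoffel (hG : ContDiffAt ℝ ∞ G y) (h0 : (gram G y).det ≠ 0)
    (k i j : Fin 4) : ContDiffAt ℝ ∞ (fun z => christoffel G z k i j) y := by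
  have hd : ∀ k i j, ContDiffAt ℝ ∞ (fun z => dGram G z k i j) y := fun k i j =>
    ((contDiffAt_gram hG i j).fderiv_right (m := ∞) (by simp)).clm_apply contDiffAt_const
  unfold christoffel
  exact contDiffAt_const.mul (ContDiffAt.sum fun l _ =>
    (contDiffAt_matrix_inv (contDiffAt_gram hG) h0 k l).mul
      (((hd _ _ _).add (hd _ _ _)).sub (hd _ _ _)))

theorem contDiffAt_smul_const {F W : Type*} [NormedAddCommGroup F] [NormedSpace ℝ F]
    [NormedAddCommGroup W] [NormedSpace ℝ W] {n : WithTop ℕ∞} {f : F → ℝ} {p : F}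
    (hf : ContDiffAt ℝ n f p) (c : W) : ContDiffAt ℝ n (fun z => f z • c) p :=
  hf.smul contDiffAt_const

theorem contDiffAt_christoffelMap (hG : ContDiffAt ℝ ∞ G y) (h0 : (gram G y).det ≠ 0) :
    ContDiffAt ℝ ∞ (christoffelMap G) y := by
  unfold christoffelMap
  exact ContDiffAt.sum fun k _ => ContDiffAt.sum fun i _ => ContDiffAt.sum fun j _ =>
    contDiffAt_smul_const (contDiffAt_christoffel hG h0 k i j) _

theorem gram_symm (hs : ∀ u v, G y u v = G y v u) (i j : Fin 4) : gram G y i j = gram G y j i :=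
  hs _ _

theorem dGram_symm (hs : ∀ᶠ z in 𝓝 y, ∀ u v, G z u v = G z v u) (k i j : Fin 4) :
    dGram G y k i j = dGram G y k j i := by
  have h : (fun z => gram G z i j) =ᶠ[𝓝 y] fun z => gram G z j i :=
    hs.mono fun z hz => gram_symm hz i j
  rw [dGram, h.fderiv_eq, dGram]

theorem christoffelMap_symm (hs : ∀ᶠ z in 𝓝 y, ∀ u v, G z u v = G z v u) (u v : E4) :
    christoffelMap G y u v = christoffelMap G y v u := by
  ext k
  rw [christoffelMap_apply, christoffelMap_apply, Finset.sum_comm]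
  refine Finset.sum_congr rfl fun j _ => Finset.sum_congr rfl fun i _ => ?_
  have : christoffel G y k i j = christoffel G y k j i := by
    unfold christoffel
    congr 1
    refine Finset.sum_congr rfl fun l _ => ?_
    rw [dGram_symm hs l i j]
    ring
  rw [this]
  ring

theorem gram_mul_christoffel (h0 : (gram G y).det ≠ 0) (m i j : Fin 4) :
    ∑ k, gram G y m k * christoffel G y k i j
      = (1 / 2) * (dGram G y i j m + dGram G y j i m - dGram G y m i j) := by
  have h1 : gram G y * (gram G y)⁻¹ = 1 := Matrix.mul_nonsing_inv _ (Ne.isUnit h0)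
  have h2 : ∀ l, ∑ k, gram G y m k * (gram G y)⁻¹ k l = if m = l then 1 else 0 := fun l => by
    rw [← Matrix.mul_apply, h1, Matrix.one_apply]
  calc ∑ k, gram G y m k * christoffel G y k i j
      = (1 / 2) * ∑ l, (∑ k, gram G y m k * (gram G y)⁻¹ k l)
          * (dGram G y i j l + dGram G y j i l - dGram G y l i j) := by
        simp only [christoffel, Finset.mul_sum, Finset.sum_mul]
        rw [Finset.sum_comm]
        exact Finset.sum_congr rfl fun l _ => Finset.sum_congr rfl fun k _ => by ring
    _ = _ := by simp [h2]

/-- The Christoffel symbols define a metric connection. -/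
theorem fderiv_metric_eq (hG : DifferentiableAt ℝ G y) (h0 : (gram G y).det ≠ 0)
    (hs : ∀ᶠ z in 𝓝 y, ∀ u v, G z u v = G z v u) (u v w : E4) :
    fderiv ℝ G y u v w
      = G y (christoffelMap G y u v) w + G y v (christoffelMap G y u w) := by
  have hsy := hs.self_of_nhds
  -- the Christoffel symbols with the upper index lowered
  have hlow : ∀ i j m, G y (basisVec m) (christoffelMap G y (basisVec i) (basisVec j))
      = (1 / 2) * (dGram G y i j m + dGram G y j i m - dGram G y m i j) := by
    intro i j m
    rw [← gram_mul_christoffel h0, bilin_eq_gram]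
    simp [christoffelMap_apply]
  have hb : ∀ k i j, fderiv ℝ G y (basisVec k) (basisVec i) (basisVec j)
      = G y (christoffelMap G y (basisVec k) (basisVec i)) (basisVec j)
        + G y (basisVec i) (christoffelMap G y (basisVec k) (basisVec j)) := by
    intro k i j
    rw [hsy _ (basisVec j), hlow, hlow, ← dGram_eq hG, dGram_symm hs k j i,
      dGram_symm hs j k i, dGram_symm hs i k j]
    ring
  have h1 : ∀ i j w, fderiv ℝ G y (basisVec i) (basisVec j) w
      = G y (christoffelMap G y (basisVec i) (basisVec j)) w
        + G y (basisVec j) (christoffelMap G y (basisVec i) w) := fun i j w =>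
    eq_of_basisVec (f := fun w => fderiv ℝ G y (basisVec i) (basisVec j) w)
      (g := fun w => G y (christoffelMap G y (basisVec i) (basisVec j)) w
        + G y (basisVec j) (christoffelMap G y (basisVec i) w))
      ⟨by simp, by simp⟩ ⟨by intros; simp; ring, by intros; simp; ring⟩ (hb i j) w
  have h2 : ∀ i v w, fderiv ℝ G y (basisVec i) v w
      = G y (christoffelMap G y (basisVec i) v) w
        + G y v (christoffelMap G y (basisVec i) w) := fun i v w =>
    eq_of_basisVec (f := fun v => fderiv ℝ G y (basisVec i) v w)
      (g := fun v => G y (christoffelMap G y (basisVec i) v) w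
        + G y v (christoffelMap G y (basisVec i) w))
      ⟨by simp, by simp⟩ ⟨by intros; simp; ring, by intros; simp; ring⟩ (fun j => h1 i j w) v
  exact eq_of_basisVec (f := fun u => fderiv ℝ G y u v w)
      (g := fun u => G y (christoffelMap G y u v) w + G y v (christoffelMap G y u w))
      ⟨by simp, by simp⟩ ⟨by intros; simp; ring, by intros; simp; ring⟩ (fun i => h2 i v w) u

/-- The coordinate Riemann tensor is the curvature of the connection with Christoffel map
`christoffelMap G`, evaluated as `R(u, v) w`. -/
theorem curvOp_christoffelMap (hG : ContDiffAt ℝ ∞ G y) (h0 : (gram G y).det ≠ 0)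
    (u v w : E4) (a : Fin 4) :
    curvOp (christoffelMap G) y u v w a
      = ∑ b, ∑ c, ∑ d, riemann G y a b c d * w b * u c * v d := by
  have hC := (contDiffAt_christoffelMap hG h0).differentiableAt (by simp)
  -- the terms linear in the derivatives of the Christoffel symbols
  have hD : ∀ u v w : E4, fderiv ℝ (christoffelMap G) y u v w a
      = ∑ b, ∑ c, ∑ d, fderiv ℝ (fun z => christoffel G z a d b) y (basisVec c)
        * w b * u c * v d := by
    intro u v w
    have e1 : HasFDerivAt (fun z => dcoord a (christoffelMap G z v w)) _ y :=
      (dcoord a).hasFDerivAt.comp y ((hC.hasFDerivAt.clm_apply (hasFDerivAt_const v y)).clm_apply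
        (hasFDerivAt_const w y))
    have e2 : HasFDerivAt (fun z => ∑ i, ∑ j, christoffel G z a i j * v i * w j) _ y :=
      HasFDerivAt.fun_sum (u := Finset.univ) fun i _ =>
        HasFDerivAt.fun_sum (u := Finset.univ) fun j _ =>
          (((contDiffAt_christoffel hG h0 a i j).differentiableAt
            (by simp)).hasFDerivAt.mul_const (v i)).mul_const (w j)
    have e3 : (fun z => dcoord a (christoffelMap G z v w))
        = fun z => ∑ i, ∑ j, christoffel G z a i j * v i * w j :=
      funext fun z => by rw [dcoord_apply, christoffelMap_apply]
    rw [e3] at e1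
    have h := DFunLike.congr_fun (e1.unique e2) u
    simp only [ContinuousLinearMap.comp_apply, add_apply, ContinuousLinearMap.flip_apply,
      zero_apply, map_zero, zero_add, dcoord_apply, sum_apply, smul_apply,
      smul_eq_mul] at h
    rw [h, Finset.sum_comm]
    refine Finset.sum_congr rfl fun b _ => ?_
    rw [Finset.sum_comm]
    refine Finset.sum_congr rfl fun d _ => ?_
    conv_lhs => rw [← sum_basisVec u]
    rw [map_sum, Finset.mul_sum, Finset.mul_sum]
    refine Finset.sum_congr rfl fun c _ => ?_
    rw [map_smul, smul_eq_mul]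
    ring
  -- the quadratic terms
  have hQ : ∀ u v w : E4, christoffelMap G y u (christoffelMap G y v w) a
      = ∑ b, ∑ c, ∑ d, (∑ e, christoffel G y a c e * christoffel G y e d b)
        * w b * u c * v d := by
    intro u v w
    simp only [christoffelMap_apply, Finset.mul_sum, Finset.sum_mul]
    calc _ = ∑ c, ∑ e, ∑ b, ∑ d, christoffel G y a c e * christoffel G y e d b
              * w b * u c * v d := by
            refine Finset.sum_congr rfl fun c _ => Finset.sum_congr rfl fun e _ => ?_
            rw [Finset.sum_comm]
            exact Finset.sum_congr rfl fun b _ => Finset.sum_congr rfl fun d _ => by ring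
      _ = ∑ c, ∑ b, ∑ d, ∑ e, christoffel G y a c e * christoffel G y e d b
              * w b * u c * v d := by
            refine Finset.sum_congr rfl fun c _ => ?_
            rw [Finset.sum_comm]
            exact Finset.sum_congr rfl fun b _ => Finset.sum_comm
      _ = _ := Finset.sum_comm
  have hswap : ∀ f : Fin 4 → Fin 4 → Fin 4 → ℝ, ∑ b, ∑ c, ∑ d, f b c d * w b * v c * u d
      = ∑ b, ∑ c, ∑ d, f b d c * w b * u c * v d := by
    intro f
    refine Finset.sum_congr rfl fun b _ => ?_
    rw [Finset.sum_comm]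
    exact Finset.sum_congr rfl fun c _ => Finset.sum_congr rfl fun d _ => by ring
  simp only [curvOp, PiLp.add_apply, PiLp.sub_apply, hD, hQ]
  rw [hswap, hswap, ← Finset.sum_sub_distrib, ← Finset.sum_add_distrib, ← Finset.sum_sub_distrib]
  refine Finset.sum_congr rfl fun b _ => ?_
  rw [← Finset.sum_sub_distrib, ← Finset.sum_add_distrib, ← Finset.sum_sub_distrib]
  refine Finset.sum_congr rfl fun c _ => ?_
  rw [← Finset.sum_sub_distrib, ← Finset.sum_add_distrib, ← Finset.sum_sub_distrib]
  refine Finset.sum_congr rfl fun d _ => ?_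
  rw [riemann, Finset.sum_sub_distrib]
  ring

end Coordinates

/-! ### Exterior calculus of one-forms on manifolds -/

section VectorForms

variable {F F' : Type*} [NormedAddCommGroup F] [NormedSpace ℝ F] [NormedAddCommGroup F']
  [NormedSpace ℝ F']

theorem dVec_congr {θ θ' : F → F →L[ℝ] ℝ} {y : F} (h : θ =ᶠ[𝓝 y] θ') (v w : F) :
    dVec θ y v w = dVec θ' y v w := by
  rw [dVec, dVec, h.fderiv_eq]

/-- The exterior derivative commutes with pull-backs, because second derivatives are symmetric. -/
theorem dVec_pullback {f : F → F'} {θ : F → F →L[ℝ] ℝ} {θ' : F' → F' →L[ℝ] ℝ} {y : F}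
    (hf : ContDiffAt ℝ 2 f y) (hθ : DifferentiableAt ℝ θ' (f y))
    (h : θ =ᶠ[𝓝 y] fun z => (θ' (f z)).comp (fderiv ℝ f z)) (v w : F) :
    dVec θ y v w = dVec θ' (f y) (fderiv ℝ f y v) (fderiv ℝ f y w) := by
  have hf1 : DifferentiableAt ℝ f y := hf.differentiableAt (by norm_num)
  have hf2 : DifferentiableAt ℝ (fderiv ℝ f) y :=
    (hf.fderiv_right (m := 1) (by norm_num)).differentiableAt (by norm_num)
  have hs := (hf.isSymmSndFDerivAt (by simp)).eq v w
  have h1 : HasFDerivAt (fun z => θ' (f z)) ((fderiv ℝ θ' (f y)).comp (fderiv ℝ f y)) y :=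
    HasFDerivAt.comp (g := θ') (f := f) y hθ.hasFDerivAt hf1.hasFDerivAt
  rw [dVec_congr h, dVec, (h1.clm_comp hf2.hasFDerivAt).fderiv]
  simp only [add_apply, ContinuousLinearMap.comp_apply, ContinuousLinearMap.compL_apply,
    ContinuousLinearMap.flip_apply, hs, dVec]
  ring

end VectorForms

section ManifoldForms

variable {E : Type*} [NormedAddCommGroup E] [NormedSpace ℝ E]
  {N : Type*} [TopologicalSpace N] [ChartedSpace E N]
  {E' : Type*} [NormedAddCommGroup E'] [NormedSpace ℝ E']
  {N' : Type*} [TopologicalSpace N'] [ChartedSpace E' N']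

/-- Fields of covectors. -/
abbrev FormField (E : Type*) [NormedAddCommGroup E] [NormedSpace ℝ E] (N : Type*)
    [TopologicalSpace N] [ChartedSpace E N] :=
  ∀ p : N, TangentSpace 𝓘(ℝ, E) p →L[ℝ] ℝ

theorem mfderiv_eq_fderiv_chart {f : N → N'} {p : N} (hf : MDifferentiableAt 𝓘(ℝ, E) 𝓘(ℝ, E') f p)
    (v : TangentSpace 𝓘(ℝ, E) p) : mfderiv 𝓘(ℝ, E) 𝓘(ℝ, E') f p v
      = fderiv ℝ (writtenInExtChartAt 𝓘(ℝ, E) 𝓘(ℝ, E') p f) (extChartAt 𝓘(ℝ, E) p p) v := by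
  rw [hf.mfderiv, modelWithCornersSelf_coe, Set.range_id, fderivWithin_univ]
  rfl

theorem contDiffAt_writtenInExtChartAt {n : WithTop ℕ∞} {f : N → N'} {p : N}
    (hf : ContMDiffAt 𝓘(ℝ, E) 𝓘(ℝ, E') n f p) :
    ContDiffAt ℝ n (writtenInExtChartAt 𝓘(ℝ, E) 𝓘(ℝ, E') p f) (extChartAt 𝓘(ℝ, E) p p) := by
  have := (contMDiffAt_iff.1 hf).2
  rwa [modelWithCornersSelf_coe, Set.range_id, contDiffWithinAt_univ] at this

theorem extChartAt_target_mem_nhds_self (x : N) {y : E} (hy : y ∈ (extChartAt 𝓘(ℝ, E) x).target) :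
    (extChartAt 𝓘(ℝ, E) x).target ∈ 𝓝 y :=
  (isOpen_extChartAt_target x).mem_nhds hy

theorem formField_congr_point (θ : FormField E N) {p q : N} (h : p = q) (v : E) :
    θ p v = θ q v := by
  subst h; rfl

variable [IsManifold 𝓘(ℝ, E) ∞ N] [IsManifold 𝓘(ℝ, E') ∞ N']

theorem mdifferentiableAt_extChartAt_symm' {x : N} {y : E}
    (hy : y ∈ (extChartAt 𝓘(ℝ, E) x).target) :
    MDifferentiableAt 𝓘(ℝ, E) 𝓘(ℝ, E) (extChartAt 𝓘(ℝ, E) x).symm y := by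
  have : IsManifold 𝓘(ℝ, E) 1 N := IsManifold.of_le (n := ∞) (by simp)
  have := mdifferentiableWithinAt_extChartAt_symm (I := 𝓘(ℝ, E)) hy
  rwa [modelWithCornersSelf_coe, Set.range_id, mdifferentiableWithinAt_univ] at this

theorem mdifferentiableAt_extChartAt_of_mem {x q : N} (hq : q ∈ (extChartAt 𝓘(ℝ, E) x).source) :
    MDifferentiableAt 𝓘(ℝ, E) 𝓘(ℝ, E) (extChartAt 𝓘(ℝ, E) x) q := by
  have : IsManifold 𝓘(ℝ, E) 1 N := IsManifold.of_le (n := ∞) (by simp)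
  exact mdifferentiableAt_extChartAt (by rwa [extChartAt_source] at hq)

theorem chartInvDeriv_mfderiv {x q : N} (hq : q ∈ (extChartAt 𝓘(ℝ, E) x).source)
    (v : TangentSpace 𝓘(ℝ, E) q) :
    (chartInvDeriv x (extChartAt 𝓘(ℝ, E) x q)
      (mfderiv 𝓘(ℝ, E) 𝓘(ℝ, E) (extChartAt 𝓘(ℝ, E) x) q v) : E) = v := by
  have : IsManifold 𝓘(ℝ, E) 1 N := IsManifold.of_le (n := ∞) (by simp)
  have h := mfderivWithin_extChartAt_symm_comp_mfderiv_extChartAt' (I := 𝓘(ℝ, E)) hq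
  rw [modelWithCornersSelf_coe, Set.range_id, mfderivWithin_univ] at h
  exact DFunLike.congr_fun h v

theorem mfderiv_chartInvDeriv {x : N} {y : E} (hy : y ∈ (extChartAt 𝓘(ℝ, E) x).target) (v : E) :
    (mfderiv 𝓘(ℝ, E) 𝓘(ℝ, E) (extChartAt 𝓘(ℝ, E) x) ((extChartAt 𝓘(ℝ, E) x).symm y)
      (chartInvDeriv x y v) : E) = v := by
  have : IsManifold 𝓘(ℝ, E) 1 N := IsManifold.of_le (n := ∞) (by simp)
  have h := mfderiv_extChartAt_comp_mfderivWithin_extChartAt_symm (I := 𝓘(ℝ, E)) hy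
  rw [modelWithCornersSelf_coe, Set.range_id, mfderivWithin_univ] at h
  exact DFunLike.congr_fun h v

theorem chartInvDeriv_self (x : N) (v : E) :
    (chartInvDeriv x (extChartAt 𝓘(ℝ, E) x x) v : E) = v := by
  have : IsManifold 𝓘(ℝ, E) 1 N := IsManifold.of_le (n := ∞) (by simp)
  have h := mfderivWithin_range_extChartAt_symm (I := 𝓘(ℝ, E)) (x := x)
  rw [modelWithCornersSelf_coe, Set.range_id, mfderivWithin_univ] at h
  exact DFunLike.congr_fun h v

theorem oneFormInChart_mfderiv (θ : FormField E N) {x q : N}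
    (hq : q ∈ (extChartAt 𝓘(ℝ, E) x).source) (v : TangentSpace 𝓘(ℝ, E) q) :
    oneFormInChart θ x (extChartAt 𝓘(ℝ, E) x q)
      (mfderiv 𝓘(ℝ, E) 𝓘(ℝ, E) (extChartAt 𝓘(ℝ, E) x) q v) = θ q v := by
  change θ _ (chartInvDeriv x (extChartAt 𝓘(ℝ, E) x q)
      (mfderiv 𝓘(ℝ, E) 𝓘(ℝ, E) (extChartAt 𝓘(ℝ, E) x) q v)) = θ q v
  refine (congrArg (θ _) (chartInvDeriv_mfderiv hq v)).trans ?_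
  exact formField_congr_point θ ((extChartAt 𝓘(ℝ, E) x).left_inv hq) v

theorem oneFormInChart_self (θ : FormField E N) (x : N) (v : E) :
    oneFormInChart θ x (extChartAt 𝓘(ℝ, E) x x) v = θ x v := by
  refine (congrArg (θ _) (chartInvDeriv_self x v)).trans ?_
  exact formField_congr_point θ (extChartAt_to_inv x) v

/-- The chart expression of a pulled back form is the pull-back of the chart expression. -/
theorem oneFormInChart_pullback {f : N → N'} {θ : FormField E N} {θ' : FormField E' N'} {p : N}
    (hf : ContMDiffAt 𝓘(ℝ, E) 𝓘(ℝ, E') 1 f p)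
    (h : ∀ᶠ q in 𝓝 p, ∀ v, θ q v = θ' (f q) (mfderiv 𝓘(ℝ, E) 𝓘(ℝ, E') f q v)) :
    oneFormInChart θ p =ᶠ[𝓝 (extChartAt 𝓘(ℝ, E) p p)] fun y =>
      (oneFormInChart θ' (f p) (writtenInExtChartAt 𝓘(ℝ, E) 𝓘(ℝ, E') p f y)).comp
        (fderiv ℝ (writtenInExtChartAt 𝓘(ℝ, E) 𝓘(ℝ, E') p f) y) := by
  have : IsManifold 𝓘(ℝ, E) 1 N := IsManifold.of_le (n := ∞) (by simp)
  have : IsManifold 𝓘(ℝ, E') 1 N' := IsManifold.of_le (n := ∞) (by simp)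
  have hfn : ∀ᶠ q in 𝓝 p, ContMDiffAt 𝓘(ℝ, E) 𝓘(ℝ, E') 1 f q :=
    (contMDiffAt_iff_contMDiffAt_nhds (by simp)).1 hf
  have hsrc : ∀ᶠ q in 𝓝 p, f q ∈ (extChartAt 𝓘(ℝ, E') (f p)).source :=
    hf.continuousAt.eventually (extChartAt_source_mem_nhds (f p))
  have htend : Filter.Tendsto (extChartAt 𝓘(ℝ, E) p).symm (𝓝 (extChartAt 𝓘(ℝ, E) p p)) (𝓝 p) := by
    have := (continuousAt_extChartAt_symm (I := 𝓘(ℝ, E)) p)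
    rwa [ContinuousAt, extChartAt_to_inv] at this
  filter_upwards [htend.eventually h, htend.eventually hfn,
    (htend.eventually hsrc.eventually_nhds), extChartAt_target_mem_nhds (I := 𝓘(ℝ, E)) p]
    with y h1 h2 h3 h4
  ext v
  set q := (extChartAt 𝓘(ℝ, E) p).symm y with hq
  have hsy := mdifferentiableAt_extChartAt_symm' h4
  have hfq : MDifferentiableAt 𝓘(ℝ, E) 𝓘(ℝ, E') f q := h2.mdifferentiableAt (by simp)
  have hκ' := mdifferentiableAt_extChartAt_of_mem (E := E') (x := f p) (q := f q)
    h3.self_of_nhds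
  have hmem : writtenInExtChartAt 𝓘(ℝ, E) 𝓘(ℝ, E') p f y
      ∈ (extChartAt 𝓘(ℝ, E') (f p)).target :=
    (extChartAt 𝓘(ℝ, E') (f p)).map_source h3.self_of_nhds
  -- the derivative of `f` in the charts
  have hcomp : HasMFDerivAt 𝓘(ℝ, E) 𝓘(ℝ, E') (writtenInExtChartAt 𝓘(ℝ, E) 𝓘(ℝ, E') p f) y
      ((mfderiv 𝓘(ℝ, E') 𝓘(ℝ, E') (extChartAt 𝓘(ℝ, E') (f p)) (f q)).comp
        ((mfderiv 𝓘(ℝ, E) 𝓘(ℝ, E') f q).comp (chartInvDeriv p y))) :=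
    HasMFDerivAt.comp y (g := extChartAt 𝓘(ℝ, E') (f p)) hκ'.hasMFDerivAt
      (HasMFDerivAt.comp y (g := f) hfq.hasMFDerivAt hsy.hasMFDerivAt)
  have hfd : fderiv ℝ (writtenInExtChartAt 𝓘(ℝ, E) 𝓘(ℝ, E') p f) y v
      = mfderiv 𝓘(ℝ, E') 𝓘(ℝ, E') (extChartAt 𝓘(ℝ, E') (f p)) (f q)
        (mfderiv 𝓘(ℝ, E) 𝓘(ℝ, E') f q (chartInvDeriv p y v)) := by
    rw [← mfderiv_eq_fderiv]
    exact DFunLike.congr_fun hcomp.mfderiv v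
  change θ q (chartInvDeriv p y v) = oneFormInChart θ' (f p) _ (fderiv ℝ _ y v)
  rw [h1]
  refine (oneFormInChart_mfderiv θ' h3.self_of_nhds _).symm.trans ?_
  exact congrArg _ hfd.symm

/-- The exterior derivative commutes with pull-backs. -/
theorem dOne_pullback {f : N → N'} {θ : FormField E N} {θ' : FormField E' N'} {p : N}
    (hf : ContMDiffAt 𝓘(ℝ, E) 𝓘(ℝ, E') 2 f p)
    (hθ : DifferentiableAt ℝ (oneFormInChart θ' (f p)) (extChartAt 𝓘(ℝ, E') (f p) (f p)))
    (h : ∀ᶠ q in 𝓝 p, ∀ v, θ q v = θ' (f q) (mfderiv 𝓘(ℝ, E) 𝓘(ℝ, E') f q v))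
    (v w : TangentSpace 𝓘(ℝ, E) p) :
    dOne θ p v w = dOne θ' (f p) (mfderiv 𝓘(ℝ, E) 𝓘(ℝ, E') f p v)
      (mfderiv 𝓘(ℝ, E) 𝓘(ℝ, E') f p w) := by
  have hy : writtenInExtChartAt 𝓘(ℝ, E) 𝓘(ℝ, E') p f (extChartAt 𝓘(ℝ, E) p p)
      = extChartAt 𝓘(ℝ, E') (f p) (f p) := by
    simp [writtenInExtChartAt]
  have hd := dVec_pullback (contDiffAt_writtenInExtChartAt hf)
    (by rw [hy]; exact hθ)
    (oneFormInChart_pullback (hf.of_le (by norm_num)) h) v w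
  have hmf := hf.mdifferentiableAt (by norm_num)
  rw [mfderiv_eq_fderiv_chart hmf, mfderiv_eq_fderiv_chart hmf]
  rw [hy] at hd
  exact hd

theorem oneFormInChart_model (θ : FormField E E) (x : E) :
    oneFormInChart θ x = fun y => (θ y : E →L[ℝ] ℝ) := by
  funext y
  ext v
  change θ _ (chartInvDeriv x y v) = θ y v
  have h : chartInvDeriv x y = ContinuousLinearMap.id ℝ E := by
    unfold chartInvDeriv
    simp only [mfld_simps]
    exact mfderiv_id
  have h2 : (chartInvDeriv x y v : E) = v := DFunLike.congr_fun h v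
  refine (congrArg (θ _) h2).trans ?_
  exact formField_congr_point θ rfl v

theorem dOne_model (θ : FormField E E) (x v w : E) :
    dOne θ x v w = dVec (F := E) (fun y => θ y) x v w := by
  unfold dOne
  rw [oneFormInChart_model]
  simp only [mfld_simps]
  rfl

end ManifoldForms

/-! ### Leibniz rules and Lie brackets -/

section VectorLeibniz

variable {F : Type*} [NormedAddCommGroup F] [NormedSpace ℝ F] {κ : Type*} [Fintype κ] {y : F}

theorem dVec_sum_smul {h : κ → F → ℝ} {β : κ → F → F →L[ℝ] ℝ}
    (hh : ∀ k, DifferentiableAt ℝ (h k) y) (hβ : ∀ k, DifferentiableAt ℝ (β k) y) (v w : F) :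
    dVec (fun z => ∑ k, h k z • β k z) y v w = ∑ k, (fderiv ℝ (h k) y v * β k y w
      - fderiv ℝ (h k) y w * β k y v + h k y * dVec (β k) y v w) := by
  have e : HasFDerivAt (fun z => ∑ k, h k z • β k z) _ y :=
    HasFDerivAt.fun_sum (u := Finset.univ) fun k _ => (hh k).hasFDerivAt.smul (hβ k).hasFDerivAt
  rw [dVec, e.fderiv]
  simp only [sum_apply, add_apply, smul_apply, ContinuousLinearMap.smulRight_apply, smul_eq_mul,
    dVec]
  rw [← Finset.sum_sub_distrib]
  exact Finset.sum_congr rfl fun k _ => by ring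

theorem fderiv_sum_wedge {α β : κ → F → F →L[ℝ] ℝ} (hα' : ∀ k, ContDiffAt ℝ 1 (α k) y)
    (hβ' : ∀ k, ContDiffAt ℝ 1 (β k) y) (v₁ v₂ v₃ : F) :
    fderiv ℝ (fun z => ∑ k, ((α k z).smulRight (β k z) - (β k z).smulRight (α k z))) y v₁ v₂ v₃
      = ∑ k, (fderiv ℝ (α k) y v₁ v₂ * β k y v₃ + α k y v₂ * fderiv ℝ (β k) y v₁ v₃
        - (fderiv ℝ (β k) y v₁ v₂ * α k y v₃ + β k y v₂ * fderiv ℝ (α k) y v₁ v₃)) := by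
  have hα := fun k => (hα' k).differentiableAt (one_ne_zero)
  have hβ := fun k => (hβ' k).differentiableAt (one_ne_zero)
  have e : DifferentiableAt ℝ
      (fun z => ∑ k, ((α k z).smulRight (β k z) - (β k z).smulRight (α k z))) y :=
    (ContDiffAt.sum fun k _ => ((hα' k).smulRight (hβ' k)).sub
      ((hβ' k).smulRight (hα' k))).differentiableAt (one_ne_zero)
  have e1 := ((e.hasFDerivAt.clm_apply (hasFDerivAt_const v₂ y)).clm_apply
    (hasFDerivAt_const v₃ y))
  have e2 : HasFDerivAt (fun z => ∑ k, (α k z v₂ * β k z v₃ - β k z v₂ * α k z v₃)) _ y :=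
    HasFDerivAt.fun_sum (u := Finset.univ) fun k _ =>
      (((hα k).hasFDerivAt.clm_apply (hasFDerivAt_const v₂ y)).mul
        ((hβ k).hasFDerivAt.clm_apply (hasFDerivAt_const v₃ y))).sub
      (((hβ k).hasFDerivAt.clm_apply (hasFDerivAt_const v₂ y)).mul
        ((hα k).hasFDerivAt.clm_apply (hasFDerivAt_const v₃ y)))
  have e3 : (fun z => (∑ k, ((α k z).smulRight (β k z) - (β k z).smulRight (α k z))) v₂ v₃)
      = fun z => ∑ k, (α k z v₂ * β k z v₃ - β k z v₂ * α k z v₃) := by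
    funext z
    simp only [sum_apply, sub_apply, ContinuousLinearMap.smulRight_apply, smul_apply, smul_eq_mul]
  rw [e3] at e1
  have h := DFunLike.congr_fun (e1.unique e2) v₁
  simp only [map_zero, zero_add, ContinuousLinearMap.flip_apply, add_apply, sub_apply, smul_apply,
    ContinuousLinearMap.comp_apply, zero_apply, sum_apply, smul_eq_mul] at h
  rw [h]
  exact Finset.sum_congr rfl fun k _ => by ring

end VectorLeibniz

/-- A family of continuous linear maps on a finite-dimensional space is smooth if all its values
are. -/
theorem contDiffAt_clm_of_apply {F D W : Type*} [NormedAddCommGroup F] [NormedSpace ℝ F]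
    [NormedAddCommGroup D] [NormedSpace ℝ D] [FiniteDimensional ℝ D] [NormedAddCommGroup W]
    [NormedSpace ℝ W] {n : WithTop ℕ∞} {f : F → D →L[ℝ] W} {y : F}
    (h : ∀ v, ContDiffAt ℝ n (fun z => f z v) y) : ContDiffAt ℝ n f y := by
  have hd : Module.finrank ℝ D = Module.finrank ℝ (Fin (Module.finrank ℝ D) → ℝ) :=
    (Module.finrank_fin_fun ℝ).symm
  let e₁ := ContinuousLinearEquiv.ofFinrankEq hd
  let e₂ := (e₁.arrowCongr (1 : W ≃L[ℝ] W)).trans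
    (ContinuousLinearEquiv.piRing (𝕜 := ℝ) (E := W) (Fin (Module.finrank ℝ D)))
  rw [← Function.id_comp f, ← e₂.symm_comp_self]
  exact e₂.symm.contDiff.contDiffAt.comp y (contDiffAt_pi.2 fun i => h _)

section SmoothForms

variable {E : Type*} [NormedAddCommGroup E] [NormedSpace ℝ E]
  {N : Type*} [TopologicalSpace N] [ChartedSpace E N]

/-- The differential of a real function, as a field of covectors. -/
def dFun (h : N → ℝ) : FormField E N := fun p =>
  show E →L[ℝ] ℝ from mfderiv 𝓘(ℝ, E) 𝓘(ℝ, ℝ) h p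

theorem tendsto_extChartAt_symm_self (p : N) :
    Filter.Tendsto (extChartAt 𝓘(ℝ, E) p).symm (𝓝 (extChartAt 𝓘(ℝ, E) p p)) (𝓝 p) := by
  have := (continuousAt_extChartAt_symm (I := 𝓘(ℝ, E)) p)
  rwa [ContinuousAt, extChartAt_to_inv] at this

theorem fderiv_comp_extChartAt_symm {h : N → ℝ} {p : N}
    (hh : MDifferentiableAt 𝓘(ℝ, E) 𝓘(ℝ, ℝ) h p) (v : TangentSpace 𝓘(ℝ, E) p) :
    fderiv ℝ (fun y => h ((extChartAt 𝓘(ℝ, E) p).symm y)) (extChartAt 𝓘(ℝ, E) p p) v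
      = dFun h p v :=
  (mfderiv_eq_fderiv_chart hh v).symm

theorem differentiableAt_comp_extChartAt_symm {h : N → ℝ} {p : N}
    (hh : MDifferentiableAt 𝓘(ℝ, E) 𝓘(ℝ, ℝ) h p) :
    DifferentiableAt ℝ (fun y => h ((extChartAt 𝓘(ℝ, E) p).symm y))
      (extChartAt 𝓘(ℝ, E) p p) := by
  have := hh.2
  simp only [DifferentiableWithinAtProp, modelWithCornersSelf_coe, Set.range_id,
    differentiableWithinAt_univ, Function.comp_def, modelWithCornersSelf_coe_symm, id,
    Set.preimage_univ, Set.inter_univ] at this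
  exact this

variable [IsManifold 𝓘(ℝ, E) ∞ N]

/-- Smoothness of a `1`-form at a point, as a function on the tangent bundle. -/
def SmoothFormAt (θ : FormField E N) (p : N) : Prop :=
  ∀ v : TangentSpace 𝓘(ℝ, E) p, ContMDiffAt 𝓘(ℝ, E).tangent 𝓘(ℝ, ℝ) ∞
    (fun ξ : TangentBundle 𝓘(ℝ, E) N => θ ξ.1 ξ.2) ⟨p, v⟩

/-- The coordinate vector fields of a chart are smooth. -/
theorem contMDiffAt_chartInvDeriv {x : N} {y : E} (hy : y ∈ (extChartAt 𝓘(ℝ, E) x).target)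
    (v : E) : ContMDiffAt 𝓘(ℝ, E) 𝓘(ℝ, E).tangent ∞
      (fun z => (⟨(extChartAt 𝓘(ℝ, E) x).symm z, chartInvDeriv x z v⟩ : TangentBundle 𝓘(ℝ, E) N))
      y := by
  have h1 := (contMDiffOn_extChartAt_symm (I := 𝓘(ℝ, E)) (n := ∞) x).contMDiffOn_tangentMapWithin
    (m := ∞) (by simp) (isOpen_extChartAt_target x).uniqueMDiffOn
  have h3 : ContMDiffOn 𝓘(ℝ, E) 𝓘(ℝ, E).tangent ∞
      (fun z : E => (⟨z, v⟩ : TangentBundle 𝓘(ℝ, E) E)) (extChartAt 𝓘(ℝ, E) x).target :=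
    fun z _ => (contMDiffAt_vectorSpace_iff_contDiffAt.2 contDiffAt_const).contMDiffWithinAt
  have h4 := (h1.comp h3 (fun z hz => hz)).contMDiffAt (extChartAt_target_mem_nhds_self x hy)
  refine h4.congr_of_eventuallyEq ?_
  filter_upwards [extChartAt_target_mem_nhds_self x hy] with z hz
  simp only [Function.comp_apply, tangentMapWithin, chartInvDeriv]
  rw [mfderivWithin_of_mem_nhds (extChartAt_target_mem_nhds_self x hz)]
  rfl

theorem SmoothFormAt.contDiffAt_oneFormInChart [FiniteDimensional ℝ E] {θ : FormField E N} {x : N}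
    {y : E} (hy : y ∈ (extChartAt 𝓘(ℝ, E) x).target)
    (h : SmoothFormAt θ ((extChartAt 𝓘(ℝ, E) x).symm y)) :
    ContDiffAt ℝ ∞ (oneFormInChart θ x) y := by
  refine contDiffAt_clm_of_apply fun v => ?_
  rw [← contMDiffAt_iff_contDiffAt]
  exact ContMDiffAt.comp y (h (chartInvDeriv x y v)) (contMDiffAt_chartInvDeriv hy v)

theorem SmoothFormAt.contDiffAt_self [FiniteDimensional ℝ E] {θ : FormField E N} {x : N}
    (h : SmoothFormAt θ x) :
    ContDiffAt ℝ ∞ (oneFormInChart θ x) (extChartAt 𝓘(ℝ, E) x x) :=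
  SmoothFormAt.contDiffAt_oneFormInChart (mem_extChartAt_target x)
    (by rw [extChartAt_to_inv]; exact h)

/-- The Leibniz rule for the exterior derivative. -/
theorem dOne_sum_smul [FiniteDimensional ℝ E] {κ : Type*} [Fintype κ] {θ : FormField E N}
    {h : κ → N → ℝ} {β : κ → FormField E N} {p : N}
    (hh : ∀ k, MDifferentiableAt 𝓘(ℝ, E) 𝓘(ℝ, ℝ) (h k) p) (hβ : ∀ k, SmoothFormAt (β k) p)
    (heq : ∀ᶠ q in 𝓝 p, ∀ v, θ q v = ∑ k, h k q * β k q v) (v w : TangentSpace 𝓘(ℝ, E) p) :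
    dOne θ p v w = ∑ k, (dFun (h k) p v * β k p w
      - dFun (h k) p w * β k p v + h k p * dOne (β k) p v w) := by
  have e1 : oneFormInChart θ p =ᶠ[𝓝 (extChartAt 𝓘(ℝ, E) p p)] fun y =>
      ∑ k, h k ((extChartAt 𝓘(ℝ, E) p).symm y) • oneFormInChart (β k) p y := by
    filter_upwards [(tendsto_extChartAt_symm_self p).eventually heq] with y hy
    ext v
    rw [sum_apply]
    exact hy _
  have e3 : ∀ k (v : TangentSpace 𝓘(ℝ, E) p),
      oneFormInChart (β k) p (extChartAt 𝓘(ℝ, E) p p) v = β k p v :=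
    fun k v => oneFormInChart_self (β k) p v
  refine (dVec_congr e1 v w).trans ?_
  refine (dVec_sum_smul (fun k => differentiableAt_comp_extChartAt_symm (hh k))
    (fun k => (hβ k).contDiffAt_self.differentiableAt (by simp)) v w).trans ?_
  refine Finset.sum_congr rfl fun k _ => congrArg₂ (· + ·) (congrArg₂ (· - ·)
    (congrArg₂ (· * ·) (fderiv_comp_extChartAt_symm (hh k) v) (e3 k w))
    (congrArg₂ (· * ·) (fderiv_comp_extChartAt_symm (hh k) w) (e3 k v)))
    (congrArg₂ (· * ·) ?_ rfl)
  rw [extChartAt_to_inv]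

/-- For a `1`-form annihilating two vector fields, `dθ(X, Y) = - θ([X, Y])`. -/
theorem dOne_eq_neg_mlieBracket [FiniteDimensional ℝ E] {θ : FormField E N} {p : N}
    {X Y : ∀ q : N, TangentSpace 𝓘(ℝ, E) q} (hθ : SmoothFormAt θ p)
    (hX : ContMDiffAt 𝓘(ℝ, E) 𝓘(ℝ, E).tangent ∞ (fun q => (⟨q, X q⟩ : TangentBundle 𝓘(ℝ, E) N)) p)
    (hY : ContMDiffAt 𝓘(ℝ, E) 𝓘(ℝ, E).tangent ∞ (fun q => (⟨q, Y q⟩ : TangentBundle 𝓘(ℝ, E) N)) p)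
    (h0 : ∀ᶠ q in 𝓝 p, θ q (X q) = 0 ∧ θ q (Y q) = 0) :
    dOne θ p (X p) (Y p) = - θ p (VectorField.mlieBracket 𝓘(ℝ, E) X Y p) := by
  have : IsManifold 𝓘(ℝ, E) 2 N := IsManifold.of_le (n := ∞) ENat.LEInfty.out
  have : IsManifold 𝓘(ℝ, E) 1 N := IsManifold.of_le (n := ∞) (by simp)
  have : CompleteSpace E := FiniteDimensional.complete ℝ E
  set κ := extChartAt 𝓘(ℝ, E) p with hκ
  -- the vector fields in the chart
  let P : (∀ q : N, TangentSpace 𝓘(ℝ, E) q) → E → E := fun Z =>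
    VectorField.mpullbackWithin 𝓘(ℝ, E) 𝓘(ℝ, E) κ.symm Z (Set.range 𝓘(ℝ, E))
  have hP : ∀ Z, ContMDiffAt 𝓘(ℝ, E) 𝓘(ℝ, E).tangent ∞
      (fun q => (⟨q, Z q⟩ : TangentBundle 𝓘(ℝ, E) N)) p → DifferentiableAt ℝ (P Z) (κ p) := by
    intro Z hZ
    have h1 : MDifferentiableWithinAt 𝓘(ℝ, E) 𝓘(ℝ, E).tangent
        (fun q => (⟨q, Z q⟩ : TangentBundle 𝓘(ℝ, E) N)) Set.univ p :=
      (hZ.mdifferentiableAt (by simp)).mdifferentiableWithinAt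
    have h2 := h1.differentiableWithinAt_mpullbackWithin_vectorField
    rw [Set.preimage_univ, Set.univ_inter] at h2
    have hr : Set.range (𝓘(ℝ, E) : E → E) = Set.univ := Set.range_id
    have h3 : DifferentiableWithinAt ℝ (P Z) (Set.range (𝓘(ℝ, E) : E → E)) (κ p) := h2
    rw [hr] at h3
    exact h3.differentiableAt Filter.univ_mem
  -- on the chart domain `P Z` is mapped to `Z` by the inverse chart
  have hPZ : ∀ Z : ∀ q : N, TangentSpace 𝓘(ℝ, E) q, ∀ y ∈ κ.target,
      (chartInvDeriv p y (P Z y) : E) = Z (κ.symm y) := by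
    intro Z y hy
    have hinv := isInvertible_mfderivWithin_extChartAt_symm (I := 𝓘(ℝ, E)) hy
    have h1 := hinv.self_apply_inverse (Z (κ.symm y))
    have hr : mfderivWithin 𝓘(ℝ, E) 𝓘(ℝ, E) κ.symm (Set.range 𝓘(ℝ, E)) y
        = chartInvDeriv p y := by
      rw [modelWithCornersSelf_coe, Set.range_id, mfderivWithin_univ]; rfl
    have h2 : (P Z y : E) = (chartInvDeriv p y).inverse (Z (κ.symm y)) := by
      rw [← hr]; rfl
    rw [hr] at h1
    rw [h2]
    exact h1
  have hself : ∀ Z : ∀ q : N, TangentSpace 𝓘(ℝ, E) q, (P Z (κ p) : E) = Z p := by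
    intro Z
    rw [← chartInvDeriv_self p (P Z (κ p))]
    refine (hPZ Z (κ p) (mem_extChartAt_target p)).trans ?_
    have h : ∀ q, q = p → (Z q : E) = Z p := fun q hq => by subst hq; rfl
    exact h _ (extChartAt_to_inv p)
  have hθd : DifferentiableAt ℝ (oneFormInChart θ p) (κ p) :=
    hθ.contDiffAt_self.differentiableAt (by simp)
  -- differentiating `θ(Z) = 0` in the chart
  have hzero : ∀ Z, ContMDiffAt 𝓘(ℝ, E) 𝓘(ℝ, E).tangent ∞
      (fun q => (⟨q, Z q⟩ : TangentBundle 𝓘(ℝ, E) N)) p → (∀ᶠ q in 𝓝 p, θ q (Z q) = 0) → ∀ ζ : E,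
      fderiv ℝ (oneFormInChart θ p) (κ p) ζ (P Z (κ p))
        + oneFormInChart θ p (κ p) (fderiv ℝ (P Z) (κ p) ζ) = 0 := by
    intro Z hZ hZ0 ζ
    have e1 : (fun y => oneFormInChart θ p y (P Z y)) =ᶠ[𝓝 (κ p)] fun _ => (0 : ℝ) := by
      filter_upwards [(tendsto_extChartAt_symm_self p).eventually hZ0,
        extChartAt_target_mem_nhds (I := 𝓘(ℝ, E)) p] with y hy hyt
      exact (congrArg (θ _) (hPZ Z y hyt)).trans hy
    have e2 := (hθd.hasFDerivAt.clm_apply (hP Z hZ).hasFDerivAt).fderiv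
    rw [e1.fderiv_eq] at e2
    have e3 := DFunLike.congr_fun e2 ζ
    simp only [fderiv_fun_const, Pi.zero_apply, zero_apply, add_apply,
      ContinuousLinearMap.comp_apply, ContinuousLinearMap.flip_apply] at e3
    linarith
  have hX0 := hzero X hX (h0.mono fun q hq => hq.1) (P Y (κ p))
  have hY0 := hzero Y hY (h0.mono fun q hq => hq.2) (P X (κ p))
  have hbr : (VectorField.mlieBracket 𝓘(ℝ, E) X Y p : E)
      = fderiv ℝ (P Y) (κ p) (P X (κ p)) - fderiv ℝ (P X) (κ p) (P Y (κ p)) := by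
    let D : E →L[ℝ] E := mfderiv 𝓘(ℝ, E) 𝓘(ℝ, E) κ p
    have hD : D = ContinuousLinearMap.id ℝ E := mfderiv_extChartAt_self
    have h1 : (VectorField.mlieBracket 𝓘(ℝ, E) X Y p : E)
        = D.inverse (VectorField.lieBracketWithin (E := E) ℝ (P X) (P Y)
            (κ.symm ⁻¹' Set.univ ∩ Set.range (𝓘(ℝ, E) : E → E)) (κ p)) := rfl
    rw [h1, hD, Set.preimage_univ, Set.univ_inter, modelWithCornersSelf_coe, Set.range_id,
      VectorField.lieBracketWithin_univ, ContinuousLinearMap.inverse_id]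
    rfl
  have hfin := oneFormInChart_self θ p (VectorField.mlieBracket 𝓘(ℝ, E) X Y p)
  rw [← hfin, hbr]
  change fderiv ℝ (oneFormInChart θ p) (κ p) (X p) (Y p)
    - fderiv ℝ (oneFormInChart θ p) (κ p) (Y p) (X p) = _
  rw [← hself X, ← hself Y]
  change _ = - oneFormInChart θ p (κ p) (_ - _)
  rw [map_sub]
  linarith

/-- The exterior derivative of a sum of wedge products of `1`-forms. -/
theorem dTwo_sum_wedge [FiniteDimensional ℝ E] {κ : Type*} [Fintype κ]
    {ρ : ∀ p : N, TangentSpace 𝓘(ℝ, E) p →L[ℝ] TangentSpace 𝓘(ℝ, E) p →L[ℝ] ℝ}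
    {α β : κ → FormField E N} {p : N}
    (hα : ∀ k, SmoothFormAt (α k) p) (hβ : ∀ k, SmoothFormAt (β k) p)
    (heq : ∀ᶠ q in 𝓝 p, ∀ v w, ρ q v w = ∑ k, (α k q v * β k q w - β k q v * α k q w))
    (v₁ v₂ v₃ : TangentSpace 𝓘(ℝ, E) p) :
    dTwo ρ p v₁ v₂ v₃ = ∑ k, (dOne (α k) p v₁ v₂ * β k p v₃ - dOne (α k) p v₁ v₃ * β k p v₂
      + dOne (α k) p v₂ v₃ * β k p v₁ - (α k p v₁ * dOne (β k) p v₂ v₃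
        - α k p v₂ * dOne (β k) p v₁ v₃ + α k p v₃ * dOne (β k) p v₁ v₂)) := by
  have e1 : bilinInChart ρ p =ᶠ[𝓝 (extChartAt 𝓘(ℝ, E) p p)] fun y =>
      ∑ k, ((oneFormInChart (α k) p y).smulRight (oneFormInChart (β k) p y)
        - (oneFormInChart (β k) p y).smulRight (oneFormInChart (α k) p y)) := by
    filter_upwards [(tendsto_extChartAt_symm_self p).eventually heq] with y hy
    ext v w
    simp only [sum_apply, sub_apply, ContinuousLinearMap.smulRight_apply,
      smul_apply, smul_eq_mul]
    exact hy _ _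
  have hd : ∀ k, ContDiffAt ℝ 1 (oneFormInChart (α k) p) (extChartAt 𝓘(ℝ, E) p p) :=
    fun k => (hα k).contDiffAt_self.of_le (by simp)
  have hd' : ∀ k, ContDiffAt ℝ 1 (oneFormInChart (β k) p) (extChartAt 𝓘(ℝ, E) p p) :=
    fun k => (hβ k).contDiffAt_self.of_le (by simp)
  have a0 : ∀ k (v : E), oneFormInChart (α k) p (extChartAt 𝓘(ℝ, E) p p) v = α k p v :=
    fun k v => oneFormInChart_self (α k) p v
  have b0 : ∀ k (v : E), oneFormInChart (β k) p (extChartAt 𝓘(ℝ, E) p p) v = β k p v :=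
    fun k v => oneFormInChart_self (β k) p v
  have e2 : ∀ ζ v w : E, fderiv ℝ (bilinInChart ρ p) (extChartAt 𝓘(ℝ, E) p p) ζ v w
      = ∑ k, (fderiv ℝ (oneFormInChart (α k) p) (extChartAt 𝓘(ℝ, E) p p) ζ v * β k p w
        + α k p v * fderiv ℝ (oneFormInChart (β k) p) (extChartAt 𝓘(ℝ, E) p p) ζ w
        - (fderiv ℝ (oneFormInChart (β k) p) (extChartAt 𝓘(ℝ, E) p p) ζ v * α k p w
        + β k p v * fderiv ℝ (oneFormInChart (α k) p) (extChartAt 𝓘(ℝ, E) p p) ζ w)) := by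
    intro ζ v w
    rw [e1.fderiv_eq, fderiv_sum_wedge hd hd']
    exact Finset.sum_congr rfl fun k _ => by rw [a0, b0, a0, b0]
  refine (congrArg₂ (· + ·) (congrArg₂ (· - ·) (e2 v₁ v₂ v₃) (e2 v₂ v₁ v₃))
    (e2 v₃ v₁ v₂)).trans ?_
  rw [← Finset.sum_sub_distrib, ← Finset.sum_add_distrib]
  refine Finset.sum_congr rfl fun k _ => ?_
  unfold dOne
  ring

end SmoothForms

/-! ### Curvature of split metrics in null frames -/

section SplitFrame

/-- A family of vectors of `ℝ⁴` that is dual to itself up to the permutation `τ` of its four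
indices is a basis. -/
theorem expand_of_dual {ι : Type*} [Fintype ι] [DecidableEq ι] (hι : Fintype.card ι = 4)
    {τ : ι → ι} (hτ : ∀ a, τ (τ a) = a) {B : E4 → E4 →L[ℝ] ℝ} {X : ι → E4}
    (h : ∀ a b, B (X a) (X b) = if b = τ a then 1 else 0) (v : E4) :
    v = ∑ a, B (X (τ a)) v • X a := by
  have hc : ∀ (c : ι → ℝ) (b : ι), B (X (τ b)) (∑ a, c a • X a) = c b := by
    intro c b
    simp [h, hτ]
  have hli : LinearIndependent ℝ X := by
    rw [Fintype.linearIndependent_iff]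
    intro c hc0 b
    rw [← hc c b, hc0, map_zero]
  have : Nonempty ι := Fintype.card_pos_iff.1 (by omega)
  let bas := basisOfLinearIndependentOfCardEqFinrank hli (by simp [hι])
  have hv := bas.sum_repr v
  simp only [bas, coe_basisOfLinearIndependentOfCardEqFinrank] at hv
  conv_lhs => rw [← hv]
  refine Finset.sum_congr rfl fun a _ => ?_
  rw [← hc (fun a => bas.repr v a) a]
  simp only [bas]
  rw [hv]

/-- The Gram matrix of a non-degenerate bilinear form is invertible. -/
theorem gram_det_ne_zero {G : E4 → E4 →L[ℝ] E4 →L[ℝ] ℝ} {y : E4}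
    (h : ∀ v, (∀ w, G y v w = 0) → v = 0) : (gram G y).det ≠ 0 := by
  intro h0
  obtain ⟨c, hc, hc0⟩ := Matrix.exists_vecMul_eq_zero_iff.2 h0
  apply hc
  have hv : (WithLp.toLp 2 c : E4) = 0 := by
    refine h _ fun w => ?_
    rw [bilin_eq_gram, Finset.sum_comm]
    refine Finset.sum_eq_zero fun j _ => ?_
    have := congrFun hc0 j
    simp only [Matrix.vecMul, dotProduct, Pi.zero_apply] at this
    rw [← Finset.sum_mul]
    simp only [mul_comm (gram G y _ j)]
    rw [this, zero_mul]
  funext i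
  exact congrFun (congrArg WithLp.ofLp hv) i

variable {F : Type*} [NormedAddCommGroup F] [NormedSpace ℝ F]

/-- The curvature form `dΓ + Γ ∧ Γ` of a matrix-valued `1`-form on a normed space. -/
def curvVec (Γ : Fin 2 → Fin 2 → F → F →L[ℝ] ℝ) (p : F) (i j : Fin 2) (ξ η : F) : ℝ :=
  dVec (Γ i j) p ξ η + ∑ k, (Γ i k p ξ * Γ k j p η - Γ i k p η * Γ k j p ξ)

/-- The four vectors of a split frame, indexed by a sum type. -/
def joinFrame {α : Type*} (e b : Fin 2 → α) : Fin 2 ⊕ Fin 2 → α := Sum.elim e b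

/-- The connection form `diag(Γ, -Γᵀ)`. -/
def joinConn (Γ : Fin 2 → Fin 2 → F → F →L[ℝ] ℝ) :
    Fin 2 ⊕ Fin 2 → Fin 2 ⊕ Fin 2 → F → F →L[ℝ] ℝ
  | .inl i, .inl j => Γ i j
  | .inr i, .inr j => fun z => - Γ j i z
  | _, _ => fun _ => 0

theorem split_frame_dual {B : E4 →L[ℝ] E4 →L[ℝ] ℝ} {e b : Fin 2 → E4}
    (hs : ∀ u v, B u v = B v u) (hee : ∀ i j, B (e i) (e j) = 0)
    (hbb : ∀ i j, B (b i) (b j) = 0) (heb : ∀ i j, B (e i) (b j) = if i = j then 1 else 0)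
    (a c : Fin 2 ⊕ Fin 2) :
    B (joinFrame e b a) (joinFrame e b c) = if c = a.swap then 1 else 0 := by
  rcases a with i | i <;> rcases c with j | j
  · simp [joinFrame, hee]
  · simp [joinFrame, heb, eq_comm]
  · simp [joinFrame, hs (b i), heb]
  · simp [joinFrame, hbb]

/-- The expansion of a vector in a split frame. -/
theorem split_frame_expand {B : E4 →L[ℝ] E4 →L[ℝ] ℝ} {e b : Fin 2 → E4}
    (hs : ∀ u v, B u v = B v u) (hee : ∀ i j, B (e i) (e j) = 0)
    (hbb : ∀ i j, B (b i) (b j) = 0) (heb : ∀ i j, B (e i) (b j) = if i = j then 1 else 0)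
    (v : E4) : v = (∑ i, B (b i) v • e i) + ∑ i, B (e i) v • b i := by
  have h := expand_of_dual (ι := Fin 2 ⊕ Fin 2) (by simp) (τ := Sum.swap) Sum.swap_swap
    (B := fun u => B u) (split_frame_dual hs hee hbb heb) v
  rw [Fintype.sum_sum_type] at h
  exact h

/-- Both structure equations: a form `Γ` with `dα = - Γ ∧ α`, `dᾱ = Γᵀ ∧ ᾱ` for the coframe dual
to a split frame has curvature form the Riemann tensor of the metric. -/
theorem split_frame_curvature {G : E4 → E4 →L[ℝ] E4 →L[ℝ] ℝ} {q : F → E4} {e b : Fin 2 → F → E4}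
    {Γ : Fin 2 → Fin 2 → F → F →L[ℝ] ℝ} {p : F}
    (hG : ContDiffAt ℝ ∞ G (q p)) (hGs : ∀ᶠ y in 𝓝 (q p), ∀ u v, G y u v = G y v u)
    (hq : ContDiffAt ℝ ∞ q p) (he : ∀ i, ContDiffAt ℝ ∞ (e i) p)
    (hb : ∀ i, ContDiffAt ℝ ∞ (b i) p) (hΓ : ∀ i j, DifferentiableAt ℝ (Γ i j) p)
    (hee : ∀ᶠ z in 𝓝 p, ∀ i j, G (q z) (e i z) (e j z) = 0)
    (hbb : ∀ᶠ z in 𝓝 p, ∀ i j, G (q z) (b i z) (b j z) = 0)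
    (heb : ∀ᶠ z in 𝓝 p, ∀ i j, G (q z) (e i z) (b j z) = if i = j then 1 else 0)
    (hsurj : ∀ᶠ z in 𝓝 p, ∀ v, ∃ ξ, fderiv ℝ q z ξ = v)
    (hstr : ∀ᶠ z in 𝓝 p, ∀ i ξ η,
      dVec (fun z => (G (q z) (b i z)).comp (fderiv ℝ q z)) z ξ η
        = -∑ j, (Γ i j z ξ * G (q z) (b j z) (fderiv ℝ q z η)
          - Γ i j z η * G (q z) (b j z) (fderiv ℝ q z ξ)))
    (hstr' : ∀ᶠ z in 𝓝 p, ∀ i ξ η,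
      dVec (fun z => (G (q z) (e i z)).comp (fderiv ℝ q z)) z ξ η
        = ∑ j, (Γ j i z ξ * G (q z) (e j z) (fderiv ℝ q z η)
          - Γ j i z η * G (q z) (e j z) (fderiv ℝ q z ξ))) (j : Fin 2) (ξ η : F) :
    curvOp (christoffelMap G) (q p) (fderiv ℝ q p ξ) (fderiv ℝ q p η) (e j p)
        = ∑ i, curvVec Γ p i j ξ η • e i p ∧
      curvOp (christoffelMap G) (q p) (fderiv ℝ q p ξ) (fderiv ℝ q p η) (b j p)
        = -∑ i, curvVec Γ p j i ξ η • b i p := by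
  set E : Fin 2 ⊕ Fin 2 → F → E4 := joinFrame e b with hE
  have hEc : ∀ a, ContDiffAt ℝ ∞ (E a) p := by
    rintro (i | i)
    · exact he i
    · exact hb i
  have hGsz : ∀ᶠ z in 𝓝 p, ∀ᶠ y in 𝓝 (q z), ∀ u v, G y u v = G y v u :=
    hq.continuousAt.eventually hGs.eventually_nhds
  have hGz : ∀ᶠ z in 𝓝 p, ContDiffAt ℝ 1 G (q z) :=
    hq.continuousAt.eventually ((hG.of_le (by simp)).eventually (by simp))
  -- the frame `(e, b)` is dual to itself up to the exchange of `e` and `b`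
  have hdual : ∀ᶠ z in 𝓝 p, ∀ a c, G (q z) (E a z) (E c z) = if c = a.swap then 1 else 0 := by
    filter_upwards [hGsz, hee, hbb, heb] with z h1 h2 h3 h4 a c
    have h := split_frame_dual (B := G (q z)) (e := fun i => e i z) (b := fun i => b i z)
      h1.self_of_nhds h2 h3 h4 a c
    rcases a with i | i <;> rcases c with k | k <;> exact h
  have hqz : ∀ᶠ z in 𝓝 p, ContDiffAt ℝ 2 q z :=
    (hq.of_le ENat.LEInfty.out).eventually (by simp)
  have hEz : ∀ᶠ z in 𝓝 p, ∀ a, ContDiffAt ℝ 1 (E a) z :=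
    Filter.eventually_all.2 fun a => ((hEc a).of_le ENat.LEInfty.out).eventually (by simp)
  have hdet : ∀ᶠ z in 𝓝 p, (gram G (q z)).det ≠ 0 := by
    filter_upwards [hdual, hGsz] with z hz hs
    refine gram_det_ne_zero fun v hv => ?_
    rw [expand_of_dual (by simp) Sum.swap_swap (B := fun u => G (q z) u) hz v]
    refine Finset.sum_eq_zero fun a _ => ?_
    rw [hs.self_of_nhds, hv, zero_smul]
  -- `diag(Γ, -Γᵀ)` is the Levi-Civita connection form of the frame, near `p`
  have hconn : ∀ c, ∀ᶠ z in 𝓝 p, ∀ ξ, fderiv ℝ (E c) z ξ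
      + christoffelMap G (q z) (fderiv ℝ q z ξ) (E c z)
        = ∑ a, joinConn Γ a c z ξ • E a z := by
    intro c
    filter_upwards [hdual.eventually_nhds, hGsz, hGz, hqz, hEz, hdet, hsurj, hstr, hstr']
      with z h1 h2 h3 h4 h5 h6 h7 h8 h9 ξ
    have h3' : DifferentiableAt ℝ G (q z) := h3.differentiableAt (by simp)
    refine moving_frame_connection (τ := Sum.swap) Sum.swap_swap h4
      (fun a => (h5 a).differentiableAt (by simp)) h3' (christoffelMap_symm h2)
      (fderiv_metric_eq h3' h6 h2) h2.self_of_nhds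
      (fun a c => h1.mono fun z hz => hz a c)
      (expand_of_dual (by simp) Sum.swap_swap (B := fun u => G (q z) u) h1.self_of_nhds) h7
      (om := fun a c ξ => joinConn Γ a c z ξ) ?_ ?_ c ξ
    · rintro (i | i) (k | k) ξ <;> simp [joinConn]
    · rintro (i | i) ξ η
      · rw [Fintype.sum_sum_type]
        simpa [joinConn, joinFrame, hE] using h8 i ξ η
      · rw [Fintype.sum_sum_type]
        have := h9 i ξ η
        simp only [joinConn, joinFrame, hE, Sum.swap_inr, Sum.swap_inl, Sum.elim_inl,
          Sum.elim_inr, zero_apply, neg_apply, zero_mul, sub_zero, Finset.sum_const_zero,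
          zero_add] at this ⊢
        rw [this, ← Finset.sum_neg_distrib]
        exact Finset.sum_congr rfl fun k _ => by ring
  have hCd : DifferentiableAt ℝ (christoffelMap G) (q p) :=
    (contDiffAt_christoffelMap hG hdet.self_of_nhds).differentiableAt (by simp)
  have hom : ∀ a c, DifferentiableAt ℝ (joinConn Γ a c) p := by
    rintro (i | i) (k | k)
    · exact hΓ i k
    · exact differentiableAt_const _
    · exact differentiableAt_const _
    · exact (hΓ k i).neg
  -- the two null planes are parallel, so only the diagonal blocks contribute to the curvature
  have key := fun c => moving_frame_curvature hqz.self_of_nhds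
    (fun a => (hEc a).of_le ENat.LEInfty.out) hCd hom hconn c ξ η
  constructor
  · have h := key (.inl j)
    rw [Fintype.sum_sum_type] at h
    refine h.trans ?_
    rw [Finset.sum_eq_zero (s := Finset.univ) (f := fun k : Fin 2 => (_ : ℝ) • E (.inr k) p)]
    · rw [add_zero]
      refine Finset.sum_congr rfl fun i _ => ?_
      rw [Fintype.sum_sum_type]
      simp [joinConn, curvVec, hE, joinFrame]
    · intro k _
      rw [Fintype.sum_sum_type]
      simp [joinConn, dVec]
  · have h := key (.inr j)
    rw [Fintype.sum_sum_type] at h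
    refine h.trans ?_
    rw [Finset.sum_eq_zero (s := Finset.univ) (f := fun k : Fin 2 => (_ : ℝ) • E (.inl k) p)]
    · rw [zero_add, ← Finset.sum_neg_distrib]
      refine Finset.sum_congr rfl fun i _ => ?_
      rw [Fintype.sum_sum_type, ← neg_smul]
      congr 1
      have hneg : dVec (fun z => - Γ j i z) p ξ η = - dVec (Γ j i) p ξ η := by
        simp only [dVec, fderiv_fun_neg, neg_apply]; ring
      simp only [joinConn, curvVec, zero_apply, mul_zero, sub_zero,
        Finset.sum_const_zero, zero_add, hneg, neg_apply, neg_add, ← Finset.sum_neg_distrib]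
      congr 1
      exact Finset.sum_congr rfl fun k _ => by ring
    · intro k _
      rw [Fintype.sum_sum_type]
      simp [joinConn, dVec]

end SplitFrame

/-! ### Curvature of the frame geometry -/

section Naturality

variable {E : Type*} [NormedAddCommGroup E] [NormedSpace ℝ E]
  {N : Type*} [TopologicalSpace N] [ChartedSpace E N] [IsManifold 𝓘(ℝ, E) ∞ N]
  {E' : Type*} [NormedAddCommGroup E'] [NormedSpace ℝ E']
  {N' : Type*} [TopologicalSpace N'] [ChartedSpace E' N'] [IsManifold 𝓘(ℝ, E') ∞ N']
  {D : Type*} [NormedAddCommGroup D] [NormedSpace ℝ D] {H : Type*} [TopologicalSpace H]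
  {J : ModelWithCorners ℝ D H} {X : Type*} [TopologicalSpace X] [ChartedSpace H X]

/-- The differential of a smooth map, applied to a smooth family of tangent vectors. -/
theorem contMDiffAt_tangentMap {Φ : N → N'} {f : X → TangentBundle 𝓘(ℝ, E) N} {x : X}
    (hf : ContMDiffAt J 𝓘(ℝ, E).tangent ∞ f x)
    (hΦ : ∀ᶠ y in 𝓝 (f x).1, ContMDiffAt 𝓘(ℝ, E) 𝓘(ℝ, E') ∞ Φ y) :
    ContMDiffAt J 𝓘(ℝ, E').tangent ∞
      (fun z => (⟨Φ (f z).1, mfderiv 𝓘(ℝ, E) 𝓘(ℝ, E') Φ (f z).1 (f z).2⟩ :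
        TangentBundle 𝓘(ℝ, E') N')) x := by
  obtain ⟨s, hs, hso, hxs⟩ := eventually_nhds_iff.1 hΦ
  have h1 : ContMDiffOn 𝓘(ℝ, E) 𝓘(ℝ, E') ∞ Φ s := fun y hy => (hs y hy).contMDiffWithinAt
  have h2 := h1.contMDiffOn_tangentMapWithin (m := ∞) (by simp) hso.uniqueMDiffOn
  have hopen : IsOpen (π E (TangentSpace 𝓘(ℝ, E) : N → Type _) ⁻¹' s) :=
    hso.preimage (FiberBundle.continuous_proj E (TangentSpace 𝓘(ℝ, E) : N → Type _))
  have h3 := (h2.contMDiffAt (hopen.mem_nhds hxs)).comp x hf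
  refine h3.congr_of_eventuallyEq ?_
  filter_upwards [hf.continuousAt.eventually (hopen.mem_nhds hxs)] with z hz
  have hz' : (f z).1 ∈ s := hz
  simp only [Function.comp, tangentMapWithin, mfderivWithin_of_isOpen hso hz']

/-- The differential of a map to a vector space. -/
def vecDeriv (Φ : N → E') (x : N) : TangentSpace 𝓘(ℝ, E) x →L[ℝ] E' :=
  mfderiv 𝓘(ℝ, E) 𝓘(ℝ, E') Φ x

theorem contMDiffAt_vecDeriv_apply {Φ : N → E'} {f : X → TangentBundle 𝓘(ℝ, E) N} {x : X}
    (hf : ContMDiffAt J 𝓘(ℝ, E).tangent ∞ f x)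
    (hΦ : ∀ᶠ y in 𝓝 (f x).1, ContMDiffAt 𝓘(ℝ, E) 𝓘(ℝ, E') ∞ Φ y) :
    ContMDiffAt J 𝓘(ℝ, E') ∞
      (fun z => vecDeriv Φ (f z).1 (f z).2) x :=
  (contMDiff_snd_tangentBundle_modelSpace E' 𝓘(ℝ, E')).contMDiffAt.comp x
    (contMDiffAt_tangentMap hf hΦ)

/-- The exterior derivative of a form written in a chart. -/
theorem dVec_oneFormInChart [FiniteDimensional ℝ E] {θ : FormField E N} {x : N} {y : E}
    (hy : y ∈ (extChartAt 𝓘(ℝ, E) x).target)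
    (hθ : SmoothFormAt θ ((extChartAt 𝓘(ℝ, E) x).symm y)) (v w : E) :
    dVec (oneFormInChart θ x) y v w
      = dOne θ ((extChartAt 𝓘(ℝ, E) x).symm y) (chartInvDeriv x y v) (chartInvDeriv x y w) := by
  have h := dOne_pullback (f := (extChartAt 𝓘(ℝ, E) x).symm) (p := y) (θ' := θ)
    (θ := (oneFormInChart θ x : E → E →L[ℝ] ℝ))
    (((contMDiffOn_extChartAt_symm (n := ∞) x).contMDiffAt
      (extChartAt_target_mem_nhds_self x hy)).of_le ENat.LEInfty.out)
    (hθ.contDiffAt_self.differentiableAt (by simp)) (Filter.Eventually.of_forall fun q v => rfl) v w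
  exact (dOne_model (E := E) _ y v w).symm.trans h

end Naturality

section Frame

variable {M : Type u} [TopologicalSpace M] [ChartedSpace E4 M] [IsManifold 𝓘(ℝ, E4) ∞ M]
  {g : BilinField M} {K : EndField M}

/-- The `1`-form `Γ i j` on the total space. -/
def gamForm (𝒢 : CartanGeometry M) (i j : Fin 2) : FormField E8 𝒢.P := fun p =>
  𝒢.conn i.castSucc j.castSucc p - if i = j then 𝒢.conn 2 2 p else 0

theorem gamForm_apply (𝒢 : CartanGeometry M) (i j : Fin 2) (p : 𝒢.P)
    (ξ : TangentSpace 𝓘(ℝ, E8) p) : gamForm 𝒢 i j p ξ = 𝒢.Gam p ξ i j := by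
  unfold gamForm CartanGeometry.Gam
  split_ifs <;> simp

theorem smoothFormAt_conn (𝒢 : CartanGeometry M) (i j : Fin 3) (p : 𝒢.P) :
    SmoothFormAt (𝒢.conn i j) p := fun _ => (𝒢.smooth_conn i j).contMDiffAt

theorem smoothFormAt_gamForm (𝒢 : CartanGeometry M) (i j : Fin 2) (p : 𝒢.P) :
    SmoothFormAt (gamForm 𝒢 i j) p := by
  intro v
  have h1 := smoothFormAt_conn 𝒢 i.castSucc j.castSucc p v
  have h2 := smoothFormAt_conn 𝒢 2 2 p v
  by_cases hij : i = j
  · refine (h1.sub h2).congr_of_eventuallyEq (Filter.Eventually.of_forall fun ξ => ?_)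
    simp [gamForm, hij]
  · refine h1.congr_of_eventuallyEq (Filter.Eventually.of_forall fun ξ => ?_)
    simp [gamForm, hij]

/-- The curvature form `dΓ + Γ ∧ Γ` on the total space. -/
def curvForm (𝒢 : CartanGeometry M) (p : 𝒢.P) (i j : Fin 2) (ξ η : TangentSpace 𝓘(ℝ, E8) p) : ℝ :=
  dOne (gamForm 𝒢 i j) p ξ η
    + ∑ k, (gamForm 𝒢 i k p ξ * gamForm 𝒢 k j p η - gamForm 𝒢 i k p η * gamForm 𝒢 k j p ξ)

/-- A vector is determined by its products with a null frame. -/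
theorem eq_of_inner_frame {B : E4 →L[ℝ] E4 →L[ℝ] ℝ} {e b : Fin 2 → E4}
    (hs : ∀ u v, B u v = B v u) (hee : ∀ i j, B (e i) (e j) = 0)
    (hbb : ∀ i j, B (b i) (b j) = 0) (heb : ∀ i j, B (e i) (b j) = if i = j then 1 else 0)
    {u v : E4} (h1 : ∀ i, B (b i) u = B (b i) v) (h2 : ∀ i, B (e i) u = B (e i) v) : u = v := by
  rw [split_frame_expand hs hee hbb heb u, split_frame_expand hs hee hbb heb v]
  simp only [h1, h2]

/-- The entries `α`, `ᾱ`, `Γ` of the Cartan connection can be prescribed independently. -/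
theorem exists_conn_eq (𝒢 : CartanGeometry M) (p : 𝒢.P) (a b : Fin 2 → ℝ) (c : Fin 2 → Fin 2 → ℝ) :
    ∃ ξ : TangentSpace 𝓘(ℝ, E8) p, (∀ i : Fin 2, 𝒢.conn i.castSucc 2 p ξ = a i)
      ∧ (∀ i : Fin 2, 𝒢.conn 2 i.castSucc p ξ = b i) ∧ ∀ i j, gamForm 𝒢 i j p ξ = c i j := by
  obtain ⟨ξ, hξ, -⟩ := 𝒢.iso p !![c 0 0 - (c 0 0 + c 1 1) / 3, c 0 1, a 0;
    c 1 0, c 1 1 - (c 0 0 + c 1 1) / 3, a 1; b 0, b 1, - (c 0 0 + c 1 1) / 3]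
    (by simp [Matrix.trace_fin_three]; ring)
  refine ⟨ξ, fun i => ?_, fun i => ?_, fun i j => ?_⟩
  · fin_cases i
    · exact hξ 0 2
    · exact hξ 1 2
  · fin_cases i
    · exact hξ 2 0
    · exact hξ 2 1
  · rw [gamForm_apply]
    unfold CartanGeometry.Gam
    fin_cases i <;> fin_cases j
    · refine (congrArg₂ (· - ·) (hξ 0 0) (if_pos rfl |>.trans (hξ 2 2))).trans ?_
      simp; ring
    · refine (congrArg₂ (· - ·) (hξ 0 1) (if_neg (by decide))).trans ?_
      simp
    · refine (congrArg₂ (· - ·) (hξ 1 0) (if_neg (by decide))).trans ?_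
      simp
    · refine (congrArg₂ (· - ·) (hξ 1 1) (if_pos rfl |>.trans (hξ 2 2))).trans ?_
      simp; ring

/-- For an isometric immersion `Φ` of an open subset of `M` in `ℝ⁴` with a metric `G`, the Riemann
tensor of `G` in the frame `dΦ(fr p)` is the curvature form of the frame geometry. -/
theorem curvOp_frame {𝒢 : CartanGeometry M} {fr : ∀ p : 𝒢.P, AdaptedFrame g K (𝒢.proj p)}
    (h : IsFrameGeometry 𝒢 fr) (p : 𝒢.P) {Φ : M → E4}
    {G : E4 → E4 →L[ℝ] E4 →L[ℝ] ℝ}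
    (hΦ : ∀ᶠ x in 𝓝 (𝒢.proj p), ContMDiffAt 𝓘(ℝ, E4) 𝓘(ℝ, E4) ∞ Φ x)
    (hG : ContDiffAt ℝ ∞ G (Φ (𝒢.proj p)))
    (hGs : ∀ᶠ y in 𝓝 (Φ (𝒢.proj p)), ∀ u v, G y u v = G y v u)
    (hiso : ∀ᶠ x in 𝓝 (𝒢.proj p), ∀ v w : TangentSpace 𝓘(ℝ, E4) x,
      g x v w = G (Φ x) (vecDeriv Φ x v) (vecDeriv Φ x w))
    (j : Fin 2) (ξ η : TangentSpace 𝓘(ℝ, E8) p) :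
    curvOp (christoffelMap G) (Φ (𝒢.proj p))
        (vecDeriv Φ (𝒢.proj p) (mfderiv 𝓘(ℝ, E8) 𝓘(ℝ, E4) 𝒢.proj p ξ))
        (vecDeriv Φ (𝒢.proj p) (mfderiv 𝓘(ℝ, E8) 𝓘(ℝ, E4) 𝒢.proj p η))
        (vecDeriv Φ (𝒢.proj p) ((fr p).e j))
        = ∑ i, curvForm 𝒢 p i j ξ η • vecDeriv Φ (𝒢.proj p) ((fr p).e i) ∧
      curvOp (christoffelMap G) (Φ (𝒢.proj p))
        (vecDeriv Φ (𝒢.proj p) (mfderiv 𝓘(ℝ, E8) 𝓘(ℝ, E4) 𝒢.proj p ξ))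
        (vecDeriv Φ (𝒢.proj p) (mfderiv 𝓘(ℝ, E8) 𝓘(ℝ, E4) 𝒢.proj p η))
        (vecDeriv Φ (𝒢.proj p) ((fr p).ebar j))
        = -∑ i, curvForm 𝒢 p j i ξ η • vecDeriv Φ (𝒢.proj p) ((fr p).ebar i) := by
  -- everything is transported to a chart of the total space: `q` is the map to `ℝ⁴`, `e` and `b`
  -- are the images of the frame, and `Γ` is the connection form
  set κ := extChartAt 𝓘(ℝ, E8) p with hκ
  set z₀ := κ p with hz₀
  let dΦ : ∀ x : M, E4 →L[ℝ] E4 := vecDeriv Φ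
  let dπ : ∀ p : 𝒢.P, E8 →L[ℝ] E4 := fun p => mfderiv 𝓘(ℝ, E8) 𝓘(ℝ, E4) 𝒢.proj p
  let q : E8 → E4 := fun z => Φ (𝒢.proj (κ.symm z))
  let e : Fin 2 → E8 → E4 := fun i z => dΦ (𝒢.proj (κ.symm z)) ((fr (κ.symm z)).e i)
  let b : Fin 2 → E8 → E4 := fun i z => dΦ (𝒢.proj (κ.symm z)) ((fr (κ.symm z)).ebar i)
  let Γ : Fin 2 → Fin 2 → E8 → E8 →L[ℝ] ℝ := fun i j => oneFormInChart (gamForm 𝒢 i j) p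
  have hsymm0 : κ.symm z₀ = p := extChartAt_to_inv p
  have htend : Filter.Tendsto κ.symm (𝓝 z₀) (𝓝 p) := tendsto_extChartAt_symm_self p
  have hπc : Continuous 𝒢.proj := 𝒢.smooth_proj.continuous
  have htend' : Filter.Tendsto (fun z => 𝒢.proj (κ.symm z)) (𝓝 z₀) (𝓝 (𝒢.proj p)) :=
    (hπc.tendsto p).comp htend
  have htar : ∀ᶠ z in 𝓝 z₀, z ∈ κ.target := extChartAt_target_mem_nhds (I := 𝓘(ℝ, E8)) p
  have hΦz := htend'.eventually hΦ
  have hΦz2 := htend'.eventually hΦ.eventually_nhds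
  have hisoz := htend'.eventually hiso
  have hκsm : ∀ z ∈ κ.target, ContMDiffAt 𝓘(ℝ, E8) 𝓘(ℝ, E8) ∞ κ.symm z := fun z hz =>
    (contMDiffOn_extChartAt_symm (n := ∞) p).contMDiffAt (extChartAt_target_mem_nhds_self p hz)
  have hz₀t : z₀ ∈ κ.target := mem_extChartAt_target p
  have hqd : ∀ z ∈ κ.target, ContMDiffAt 𝓘(ℝ, E4) 𝓘(ℝ, E4) ∞ Φ (𝒢.proj (κ.symm z)) → ∀ ζ,
      fderiv ℝ q z ζ = dΦ (𝒢.proj (κ.symm z)) (dπ (κ.symm z) (chartInvDeriv p z ζ)) := by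
    intro z hz hd ζ
    have h1 := mfderiv_comp z (g := fun x => Φ (𝒢.proj x)) (f := κ.symm) (I := 𝓘(ℝ, E8))
      (I' := 𝓘(ℝ, E8)) (I'' := 𝓘(ℝ, E4))
      ((hd.comp _ 𝒢.smooth_proj.contMDiffAt).mdifferentiableAt (by simp))
      ((hκsm z hz).mdifferentiableAt (by simp))
    have h2 := mfderiv_comp (κ.symm z) (g := Φ) (f := 𝒢.proj) (I := 𝓘(ℝ, E8))
      (I' := 𝓘(ℝ, E4)) (I'' := 𝓘(ℝ, E4)) (hd.mdifferentiableAt (by simp))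
      (𝒢.smooth_proj.contMDiffAt.mdifferentiableAt (by simp))
    have h3 : fderiv ℝ q z = mfderiv 𝓘(ℝ, E8) 𝓘(ℝ, E4) q z := mfderiv_eq_fderiv.symm
    rw [h3]
    refine (DFunLike.congr_fun h1 ζ).trans ?_
    exact DFunLike.congr_fun h2 _
  have hqz₀ : q z₀ = Φ (𝒢.proj p) := by simp only [q, hsymm0]
  have hqsm : ContDiffAt ℝ ∞ q z₀ := by
    have h1 : ContMDiffAt 𝓘(ℝ, E8) 𝓘(ℝ, E4) ∞ q z₀ :=
      ContMDiffAt.comp (g := Φ) (f := fun z => 𝒢.proj (κ.symm z)) z₀ hΦz.self_of_nhds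
        (𝒢.smooth_proj.contMDiffAt.comp z₀ (hκsm z₀ hz₀t))
    exact h1.contDiffAt
  have hesm : ∀ i, ContDiffAt ℝ ∞ (e i) z₀ := fun i =>
    (contMDiffAt_vecDeriv_apply (((h.smooth_e i).contMDiffAt).comp z₀ (hκsm z₀ hz₀t))
      hΦz2.self_of_nhds).contDiffAt
  have hbsm : ∀ i, ContDiffAt ℝ ∞ (b i) z₀ := fun i =>
    (contMDiffAt_vecDeriv_apply (((h.smooth_ebar i).contMDiffAt).comp z₀ (hκsm z₀ hz₀t))
      hΦz2.self_of_nhds).contDiffAt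
  have hΓ : ∀ i j, DifferentiableAt ℝ (Γ i j) z₀ := fun i j =>
    (smoothFormAt_gamForm 𝒢 i j p).contDiffAt_self.differentiableAt (by simp)
  have hGsz : ∀ᶠ z in 𝓝 z₀, ∀ u v, G (q z) u v = G (q z) v u :=
    hqsm.continuousAt.eventually (hqz₀ ▸ hGs)
  have hee : ∀ᶠ z in 𝓝 z₀, ∀ i j, G (q z) (e i z) (e j z) = 0 := by
    filter_upwards [hisoz] with z hz i j
    exact (hz _ _).symm.trans ((fr (κ.symm z)).g_e_e i j)
  have hbb : ∀ᶠ z in 𝓝 z₀, ∀ i j, G (q z) (b i z) (b j z) = 0 := by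
    filter_upwards [hisoz] with z hz i j
    exact (hz _ _).symm.trans ((fr (κ.symm z)).g_ebar_ebar i j)
  have heb : ∀ᶠ z in 𝓝 z₀, ∀ i j, G (q z) (e i z) (b j z) = if i = j then 1 else 0 := by
    filter_upwards [hisoz] with z hz i j
    exact (hz _ _).symm.trans ((fr (κ.symm z)).g_e_ebar i j)
  -- the pulled back coframes are the tautological forms
  have hα : ∀ᶠ z in 𝓝 z₀, ∀ i, (G (q z) (b i z)).comp (fderiv ℝ q z)
      = oneFormInChart (tautForm 𝒢 fr i) p z := by
    filter_upwards [hisoz, htar, hΦz] with z h1 h2 h3 i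
    refine ContinuousLinearMap.ext fun ζ => ?_
    rw [ContinuousLinearMap.comp_apply, hqd z h2 h3]
    exact (h1 _ _).symm
  have hα' : ∀ᶠ z in 𝓝 z₀, ∀ i, (G (q z) (e i z)).comp (fderiv ℝ q z)
      = oneFormInChart (tautFormBar 𝒢 fr i) p z := by
    filter_upwards [hisoz, htar, hΦz] with z h1 h2 h3 i
    refine ContinuousLinearMap.ext fun ζ => ?_
    rw [ContinuousLinearMap.comp_apply, hqd z h2 h3]
    exact (h1 _ _).symm
  have htaut : ∀ i, tautForm 𝒢 fr i = 𝒢.conn i.castSucc 2 := by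
    intro i; funext z; ext1 ζ; exact (h.conn_alpha z ζ i).symm
  have htaut' : ∀ i, tautFormBar 𝒢 fr i = 𝒢.conn 2 i.castSucc := by
    intro i; funext z; ext1 ζ; exact (h.conn_alphaBar z ζ i).symm
  -- `q` is a submersion since `α` and `ᾱ` take arbitrary values
  have hsurj : ∀ᶠ z in 𝓝 z₀, ∀ v, ∃ ζ, fderiv ℝ q z ζ = v := by
    filter_upwards [htar, hα, hα', hGsz, hee, hbb, heb] with z h1 h2 h3 h4 h5 h6 h7 v
    obtain ⟨ζ, ha, hb, -⟩ := exists_conn_eq 𝒢 (κ.symm z) (fun i => G (q z) (b i z) v)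
      (fun i => G (q z) (e i z) v) 0
    let ζ' : E8 := mfderiv 𝓘(ℝ, E8) 𝓘(ℝ, E8) κ (κ.symm z) ζ
    have hζ : ∀ i j, oneFormInChart (𝒢.conn i j) p z ζ' = 𝒢.conn i j (κ.symm z) ζ := by
      intro i j
      have := oneFormInChart_mfderiv (𝒢.conn i j) (κ.map_target h1) ζ
      have hr : κ (κ.symm z) = z := κ.right_inv h1
      rw [← hκ, hr] at this
      exact this
    refine ⟨ζ', eq_of_inner_frame h4 h5 h6 h7 (fun i => ?_) fun i => ?_⟩
    · refine (DFunLike.congr_fun (h2 i) ζ').trans ?_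
      rw [htaut, hζ, ha]
    · refine (DFunLike.congr_fun (h3 i) ζ').trans ?_
      rw [htaut', hζ, hb]
  -- the torsion-free equations of the frame geometry
  have hstr : ∀ᶠ z in 𝓝 z₀, ∀ i ξ η,
      dVec (fun z => (G (q z) (b i z)).comp (fderiv ℝ q z)) z ξ η
        = -∑ j, (Γ i j z ξ * G (q z) (b j z) (fderiv ℝ q z η)
          - Γ i j z η * G (q z) (b j z) (fderiv ℝ q z ξ)) := by
    filter_upwards [hα.eventually_nhds, htar] with z h1 h2 i ζ ζ'
    have h3 : (fun z => (G (q z) (b i z)).comp (fderiv ℝ q z)) =ᶠ[𝓝 z]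
      oneFormInChart (tautForm 𝒢 fr i) p := h1.mono fun z hz => hz i
    refine (dVec_congr h3 ζ ζ').trans ((dVec_oneFormInChart h2 ?_ ζ ζ').trans ?_)
    · rw [htaut]; exact smoothFormAt_conn 𝒢 _ _ _
    · refine (h.torsion_free i _ _ _).trans (congrArg Neg.neg (Finset.sum_congr rfl fun j _ => ?_))
      rw [← gamForm_apply, ← gamForm_apply]
      exact congrArg₂ (· - ·)
        (congrArg₂ (· * ·) rfl (DFunLike.congr_fun (h1.self_of_nhds j) ζ').symm)
        (congrArg₂ (· * ·) rfl (DFunLike.congr_fun (h1.self_of_nhds j) ζ).symm)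
  have hstr' : ∀ᶠ z in 𝓝 z₀, ∀ i ξ η,
      dVec (fun z => (G (q z) (e i z)).comp (fderiv ℝ q z)) z ξ η
        = ∑ j, (Γ j i z ξ * G (q z) (e j z) (fderiv ℝ q z η)
          - Γ j i z η * G (q z) (e j z) (fderiv ℝ q z ξ)) := by
    filter_upwards [hα'.eventually_nhds, htar] with z h1 h2 i ζ ζ'
    have h3 : (fun z => (G (q z) (e i z)).comp (fderiv ℝ q z)) =ᶠ[𝓝 z]
      oneFormInChart (tautFormBar 𝒢 fr i) p := h1.mono fun z hz => hz i
    refine (dVec_congr h3 ζ ζ').trans ((dVec_oneFormInChart h2 ?_ ζ ζ').trans ?_)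
    · rw [htaut']; exact smoothFormAt_conn 𝒢 _ _ _
    · refine (h.torsion_free_bar i _ _ _).trans (Finset.sum_congr rfl fun j _ => ?_)
      rw [← gamForm_apply, ← gamForm_apply]
      exact congrArg₂ (· - ·)
        (congrArg₂ (· * ·) rfl (DFunLike.congr_fun (h1.self_of_nhds j) ζ').symm)
        (congrArg₂ (· * ·) rfl (DFunLike.congr_fun (h1.self_of_nhds j) ζ).symm)
  have key := split_frame_curvature (G := G) (q := q) (e := e) (b := b) (Γ := Γ) (p := z₀)
    (hqz₀ ▸ hG) (hqz₀ ▸ hGs) hqsm hesm hbsm hΓ hee hbb heb hsurj hstr hstr' j ξ η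
  have hdq : ∀ ζ, fderiv ℝ q z₀ ζ = dΦ (𝒢.proj p) (dπ p ζ) := by
    intro ζ
    rw [hqd z₀ hz₀t hΦz.self_of_nhds, hsymm0]
    exact congrArg (fun t => dΦ (𝒢.proj p) (dπ p t)) (chartInvDeriv_self p ζ)
  have hfr : ∀ p', p' = p → ∀ i, dΦ (𝒢.proj p') ((fr p').e i) = dΦ (𝒢.proj p) ((fr p).e i)
      ∧ dΦ (𝒢.proj p') ((fr p').ebar i) = dΦ (𝒢.proj p) ((fr p).ebar i) := by
    rintro _ rfl i; exact ⟨rfl, rfl⟩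
  have hei : ∀ i, e i z₀ = dΦ (𝒢.proj p) ((fr p).e i) := fun i => (hfr _ hsymm0 i).1
  have hbi : ∀ i, b i z₀ = dΦ (𝒢.proj p) ((fr p).ebar i) := fun i => (hfr _ hsymm0 i).2
  have hcurv : ∀ i j, curvVec Γ z₀ i j ξ η = curvForm 𝒢 p i j ξ η := by
    intro i j
    have hd : dVec (Γ i j) z₀ ξ η = dOne (gamForm 𝒢 i j) p ξ η := rfl
    have hs : ∀ i j (ζ : E8), Γ i j z₀ ζ = gamForm 𝒢 i j p ζ :=
      fun i j ζ => oneFormInChart_self (gamForm 𝒢 i j) p ζ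
    refine congrArg₂ (· + ·) hd (Finset.sum_congr rfl fun k _ => congrArg₂ (· - ·)
      (congrArg₂ (· * ·) (hs _ _ ξ) (hs _ _ η)) (congrArg₂ (· * ·) (hs _ _ η) (hs _ _ ξ)))
  have hξ := hdq ξ
  have hη := hdq η
  simp only [hqz₀, hei, hbi, hcurv] at key
  rw [hξ, hη] at key
  exact key

end Frame

/-! ### Ricci and Weyl tensors in split frames -/

section CurvTri

variable {V : Type*} [NormedAddCommGroup V] [NormedSpace ℝ V]

theorem curvOp_add_left (C : V → V →L[ℝ] V →L[ℝ] V) (y u u' v w : V) :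
    curvOp C y (u + u') v w = curvOp C y u v w + curvOp C y u' v w := by
  unfold curvOp
  generalize fderiv ℝ C y = D
  rw [D.map_add, (D v).map_add, (C y).map_add, add_apply, add_apply, add_apply, add_apply,
    add_apply, (C y v).map_add]
  abel

theorem curvOp_smul_left (C : V → V →L[ℝ] V →L[ℝ] V) (y : V) (c : ℝ) (u v w : V) :
    curvOp C y (c • u) v w = c • curvOp C y u v w := by
  unfold curvOp
  generalize fderiv ℝ C y = D
  rw [D.map_smul, (D v).map_smul, (C y).map_smul, smul_apply, smul_apply, smul_apply, smul_apply,
    smul_apply, (C y v).map_smul]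
  module

theorem curvOp_swap (C : V → V →L[ℝ] V →L[ℝ] V) (y u v w : V) :
    curvOp C y u v w = - curvOp C y v u w := by
  unfold curvOp; abel

/-- The curvature as a trilinear map. -/
def curvTri (C : V → V →L[ℝ] V →L[ℝ] V) (y : V) : V →ₗ[ℝ] V →ₗ[ℝ] V →ₗ[ℝ] V :=
  LinearMap.mk₂ ℝ (fun u v =>
    { toFun := fun w => curvOp C y u v w
      map_add' := fun w w' => by
        unfold curvOp
        generalize fderiv ℝ C y = D
        rw [(D u v).map_add, (D v u).map_add, (C y v).map_add, (C y u).map_add, (C y u).map_add,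
          (C y v).map_add]
        abel
      map_smul' := fun c w => by
        unfold curvOp
        generalize fderiv ℝ C y = D
        rw [(D u v).map_smul, (D v u).map_smul, (C y v).map_smul, (C y u).map_smul,
          (C y u).map_smul, (C y v).map_smul, RingHom.id_apply]
        module })
    (fun u u' v => LinearMap.ext fun w => curvOp_add_left C y u u' v w)
    (fun c u v => LinearMap.ext fun w => curvOp_smul_left C y c u v w)
    (fun u v v' => LinearMap.ext fun w => by
      change curvOp C y u (v + v') w = curvOp C y u v w + curvOp C y u v' w
      rw [curvOp_swap, curvOp_add_left, curvOp_swap C y u v, curvOp_swap C y u v', neg_add])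
    (fun c u v => LinearMap.ext fun w => by
      change curvOp C y u (c • v) w = c • curvOp C y u v w
      rw [curvOp_swap, curvOp_smul_left, curvOp_swap C y u v, smul_neg])

theorem curvTri_apply (C : V → V →L[ℝ] V →L[ℝ] V) (y u v w : V) :
    curvTri C y u v w = curvOp C y u v w := rfl

/-- The first Bianchi identity. -/
theorem curvOp_bianchi {C : V → V →L[ℝ] V →L[ℝ] V} {y : V} (hC : DifferentiableAt ℝ C y)
    (hs : ∀ᶠ z in 𝓝 y, ∀ u v, C z u v = C z v u) (u v w : V) :
    curvOp C y u v w + curvOp C y v w u + curvOp C y w u v = 0 := by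
  have h1 : ∀ a v w, fderiv ℝ C y a v w = fderiv ℝ C y a w v := by
    intro a v w
    have e : ∀ v w, fderiv ℝ (fun z => C z v w) y a = fderiv ℝ C y a v w := by
      intro v w
      have := ((hC.hasFDerivAt.clm_apply (hasFDerivAt_const v y)).clm_apply
        (hasFDerivAt_const w y)).fderiv
      rw [this]; simp
    rw [← e v w, ← e w v]
    have h : (fun z => C z v w) =ᶠ[𝓝 y] fun z => C z w v := hs.mono fun z hz => hz v w
    rw [h.fderiv_eq]
  have h2 := hs.self_of_nhds
  unfold curvOp
  rw [h1 u v w, h1 v w u, h1 w u v, h2 v w, h2 w u, h2 u v]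
  abel

end CurvTri

section Trace

variable {B : E4 →L[ℝ] E4 →L[ℝ] ℝ} {e b : Fin 2 → E4}

/-- The trace of an endomorphism in a split frame. -/
theorem trace_eq_split (hexp : ∀ v, v = (∑ i, B (b i) v • e i) + ∑ i, B (e i) v • b i)
    (T : E4 →ₗ[ℝ] E4) :
    ∑ c, T (basisVec c) c = (∑ i, B (b i) (T (e i))) + ∑ i, B (e i) (T (b i)) := by
  have h1 : ∀ (l : E4 →L[ℝ] ℝ) (X : E4), l (T X) = ∑ c, X c * l (T (basisVec c)) := by
    intro l X
    conv_lhs => rw [← sum_basisVec X]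
    simp
  have h2 : ∀ c, T (basisVec c) c = (∑ i, B (b i) (T (basisVec c)) * e i c)
      + ∑ i, B (e i) (T (basisVec c)) * b i c := by
    intro c
    have := congrArg (dcoord c) (hexp (T (basisVec c)))
    simpa only [map_add, map_sum, map_smul, smul_eq_mul, dcoord_apply] using this
  have h3 : ∀ i, B (b i) (T (e i)) = ∑ c, e i c * B (b i) (T (basisVec c)) := fun i => h1 _ _
  have h4 : ∀ i, B (e i) (T (b i)) = ∑ c, b i c * B (e i) (T (basisVec c)) := fun i => h1 _ _
  simp only [h2, h3, h4]
  rw [Finset.sum_add_distrib, Finset.sum_comm, Finset.sum_comm (γ := Fin 4)]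
  simp only [mul_comm]

theorem sum_comm_four {ι : Type*} [Fintype ι] (f : ι → ι → ι → ι → ℝ) :
    ∑ b, ∑ c, ∑ d, ∑ e, f e b c d = ∑ e, ∑ b, ∑ c, ∑ d, f e b c d := by
  calc _ = ∑ b, ∑ c, ∑ e, ∑ d, f e b c d :=
        Finset.sum_congr rfl fun b _ => Finset.sum_congr rfl fun c _ => Finset.sum_comm
    _ = ∑ b, ∑ e, ∑ c, ∑ d, f e b c d := Finset.sum_congr rfl fun b _ => Finset.sum_comm
    _ = _ := Finset.sum_comm

variable {G : E4 → E4 →L[ℝ] E4 →L[ℝ] ℝ} {y : E4}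

/-- The Ricci tensor is the trace of the curvature. -/
theorem ricciCoord_sum (hG : ContDiffAt ℝ ∞ G y) (h0 : (gram G y).det ≠ 0)
    (hexp : ∀ v, v = (∑ i, B (b i) v • e i) + ∑ i, B (e i) v • b i) (v w : E4) :
    ∑ a, ∑ c, ricciCoord G y a c * v a * w c
      = (∑ i, B (b i) (curvOp (christoffelMap G) y (e i) w v))
        + ∑ i, B (e i) (curvOp (christoffelMap G) y (b i) w v) := by
  have h := trace_eq_split hexp (((curvTri (christoffelMap G) y).flip w).flip v)
  simp only [LinearMap.flip_apply, curvTri_apply] at h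
  rw [← h]
  simp only [curvOp_christoffelMap hG h0, ricciCoord, Finset.sum_mul, basisVec_apply]
  simp only [mul_ite, mul_one, mul_zero, ite_mul, zero_mul, Finset.sum_ite_irrel,
    Finset.sum_const_zero, Finset.sum_ite_eq', Finset.mem_univ, if_true]
  calc _ = ∑ a, ∑ d, ∑ c, riemann G y d a d c * v a * w c :=
        Finset.sum_congr rfl fun a _ => Finset.sum_comm
    _ = _ := Finset.sum_comm

/-- The Riemann tensor with lowered index is `g(X, R(Z, W) Y)`. -/
theorem riemannLow_sum (hG : ContDiffAt ℝ ∞ G y) (h0 : (gram G y).det ≠ 0) (X Y Z W : E4) :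
    ∑ a, ∑ b, ∑ c, ∑ d, riemannLow G y a b c d * X a * Y b * Z c * W d
      = G y X (curvOp (christoffelMap G) y Z W Y) := by
  rw [bilin_eq_gram]
  refine Finset.sum_congr rfl fun a _ => ?_
  simp only [riemannLow, curvOp_christoffelMap hG h0, Finset.sum_mul, Finset.mul_sum]
  rw [sum_comm_four]
  refine Finset.sum_congr rfl fun e _ => Finset.sum_congr rfl fun b _ =>
    Finset.sum_congr rfl fun c _ => Finset.sum_congr rfl fun d _ => ?_
  ring

theorem gram_gram_sum (X Y Z W : E4) :
    ∑ a, ∑ b, ∑ c, ∑ d, gram G y a c * gram G y b d * X a * Y b * Z c * W d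
      = G y X Z * G y Y W := by
  rw [bilin_eq_gram X Z, bilin_eq_gram Y W, Finset.sum_mul_sum]
  refine Finset.sum_congr rfl fun a _ => Finset.sum_congr rfl fun b _ => ?_
  rw [Finset.sum_mul_sum]
  refine Finset.sum_congr rfl fun c _ => Finset.sum_congr rfl fun d _ => ?_
  ring

/-- The Weyl tensor of an Einstein metric. -/
theorem weylCoord_sum (hG : ContDiffAt ℝ ∞ G y) (h0 : (gram G y).det ≠ 0)
    (hs : ∀ u v, G y u v = G y v u) {l : ℝ} (hric : ∀ a b, ricciCoord G y a b = l * gram G y a b)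
    (hscal : scalarCoord G y = 4 * l) (X Y Z W : E4) :
    ∑ a, ∑ b, ∑ c, ∑ d, weylCoord G y a b c d * X a * Y b * Z c * W d
      = G y X (curvOp (christoffelMap G) y Z W Y)
        + l / 3 * (G y X W * G y Y Z - G y X Z * G y Y W) := by
  have h1 : ∀ a b c d, weylCoord G y a b c d * X a * Y b * Z c * W d
      = riemannLow G y a b c d * X a * Y b * Z c * W d
        + l / 3 * (gram G y a d * gram G y b c * X a * Y b * W d * Z c)
        - l / 3 * (gram G y a c * gram G y b d * X a * Y b * Z c * W d) := by
    intro a b c d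
    simp only [weylCoord, schoutenCoord, hric, hscal]
    rw [gram_symm hs c b, gram_symm hs d b, gram_symm hs d a, gram_symm hs c a]
    ring
  simp only [h1, Finset.sum_add_distrib, Finset.sum_sub_distrib, ← Finset.mul_sum]
  rw [riemannLow_sum hG h0, gram_gram_sum, ← gram_gram_sum X Y W Z]
  have h2 : ∑ a, ∑ b, ∑ c, ∑ d, gram G y a d * gram G y b c * X a * Y b * W d * Z c
      = ∑ a, ∑ b, ∑ c, ∑ d, gram G y a c * gram G y b d * X a * Y b * W c * Z d :=
    Finset.sum_congr rfl fun a _ => Finset.sum_congr rfl fun b _ => Finset.sum_comm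
  rw [h2]; ring

end Trace

/-! ### Curvature tensors of para-Kähler type -/

section SplitCurvature

/-- A signed sum over the permutations of four indices, written out. -/
theorem sum_perm_four (G : Fin 4 → Fin 4 → Fin 4 → Fin 4 → ℝ) :
    ∑ s : Equiv.Perm (Fin 4), ((Equiv.Perm.sign s : ℤ) : ℝ) * G (s 0) (s 1) (s 2) (s 3) =
    G 0 1 2 3 - G 0 1 3 2 - G 0 2 1 3 + G 0 2 3 1 + G 0 3 1 2 - G 0 3 2 1
     - G 1 0 2 3 + G 1 0 3 2 + G 1 2 0 3 - G 1 2 3 0 - G 1 3 0 2 + G 1 3 2 0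
     + G 2 0 1 3 - G 2 0 3 1 - G 2 1 0 3 + G 2 1 3 0 + G 2 3 0 1 - G 2 3 1 0
     - G 3 0 1 2 + G 3 0 2 1 + G 3 1 0 2 - G 3 1 2 0 - G 3 2 0 1 + G 3 2 1 0 := by
  have h : (Finset.univ : Finset (Equiv.Perm (Fin 4))).val.map
      (fun s => (((Equiv.Perm.sign s : ℤˣ) : ℤ), s 0, s 1, s 2, s 3))
   = {(1,0,1,2,3),(-1,0,1,3,2),(-1,0,2,1,3),(1,0,2,3,1),(1,0,3,1,2),(-1,0,3,2,1),
      (-1,1,0,2,3),(1,1,0,3,2),(1,1,2,0,3),(-1,1,2,3,0),(-1,1,3,0,2),(1,1,3,2,0),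
      (1,2,0,1,3),(-1,2,0,3,1),(-1,2,1,0,3),(1,2,1,3,0),(1,2,3,0,1),(-1,2,3,1,0),
      (-1,3,0,1,2),(1,3,0,2,1),(1,3,1,0,2),(-1,3,1,2,0),(-1,3,2,0,1),(1,3,2,1,0)} := by
    decide +kernel
  have h2 := congrArg (fun m => (m.map (fun q : ℤ × Fin 4 × Fin 4 × Fin 4 × Fin 4 =>
    ((q.1 : ℤ) : ℝ) * G q.2.1 q.2.2.1 q.2.2.2.1 q.2.2.2.2)).sum) h
  simp only [Multiset.map_map, Function.comp_def] at h2
  refine Eq.trans ?_ (h2.trans ?_)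
  · rfl
  · simp
    ring

/-- A curvature tensor `R` of a metric `B` that preserves the two null planes spanned by `e` and
`b`, where `(e, b)` is a null frame with `B(eᵢ, bⱼ) = δᵢⱼ`. -/
structure IsSplitCurvature (R : E4 →ₗ[ℝ] E4 →ₗ[ℝ] E4 →ₗ[ℝ] E4) (B : E4 →L[ℝ] E4 →L[ℝ] ℝ)
    (e b : Fin 2 → E4) : Prop where
  symm : ∀ u v, B u v = B v u
  e_e : ∀ i j, B (e i) (e j) = 0
  b_b : ∀ i j, B (b i) (b j) = 0
  e_b : ∀ i j, B (e i) (b j) = if i = j then 1 else 0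
  swap : ∀ u v w, R u v w = - R v u w
  bianchi : ∀ u v w, R u v w + R v w u + R w u v = 0
  R_e : ∀ u v j, R u v (e j) = ∑ i, B (b i) (R u v (e j)) • e i
  R_b : ∀ u v j, R u v (b j) = -∑ i, B (b j) (R u v (e i)) • b i

namespace IsSplitCurvature

variable {R : E4 →ₗ[ℝ] E4 →ₗ[ℝ] E4 →ₗ[ℝ] E4} {B : E4 →L[ℝ] E4 →L[ℝ] ℝ}
    {e b : Fin 2 → E4}

/-- The curvature of the model, `R^i_k = - αⁱ ∧ ᾱₖ - δⁱₖ Σ αᵐ ∧ ᾱₘ`. -/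
def Model (R : E4 →ₗ[ℝ] E4 →ₗ[ℝ] E4 →ₗ[ℝ] E4) (B : E4 →L[ℝ] E4 →L[ℝ] ℝ)
    (e b : Fin 2 → E4) : Prop :=
  ∀ i k l j, B (b i) (R (e l) (b j) (e k))
    = - ((if i = l then 1 else 0) * (if k = j then 1 else 0)
      + (if i = k then 1 else 0) * (if l = j then 1 else 0))

/-- The Weyl tensor of an Einstein metric with scalar curvature `4 l`, as a bilinear form in its
last two arguments. -/
def weylForm (R : E4 →ₗ[ℝ] E4 →ₗ[ℝ] E4 →ₗ[ℝ] E4) (B : E4 →L[ℝ] E4 →L[ℝ] ℝ) (l : ℝ) (X Y : E4) :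
    E4 →ₗ[ℝ] E4 →ₗ[ℝ] ℝ :=
  LinearMap.mk₂ ℝ (fun Z W => B X (R Z W Y) + l / 3 * (B X W * B Y Z - B X Z * B Y W))
    (fun Z Z' W => by simp only [map_add, LinearMap.add_apply]; ring)
    (fun c Z W => by simp only [map_smul, LinearMap.smul_apply, smul_eq_mul]; ring)
    (fun Z W W' => by simp only [map_add, LinearMap.add_apply]; ring)
    (fun c Z W => by simp only [map_smul, LinearMap.smul_apply, smul_eq_mul]; ring)

theorem weylForm_apply (l : ℝ) (X Y Z W : E4) : weylForm R B l X Y Z W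
    = B X (R Z W Y) + l / 3 * (B X W * B Y Z - B X Z * B Y W) := rfl

variable (h : IsSplitCurvature R B e b)
include h

theorem b_e (i j : Fin 2) : B (b i) (e j) = if i = j then 1 else 0 := by
  rw [h.symm, h.e_b]; simp only [eq_comm]

theorem expand (v : E4) : v = (∑ i, B (b i) v • e i) + ∑ i, B (e i) v • b i :=
  split_frame_expand h.symm h.e_e h.b_b h.e_b v

theorem e_R_e (u v : E4) (i j : Fin 2) : B (e i) (R u v (e j)) = 0 := by
  rw [h.R_e]; simp [h.e_e]

theorem b_R_b (u v : E4) (i j : Fin 2) : B (b i) (R u v (b j)) = 0 := by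
  rw [h.R_b]; simp [h.b_b]

theorem e_R_b (u v : E4) (i j : Fin 2) : B (e i) (R u v (b j)) = - B (b j) (R u v (e i)) := by
  rw [h.R_b]; fin_cases i <;> simp [h.e_b]

/-- The curvature vanishes on the null plane of `e`. -/
theorem R_ee (i j k l : Fin 2) : B (b i) (R (e k) (e l) (e j)) = 0 := by
  have h1 := congrArg (B (e j)) (h.bianchi (e k) (e l) (b i))
  rw [map_add, map_add, h.e_R_b, h.e_R_e, h.e_R_e, map_zero] at h1
  linarith

/-- The curvature vanishes on the null plane of `b`. -/
theorem R_bb (i j k l : Fin 2) : B (b i) (R (b k) (b l) (e j)) = 0 := by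
  have h1 := congrArg (B (b i)) (h.bianchi (b k) (b l) (e j))
  rw [map_add, map_add, h.b_R_b, h.b_R_b, map_zero] at h1
  linarith

/-- The mixed components are symmetric in the two `e` indices, by the first Bianchi identity. -/
theorem comp_symm (i k l j : Fin 2) :
    B (b i) (R (e l) (b j) (e k)) = B (b i) (R (e k) (b j) (e l)) := by
  have h1 := congrArg (B (b i)) (h.bianchi (e k) (e l) (b j))
  rw [map_add, map_add, h.b_R_b, map_zero, h.swap (b j) (e k), map_neg] at h1
  linarith

/-- The Ricci tensor is a contraction of the mixed components. -/
theorem ricci_mixed (k j : Fin 2) :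
    (∑ i, B (b i) (R (e i) (b j) (e k))) + ∑ i, B (e i) (R (b i) (b j) (e k))
      = ∑ i, B (b i) (R (e i) (b j) (e k)) := by
  simp [h.e_R_e]

/-- The mixed components determine the curvature form. -/
theorem comp_expand (u v : E4) (i k : Fin 2) :
    B (b i) (R u v (e k)) = ∑ l, ∑ j, (B (b l) u * B (e j) v - B (b l) v * B (e j) u)
      * B (b i) (R (e l) (b j) (e k)) := by
  have h1 : ∀ l j, B (b i) (R (b j) (e l) (e k)) = - B (b i) (R (e l) (b j) (e k)) := by
    intro l j; rw [h.swap, map_neg]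
  conv_lhs => rw [h.expand u, h.expand v]
  simp only [Fin.sum_univ_two, map_add, map_smul, LinearMap.add_apply, LinearMap.smul_apply,
    h.R_ee, h.R_bb, h1, smul_eq_mul]
  ring

/-- The equations defining `Model` as an equation of curvature `2`-forms. -/
theorem model_iff : Model R B e b ↔ ∀ u v i k, B (b i) (R u v (e k))
    = - (B (b i) u * B (e k) v - B (b i) v * B (e k) u)
      - if i = k then ∑ m, (B (b m) u * B (e m) v - B (b m) v * B (e m) u) else 0 := by
  constructor
  · intro hm u v i k
    rw [h.comp_expand]
    simp only [hm _ _ _ _]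
    fin_cases i <;> fin_cases k <;> simp [Fin.sum_univ_two] <;> ring
  · intro hm i k l j
    rw [hm]
    simp only [h.b_e, h.e_b, h.e_e, h.b_b]
    fin_cases i <;> fin_cases k <;> fin_cases l <;> fin_cases j <;> norm_num

/-- The trace of the model curvature. -/
theorem einstein_of_model (hm : Model R B e b) (k j : Fin 2) :
    ∑ i, B (b i) (R (e i) (b j) (e k)) = - 3 * if k = j then 1 else 0 := by
  simp only [hm _ _ _ _]
  fin_cases k <;> fin_cases j <;> norm_num [Fin.sum_univ_two]

theorem weylForm_swap (l : ℝ) (X Y Z W : E4) :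
    weylForm R B l X Y Z W = - weylForm R B l X Y W Z := by
  rw [weylForm_apply, weylForm_apply, h.swap Z W, map_neg]; ring

/-- The left side is twice the anti-self-dual part `β - ⋆β` of a `2`-form. It has the three
components `β(e₀, b₀) - β(e₁, b₁)`, `β(e₀, b₁)` and `β(e₁, b₀)`. -/
theorem sub_hodge {β : E4 →ₗ[ℝ] E4 →ₗ[ℝ] ℝ} (hβ : ∀ u v, β u v = - β v u) (Z W : E4) :
    β Z W - (1 / 2) * ∑ σ : Equiv.Perm (Fin 4), ((Equiv.Perm.sign σ : ℤ) : ℝ) *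
      (β ((![e 0, e 1, b 0, b 1] : Fin 4 → E4) (σ 0)) ((![e 0, e 1, b 0, b 1] : Fin 4 → E4) (σ 1))
        * B Z ((![e 0, e 1, b 0, b 1] : Fin 4 → E4) (σ 2))
        * B W ((![e 0, e 1, b 0, b 1] : Fin 4 → E4) (σ 3)))
      = (β (e 0) (b 0) - β (e 1) (b 1)) * ((B (b 0) Z * B (e 0) W - B (e 0) Z * B (b 0) W)
          - (B (b 1) Z * B (e 1) W - B (e 1) Z * B (b 1) W))
        + 2 * β (e 0) (b 1) * (B (b 0) Z * B (e 1) W - B (e 1) Z * B (b 0) W)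
        + 2 * β (e 1) (b 0) * (B (b 1) Z * B (e 0) W - B (e 0) Z * B (b 1) W) := by
  have hself : ∀ u, β u u = 0 := fun u => by linarith [hβ u u]
  rw [sum_perm_four fun i j k l => β ((![e 0, e 1, b 0, b 1] : Fin 4 → E4) i)
    ((![e 0, e 1, b 0, b 1] : Fin 4 → E4) j) * B Z ((![e 0, e 1, b 0, b 1] : Fin 4 → E4) k)
        * B W ((![e 0, e 1, b 0, b 1] : Fin 4 → E4) l)]
  have h1 : β Z W = β ((∑ i, B (b i) Z • e i) + ∑ i, B (e i) Z • b i)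
      ((∑ i, B (b i) W • e i) + ∑ i, B (e i) W • b i) := by
    rw [← h.expand Z, ← h.expand W]
  rw [h1]
  simp only [Fin.sum_univ_two, map_add, map_smul, LinearMap.add_apply, LinearMap.smul_apply,
    smul_eq_mul, hself, Matrix.cons_val]
  rw [hβ (e 1) (e 0), hβ (b 0) (e 0), hβ (b 0) (e 1), hβ (b 1) (e 0), hβ (b 1) (e 1),
    hβ (b 1) (b 0), h.symm Z (e 0), h.symm Z (e 1), h.symm Z (b 0), h.symm Z (b 1),
    h.symm W (e 0), h.symm W (e 1), h.symm W (b 0), h.symm W (b 1)]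
  ring

/-- For `Ric = -3 g`, the anti-self-dual part of the Weyl tensor vanishes exactly when the curvature
is that of the model. -/
theorem model_iff_weyl : Model R B e b ↔ ∀ X Y, weylForm R B (-3) X Y (e 0) (b 1) = 0
    ∧ weylForm R B (-3) X Y (e 1) (b 0) = 0
    ∧ weylForm R B (-3) X Y (e 0) (b 0) = weylForm R B (-3) X Y (e 1) (b 1) := by
  -- the values of the Weyl tensor on `e_l ∧ b_j` are combinations of the mixed components
  have hW : ∀ X Y l j, weylForm R B (-3) X Y (e l) (b j)
      = (∑ k, ∑ i, B (b k) Y * (B (b i) (R (e l) (b j) (e k)) * B X (e i)))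
        - (∑ k, ∑ i, B (e k) Y * (B (b k) (R (e l) (b j) (e i)) * B X (b i)))
        - (B (b j) X * B (e l) Y - B (e l) X * B (b j) Y) := by
    intro X Y l j
    have h1 : R (e l) (b j) Y = (∑ k, B (b k) Y • ∑ i, B (b i) (R (e l) (b j) (e k)) • e i)
        + ∑ k, B (e k) Y • -∑ i, B (b k) (R (e l) (b j) (e i)) • b i := by
      conv_lhs => rw [h.expand Y]
      simp only [map_add, map_sum, map_smul]
      rw [Finset.sum_congr rfl fun k _ => congrArg (B (b k) Y • ·) (h.R_e (e l) (b j) k),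
        Finset.sum_congr rfl fun k _ => congrArg (B (e k) Y • ·) (h.R_b (e l) (b j) k)]
    rw [weylForm_apply, h1, h.symm X (b j), h.symm X (e l), h.symm Y (b j), h.symm Y (e l)]
    simp only [map_add, map_smul, map_neg, smul_eq_mul, Fin.sum_univ_two]
    ring
  constructor
  · intro hm X Y
    simp only [hW, hm _ _ _ _, Fin.sum_univ_two, h.symm X]
    refine ⟨?_, ?_, ?_⟩ <;> norm_num <;> ring
  · intro hw
    -- conversely, the arguments `b_i`, `e_k` isolate one mixed component
    have h2 : ∀ i k l j, weylForm R B (-3) (b i) (e k) (e l) (b j)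
        = B (b i) (R (e l) (b j) (e k))
          + (if i = l then 1 else 0) * (if k = j then 1 else 0) := by
      intro i k l j
      rw [weylForm_apply]
      simp only [h.b_b, h.e_e, h.b_e, h.e_b]
      ring
    have h3 := fun i k => hw (b i) (e k)
    simp only [h2] at h3
    intro i k l j
    -- with the symmetry of the mixed components this is a linear system whose only solution is the
    -- model curvature
    have e1 := h3 0 0
    have e2 := h3 0 1
    have e3 := h3 1 0
    have e4 := h3 1 1
    have s1 := fun i j => h.comp_symm i 0 1 j
    have s00 := s1 0 0
    have s01 := s1 0 1
    have s10 := s1 1 0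
    have s11 := s1 1 1
    norm_num at e1 e2 e3 e4
    fin_cases i <;> fin_cases k <;> fin_cases l <;> fin_cases j <;> norm_num <;> linarith

end IsSplitCurvature

end SplitCurvature

/-! ### Flatness in terms of curvature tensors -/

section MetricInChart

variable {M : Type u} [TopologicalSpace M] [ChartedSpace E4 M] [IsManifold 𝓘(ℝ, E4) ∞ M]
  {g : BilinField M} {K : EndField M}
  {D : Type*} [NormedAddCommGroup D] [NormedSpace ℝ D]
  {H : Type*} [TopologicalSpace H] {J : ModelWithCorners ℝ D H}
  {X : Type*} [TopologicalSpace X] [ChartedSpace H X]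

/-- Smoothness of a field of bilinear forms at a point. -/
def SmoothBilinAt (g : BilinField M) (x : M) : Prop :=
  ContMDiffAt 𝓘(ℝ, E4) (𝓘(ℝ, E4).prod 𝓘(ℝ, E4 →L[ℝ] E4 →L[ℝ] ℝ)) ∞
    (fun x => TotalSpace.mk' (E4 →L[ℝ] E4 →L[ℝ] ℝ)
      (E := fun x : M => TangentSpace 𝓘(ℝ, E4) x →L[ℝ] TangentSpace 𝓘(ℝ, E4) x →L[ℝ] ℝ) x (g x)) x

theorem SmoothBilinAt.contMDiffAt_apply {f : X → M} {v w : ∀ z, TangentSpace 𝓘(ℝ, E4) (f z)} {z : X}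
    (hg : SmoothBilinAt g (f z)) (hf : ContMDiffAt J 𝓘(ℝ, E4) ∞ f z)
    (hv : ContMDiffAt J 𝓘(ℝ, E4).tangent ∞
      (fun z => (⟨f z, v z⟩ : TangentBundle 𝓘(ℝ, E4) M)) z)
    (hw : ContMDiffAt J 𝓘(ℝ, E4).tangent ∞
      (fun z => (⟨f z, w z⟩ : TangentBundle 𝓘(ℝ, E4) M)) z) :
    ContMDiffAt J 𝓘(ℝ, ℝ) ∞ (fun z => g (f z) (v z) (w z)) z := by
  have h1 := ContMDiffAt.comp z hg hf
  have h2 := ContMDiffAt.clm_bundle_apply₂ (F₁ := E4) (F₂ := E4) (F₃ := ℝ)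
    (E₃ := Bundle.Trivial M ℝ) (b := f) (ψ := fun z => g (f z)) h1 hv hw
  simp only [contMDiffAt_totalSpace] at h2
  exact h2.2

theorem contDiffAt_bilinInChart {x : M} {y : E4} (hy : y ∈ (extChartAt 𝓘(ℝ, E4) x).target)
    (hg : SmoothBilinAt g ((extChartAt 𝓘(ℝ, E4) x).symm y)) :
    ContDiffAt ℝ ∞ (bilinInChart g x) y := by
  refine contDiffAt_clm_of_apply fun v => contDiffAt_clm_of_apply fun w => ?_
  rw [← contMDiffAt_iff_contDiffAt]
  exact SmoothBilinAt.contMDiffAt_apply (g := g) (f := (extChartAt 𝓘(ℝ, E4) x).symm)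
    (v := fun z => chartInvDeriv x z v) (w := fun z => chartInvDeriv x z w) hg
    ((contMDiffOn_extChartAt_symm (n := ∞) x).contMDiffAt (extChartAt_target_mem_nhds_self x hy))
    (contMDiffAt_chartInvDeriv hy v) (contMDiffAt_chartInvDeriv hy w)

theorem bilinField_congr_point (g : BilinField M) {p q : M} (h : p = q) (v w : E4) :
    g p v w = g q v w := by
  subst h; rfl

/-- A chart is an isometry onto its image with the metric `bilinInChart g x`. -/
theorem bilinInChart_mfderiv (g : BilinField M) {x q : M}
    (hq : q ∈ (extChartAt 𝓘(ℝ, E4) x).source) (v w : TangentSpace 𝓘(ℝ, E4) q) :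
    bilinInChart g x (extChartAt 𝓘(ℝ, E4) x q) (vecDeriv (extChartAt 𝓘(ℝ, E4) x) q v)
      (vecDeriv (extChartAt 𝓘(ℝ, E4) x) q w) = g q v w := by
  change g _ (chartInvDeriv x (extChartAt 𝓘(ℝ, E4) x q)
      (mfderiv 𝓘(ℝ, E4) 𝓘(ℝ, E4) (extChartAt 𝓘(ℝ, E4) x) q v))
      (chartInvDeriv x (extChartAt 𝓘(ℝ, E4) x q)
      (mfderiv 𝓘(ℝ, E4) 𝓘(ℝ, E4) (extChartAt 𝓘(ℝ, E4) x) q w)) = g q v w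
  refine (congrArg₂ (fun v w : E4 => g _ v w) (chartInvDeriv_mfderiv hq v)
    (chartInvDeriv_mfderiv hq w)).trans ?_
  exact bilinField_congr_point g ((extChartAt 𝓘(ℝ, E4) x).left_inv hq) v w

theorem bilinInChart_self (g : BilinField M) (x : M) (v w : E4) :
    bilinInChart g x (extChartAt 𝓘(ℝ, E4) x x) v w = g x v w := by
  refine (congrArg₂ (fun v w : E4 => g _ v w) (chartInvDeriv_self x v)
    (chartInvDeriv_self x w)).trans ?_
  exact bilinField_congr_point g (extChartAt_to_inv x) v w

theorem vecDeriv_extChartAt_self (x : M) (v : TangentSpace 𝓘(ℝ, E4) x) :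
    vecDeriv (extChartAt 𝓘(ℝ, E4) x) x v = v := by
  have hD : mfderiv 𝓘(ℝ, E4) 𝓘(ℝ, E4) (extChartAt 𝓘(ℝ, E4) x) x = ContinuousLinearMap.id ℝ E4 :=
    mfderiv_extChartAt_self
  exact DFunLike.congr_fun hD v

/-- The metric as a bilinear form on the model space. -/
def bilinAt (g : BilinField M) (x : M) : E4 →L[ℝ] E4 →L[ℝ] ℝ := g x

/-- The Riemann tensor of a metric at `x`, in the preferred chart at `x`. -/
def curvAt (g : BilinField M) (x : M) : E4 →ₗ[ℝ] E4 →ₗ[ℝ] E4 →ₗ[ℝ] E4 :=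
  curvTri (christoffelMap (bilinInChart g x)) (extChartAt 𝓘(ℝ, E4) x x)

theorem bilinInChart_self_eq (g : BilinField M) (x : M) :
    bilinInChart g x (extChartAt 𝓘(ℝ, E4) x x) = bilinAt g x :=
  ContinuousLinearMap.ext fun v => ContinuousLinearMap.ext fun w => bilinInChart_self g x v w

end MetricInChart

section Flat

variable {M : Type u} [TopologicalSpace M] [ChartedSpace E4 M] [IsManifold 𝓘(ℝ, E4) ∞ M]
  {g : BilinField M} {K : EndField M}

theorem gram_bilinInChart_det_ne_zero (h : IsAlmostParaHermitian g K) (x : M) :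
    (gram (bilinInChart g x) (extChartAt 𝓘(ℝ, E4) x x)).det ≠ 0 := by
  refine gram_det_ne_zero fun v hv => ?_
  rw [bilinInChart_self_eq] at hv
  exact h.nondegenerate x v hv

theorem contDiffAt_bilinInChart_self (h : IsAlmostParaHermitian g K) (x : M) :
    ContDiffAt ℝ ∞ (bilinInChart g x) (extChartAt 𝓘(ℝ, E4) x x) :=
  contDiffAt_bilinInChart (mem_extChartAt_target x) (h.smooth_metric _)

/-- The Ricci tensor is the trace of the Riemann tensor in a split frame. -/
theorem ricci_eq (h : IsAlmostParaHermitian g K) {x : M} {e b : Fin 2 → E4}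
    (hexp : ∀ v, v = (∑ i, bilinAt g x (b i) v • e i) + ∑ i, bilinAt g x (e i) v • b i)
    (v w : E4) :
    ricci g x v w = (∑ i, bilinAt g x (b i) (curvAt g x (e i) w v))
      + ∑ i, bilinAt g x (e i) (curvAt g x (b i) w v) := by
  have h1 := ricciCoord_sum (contDiffAt_bilinInChart_self h x) (gram_bilinInChart_det_ne_zero h x)
    hexp v w
  simp only [← curvTri_apply] at h1
  exact h1

theorem ricci_basisVec (x : M) (i j : Fin 4) :
    ricci g x (basisVec i) (basisVec j) = ricciCoord (bilinInChart g x)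
      (extChartAt 𝓘(ℝ, E4) x x) i j := by
  unfold ricci
  have : ∀ (i k : Fin 4), tcoord (x := x) (basisVec i) k = if k = i then 1 else 0 :=
    fun i k => basisVec_apply i k
  simp [this]

/-- The Weyl tensor of an Einstein metric is the form `weylForm` of the Riemann tensor. -/
theorem weyl_eq (h : IsAlmostParaHermitian g K) {x : M} {l : ℝ}
    (hric : ∀ v w : E4, ricci g x v w = l * g x v w) (hscal : scalarCurv g x = 4 * l)
    (X Y Z W : E4) :
    weyl g x X Y Z W = IsSplitCurvature.weylForm (curvAt g x) (bilinAt g x) l X Y Z W := by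
  have h1 := weylCoord_sum (contDiffAt_bilinInChart_self h x) (gram_bilinInChart_det_ne_zero h x)
    (l := l) (by rw [bilinInChart_self_eq]; exact h.symm x) (fun a b => by
      rw [← ricci_basisVec, hric]
      unfold gram
      rw [bilinInChart_self_eq]; rfl) hscal X Y Z W
  rw [bilinInChart_self_eq] at h1
  rw [IsSplitCurvature.weylForm_apply]
  unfold curvAt
  simp only [curvTri_apply]
  exact h1

end Flat

/-! ### The curvature of the Cartan connection and of the metric -/

section DerivLinear

variable {E : Type*} [NormedAddCommGroup E] [NormedSpace ℝ E]
  {N : Type*} [TopologicalSpace N] [ChartedSpace E N] [IsManifold 𝓘(ℝ, E) ∞ N]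

theorem dOne_lincomb [FiniteDimensional ℝ E] {κ : Type*} [Fintype κ] {θ : FormField E N}
    {c : κ → ℝ} {β : κ → FormField E N} {p : N} (hβ : ∀ k, SmoothFormAt (β k) p)
    (heq : ∀ᶠ q in 𝓝 p, ∀ v, θ q v = ∑ k, c k * β k q v) (v w : TangentSpace 𝓘(ℝ, E) p) :
    dOne θ p v w = ∑ k, c k * dOne (β k) p v w := by
  have h0 : ∀ (k : κ) (v : TangentSpace 𝓘(ℝ, E) p), dFun (fun _ : N => c k) p v = 0 := by
    intro k v
    have : mfderiv 𝓘(ℝ, E) 𝓘(ℝ, ℝ) (fun _ : N => c k) p = 0 := mfderiv_const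
    exact DFunLike.congr_fun this v
  rw [dOne_sum_smul (h := fun k _ => c k) (fun k => mdifferentiableAt_const) hβ heq]
  simp [h0]

end DerivLinear

section Flat

variable {M : Type u} [TopologicalSpace M] [ChartedSpace E4 M] [IsManifold 𝓘(ℝ, E4) ∞ M]
  {g : BilinField M} {K : EndField M}

theorem conn_two_two (𝒢 : CartanGeometry M) (p : 𝒢.P) (ξ : TangentSpace 𝓘(ℝ, E8) p) :
    𝒢.conn 2 2 p ξ = - (1 / 3) * (gamForm 𝒢 0 0 p ξ + gamForm 𝒢 1 1 p ξ) := by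
  have h := 𝒢.trace_zero p ξ
  rw [Fin.sum_univ_three] at h
  rw [gamForm_apply, gamForm_apply]
  simp only [CartanGeometry.Gam, if_true, Fin.castSucc_zero, Fin.castSucc_one]
  linarith

theorem conn_castSucc (𝒢 : CartanGeometry M) (p : 𝒢.P) (ξ : TangentSpace 𝓘(ℝ, E8) p)
    (i j : Fin 2) : 𝒢.conn i.castSucc j.castSucc p ξ = gamForm 𝒢 i j p ξ
      - (if i = j then 1 else 0) * (1 / 3) * (gamForm 𝒢 0 0 p ξ + gamForm 𝒢 1 1 p ξ) := by
  have h := conn_two_two 𝒢 p ξ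
  rw [gamForm_apply 𝒢 i j, CartanGeometry.Gam, h]
  split_ifs <;> ring

theorem dOne_conn_two_two (𝒢 : CartanGeometry M) (p : 𝒢.P) (ξ η : TangentSpace 𝓘(ℝ, E8) p) :
    dOne (𝒢.conn 2 2) p ξ η
      = - (1 / 3) * (dOne (gamForm 𝒢 0 0) p ξ η + dOne (gamForm 𝒢 1 1) p ξ η) := by
  rw [dOne_lincomb (c := ![- (1 / 3), - (1 / 3)]) (β := ![gamForm 𝒢 0 0, gamForm 𝒢 1 1])
    (by intro k; fin_cases k <;> exact smoothFormAt_gamForm 𝒢 _ _ p)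
    (Filter.Eventually.of_forall fun q v => by
      rw [conn_two_two]; simp [Fin.sum_univ_two]; ring)]
  simp [Fin.sum_univ_two]
  ring

theorem dOne_conn_castSucc (𝒢 : CartanGeometry M) (p : 𝒢.P) (ξ η : TangentSpace 𝓘(ℝ, E8) p)
    (i j : Fin 2) :
    dOne (𝒢.conn i.castSucc j.castSucc) p ξ η = dOne (gamForm 𝒢 i j) p ξ η
      - (if i = j then 1 else 0) * (1 / 3)
        * (dOne (gamForm 𝒢 0 0) p ξ η + dOne (gamForm 𝒢 1 1) p ξ η) := by
  set d : ℝ := if i = j then 1 else 0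
  rw [dOne_lincomb (c := ![1, - (d * (1 / 3)), - (d * (1 / 3))])
    (β := ![gamForm 𝒢 i j, gamForm 𝒢 0 0, gamForm 𝒢 1 1])
    (by intro k; fin_cases k <;> exact smoothFormAt_gamForm 𝒢 _ _ p)
    (Filter.Eventually.of_forall fun q v => by
      rw [conn_castSucc]; simp [Fin.sum_univ_three, d]; split_ifs <;> ring)]
  simp [Fin.sum_univ_three]
  ring

variable {𝒢 : CartanGeometry M} {fr : ∀ p : 𝒢.P, AdaptedFrame g K (𝒢.proj p)}

/-- The `2`-form `αⁱ ∧ ᾱⱼ`. -/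
def wedgeTaut (𝒢 : CartanGeometry M) (fr : ∀ p : 𝒢.P, AdaptedFrame g K (𝒢.proj p)) (p : 𝒢.P)
    (i j : Fin 2) (ξ η : TangentSpace 𝓘(ℝ, E8) p) : ℝ :=
  tautForm 𝒢 fr i p ξ * tautFormBar 𝒢 fr j p η - tautForm 𝒢 fr i p η * tautFormBar 𝒢 fr j p ξ

theorem curvature_apply (p : 𝒢.P) (ξ η : TangentSpace 𝓘(ℝ, E8) p) (i j : Fin 3) :
    𝒢.curvature p ξ η i j = dOne (𝒢.conn i j) p ξ η
      + ((∑ k : Fin 2, (𝒢.conn i k.castSucc p ξ * 𝒢.conn k.castSucc j p η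
        - 𝒢.conn i k.castSucc p η * 𝒢.conn k.castSucc j p ξ))
        + (𝒢.conn i 2 p ξ * 𝒢.conn 2 j p η - 𝒢.conn i 2 p η * 𝒢.conn 2 j p ξ)) := by
  simp only [CartanGeometry.curvature, CartanGeometry.A, Matrix.add_apply, Matrix.sub_apply,
    Matrix.mul_apply, Matrix.of_apply, Fin.sum_univ_three, Fin.sum_univ_two, Fin.castSucc_zero,
    Fin.castSucc_one]
  ring

/-- The `𝔤𝔩₂` block of the curvature of the Cartan connection. -/
theorem curvature_castSucc (h : IsFrameGeometry 𝒢 fr) (p : 𝒢.P) (ξ η : TangentSpace 𝓘(ℝ, E8) p)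
    (i j : Fin 2) : 𝒢.curvature p ξ η i.castSucc j.castSucc = curvForm 𝒢 p i j ξ η
      - (if i = j then 1 else 0) * (1 / 3) * (curvForm 𝒢 p 0 0 ξ η + curvForm 𝒢 p 1 1 ξ η)
      + wedgeTaut 𝒢 fr p i j ξ η := by
  rw [curvature_apply, dOne_conn_castSucc]
  simp only [conn_castSucc, h.conn_alpha, h.conn_alphaBar, curvForm, wedgeTaut, Fin.sum_univ_two]
  fin_cases i <;> fin_cases j <;> simp <;> ring

theorem curvature_two_two (h : IsFrameGeometry 𝒢 fr) (p : 𝒢.P) (ξ η : TangentSpace 𝓘(ℝ, E8) p) :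
    𝒢.curvature p ξ η 2 2 = - (1 / 3) * (curvForm 𝒢 p 0 0 ξ η + curvForm 𝒢 p 1 1 ξ η)
      - (wedgeTaut 𝒢 fr p 0 0 ξ η + wedgeTaut 𝒢 fr p 1 1 ξ η) := by
  rw [curvature_apply, dOne_conn_two_two]
  simp only [conn_two_two, h.conn_alpha, h.conn_alphaBar, curvForm, wedgeTaut, Fin.sum_univ_two]
  ring

/-- The entries of the curvature in the last column are the torsion, which vanishes by the first
structure equation. -/
theorem curvature_castSucc_two (h : IsFrameGeometry 𝒢 fr) (p : 𝒢.P)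
    (ξ η : TangentSpace 𝓘(ℝ, E8) p) (i : Fin 2) : 𝒢.curvature p ξ η i.castSucc 2 = 0 := by
  have h1 : 𝒢.conn i.castSucc 2 = tautForm 𝒢 fr i := by
    funext z; exact ContinuousLinearMap.ext fun ζ => h.conn_alpha z ζ i
  rw [curvature_apply, h1, h.torsion_free]
  simp only [conn_castSucc, conn_two_two, h.conn_alpha, Fin.sum_univ_two, ← gamForm_apply]
  fin_cases i <;> simp <;> ring

theorem curvature_two_castSucc (h : IsFrameGeometry 𝒢 fr) (p : 𝒢.P)
    (ξ η : TangentSpace 𝓘(ℝ, E8) p) (i : Fin 2) : 𝒢.curvature p ξ η 2 i.castSucc = 0 := by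
  have h1 : 𝒢.conn 2 i.castSucc = tautFormBar 𝒢 fr i := by
    funext z; exact ContinuousLinearMap.ext fun ζ => h.conn_alphaBar z ζ i
  rw [curvature_apply, h1, h.torsion_free_bar]
  simp only [conn_castSucc, conn_two_two, h.conn_alphaBar, Fin.sum_univ_two, ← gamForm_apply]
  fin_cases i <;> simp <;> ring

/-- Flatness is the equation `dΓ + Γ ∧ Γ = - α ∧ ᾱ - (Σ αᵏ ∧ ᾱₖ) id`. -/
theorem isFlat_iff_curvForm (h : IsFrameGeometry 𝒢 fr) : 𝒢.IsFlat ↔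
    ∀ p ξ η i j, curvForm 𝒢 p i j ξ η = - wedgeTaut 𝒢 fr p i j ξ η
      - if i = j then ∑ m, wedgeTaut 𝒢 fr p m m ξ η else 0 := by
  constructor
  · intro hf p ξ η i j
    have h1 := congrFun (congrFun (hf p ξ η) i.castSucc) j.castSucc
    have h2 := congrFun (congrFun (hf p ξ η) 2) 2
    rw [curvature_castSucc h, Matrix.zero_apply] at h1
    rw [curvature_two_two h, Matrix.zero_apply] at h2
    rw [Fin.sum_univ_two]
    split_ifs at h1 ⊢ <;> linarith
  · intro hc p ξ η
    have h2 : 𝒢.curvature p ξ η 2 2 = 0 := by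
      rw [curvature_two_two h, hc, hc]
      simp [Fin.sum_univ_two]; ring
    have h1 : ∀ i j : Fin 2, 𝒢.curvature p ξ η i.castSucc j.castSucc = 0 := by
      intro i j
      rw [curvature_castSucc h, hc, hc, hc]
      simp only [Fin.sum_univ_two]
      split_ifs <;> ring
    ext i j
    refine Fin.lastCases ?_ (fun i => ?_) i <;> refine Fin.lastCases ?_ (fun j => ?_) j
    · exact h2
    · exact curvature_two_castSucc h p ξ η j
    · exact curvature_castSucc_two h p ξ η i
    · exact h1 i j

/-- The differential of the projection, as a map of the model spaces. -/
def dproj (𝒢 : CartanGeometry M) (p : 𝒢.P) : E8 →L[ℝ] E4 := mfderiv 𝓘(ℝ, E8) 𝓘(ℝ, E4) 𝒢.proj p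

/-- The vectors `eᵢ` of an adapted frame, in the model space. -/
def AdaptedFrame.eVec {x : M} (f : AdaptedFrame g K x) (i : Fin 2) : E4 := f.e i

/-- The vectors `ēᵢ` of an adapted frame, in the model space. -/
def AdaptedFrame.bVec {x : M} (f : AdaptedFrame g K x) (i : Fin 2) : E4 := f.ebar i

/-- The projection of a frame geometry is a submersion. -/
theorem frame_surjective (h : IsFrameGeometry 𝒢 fr) (hg : IsAlmostParaHermitian g K) (p : 𝒢.P)
    (v : E4) : ∃ ξ, dproj 𝒢 p ξ = v := by
  obtain ⟨ξ, ha, hb, -⟩ := exists_conn_eq 𝒢 p (fun i => bilinAt g (𝒢.proj p) ((fr p).bVec i) v)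
    (fun i => bilinAt g (𝒢.proj p) ((fr p).eVec i) v) 0
  refine ⟨ξ, eq_of_inner_frame (B := bilinAt g (𝒢.proj p)) (e := (fr p).eVec) (b := (fr p).bVec)
    (hg.symm _) (fr p).g_e_e (fr p).g_ebar_ebar (fr p).g_e_ebar (fun i => ?_) fun i => ?_⟩
  · exact (h.conn_alpha p ξ i).symm.trans (ha i)
  · exact (h.conn_alphaBar p ξ i).symm.trans (hb i)

theorem bilinInChart_symm (hg : IsAlmostParaHermitian g K) (x : M) (y u v : E4) :
    bilinInChart g x y u v = bilinInChart g x y v u := hg.symm _ _ _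

/-- The Riemann tensor in an adapted frame is the curvature form of the frame geometry. -/
theorem curvAt_frame (h : IsFrameGeometry 𝒢 fr) (hg : IsAlmostParaHermitian g K) (p : 𝒢.P)
    (j : Fin 2) (ξ η : E8) :
    curvAt g (𝒢.proj p) (dproj 𝒢 p ξ) (dproj 𝒢 p η) ((fr p).eVec j)
        = ∑ i, curvForm 𝒢 p i j ξ η • (fr p).eVec i ∧
      curvAt g (𝒢.proj p) (dproj 𝒢 p ξ) (dproj 𝒢 p η) ((fr p).bVec j)
        = -∑ i, curvForm 𝒢 p j i ξ η • (fr p).bVec i := by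
  have hsrc : ∀ᶠ q in 𝓝 (𝒢.proj p), q ∈ (extChartAt 𝓘(ℝ, E4) (𝒢.proj p)).source :=
    extChartAt_source_mem_nhds _
  have h1 := curvOp_frame h p (Φ := extChartAt 𝓘(ℝ, E4) (𝒢.proj p))
    (G := bilinInChart g (𝒢.proj p))
    (by
      filter_upwards [hsrc] with q hq
      exact contMDiffAt_extChartAt' (by rwa [extChartAt_source] at hq))
    (contDiffAt_bilinInChart_self hg _)
    (Filter.Eventually.of_forall (bilinInChart_symm hg _))
    (by
      filter_upwards [hsrc] with q hq v w
      exact (bilinInChart_mfderiv g hq v w).symm) j ξ η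
  have hv : vecDeriv (extChartAt 𝓘(ℝ, E4) (𝒢.proj p)) (𝒢.proj p)
      = (ContinuousLinearMap.id ℝ E4 : E4 →L[ℝ] E4) :=
    ContinuousLinearMap.ext fun v => vecDeriv_extChartAt_self _ v
  rw [hv] at h1
  unfold curvAt
  rw [curvTri_apply, curvTri_apply]
  exact h1

theorem bVec_eVec (p : 𝒢.P) (i j : Fin 2) :
    bilinAt g (𝒢.proj p) ((fr p).bVec i) ((fr p).eVec j) = if i = j then 1 else 0 :=
  (fr p).g_ebar_e i j

theorem curvForm_eq (h : IsFrameGeometry 𝒢 fr) (hg : IsAlmostParaHermitian g K) (p : 𝒢.P)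
    (i j : Fin 2) (ξ η : E8) :
    curvForm 𝒢 p i j ξ η = bilinAt g (𝒢.proj p) ((fr p).bVec i)
      (curvAt g (𝒢.proj p) (dproj 𝒢 p ξ) (dproj 𝒢 p η) ((fr p).eVec j)) := by
  rw [(curvAt_frame h hg p j ξ η).1, map_sum]
  simp [bVec_eVec]

theorem curvAt_bianchi (hg : IsAlmostParaHermitian g K) (x : M) (u v w : E4) :
    curvAt g x u v w + curvAt g x v w u + curvAt g x w u v = 0 := by
  have h1 := bilinInChart_symm hg x
  have h2 : DifferentiableAt ℝ (christoffelMap (bilinInChart g x)) (extChartAt 𝓘(ℝ, E4) x x) :=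
    (contDiffAt_christoffelMap (contDiffAt_bilinInChart_self hg x)
      (gram_bilinInChart_det_ne_zero hg x)).differentiableAt (by simp)
  have h3 : ∀ z u v, christoffelMap (bilinInChart g x) z u v
      = christoffelMap (bilinInChart g x) z v u :=
    fun z => christoffelMap_symm (Filter.Eventually.of_forall h1)
  unfold curvAt
  rw [curvTri_apply, curvTri_apply, curvTri_apply]
  exact curvOp_bianchi h2 (Filter.Eventually.of_forall h3) u v w

/-- The Riemann tensor preserves the two eigenspaces of `K`. -/
theorem frame_isSplitCurvature (h : IsFrameGeometry 𝒢 fr) (hg : IsAlmostParaHermitian g K)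
    (p : 𝒢.P) : IsSplitCurvature (curvAt g (𝒢.proj p)) (bilinAt g (𝒢.proj p)) (fr p).eVec
      (fr p).bVec where
  symm := hg.symm _
  e_e := (fr p).g_e_e
  b_b := (fr p).g_ebar_ebar
  e_b := (fr p).g_e_ebar
  swap u v w := by
    unfold curvAt
    rw [curvTri_apply, curvTri_apply, curvOp_swap]
  bianchi := curvAt_bianchi hg _
  R_e u v j := by
    obtain ⟨ξ, rfl⟩ := frame_surjective h hg p u
    obtain ⟨η, rfl⟩ := frame_surjective h hg p v
    simp only [← curvForm_eq h hg]
    exact (curvAt_frame h hg p j ξ η).1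
  R_b u v j := by
    obtain ⟨ξ, rfl⟩ := frame_surjective h hg p u
    obtain ⟨η, rfl⟩ := frame_surjective h hg p v
    simp only [← curvForm_eq h hg]
    exact (curvAt_frame h hg p j ξ η).2

/-- The Riemann tensor at the base point of `p` is that of the model. -/
def IsModelAt (𝒢 : CartanGeometry M) (fr : ∀ p : 𝒢.P, AdaptedFrame g K (𝒢.proj p)) (p : 𝒢.P) :
    Prop :=
  IsSplitCurvature.Model (curvAt g (𝒢.proj p)) (bilinAt g (𝒢.proj p)) (fr p).eVec (fr p).bVec

/-- The geometry is flat if and only if the Riemann tensor is that of the model. -/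
theorem isFlat_iff_model (h : IsFrameGeometry 𝒢 fr) (hg : IsAlmostParaHermitian g K) :
    𝒢.IsFlat ↔ ∀ p, IsModelAt 𝒢 fr p := by
  rw [isFlat_iff_curvForm h]
  refine forall_congr' fun p => ?_
  unfold IsModelAt
  rw [(frame_isSplitCurvature h hg p).model_iff]
  constructor
  · intro hf u v i k
    obtain ⟨ξ, rfl⟩ := frame_surjective h hg p u
    obtain ⟨η, rfl⟩ := frame_surjective h hg p v
    exact (curvForm_eq h hg p i k ξ η).symm.trans (hf ξ η i k)
  · intro hf ξ η i j
    exact (curvForm_eq h hg p i j ξ η).trans (hf _ _ i j)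

/-- Every adapted frame is a point of the total space. -/
theorem exists_frame_eq (h : IsFrameGeometry 𝒢 fr) {x : M} (f : AdaptedFrame g K x) :
    ∃ p : 𝒢.P, ∃ hp : 𝒢.proj p = x, hp ▸ fr p = f := by
  obtain ⟨p, hp⟩ := h.bijective.2 ⟨x, f⟩
  obtain ⟨h1, h2⟩ := Sigma.mk.inj_iff.1 hp
  subst h1
  exact ⟨p, rfl, eq_of_heq h2⟩

theorem exists_proj_eq (𝒢 : CartanGeometry M) (x : M) : ∃ p : 𝒢.P, 𝒢.proj p = x := by
  obtain ⟨U, s, ψ, -, hx, -, -, hs, -⟩ := 𝒢.locally_trivial x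
  exact ⟨s x, hs x hx⟩

/-- Statements about all adapted frames are statements about the points of the total space. -/
theorem forall_frame_iff (h : IsFrameGeometry 𝒢 fr)
    {Q : ∀ x : M, AdaptedFrame g K x → Prop} :
    (∀ x f, Q x f) ↔ ∀ p : 𝒢.P, Q (𝒢.proj p) (fr p) := by
  refine ⟨fun hQ p => hQ _ _, fun hQ x f => ?_⟩
  obtain ⟨p, rfl, rfl⟩ := exists_frame_eq h f
  exact hQ p

section Einstein

/-- The Einstein condition in the model space. -/
theorem ricci_eq_smul {x : M} {l : ℝ}
    (hE : ∀ v w, ricci g x v w = (1 / 4) * scalarCurv g x * g x v w)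
    (hscal : scalarCurv g x = 4 * l) (v w : E4) : ricci g x v w = l * g x v w := by
  refine (hE v w).trans ?_
  rw [hscal]
  exact congrArg (· * g x v w) (by ring)

variable (h : IsFrameGeometry 𝒢 fr) (hg : IsAlmostParaHermitian g K)
include h hg

/-- The mixed components of the Ricci tensor, as a trace over half of the frame. -/
theorem ricci_mixed_eq (p : 𝒢.P) (k j : Fin 2) :
    ricci g (𝒢.proj p) ((fr p).eVec k) ((fr p).bVec j) = ∑ i, bilinAt g (𝒢.proj p) ((fr p).bVec i)
      (curvAt g (𝒢.proj p) ((fr p).eVec i) ((fr p).bVec j) ((fr p).eVec k)) := by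
  have hs := frame_isSplitCurvature h hg p
  exact (ricci_eq hg hs.expand _ _).trans (hs.ricci_mixed k j)

variable (hE : ∀ x v w, ricci g x v w = (1 / 4) * scalarCurv g x * g x v w)
include hE

theorem scalarCurv_of_model (p : 𝒢.P) (hm : IsModelAt 𝒢 fr p) :
    scalarCurv g (𝒢.proj p) = 4 * (-3) := by
  have hs := frame_isSplitCurvature h hg p
  have h1 := ricci_mixed_eq h hg p 0 0
  rw [hs.einstein_of_model hm 0 0] at h1
  have h2 := (hE (𝒢.proj p) ((fr p).e 0) ((fr p).ebar 0)).symm.trans h1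
  rw [(fr p).g_e_ebar] at h2
  norm_num at h2
  linarith

/-- The anti-self-dual Weyl tensor for `Ric = -3 g`, expanded in an adapted frame. -/
theorem weylMinus_eq (p : 𝒢.P) (hscal : scalarCurv g (𝒢.proj p) = 4 * (-3)) (X Y Z W : E4) :
    ∃ β, β = IsSplitCurvature.weylForm (curvAt g (𝒢.proj p)) (bilinAt g (𝒢.proj p)) (-3) X Y ∧
    weylMinus (fr p) X Y Z W = (1 / 2) * (
      (β ((fr p).eVec 0) ((fr p).bVec 0) - β ((fr p).eVec 1) ((fr p).bVec 1))
        * ((bilinAt g (𝒢.proj p) ((fr p).bVec 0) Z * bilinAt g (𝒢.proj p) ((fr p).eVec 0) W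
            - bilinAt g (𝒢.proj p) ((fr p).eVec 0) Z * bilinAt g (𝒢.proj p) ((fr p).bVec 0) W)
          - (bilinAt g (𝒢.proj p) ((fr p).bVec 1) Z * bilinAt g (𝒢.proj p) ((fr p).eVec 1) W
            - bilinAt g (𝒢.proj p) ((fr p).eVec 1) Z * bilinAt g (𝒢.proj p) ((fr p).bVec 1) W))
        + 2 * β ((fr p).eVec 0) ((fr p).bVec 1)
          * (bilinAt g (𝒢.proj p) ((fr p).bVec 0) Z * bilinAt g (𝒢.proj p) ((fr p).eVec 1) W
            - bilinAt g (𝒢.proj p) ((fr p).eVec 1) Z * bilinAt g (𝒢.proj p) ((fr p).bVec 0) W)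
        + 2 * β ((fr p).eVec 1) ((fr p).bVec 0)
          * (bilinAt g (𝒢.proj p) ((fr p).bVec 1) Z * bilinAt g (𝒢.proj p) ((fr p).eVec 0) W
            - bilinAt g (𝒢.proj p) ((fr p).eVec 0) Z *
              bilinAt g (𝒢.proj p) ((fr p).bVec 1) W)) := by
  have hs := frame_isSplitCurvature h hg p
  have hw : ∀ X Y Z W : E4, weyl g (𝒢.proj p) X Y Z W
      = IsSplitCurvature.weylForm (curvAt g (𝒢.proj p)) (bilinAt g (𝒢.proj p)) (-3) X Y Z W :=
    weyl_eq hg (ricci_eq_smul (hE _) hscal) hscal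
  refine ⟨_, rfl, ?_⟩
  refine congrArg ((1 / 2) * ·) (Eq.trans ?_ (hs.sub_hodge (hs.weylForm_swap (-3) X Y) Z W))
  refine congrArg₂ (· - ·) (hw X Y Z W) ?_
  refine congrArg ((1 / 2) * ·) (Finset.sum_congr rfl fun σ _ => ?_)
  exact congrArg (_ * ·) (congrArg (· * _) (congrArg (· * _) (hw X Y _ _)))

/-- For `Ric = -3 g`, the curvature is that of the model if and only if `Weyl⁻ = 0`. -/
theorem model_iff_weylMinus (p : 𝒢.P) (hscal : scalarCurv g (𝒢.proj p) = 4 * (-3)) :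
    IsModelAt 𝒢 fr p ↔ ∀ X Y Z W, weylMinus (fr p) X Y Z W = 0 := by
  have hs := frame_isSplitCurvature h hg p
  unfold IsModelAt
  rw [hs.model_iff_weyl]
  constructor
  · intro hm X Y Z W
    obtain ⟨β, hβ, hw⟩ := weylMinus_eq h hg hE p hscal X Y Z W
    obtain ⟨h1, h2, h3⟩ := hm X Y
    rw [hβ, h1, h2, h3] at hw
    refine hw.trans ?_
    ring
  · intro hm X Y
    have hw : ∀ Z W, _ := fun Z W => weylMinus_eq h hg hE p hscal X Y Z W
    have hz : ∀ Z W : E4, weylMinus (fr p) X Y Z W = 0 := hm X Y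
    simp only [hz] at hw
    -- the three components of `Weyl⁻` are its values on these pairs of frame vectors
    have h1 := hw ((fr p).eVec 0) ((fr p).bVec 1)
    have h2 := hw ((fr p).eVec 1) ((fr p).bVec 0)
    have h3 := hw ((fr p).eVec 0) ((fr p).bVec 0)
    simp only [hs.e_e, hs.b_b, hs.b_e, hs.e_b] at h1 h2 h3
    obtain ⟨_, rfl, h1⟩ := h1
    obtain ⟨_, rfl, h2⟩ := h2
    obtain ⟨_, rfl, h3⟩ := h3
    norm_num at h1 h2 h3
    refine ⟨h1, h2, ?_⟩
    linarith

end Einstein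

end Flat

/-! ### Flatness in terms of the Einstein constant -/

section FlatIff

variable {M : Type u} [TopologicalSpace M] [ChartedSpace E4 M] [IsManifold 𝓘(ℝ, E4) ∞ M]
  {g : BilinField M} {K : EndField M} {𝒢 : CartanGeometry M}
  {fr : ∀ p : 𝒢.P, AdaptedFrame g K (𝒢.proj p)}
  (h : IsFrameGeometry 𝒢 fr) (hg : IsParaKahlerEinstein g K)
include h hg

/-- An Einstein metric in dimension four with `R = -12` has `Ric = -3 g`. -/
theorem isFlat_of_scalar (hscal : ∀ x, scalarCurv g x = 4 * (-3)) (hw : WeylMinusVanishes g K) :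
    𝒢.IsFlat :=
  (isFlat_iff_model h hg.toIsAlmostParaHermitian).2 fun p =>
    (model_iff_weylMinus h hg.toIsAlmostParaHermitian hg.einstein p (hscal _)).2
      fun X Y Z W => hw _ (fr p) X Y Z W

theorem scalar_of_isFlat (hf : 𝒢.IsFlat) (x : M) : scalarCurv g x = 4 * (-3) := by
  obtain ⟨p, rfl⟩ := exists_proj_eq 𝒢 x
  exact scalarCurv_of_model h hg.toIsAlmostParaHermitian hg.einstein p
    ((isFlat_iff_model h hg.toIsAlmostParaHermitian).1 hf p)

theorem weylMinusVanishes_of_isFlat (hf : 𝒢.IsFlat) : WeylMinusVanishes g K := by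
  refine (forall_frame_iff h (Q := fun x f => ∀ X Y Z W, weylMinus f X Y Z W = 0)).2 fun p => ?_
  exact (model_iff_weylMinus h hg.toIsAlmostParaHermitian hg.einstein p
    (scalar_of_isFlat h hg hf _)).1 ((isFlat_iff_model h hg.toIsAlmostParaHermitian).1 hf p)

/-- In terms of the scalar curvature, `Ψ₂' = - R / 12`. -/
theorem psi2'_eq (p : 𝒢.P) : psi2' (fr p) = - (scalarCurv g (𝒢.proj p) / 12) := by
  have hs := frame_isSplitCurvature h hg.toIsAlmostParaHermitian p
  have h4 : scalarCurv g (𝒢.proj p) = 4 * (scalarCurv g (𝒢.proj p) / 4) := by ring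
  refine (weyl_eq hg.toIsAlmostParaHermitian (ricci_eq_smul (hg.einstein _) h4) h4
    ((fr p).eVec 0) ((fr p).eVec 1) ((fr p).bVec 0) ((fr p).bVec 1)).trans ?_
  rw [IsSplitCurvature.weylForm_apply, hs.e_R_e]
  simp only [hs.e_b]
  norm_num
  ring

/-- The first characterization of flatness: `Ψ₂' = 1` fixes the scalar curvature as `-12`. -/
theorem isFlat_iff_psi : 𝒢.IsFlat ↔ PsiTwoPrimeEqOne g K ∧ WeylMinusVanishes g K := by
  have hpsi : PsiTwoPrimeEqOne g K ↔ ∀ p : 𝒢.P, psi2' (fr p) = 1 :=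
    forall_frame_iff h (Q := fun x f => psi2' f = 1)
  rw [hpsi]
  constructor
  · intro hf
    refine ⟨fun p => ?_, weylMinusVanishes_of_isFlat h hg hf⟩
    rw [psi2'_eq h hg, scalar_of_isFlat h hg hf]
    norm_num
  · rintro ⟨h1, h2⟩
    refine isFlat_of_scalar h hg (fun x => ?_) h2
    obtain ⟨p, rfl⟩ := exists_proj_eq 𝒢 x
    have := h1 p
    rw [psi2'_eq h hg] at this
    linarith

/-- The second characterization of flatness, by the Einstein constant `-3`. -/
theorem isFlat_iff_einstein :
    𝒢.IsFlat ↔ HasEinsteinConstant g (-3) ∧ WeylMinusVanishes g K := by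
  constructor
  · intro hf
    refine ⟨fun x v w => ?_, weylMinusVanishes_of_isFlat h hg hf⟩
    rw [hg.einstein, scalar_of_isFlat h hg hf]
    ring
  · rintro ⟨h1, h2⟩
    refine isFlat_of_scalar h hg (fun x => ?_) h2
    obtain ⟨p, rfl⟩ := exists_proj_eq 𝒢 x
    have e1 := (hg.einstein _ ((fr p).e 0) ((fr p).ebar 0)).symm.trans (h1 _ _ _)
    rw [(fr p).g_e_ebar] at e1
    norm_num at e1
    linarith

end FlatIff

/-! ### The dancing metric in coordinates -/

section ModelRicci

namespace IsSplitCurvature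

variable {R : E4 →ₗ[ℝ] E4 →ₗ[ℝ] E4 →ₗ[ℝ] E4} {B : E4 →L[ℝ] E4 →L[ℝ] ℝ}
    {e b : Fin 2 → E4} (h : IsSplitCurvature R B e b) (hm : Model R B e b)
include h hm

/-- The Ricci tensor of the model. -/
theorem ricci_of_model (v w : E4) :
    (∑ i, B (b i) (R (e i) w v)) + ∑ i, B (e i) (R (b i) w v) = - 3 * B v w := by
  have h2 : ∀ k j, ∑ i, B (e i) (R (b i) (e j) (b k)) = - 3 * if k = j then 1 else 0 := by
    intro k j
    have : ∀ i, B (e i) (R (b i) (e j) (b k)) = B (b k) (R (e j) (b i) (e i)) := by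
      intro i; rw [h.e_R_b, h.swap, map_neg, neg_neg]
    simp only [this, hm _ _ _ _]
    fin_cases k <;> fin_cases j <;> norm_num [Fin.sum_univ_two]
  have h1 := h.einstein_of_model hm
  have e00 := h1 0 0
  have e01 := h1 0 1
  have e10 := h1 1 0
  have e11 := h1 1 1
  have f00 := h2 0 0
  have f01 := h2 0 1
  have f10 := h2 1 0
  have f11 := h2 1 1
  have hz : ∀ i k l j, B (e i) (R (b k) (b l) (b j)) = 0 := fun i j k l => by
    rw [h.e_R_b, h.R_bb, neg_zero]
  rw [h.expand v, h.expand w]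
  simp only [Fin.sum_univ_two, map_add, map_smul, LinearMap.add_apply, LinearMap.smul_apply,
    add_apply, smul_apply, smul_eq_mul, h.R_ee, h.b_R_b, h.e_R_e, hz, h.e_e, h.b_b, h.b_e, h.e_b]
    at e00 e01 e10 e11 f00 f01 f10 f11 ⊢
  norm_num at e00 e01 e10 e11 f00 f01 f10 f11 ⊢
  linear_combination (B (b 0) v * B (e 0) w) * e00 + (B (b 0) v * B (e 1) w) * e01
    + (B (b 1) v * B (e 0) w) * e10 + (B (b 1) v * B (e 1) w) * e11
    + (B (e 0) v * B (b 0) w) * f00 + (B (e 0) v * B (b 1) w) * f01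
    + (B (e 1) v * B (b 0) w) * f10 + (B (e 1) v * B (b 1) w) * f11

/-- The Riemann tensor of the model in terms of the projection `P` to the null plane of `e`. -/
theorem R_of_model {P : E4 →L[ℝ] E4} (hPe : ∀ i, P (e i) = e i) (hPb : ∀ i, P (b i) = 0)
    (u v w : E4) :
    R u v (P w) = - (B (P w) v • P u - B (P w) u • P v) - (B (P u) v - B (P v) u) • P w := by
  have hP : ∀ w, P w = ∑ i, B (b i) w • e i := by
    intro w
    conv_lhs => rw [h.expand w]
    simp [hPe, hPb]
  have hR : ∀ k, R u v (e k) = ∑ i, (- (B (b i) u * B (e k) v - B (b i) v * B (e k) u)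
      - if i = k then ∑ m, (B (b m) u * B (e m) v - B (b m) v * B (e m) u) else 0) • e i := by
    intro k
    rw [h.R_e]
    exact Finset.sum_congr rfl fun i _ => by rw [h.model_iff.1 hm]
  simp only [hP, map_smul, hR, Fin.sum_univ_two, map_add, add_apply, smul_apply,
    smul_eq_mul]
  norm_num
  module

end IsSplitCurvature

end ModelRicci

section Dancing

/-- The function `u = b + a x - y`. -/
def dancU (p : E4) : ℝ := p 1 + p 0 * p 2 - p 3

/-- The dancing metric as a function on `ℝ⁴`. -/
def dancForm (p : E4) : E4 →L[ℝ] E4 →L[ℝ] ℝ :=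
  ((p 1 + p 0 * p 2 - p 3) ^ 2)⁻¹ •
    (symProd (dcoord 0) ((p 3 - p 1) • dcoord 2 - p 2 • dcoord 3)
      + symProd (dcoord 1) (p 0 • dcoord 2 - dcoord 3))

/-- The para-complex structure of the dancing metric, as an endomorphism of `ℝ⁴`. -/
def dancEnd : E4 →L[ℝ] E4 :=
  (dcoord 0).smulRight (basisVec 0) + (dcoord 1).smulRight (basisVec 1)
    - (dcoord 2).smulRight (basisVec 2) - (dcoord 3).smulRight (basisVec 3)

/-- The `1`-form with given coefficients. -/
def coordForm (c : Fin 4 → ℝ) : E4 →L[ℝ] ℝ := ∑ k, c k • dcoord k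

theorem coordForm_apply (c : Fin 4 → ℝ) (v : E4) : coordForm c v = ∑ k, c k * v k := by
  simp [coordForm, dcoord_apply]

theorem dVec_coordForm {c : E4 → Fin 4 → ℝ} {c' : Fin 4 → E4 →L[ℝ] ℝ} {p : E4}
    (h : ∀ k, HasFDerivAt (fun z => c z k) (c' k) p) (v w : E4) :
    dVec (fun z => coordForm (c z)) p v w = ∑ k, (c' k v * w k - c' k w * v k) := by
  have h1 := dVec_sum_smul (h := fun k z => c z k) (β := fun k _ => dcoord k) (y := p)
    (fun k => (h k).differentiableAt) (fun k => differentiableAt_const _) v w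
  refine h1.trans (Finset.sum_congr rfl fun k _ => ?_)
  rw [(h k).fderiv]
  simp [dVec, dcoord_apply]

theorem hasFDerivAt_coord (i : Fin 4) (p : E4) : HasFDerivAt (fun z : E4 => z i) (dcoord i) p :=
  (dcoord i).hasFDerivAt

/-- The differential of `1 / u`. -/
theorem hasFDerivAt_inv_dancU {p : E4} (hp : dancU p ≠ 0) :
    HasFDerivAt (fun z => (dancU z)⁻¹) (coordForm ![- ((dancU p)⁻¹ ^ 2 * p 2), - (dancU p)⁻¹ ^ 2,
      - ((dancU p)⁻¹ ^ 2 * p 0), (dancU p)⁻¹ ^ 2]) p := by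
  have h1 : HasFDerivAt dancU (coordForm ![p 2, 1, p 0, -1]) p := by
    have h := ((hasFDerivAt_coord 1 p).add
      ((hasFDerivAt_coord 0 p).mul (hasFDerivAt_coord 2 p))).sub (hasFDerivAt_coord 3 p)
    refine h.congr_fderiv ?_
    ext v
    simp [coordForm_apply, Fin.sum_univ_four, dcoord_apply]
    ring
  have h2 := (hasDerivAt_inv hp).comp_hasFDerivAt p h1
  refine HasFDerivAt.congr_fderiv (f := fun z => (dancU z)⁻¹) h2 ?_
  ext v
  simp [coordForm_apply, Fin.sum_univ_four]
  ring

/-- The forms `α¹, α²` of a null coframe of the dancing metric. -/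
def dancAlpha (i : Fin 2) (p : E4) : Fin 4 → ℝ :=
  ![![(dancU p)⁻¹ - p 0 * p 2 * (dancU p)⁻¹ ^ 2, - (p 0 * (dancU p)⁻¹ ^ 2), 0, 0],
    ![p 2 * (dancU p)⁻¹ ^ 2, (dancU p)⁻¹ ^ 2, 0, 0]] i

/-- The forms `ᾱ¹, ᾱ²` of a null coframe of the dancing metric. -/
def dancAlphaBar (i : Fin 2) : Fin 4 → ℝ := ![![0, 0, -1, 0], ![0, 0, 0, -1]] i

/-- The connection form of the dancing metric. -/
def dancGam (i j : Fin 2) (p : E4) : Fin 4 → ℝ :=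
  ![![![0, 0, 2 * (p 0 * (dancU p)⁻¹), - (dancU p)⁻¹], ![0, 0, 0, p 0 * (dancU p)⁻¹]],
    ![![0, 0, - (dancU p)⁻¹, 0], ![0, 0, p 0 * (dancU p)⁻¹, - (2 * (dancU p)⁻¹)]]] i j

/-- The vectors `e₁, e₂` of the null frame of the dancing metric dual to `dancAlpha`,
`dancAlphaBar`. -/
def dancE (i : Fin 2) (p : E4) : E4 :=
  ![dancU p • (basisVec 0 - p 2 • basisVec 1),
    dancU p • (p 0 • basisVec 0 + (p 1 - p 3) • basisVec 1)] i

/-- The vectors `ē₁, ē₂` of the null frame of the dancing metric. -/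
def dancB (i : Fin 2) : E4 := ![- basisVec 2, - basisVec 3] i

/-- The dancing metric is `2 Σ αⁱ ᾱᵢ`. -/
theorem dancForm_apply {p : E4} (hp : dancU p ≠ 0) (v w : E4) :
    dancForm p v w = ∑ i, (coordForm (dancAlpha i p) v * coordForm (dancAlphaBar i) w
      + coordForm (dancAlphaBar i) v * coordForm (dancAlpha i p) w) := by
  have h1 : p 1 = dancU p - p 0 * p 2 + p 3 := by unfold dancU; ring
  have h2 : p 1 + p 0 * p 2 - p 3 = dancU p := rfl
  simp only [dancForm, symProd, coordForm_apply, Fin.sum_univ_two, Fin.sum_univ_four, dancAlpha,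
    dancAlphaBar, smul_apply, add_apply, sub_apply, ContinuousLinearMap.smulRight_apply,
    dcoord_apply, smul_eq_mul, Matrix.cons_val, h2]
  rw [h1]
  field_simp
  ring

/-- The first structure equation `dα = -Γ ∧ α`. -/
theorem dVec_dancAlpha {p : E4} (hp : dancU p ≠ 0) (i : Fin 2) (v w : E4) :
    dVec (fun z => coordForm (dancAlpha i z)) p v w
      = -∑ j, (coordForm (dancGam i j p) v * coordForm (dancAlpha j p) w
        - coordForm (dancGam i j p) w * coordForm (dancAlpha j p) v) := by
  have hr := hasFDerivAt_inv_dancU hp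
  have h0 := hasFDerivAt_coord 0 p
  have h2 := hasFDerivAt_coord 2 p
  have hz : HasFDerivAt (fun _ : E4 => (0 : ℝ)) (0 : E4 →L[ℝ] ℝ) p := hasFDerivAt_const _ _
  fin_cases i
  · simp only [Fin.zero_eta]
    rw [dVec_coordForm (c := dancAlpha 0) (c' := ![_, _, 0, 0]) (by
      intro k
      fin_cases k
      · exact hr.sub ((h0.mul h2).mul (hr.pow 2))
      · exact (h0.mul (hr.pow 2)).neg
      · exact hz
      · exact hz)]
    simp [Fin.sum_univ_four, Fin.sum_univ_two, coordForm_apply, dancAlpha, dancGam, dcoord_apply]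
    ring
  · simp only [Fin.mk_one]
    rw [dVec_coordForm (c := dancAlpha 1) (c' := ![_, _, 0, 0]) (by
      intro k
      fin_cases k
      · exact h2.mul (hr.pow 2)
      · exact hr.pow 2
      · exact hz
      · exact hz)]
    simp [Fin.sum_univ_four, Fin.sum_univ_two, coordForm_apply, dancAlpha, dancGam, dcoord_apply]
    ring

/-- The first structure equation `dᾱ = Γᵀ ∧ ᾱ`. -/
theorem dVec_dancAlphaBar (p : E4) (i : Fin 2) (v w : E4) :
    dVec (fun _ => coordForm (dancAlphaBar i)) p v w
      = ∑ j, (coordForm (dancGam j i p) v * coordForm (dancAlphaBar j) w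
        - coordForm (dancGam j i p) w * coordForm (dancAlphaBar j) v) := by
  fin_cases i <;> simp [dVec, Fin.sum_univ_four, Fin.sum_univ_two, coordForm_apply, dancAlphaBar,
    dancGam] <;> ring

/-- The curvature of the dancing metric. -/
theorem curvVec_dancGam {p : E4} (hp : dancU p ≠ 0) (i j : Fin 2) (v w : E4) :
    curvVec (fun i j z => coordForm (dancGam i j z)) p i j v w
      = - (coordForm (dancAlpha i p) v * coordForm (dancAlphaBar j) w
          - coordForm (dancAlpha i p) w * coordForm (dancAlphaBar j) v)
        - if i = j then ∑ m, (coordForm (dancAlpha m p) v * coordForm (dancAlphaBar m) w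
          - coordForm (dancAlpha m p) w * coordForm (dancAlphaBar m) v) else 0 := by
  have hr := hasFDerivAt_inv_dancU hp
  have h0 := hasFDerivAt_coord 0 p
  have hz : HasFDerivAt (fun _ : E4 => (0 : ℝ)) (0 : E4 →L[ℝ] ℝ) p := hasFDerivAt_const _ _
  unfold curvVec
  fin_cases i <;> fin_cases j
  · simp only [Fin.zero_eta]
    rw [dVec_coordForm (c := dancGam 0 0) (c' := ![0, 0, _, _]) (by
      intro k
      fin_cases k
      · exact hz
      · exact hz
      · exact (h0.mul hr).const_mul 2
      · exact hr.neg)]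
    simp [Fin.sum_univ_four, Fin.sum_univ_two, coordForm_apply, dancAlpha, dancAlphaBar, dancGam,
      dcoord_apply]
    ring
  · simp only [Fin.zero_eta, Fin.mk_one]
    rw [dVec_coordForm (c := dancGam 0 1) (c' := ![0, 0, 0, _]) (by
      intro k
      fin_cases k
      · exact hz
      · exact hz
      · exact hz
      · exact h0.mul hr)]
    simp [Fin.sum_univ_four, Fin.sum_univ_two, coordForm_apply, dancAlpha, dancAlphaBar, dancGam,
      dcoord_apply]
    ring
  · simp only [Fin.zero_eta, Fin.mk_one]
    rw [dVec_coordForm (c := dancGam 1 0) (c' := ![0, 0, _, 0]) (by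
      intro k
      fin_cases k
      · exact hz
      · exact hz
      · exact hr.neg
      · exact hz)]
    simp [Fin.sum_univ_four, Fin.sum_univ_two, coordForm_apply, dancAlpha, dancAlphaBar, dancGam]
    ring
  · simp only [Fin.mk_one]
    rw [dVec_coordForm (c := dancGam 1 1) (c' := ![0, 0, _, _]) (by
      intro k
      fin_cases k
      · exact hz
      · exact hz
      · exact h0.mul hr
      · exact (hr.const_mul 2).neg)]
    simp [Fin.sum_univ_four, Fin.sum_univ_two, coordForm_apply, dancAlpha, dancAlphaBar, dancGam,
      dcoord_apply]
    ring

theorem dancAlpha_dancE {p : E4} (hp : dancU p ≠ 0) (i j : Fin 2) :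
    coordForm (dancAlpha i p) (dancE j p) = if i = j then 1 else 0 := by
  have h1 : p 1 - p 3 = dancU p - p 0 * p 2 := by unfold dancU; ring
  have h2 : (dancU p)⁻¹ * dancU p = 1 := inv_mul_cancel₀ hp
  fin_cases i <;> fin_cases j <;>
    simp only [coordForm_apply, Fin.sum_univ_four, dancAlpha, dancE, h1, Fin.zero_eta, Fin.mk_one,
      Matrix.cons_val, PiLp.smul_apply, PiLp.add_apply, PiLp.sub_apply, basisVec_apply,
      smul_eq_mul]
  · norm_num
    linear_combination h2
  · norm_num
    linear_combination (-(dancU p)⁻¹ * dancU p * p 0) * h2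
  · norm_num
    ring
  · norm_num
    linear_combination ((dancU p)⁻¹ * dancU p + 1) * h2

theorem dancAlpha_dancB (p : E4) (i j : Fin 2) : coordForm (dancAlpha i p) (dancB j) = 0 := by
  fin_cases i <;> fin_cases j <;>
    simp [coordForm_apply, dancAlpha, dancB]

theorem dancAlphaBar_dancE (p : E4) (i j : Fin 2) :
    coordForm (dancAlphaBar i) (dancE j p) = 0 := by
  fin_cases i <;> fin_cases j <;>
    simp [coordForm_apply, Fin.sum_univ_four, dancAlphaBar, dancE]

theorem dancAlphaBar_dancB (i j : Fin 2) :
    coordForm (dancAlphaBar i) (dancB j) = if i = j then 1 else 0 := by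
  fin_cases i <;> fin_cases j <;>
    simp [coordForm_apply, dancAlphaBar, dancB]

theorem dancForm_dancB {p : E4} (hp : dancU p ≠ 0) (i : Fin 2) :
    dancForm p (dancB i) = coordForm (dancAlpha i p) := by
  ext v
  rw [dancForm_apply hp]
  simp only [dancAlpha_dancB, dancAlphaBar_dancB]
  simp

theorem dancForm_dancE {p : E4} (hp : dancU p ≠ 0) (i : Fin 2) :
    dancForm p (dancE i p) = coordForm (dancAlphaBar i) := by
  ext v
  rw [dancForm_apply hp]
  simp only [dancAlpha_dancE hp, dancAlphaBar_dancE]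
  simp

theorem dancForm_symm (p v w : E4) : dancForm p v w = dancForm p w v := by
  simp only [dancForm, symProd, smul_apply, add_apply, ContinuousLinearMap.smulRight_apply,
    smul_eq_mul]
  ring

theorem continuous_dancU : Continuous dancU := by
  unfold dancU; fun_prop

theorem contDiffAt_dancForm {p : E4} (hp : dancU p ≠ 0) : ContDiffAt ℝ ∞ dancForm p := by
  refine contDiffAt_clm_of_apply fun v => contDiffAt_clm_of_apply fun w => ?_
  have hc : ∀ i : Fin 4, ContDiffAt ℝ ∞ (fun z : E4 => z i) p :=
    fun i => (dcoord i).contDiff.contDiffAt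
  simp only [dancForm, symProd, smul_apply, add_apply, sub_apply,
    ContinuousLinearMap.smulRight_apply, dcoord_apply, smul_eq_mul]
  have h0 := hc 0
  have h1 := hc 1
  have h2 := hc 2
  have h3 := hc 3
  refine ContDiffAt.mul (ContDiffAt.inv (by fun_prop) (pow_ne_zero 2 hp)) ?_
  fun_prop

theorem contDiffAt_dancE (p : E4) (i : Fin 2) : ContDiffAt ℝ ∞ (dancE i) p := by
  have hc : ∀ i : Fin 4, ContDiffAt ℝ ∞ (fun z : E4 => z i) p :=
    fun i => (dcoord i).contDiff.contDiffAt
  have h0 := hc 0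
  have h1 := hc 1
  have h2 := hc 2
  have h3 := hc 3
  fin_cases i
  · change ContDiffAt ℝ ∞ (fun z : E4 =>
      (z 1 + z 0 * z 2 - z 3) • (basisVec 0 - z 2 • basisVec 1)) p
    fun_prop
  · change ContDiffAt ℝ ∞ (fun z : E4 => (z 1 + z 0 * z 2 - z 3) •
      (z 0 • basisVec 0 + (z 1 - z 3) • basisVec 1)) p
    fun_prop

theorem differentiableAt_dancGam {p : E4} (hp : dancU p ≠ 0) (i j : Fin 2) :
    DifferentiableAt ℝ (fun z => coordForm (dancGam i j z)) p := by
  have hr := (hasFDerivAt_inv_dancU hp).differentiableAt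
  have h0 := (hasFDerivAt_coord 0 p).differentiableAt
  unfold coordForm
  refine DifferentiableAt.fun_sum fun k _ => DifferentiableAt.smul_const ?_ _
  fin_cases i <;> fin_cases j <;> fin_cases k <;> simp [dancGam] <;> fun_prop

variable {G : E4 → E4 →L[ℝ] E4 →L[ℝ] ℝ} {p : E4}

/-- The dancing metric has the curvature of the model. -/
theorem danc_curvature (hp : dancU p ≠ 0) (hG : G =ᶠ[𝓝 p] dancForm) :
    IsSplitCurvature (curvTri (christoffelMap G) p) (G p) (fun i => dancE i p) dancB ∧
    IsSplitCurvature.Model (curvTri (christoffelMap G) p) (G p) (fun i => dancE i p) dancB := by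
  have hu : ∀ᶠ z in 𝓝 p, dancU z ≠ 0 := continuous_dancU.continuousAt.eventually_ne hp
  have hGp : G p = dancForm p := hG.self_of_nhds
  have hsm : ContDiffAt ℝ ∞ G p := (contDiffAt_dancForm hp).congr_of_eventuallyEq hG
  have hs : ∀ᶠ z in 𝓝 p, ∀ u v, G z u v = G z v u := by
    filter_upwards [hG] with z hz u v
    rw [hz, dancForm_symm]
  have hid : ∀ z, fderiv ℝ (fun z : E4 => z) z = ContinuousLinearMap.id ℝ E4 :=
    fun z => fderiv_fun_id
  -- the structure equations for the identity map of `ℝ⁴` and the explicit frame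
  have key := fun j v w => split_frame_curvature (F := E4) (G := G) (q := fun z => z) (p := p)
    (e := dancE) (b := fun i _ => dancB i) (Γ := fun i j z => coordForm (dancGam i j z))
    hsm hs contDiffAt_id (contDiffAt_dancE p) (fun i => contDiffAt_const)
    (differentiableAt_dancGam hp)
    (by
      filter_upwards [hG, hu] with z h1 h2 i j
      rw [h1, dancForm_dancE h2, dancAlphaBar_dancE])
    (by
      filter_upwards [hG, hu] with z h1 h2 i j
      rw [h1, dancForm_dancB h2, dancAlpha_dancB])
    (by
      filter_upwards [hG, hu] with z h1 h2 i j
      rw [h1, dancForm_dancE h2, dancAlphaBar_dancB])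
    (Filter.Eventually.of_forall fun z v => ⟨v, by rw [hid]; rfl⟩)
    (by
      filter_upwards [hG.eventually_nhds, hu.eventually_nhds] with z h1 h2 i v w
      have h3 : (fun z => (G z (dancB i)).comp (fderiv ℝ (fun z : E4 => z) z)) =ᶠ[𝓝 z]
          fun z => coordForm (dancAlpha i z) := by
        filter_upwards [h1, h2] with z h1 h2
        rw [h1, dancForm_dancB h2, hid, ContinuousLinearMap.comp_id]
      rw [dVec_congr h3, dVec_dancAlpha h2.self_of_nhds, h1.self_of_nhds]
      simp only [dancForm_dancB h2.self_of_nhds, hid, ContinuousLinearMap.id_apply])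
    (by
      filter_upwards [hG.eventually_nhds, hu.eventually_nhds] with z h1 h2 i v w
      have h3 : (fun z => (G z (dancE i z)).comp (fderiv ℝ (fun z : E4 => z) z)) =ᶠ[𝓝 z]
          fun z => coordForm (dancAlphaBar i) := by
        filter_upwards [h1, h2] with z h1 h2
        rw [h1, dancForm_dancE h2, hid, ContinuousLinearMap.comp_id]
      rw [dVec_congr h3, dVec_dancAlphaBar, h1.self_of_nhds]
      simp only [dancForm_dancE h2.self_of_nhds, hid, ContinuousLinearMap.id_apply]) j v w
  simp only [hid, ContinuousLinearMap.id_apply] at key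
  have hcomp : ∀ v w i j, G p (dancB i) (curvTri (christoffelMap G) p v w (dancE j p))
      = curvVec (fun i j z => coordForm (dancGam i j z)) p i j v w := by
    intro v w i j
    rw [curvTri_apply, (key j v w).1, map_sum]
    simp only [map_smul, hGp, dancForm_dancB hp, dancAlpha_dancE hp]
    simp
  have hsplit : IsSplitCurvature (curvTri (christoffelMap G) p) (G p) (fun i => dancE i p) dancB :=
    { symm := hs.self_of_nhds
      e_e := fun i j => by rw [hGp, dancForm_dancE hp, dancAlphaBar_dancE]
      b_b := fun i j => by rw [hGp, dancForm_dancB hp, dancAlpha_dancB]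
      e_b := fun i j => by rw [hGp, dancForm_dancE hp, dancAlphaBar_dancB]
      swap := fun u v w => by rw [curvTri_apply, curvTri_apply, curvOp_swap]
      bianchi := fun u v w => by
        have hdet : (gram G p).det ≠ 0 := gram_det_ne_zero fun v hv => by
          refine eq_of_inner_frame (B := G p) (e := fun i => dancE i p) (b := dancB)
            hs.self_of_nhds (fun i j => by rw [hGp, dancForm_dancE hp, dancAlphaBar_dancE])
            (fun i j => by rw [hGp, dancForm_dancB hp, dancAlpha_dancB])
            (fun i j => by rw [hGp, dancForm_dancE hp, dancAlphaBar_dancB])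
            (fun i => ?_) fun i => ?_
          · rw [hs.self_of_nhds, hv, map_zero]
          · rw [hs.self_of_nhds, hv, map_zero]
        rw [curvTri_apply, curvTri_apply, curvTri_apply]
        refine curvOp_bianchi ((contDiffAt_christoffelMap hsm hdet).differentiableAt (by simp))
          ?_ u v w
        filter_upwards [hs.eventually_nhds] with z hz
        exact christoffelMap_symm hz
      R_e := fun u v j => by
        simp only [hcomp]
        exact (key j u v).1
      R_b := fun u v j => by
        simp only [hcomp]
        exact (key j u v).2 }
  refine ⟨hsplit, hsplit.model_iff.2 fun u v i k => ?_⟩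
  rw [hcomp, curvVec_dancGam hp]
  simp only [hGp, dancForm_dancB hp, dancForm_dancE hp]

end Dancing

/-! ### Smoothness of fields of bilinear forms -/

section Criterion

variable {M : Type u} [TopologicalSpace M] [ChartedSpace E4 M] [IsManifold 𝓘(ℝ, E4) ∞ M]

theorem contMDiffAt_clm_of_apply {f : M → E4 →L[ℝ] E4 →L[ℝ] ℝ} {x₀ : M}
    (h : ∀ v w, ContMDiffAt 𝓘(ℝ, E4) 𝓘(ℝ, ℝ) ∞ (fun x => f x v w) x₀) :
    ContMDiffAt 𝓘(ℝ, E4) 𝓘(ℝ, E4 →L[ℝ] E4 →L[ℝ] ℝ) ∞ f x₀ := by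
  have key : f = fun x => ∑ i : Fin 4, ∑ j : Fin 4,
      (f x (basisVec i) (basisVec j)) • ((dcoord i).smulRight (dcoord j)) := by
    funext x
    ext v w
    rw [bilin_eq_gram (G := fun _ : E4 => f x) (y := 0)]
    simp only [sum_apply, smul_apply, ContinuousLinearMap.smulRight_apply, smul_eq_mul,
      dcoord_apply, gram, Matrix.of_apply]
    refine Finset.sum_congr rfl fun i _ => Finset.sum_congr rfl fun j _ => ?_
    ring
  rw [key]
  refine ContMDiffAt.sum fun i _ => ContMDiffAt.sum fun j _ => ?_
  exact (h _ _).smul contMDiffAt_const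

/-- A field of bilinear forms is smooth if its values on the frame of a local trivialization are. -/
theorem smoothBilinAt_of_apply {g : BilinField M} {x₀ : M}
    (h : ∀ v w : E4, ContMDiffAt 𝓘(ℝ, E4) 𝓘(ℝ, ℝ) ∞ (fun x => g x
      ((trivializationAt E4 (TangentSpace 𝓘(ℝ, E4)) x₀).symmL ℝ x v)
      ((trivializationAt E4 (TangentSpace 𝓘(ℝ, E4)) x₀).symmL ℝ x w)) x₀) :
    SmoothBilinAt g x₀ := by
  unfold SmoothBilinAt
  rw [contMDiffAt_hom_bundle]
  refine ⟨contMDiffAt_id, contMDiffAt_clm_of_apply fun v w => ?_⟩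
  have hb : (trivializationAt E4 (TangentSpace 𝓘(ℝ, E4)) x₀).baseSet ∈ 𝓝 x₀ :=
    (trivializationAt E4 (TangentSpace 𝓘(ℝ, E4)) x₀).open_baseSet.mem_nhds
      (FiberBundle.mem_baseSet_trivializationAt' x₀)
  refine (h v w).congr_of_eventuallyEq ?_
  filter_upwards [hb] with x hx
  simp only [ContinuousLinearMap.inCoordinates, ContinuousLinearMap.comp_apply]
  have hx' : x ∈ (trivializationAt (E4 →L[ℝ] ℝ)
      (fun b : M => TangentSpace 𝓘(ℝ, E4) b →L[ℝ] ℝ) x₀).baseSet := ⟨hx, Set.mem_univ _⟩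
  rw [Trivialization.continuousLinearMapAt_apply, Trivialization.linearMapAt_apply, if_pos hx',
    hom_trivializationAt_apply]
  simp [ContinuousLinearMap.inCoordinates]

end Criterion

/-! ### Calculus on the domain of the dancing metric -/

section Opens

/-- The charts of an open subset of `ℝ⁴` are restrictions of the identity. -/
theorem coe_extChartAt_danc (x : dancingDomain) :
    (extChartAt 𝓘(ℝ, E4) x : dancingDomain → E4) = Subtype.val := by
  ext1 y
  simp [extChartAt, TopologicalSpace.Opens.chartAt_eq, chartAt_self_eq]

theorem vecDeriv_extChartAt_danc (x q : dancingDomain) (v : TangentSpace 𝓘(ℝ, E4) q) :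
    vecDeriv (extChartAt 𝓘(ℝ, E4) x) q v = v := by
  rw [coe_extChartAt_danc x, ← coe_extChartAt_danc q]
  exact vecDeriv_extChartAt_self q v

theorem extChartAt_danc_source (x : dancingDomain) :
    (extChartAt 𝓘(ℝ, E4) x).source = Set.univ := by
  simp [extChartAt, TopologicalSpace.Opens.chartAt_eq, chartAt_self_eq]

theorem extChartAt_danc_self (x : dancingDomain) : extChartAt 𝓘(ℝ, E4) x x = (x : E4) := by
  rw [coe_extChartAt_danc]

theorem extChartAt_danc_symm (x : dancingDomain) {y : E4}
    (hy : y ∈ (extChartAt 𝓘(ℝ, E4) x).target) :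
    ((extChartAt 𝓘(ℝ, E4) x).symm y : E4) = y := by
  have h := (extChartAt 𝓘(ℝ, E4) x).right_inv hy
  rwa [coe_extChartAt_danc x] at h

theorem chartInvDeriv_danc (x : dancingDomain) {y : E4}
    (hy : y ∈ (extChartAt 𝓘(ℝ, E4) x).target) (v : E4) : (chartInvDeriv x y v : E4) = v := by
  have h1 := mfderiv_chartInvDeriv hy v
  have h2 := vecDeriv_extChartAt_danc x _ (chartInvDeriv x y v)
  exact h2.symm.trans h1

theorem bilinInChart_danc (g : BilinField dancingDomain) (x : dancingDomain) {y : E4}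
    (hy : y ∈ (extChartAt 𝓘(ℝ, E4) x).target) (v w : E4) :
    bilinInChart g x y v w = bilinAt g ((extChartAt 𝓘(ℝ, E4) x).symm y) v w :=
  congrArg₂ (fun v w : E4 => bilinAt g ((extChartAt 𝓘(ℝ, E4) x).symm y) v w)
    (chartInvDeriv_danc x hy v) (chartInvDeriv_danc x hy w)

theorem mem_chart_danc (x q : dancingDomain) : q ∈ (chartAt E4 x).source := by
  have := extChartAt_danc_source x
  rw [extChartAt_source] at this
  rw [this]; trivial

/-- The tangent bundle of an open subset of `ℝ⁴` is trivial, with the identity as trivialization. -/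
theorem trivializationAt_danc (x q : dancingDomain) (v : TangentSpace 𝓘(ℝ, E4) q) :
    (trivializationAt E4 (TangentSpace 𝓘(ℝ, E4)) x
      (⟨q, v⟩ : TangentBundle 𝓘(ℝ, E4) dancingDomain)).2
      = v := by
  have hq := mem_chart_danc x q
  have hq' : q ∈ (trivializationAt E4 (TangentSpace 𝓘(ℝ, E4)) x).baseSet := hq
  have h := TangentBundle.continuousLinearMapAt_trivializationAt (I := 𝓘(ℝ, E4)) hq
  have h2 := vecDeriv_extChartAt_danc x q v
  unfold vecDeriv at h2
  rw [← h] at h2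
  exact (Trivialization.continuousLinearMapAt_apply_of_mem (R := ℝ) _ hq' v).symm.trans h2

theorem symmL_trivializationAt_danc (x q : dancingDomain) (v : E4) :
    ((trivializationAt E4 (TangentSpace 𝓘(ℝ, E4)) x).symmL ℝ q v : E4) = v := by
  have hq' : q ∈ (trivializationAt E4 (TangentSpace 𝓘(ℝ, E4)) x).baseSet := mem_chart_danc x q
  have h1 := (trivializationAt E4 (TangentSpace 𝓘(ℝ, E4)) x).continuousLinearMapAt_symmL (R := ℝ)
    hq' v
  rw [Trivialization.continuousLinearMapAt_apply_of_mem (R := ℝ) _ hq'] at h1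
  exact (trivializationAt_danc x q _).symm.trans h1

theorem contMDiffAt_comp_val {F : Type*} [NormedAddCommGroup F] [NormedSpace ℝ F] {f : E4 → F}
    {x : dancingDomain} (hf : ContDiffAt ℝ ∞ f x) :
    ContMDiffAt 𝓘(ℝ, E4) 𝓘(ℝ, F) ∞ (fun q : dancingDomain => f q) x :=
  ContMDiffAt.comp x (g := f) hf.contMDiffAt contMDiff_subtype_val.contMDiffAt

theorem dancU_ne_zero (x : dancingDomain) : dancU x ≠ 0 := x.2

theorem smooth_dancingMetric (x : dancingDomain) : SmoothBilinAt dancingMetric x := by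
  refine smoothBilinAt_of_apply fun v w => ?_
  have h1 : ContMDiffAt 𝓘(ℝ, E4) 𝓘(ℝ, ℝ) ∞ (fun q : dancingDomain => dancForm q v w) x :=
    contMDiffAt_comp_val (f := fun y => dancForm y v w)
      (((contDiffAt_dancForm (dancU_ne_zero x)).clm_apply contDiffAt_const).clm_apply
        contDiffAt_const)
  refine h1.congr_of_eventuallyEq (Filter.Eventually.of_forall fun q => ?_)
  exact congrArg₂ (fun v w : E4 => dancForm q v w) (symmL_trivializationAt_danc x q v)
    (symmL_trivializationAt_danc x q w)

theorem contMDiffAt_snd_danc (ξ : TangentBundle 𝓘(ℝ, E4) dancingDomain) :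
    ContMDiffAt 𝓘(ℝ, E4).tangent 𝓘(ℝ, E4) ∞
      (fun v : TangentBundle 𝓘(ℝ, E4) dancingDomain => (v.2 : E4)) ξ := by
  have h := ((contMDiffAt_totalSpace (IB := 𝓘(ℝ, E4))
    (f := fun v : TangentBundle 𝓘(ℝ, E4) dancingDomain => v) (x₀ := ξ)).1
    (contMDiffAt_id (I := 𝓘(ℝ, E4).tangent) (n := ∞))).2
  refine h.congr_of_eventuallyEq (Filter.Eventually.of_forall fun v => ?_)
  exact (trivializationAt_danc ξ.1 v.1 v.2).symm

theorem contMDiffAt_tangent_danc {D H X : Type*} [NormedAddCommGroup D] [NormedSpace ℝ D]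
    [TopologicalSpace H] {J : ModelWithCorners ℝ D H} [TopologicalSpace X] [ChartedSpace H X]
    {f : X → TangentBundle 𝓘(ℝ, E4) dancingDomain} {x : X}
    (h1 : ContMDiffAt J 𝓘(ℝ, E4) ∞ (fun z => (f z).1) x)
    (h2 : ContMDiffAt J 𝓘(ℝ, E4) ∞ (fun z => ((f z).2 : E4)) x) :
    ContMDiffAt J 𝓘(ℝ, E4).tangent ∞ f x := by
  refine (contMDiffAt_totalSpace (IB := 𝓘(ℝ, E4))).2 ⟨h1, ?_⟩
  refine h2.congr_of_eventuallyEq (Filter.Eventually.of_forall fun v => ?_)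
  exact trivializationAt_danc _ _ (f v).2

/-- The restriction to the dancing domain of a `1`-form on `ℝ⁴`. -/
def formD (A : E4 → E4 →L[ℝ] ℝ) : FormField E4 dancingDomain := fun q =>
  show E4 →L[ℝ] ℝ from A q

theorem oneFormInChart_formD (A : E4 → E4 →L[ℝ] ℝ) (x : dancingDomain) {y : E4}
    (hy : y ∈ (extChartAt 𝓘(ℝ, E4) x).target) : oneFormInChart (formD A) x y = A y := by
  ext v
  exact congrArg₂ (fun z v : E4 => A z v) (extChartAt_danc_symm x hy) (chartInvDeriv_danc x hy v)

theorem dOne_formD (A : E4 → E4 →L[ℝ] ℝ) (x : dancingDomain) (v w : E4) :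
    dOne (formD A) x v w = dVec A x v w := by
  have h : oneFormInChart (formD A) x =ᶠ[𝓝 (extChartAt 𝓘(ℝ, E4) x x)] A := by
    filter_upwards [extChartAt_target_mem_nhds (I := 𝓘(ℝ, E4)) x] with y hy
    exact oneFormInChart_formD A x hy
  unfold dOne dVec
  rw [h.fderiv_eq, extChartAt_danc_self]

theorem smoothFormAt_formD {A : E4 → E4 →L[ℝ] ℝ} {x : dancingDomain} (hA : ContDiffAt ℝ ∞ A x) :
    SmoothFormAt (formD A) x := by
  intro v
  have h1 : ContMDiffAt 𝓘(ℝ, E4).tangent 𝓘(ℝ, E4 →L[ℝ] ℝ) ∞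
      (fun ξ : TangentBundle 𝓘(ℝ, E4) dancingDomain => A ξ.1) ⟨x, v⟩ :=
    ContMDiffAt.comp _ (g := fun q : dancingDomain => A q) (contMDiffAt_comp_val hA)
      (contMDiff_proj (TangentSpace 𝓘(ℝ, E4))).contMDiffAt
  exact h1.clm_apply (contMDiffAt_snd_danc ⟨x, v⟩)

end Opens

/-! ### The dancing metric is para-Kähler-Einstein -/

theorem dancEnd_apply (v : E4) (i : Fin 4) : dancEnd v i = ![v 0, v 1, - v 2, - v 3] i := by
  fin_cases i <;> simp [dancEnd, dcoord_apply, basisVec_apply]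

theorem dancEnd_dancEnd (v : E4) : dancEnd (dancEnd v) = v := by
  ext i
  fin_cases i <;> simp [dancEnd_apply]

theorem dancForm_dancEnd_dancEnd (p v w : E4) :
    dancForm p (dancEnd v) (dancEnd w) = - dancForm p v w := by
  simp only [dancForm, symProd, smul_apply, add_apply, sub_apply,
    ContinuousLinearMap.smulRight_apply, dcoord_apply, smul_eq_mul, dancEnd_apply,
    Matrix.cons_val]
  ring

/-- The fundamental form of the dancing metric is `Σ αᵏ ∧ ᾱₖ`. -/
theorem dancForm_dancEnd {p : E4} (hp : dancU p ≠ 0) (v w : E4) :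
    dancForm p (dancEnd v) w = ∑ k, (coordForm (dancAlpha k p) v * coordForm (dancAlphaBar k) w
      - coordForm (dancAlphaBar k) v * coordForm (dancAlpha k p) w) := by
  rw [dancForm_apply hp]
  refine Finset.sum_congr rfl fun k _ => ?_
  have h1 : coordForm (dancAlpha k p) (dancEnd v) = coordForm (dancAlpha k p) v := by
    fin_cases k <;> simp [coordForm_apply, Fin.sum_univ_four, dancAlpha, dancEnd_apply]
  have h2 : coordForm (dancAlphaBar k) (dancEnd v) = - coordForm (dancAlphaBar k) v := by
    fin_cases k <;> simp [coordForm_apply, Fin.sum_univ_four, dancAlphaBar, dancEnd_apply]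
  rw [h1, h2]
  ring

theorem mem_eigenspace_dancEnd_one (v : E4) :
    v ∈ Module.End.eigenspace (dancEnd : E4 →ₗ[ℝ] E4) 1 ↔ ∀ i : Fin 2, v (i.natAdd 2) = 0 := by
  rw [Module.End.mem_eigenspace_iff, one_smul, ContinuousLinearMap.coe_coe]
  constructor
  · intro h i
    have := congrArg (fun z : E4 => z (i.natAdd 2)) h
    fin_cases i <;> simp [dancEnd_apply] at this ⊢ <;> linarith
  · intro h
    have h0 := h 0
    have h1 := h 1
    ext i
    fin_cases i <;> simp [dancEnd_apply] at h0 h1 ⊢ <;> simp [h0, h1]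

theorem mem_eigenspace_dancEnd_neg_one (v : E4) :
    v ∈ Module.End.eigenspace (dancEnd : E4 →ₗ[ℝ] E4) (-1)
      ↔ ∀ i : Fin 2, v (Fin.castAdd 2 i) = 0 := by
  rw [Module.End.mem_eigenspace_iff, neg_one_smul, ContinuousLinearMap.coe_coe]
  constructor
  · intro h i
    have := congrArg (fun z : E4 => z (Fin.castAdd 2 i)) h
    fin_cases i <;> simp [dancEnd_apply] at this ⊢ <;> linarith
  · intro h
    have h0 := h 0
    have h1 := h 1
    ext i
    fin_cases i <;> simp [dancEnd_apply] at h0 h1 ⊢ <;> simp [h0, h1]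

theorem finrank_eq_two_of_coord {W : Submodule ℝ E4} (f g : Fin 2 → Fin 4)
    (hfg : ∀ v : E4, (∀ i, v (f i) = 0) → (∀ i, v (g i) = 0) → v = 0)
    (hgf : ∀ i j, f i ≠ g j) (hg : Function.Injective g)
    (hW : ∀ v : E4, v ∈ W ↔ ∀ i, v (f i) = 0) : Module.finrank ℝ W = 2 := by
  let L : W →ₗ[ℝ] (Fin 2 → ℝ) :=
    { toFun := fun v i => (v : E4) (g i)
      map_add' := fun v w => rfl
      map_smul' := fun c v => rfl }
  have hinj : Function.Injective L := by
    rw [injective_iff_map_eq_zero]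
    intro v hv
    exact Subtype.ext (hfg v ((hW v).1 v.2) fun i => congrFun hv i)
  have hsurj : Function.Surjective L := by
    intro c
    refine ⟨⟨∑ j, c j • basisVec (g j), (hW _).2 fun i => ?_⟩, ?_⟩
    · simp [basisVec_apply, hgf]
    · funext i
      change (∑ j, c j • basisVec (g j)) (g i) = c i
      simp only [PiLp.smul_apply, WithLp.ofLp_sum, Finset.sum_apply, basisVec_apply, hg.eq_iff,
        smul_eq_mul, mul_ite, mul_one, mul_zero, Finset.sum_ite_eq, Finset.mem_univ, if_true]
  rw [(LinearEquiv.ofBijective L ⟨hinj, hsurj⟩).finrank_eq]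
  simp

theorem finrank_eigenspace_dancEnd_one :
    Module.finrank ℝ (Module.End.eigenspace (dancEnd : E4 →ₗ[ℝ] E4) 1) = 2 := by
  refine finrank_eq_two_of_coord (Fin.natAdd 2) (Fin.castAdd 2) ?_ (by decide) (by decide)
    mem_eigenspace_dancEnd_one
  intro v h1 h2
  ext i
  have a0 := h1 0
  have a1 := h1 1
  have b0 := h2 0
  have b1 := h2 1
  fin_cases i <;> assumption

theorem finrank_eigenspace_dancEnd_neg_one :
    Module.finrank ℝ (Module.End.eigenspace (dancEnd : E4 →ₗ[ℝ] E4) (-1)) = 2 := by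
  refine finrank_eq_two_of_coord (Fin.castAdd 2) (Fin.natAdd 2) ?_ (by decide) (by decide)
    mem_eigenspace_dancEnd_neg_one
  intro v h1 h2
  ext i
  have a0 := h1 0
  have a1 := h1 1
  have b0 := h2 0
  have b1 := h2 1
  fin_cases i <;> assumption

/-- A distribution cut out by coordinate functions is involutive. -/
theorem isInvolutive_of_coord {D : ∀ q : dancingDomain, Submodule ℝ (TangentSpace 𝓘(ℝ, E4) q)}
    {κ : Type*} (f : κ → Fin 4) (hD : ∀ (q : dancingDomain) (v : E4), v ∈ D q ↔ ∀ i, v (f i) = 0) :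
    IsInvolutive D := by
  intro U X Y hU hX hY hD' p hp
  have hUp : U ∈ 𝓝 p := hU.mem_nhds hp
  refine (hD p _).2 fun i => ?_
  have h1 := dOne_eq_neg_mlieBracket (θ := formD fun _ => dcoord (f i)) (p := p) (X := X) (Y := Y)
    (smoothFormAt_formD contDiffAt_const) ((hX p hp).contMDiffAt hUp)
    ((hY p hp).contMDiffAt hUp) (by
      filter_upwards [hUp] with q hq
      exact ⟨(hD q _).1 (hD' q hq).1 i, (hD q _).1 (hD' q hq).2 i⟩)
  have h2 := dOne_formD (fun _ => dcoord (f i)) p (X p) (Y p)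
  have h3 : dVec (fun _ : E4 => dcoord (f i)) p (X p) (Y p) = 0 := by
    unfold dVec
    rw [fderiv_fun_const]
    exact sub_self _
  exact neg_eq_zero.1 (h1.symm.trans (h2.trans h3))

/-- The fundamental form `Σ αᵏ ∧ ᾱₖ` is closed, by the structure equations. -/
theorem dTwo_fundForm_danc (x : dancingDomain) (v₁ v₂ v₃ : E4) :
    dTwo (fundForm dancingMetric dancingK) x v₁ v₂ v₃ = 0 := by
  have hx := dancU_ne_zero x
  have hA : ∀ k, ContDiffAt ℝ ∞ (fun z => coordForm (dancAlpha k z)) x := by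
    intro k
    have hu : ∀ᶠ z in 𝓝 (x : E4), dancU z ≠ 0 := continuous_dancU.continuousAt.eventually_ne hx
    have h1 : ContDiffAt ℝ ∞ (fun z => dancForm z (dancB k)) x :=
      (contDiffAt_dancForm hx).clm_apply contDiffAt_const
    refine h1.congr_of_eventuallyEq ?_
    filter_upwards [hu] with z hz
    exact (dancForm_dancB hz k).symm
  have h := dTwo_sum_wedge (ρ := fundForm dancingMetric dancingK) (p := x)
    (α := fun k : Fin 2 => formD fun z => coordForm (dancAlpha k z))
    (β := fun k => formD fun _ => coordForm (dancAlphaBar k))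
    (fun k => smoothFormAt_formD (hA k)) (fun k => smoothFormAt_formD contDiffAt_const)
    (Filter.Eventually.of_forall fun q v w => dancForm_dancEnd (dancU_ne_zero q) v w) v₁ v₂ v₃
  refine h.trans ?_
  have e1 : ∀ (k : Fin 2) (v w : E4), dOne (formD fun z => coordForm (dancAlpha k z)) x v w = _ :=
    fun k v w => (dOne_formD _ x v w).trans (dVec_dancAlpha hx k v w)
  have e2 : ∀ (k : Fin 2) (v w : E4), dOne (formD fun _ => coordForm (dancAlphaBar k)) x v w = _ :=
    fun k v w => (dOne_formD _ x v w).trans (dVec_dancAlphaBar x k v w)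
  have f1 : ∀ (k : Fin 2) (v : E4), formD (fun z => coordForm (dancAlpha k z)) x v
    = coordForm (dancAlpha k x) v := fun _ _ => rfl
  have f2 : ∀ (k : Fin 2) (v : E4), formD (fun _ => coordForm (dancAlphaBar k)) x v
    = coordForm (dancAlphaBar k) v := fun _ _ => rfl
  simp only [e1, e2, f1, f2, Fin.sum_univ_two]
  ring

/-- `Ric = -3 g` for the dancing metric, as the trace of the model curvature. -/
theorem ricciCoord_danc {G : E4 → E4 →L[ℝ] E4 →L[ℝ] ℝ} {p : E4} (hp : dancU p ≠ 0)
    (hG : G =ᶠ[𝓝 p] dancForm) (a c : Fin 4) : ricciCoord G p a c = -3 * gram G p a c := by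
  obtain ⟨hs, hm⟩ := danc_curvature hp hG
  have h0 : (gram G p).det ≠ 0 := gram_det_ne_zero fun v hv => by
    rw [hs.expand v]
    simp [hs.symm _ v, hv]
  have h1 := ricciCoord_sum ((contDiffAt_dancForm hp).congr_of_eventuallyEq hG) h0 hs.expand
    (basisVec a) (basisVec c)
  simp only [← curvTri_apply] at h1
  rw [hs.ricci_of_model hm] at h1
  simpa [basisVec_apply, gram] using h1

theorem scalarCoord_danc {G : E4 → E4 →L[ℝ] E4 →L[ℝ] ℝ} {p : E4} (hp : dancU p ≠ 0)
    (hG : G =ᶠ[𝓝 p] dancForm) : scalarCoord G p = -12 := by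
  obtain ⟨hs, -⟩ := danc_curvature hp hG
  have h0 : (gram G p).det ≠ 0 := gram_det_ne_zero fun v hv => by
    rw [hs.expand v]
    simp [hs.symm _ v, hv]
  have h1 : ∀ a, ∑ b, (gram G p)⁻¹ a b * gram G p b a = 1 := by
    intro a
    have := congrFun (congrFun (Matrix.nonsing_inv_mul (gram G p) h0.isUnit) a) a
    rwa [Matrix.mul_apply, Matrix.one_apply_eq] at this
  have h2 : ∀ a b, (gram G p)⁻¹ a b * ricciCoord G p a b
      = -3 * ((gram G p)⁻¹ a b * gram G p b a) := by
    intro a b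
    rw [ricciCoord_danc hp hG, gram_symm hs.symm a b]
    ring
  unfold scalarCoord
  simp only [h2, ← Finset.mul_sum, h1]
  norm_num

theorem bilinInChart_danc_eventuallyEq (x : dancingDomain) :
    bilinInChart dancingMetric x =ᶠ[𝓝 (x : E4)] dancForm := by
  have h := extChartAt_target_mem_nhds (I := 𝓘(ℝ, E4)) x
  rw [extChartAt_danc_self] at h
  filter_upwards [h] with y hy
  ext v w
  rw [bilinInChart_danc _ _ hy]
  exact congrArg (fun z => dancForm z v w) (extChartAt_danc_symm x hy)

/-- The dancing metric is para-Kähler-Einstein. -/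
theorem isParaKahlerEinstein_dancing : IsParaKahlerEinstein dancingMetric dancingK where
  smooth_metric := smooth_dancingMetric
  smooth_end := fun ξ => by
    refine contMDiffAt_tangent_danc (contMDiff_proj (TangentSpace 𝓘(ℝ, E4))).contMDiffAt ?_
    exact dancEnd.contDiff.contMDiff.contMDiffAt.comp ξ (contMDiffAt_snd_danc ξ)
  symm x v w := dancForm_symm x v w
  nondegenerate x v hv := by
    have hs := (danc_curvature (dancU_ne_zero x) (Filter.EventuallyEq.refl _ _)).1
    have h := hs.expand v
    have hv' : ∀ w : E4, dancForm x w v = 0 := fun w => (hs.symm w v).trans (hv w)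
    simp only [hv', zero_smul, Finset.sum_const_zero, add_zero] at h
    exact h
  sq_eq_id x v := dancEnd_dancEnd v
  rank_plus _ := finrank_eigenspace_dancEnd_one
  rank_minus _ := finrank_eigenspace_dancEnd_neg_one
  compatible x v w := dancForm_dancEnd_dancEnd x v w
  involutive_plus := isInvolutive_of_coord (fun i : Fin 2 => (Fin.natAdd 2 i : Fin 4))
    fun _ => mem_eigenspace_dancEnd_one
  involutive_minus := isInvolutive_of_coord (fun i : Fin 2 => (Fin.castAdd 2 i : Fin 4))
    fun _ => mem_eigenspace_dancEnd_neg_one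
  closed := dTwo_fundForm_danc
  einstein x v w := by
    have hx := dancU_ne_zero x
    have hG := bilinInChart_danc_eventuallyEq x
    have h1 : scalarCurv dancingMetric x = -12 := by
      unfold scalarCurv
      rw [extChartAt_danc_self]
      exact scalarCoord_danc hx hG
    have h2 : ricci dancingMetric x v w = -3 * dancForm x v w := by
      unfold ricci
      rw [extChartAt_danc_self]
      simp only [ricciCoord_danc hx hG]
      have hGx : bilinInChart dancingMetric x (x : E4) = dancForm x := hG.self_of_nhds
      have h3 := bilin_eq_gram (G := bilinInChart dancingMetric x) (y := x) v w
      rw [hGx] at h3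
      rw [h3, Finset.mul_sum]
      refine Finset.sum_congr rfl fun a _ => ?_
      rw [Finset.mul_sum]
      refine Finset.sum_congr rfl fun b _ => ?_
      have e1 : tcoord v a = (show E4 from v) a := rfl
      have e2 : tcoord w b = (show E4 from w) b := rfl
      rw [e1, e2]
      ring
    rw [h1, h2]
    change _ = (1 / 4) * (-12) * dancForm x v w
    ring

/-! ### Structures locally equivalent to the dancing metric are flat -/

/-- The model curvature is expressed by the same formula in every split frame adapted to the
projection `P` onto the span of the `eᵢ`. -/
theorem IsSplitCurvature.coeff_of_model {R : E4 →ₗ[ℝ] E4 →ₗ[ℝ] E4 →ₗ[ℝ] E4}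
    {B : E4 →L[ℝ] E4 →L[ℝ] ℝ} {e b e' b' : Fin 2 → E4} (h : IsSplitCurvature R B e b)
    (hm : Model R B e b) {P : E4 →L[ℝ] E4} (hPe : ∀ i, P (e i) = e i) (hPb : ∀ i, P (b i) = 0)
    (hPe' : ∀ i, P (e' i) = e' i) (hPb' : ∀ i, P (b' i) = 0)
    (hbe' : ∀ i j, B (b' i) (e' j) = if i = j then 1 else 0)
    (hexp : ∀ v, v = (∑ i, B (b' i) v • e' i) + ∑ i, B (e' i) v • b' i)
    {u v : E4} {j : Fin 2} {c : Fin 2 → ℝ} (hc : R u v (e' j) = ∑ i, c i • e' i) (i : Fin 2) :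
    c i = - (B (b' i) u * B (e' j) v - B (b' i) v * B (e' j) u)
      - if i = j then ∑ m, (B (b' m) u * B (e' m) v - B (b' m) v * B (e' m) u) else 0 := by
  have hP : ∀ w, P w = ∑ i, B (b' i) w • e' i := by
    intro w
    conv_lhs => rw [hexp w]
    simp [hPe', hPb']
  have h1 := h.R_of_model hm hPe hPb u v (e' j)
  rw [hPe'] at h1
  have h2 := congrArg (B (b' i)) (hc.symm.trans h1)
  have h3 : ∀ w, B (b' i) (P w) = B (b' i) w := by
    intro w
    rw [hP]
    simp only [map_sum, map_smul, smul_eq_mul, hbe', mul_ite, mul_one, mul_zero,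
      Finset.sum_ite_eq, Finset.mem_univ, if_true]
  have h4 : ∀ w z, B (P w) z = ∑ m, B (b' m) w * B (e' m) z := by
    intro w z
    rw [hP]
    simp
  simp only [map_sub, map_smul, map_neg, map_sum, smul_eq_mul, hbe', h3, h4, mul_ite, mul_one,
    mul_zero, Finset.sum_ite_eq, Finset.mem_univ, if_true] at h2
  rw [h2]
  simp only [Finset.sum_sub_distrib]
  split_ifs
  · simp only [Fin.sum_univ_two]
    ring
  · ring

/-- The projection onto the `+1` eigenspace of the para-complex structure of the dancing
metric. -/
def dancProj : E4 →L[ℝ] E4 := (1 / 2 : ℝ) • (ContinuousLinearMap.id ℝ E4 + dancEnd)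

theorem dancProj_of_pos {v : E4} (h : dancEnd v = v) : dancProj v = v := by
  simp only [dancProj, smul_apply, add_apply, ContinuousLinearMap.id_apply, h]
  rw [← two_smul ℝ v, smul_smul]; norm_num

theorem dancProj_of_neg {v : E4} (h : dancEnd v = -v) : dancProj v = 0 := by
  simp [dancProj, h]

theorem dancProj_dancE (p : E4) (i : Fin 2) : dancProj (dancE i p) = dancE i p := by
  refine dancProj_of_pos ?_
  ext k
  fin_cases i <;> fin_cases k <;> simp [dancEnd_apply, dancE]

theorem dancProj_dancB (i : Fin 2) : dancProj (dancB i) = 0 := by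
  refine dancProj_of_neg ?_
  ext k
  fin_cases i <;> fin_cases k <;> simp [dancEnd_apply, dancB]

section LocalModel

variable {M : Type u} [TopologicalSpace M] [ChartedSpace E4 M] [IsManifold 𝓘(ℝ, E4) ∞ M]
  {g : BilinField M} {K : EndField M}

/-- A local map into `ℝ⁴` that pulls the dancing structure back to `(g, K)`. -/
structure IsDancingMapAt (g : BilinField M) (K : EndField M) (Φ : M → E4) (x : M) : Prop where
  smooth : ContMDiffAt 𝓘(ℝ, E4) 𝓘(ℝ, E4) ∞ Φ x
  ne_zero : dancU (Φ x) ≠ 0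
  metric : ∀ v w : TangentSpace 𝓘(ℝ, E4) x,
    g x v w = dancForm (Φ x) (vecDeriv Φ x v) (vecDeriv Φ x w)
  para : ∀ v : TangentSpace 𝓘(ℝ, E4) x, vecDeriv Φ x (K x v) = dancEnd (vecDeriv Φ x v)

/-- The differential of a map into the domain of the dancing metric is that of the underlying map
into `ℝ⁴`. -/
theorem vecDeriv_comp_val {φ : M → dancingDomain} {y : M}
    (hs : MDifferentiableAt 𝓘(ℝ, E4) 𝓘(ℝ, E4) φ y) (v : TangentSpace 𝓘(ℝ, E4) y) :
    vecDeriv (fun y => (φ y : E4)) y v = mfderiv 𝓘(ℝ, E4) 𝓘(ℝ, E4) φ y v := by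
  have hval : MDifferentiableAt 𝓘(ℝ, E4) 𝓘(ℝ, E4) (Subtype.val : dancingDomain → E4) (φ y) :=
    (contMDiff_subtype_val (n := ∞)).contMDiffAt.mdifferentiableAt (by simp)
  have h3 := mfderiv_comp y hval hs
  have h4 := vecDeriv_extChartAt_danc (φ y) (φ y) (mfderiv 𝓘(ℝ, E4) 𝓘(ℝ, E4) φ y v)
  rw [coe_extChartAt_danc] at h4
  exact (DFunLike.congr_fun h3 v).trans h4

theorem IsLocallyEquivalent.exists_isDancingMapAt
    (h : IsLocallyEquivalent g K dancingMetric dancingK) (x : M) :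
    ∃ Φ : M → E4, ∀ᶠ y in 𝓝 x, IsDancingMapAt g K Φ y := by
  obtain ⟨φ, hx, h1, -, h2⟩ := h x
  refine ⟨fun y => φ y, ?_⟩
  filter_upwards [φ.open_source.mem_nhds hx] with y hy
  have hs : ContMDiffAt 𝓘(ℝ, E4) 𝓘(ℝ, E4) ∞ φ y :=
    (h1 y hy).contMDiffAt (φ.open_source.mem_nhds hy)
  have hd := vecDeriv_comp_val (hs.mdifferentiableAt (by simp))
  obtain ⟨h3, h4⟩ := h2 y hy
  refine ⟨contMDiff_subtype_val.contMDiffAt.comp y hs, dancU_ne_zero _, fun v w => ?_, fun v => ?_⟩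
  · rw [hd, hd]
    exact (h3 v w).symm
  · rw [hd, hd]
    exact h4 v

variable {𝒢 : CartanGeometry M} {fr : ∀ p : 𝒢.P, AdaptedFrame g K (𝒢.proj p)}

/-- A local isometry with the dancing metric carries the curvature form to that of the model. -/
theorem isFlat_of_isLocallyEquivalent (h : IsFrameGeometry 𝒢 fr)
    (hl : IsLocallyEquivalent g K dancingMetric dancingK) : 𝒢.IsFlat := by
  rw [isFlat_iff_curvForm h]
  intro p ξ η i j
  obtain ⟨Φ, hΦ⟩ := hl.exists_isDancingMapAt (𝒢.proj p)
  have h0 := hΦ.self_of_nhds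
  have hR := (curvOp_frame h p (Φ := Φ) (G := dancForm) (hΦ.mono fun y hy => hy.smooth)
    (contDiffAt_dancForm h0.ne_zero)
    (Filter.Eventually.of_forall fun y u v => dancForm_symm y u v)
    (hΦ.mono fun y hy => hy.metric) j ξ η).1
  rw [← curvTri_apply] at hR
  obtain ⟨hs, hm⟩ := danc_curvature h0.ne_zero (Filter.EventuallyEq.refl _ _)
  let D : E4 →L[ℝ] E4 := vecDeriv Φ (𝒢.proj p)
  have hD : ∀ v w : E4, dancForm (Φ (𝒢.proj p)) (D v) (D w) = bilinAt g (𝒢.proj p) v w :=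
    fun v w => (h0.metric v w).symm
  let e' : Fin 2 → E4 := fun i => D ((fr p).eVec i)
  let b' : Fin 2 → E4 := fun i => D ((fr p).bVec i)
  have hee : ∀ i j, dancForm (Φ (𝒢.proj p)) (e' i) (e' j) = 0 := fun i j =>
    (hD _ _).trans ((fr p).g_e_e i j)
  have hbb : ∀ i j, dancForm (Φ (𝒢.proj p)) (b' i) (b' j) = 0 := fun i j =>
    (hD _ _).trans ((fr p).g_ebar_ebar i j)
  have heb : ∀ i j, dancForm (Φ (𝒢.proj p)) (e' i) (b' j) = if i = j then 1 else 0 := fun i j =>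
    (hD _ _).trans ((fr p).g_e_ebar i j)
  have hbe : ∀ i j, dancForm (Φ (𝒢.proj p)) (b' i) (e' j) = if i = j then 1 else 0 := fun i j =>
    (hD _ _).trans ((fr p).g_ebar_e i j)
  have hPe : ∀ i, dancProj (e' i) = e' i := fun i => dancProj_of_pos
    ((h0.para ((fr p).e i)).symm.trans (congrArg D ((fr p).K_e i)))
  have hPb : ∀ i, dancProj (b' i) = 0 := fun i => dancProj_of_neg
    ((h0.para ((fr p).ebar i)).symm.trans ((congrArg D ((fr p).K_ebar i)).trans (map_neg D _)))
  -- the image of the adapted frame is a second adapted frame of the dancing metric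
  have key := hs.coeff_of_model hm (dancProj_dancE _) dancProj_dancB hPe hPb hbe
    (split_frame_expand hs.symm hee hbb heb) (u := D (dproj 𝒢 p ξ)) (v := D (dproj 𝒢 p η)) (j := j)
    (c := fun i => curvForm 𝒢 p i j ξ η) hR i
  refine key.trans ?_
  have t1 : ∀ k (ζ : TangentSpace 𝓘(ℝ, E8) p), dancForm (Φ (𝒢.proj p)) (b' k) (D (dproj 𝒢 p ζ))
      = tautForm 𝒢 fr k p ζ := fun k ζ => hD _ _
  have t2 : ∀ k (ζ : TangentSpace 𝓘(ℝ, E8) p), dancForm (Φ (𝒢.proj p)) (e' k) (D (dproj 𝒢 p ζ))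
      = tautFormBar 𝒢 fr k p ζ := fun k ζ => hD _ _
  simp only [t1, t2, wedgeTaut]

end LocalModel

/-! ### Parallel sections of flat connections -/

section Frobenius

variable {E F : Type*} [NormedAddCommGroup E] [NormedSpace ℝ E] [NormedAddCommGroup F]
  [NormedSpace ℝ F]

/-- First-order Taylor expansion, uniform in the base point. -/
theorem exists_uniform_taylor {G : E → F} {p₀ : E} (hG : ContDiffAt ℝ 2 G p₀) :
    ∃ C r : ℝ, 0 ≤ C ∧ 0 < r ∧ ∀ p ∈ Metric.ball p₀ r, ∀ q ∈ Metric.ball p₀ r,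
      ‖G q - G p‖ ≤ C * ‖q - p‖ ∧ ‖G q - G p - fderiv ℝ G p (q - p)‖ ≤ C * ‖q - p‖ ^ 2 := by
  obtain ⟨K1, t1, ht1, hK1⟩ := (hG.of_le one_le_two).exists_lipschitzOnWith
  obtain ⟨K2, t2, ht2, hK2⟩ :=
    (hG.fderiv_right (m := 1) (by norm_num)).exists_lipschitzOnWith
  have ht3 : ∀ᶠ p in 𝓝 p₀, ContDiffAt ℝ 2 G p := hG.eventually (by simp)
  obtain ⟨r, hr, hsub⟩ := Metric.mem_nhds_iff.1 (Filter.inter_mem (Filter.inter_mem ht1 ht2) ht3)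
  refine ⟨max K1 K2, r, le_max_of_le_left K1.2, hr, fun p hp q hq => ⟨?_, ?_⟩⟩
  · have h := hK1.dist_le_mul q (hsub hq).1.1 p (hsub hp).1.1
    rw [dist_eq_norm, dist_eq_norm] at h
    exact h.trans (mul_le_mul_of_nonneg_right (le_max_left _ _) (norm_nonneg _))
  · have hseg : segment ℝ p q ⊆ Metric.ball p₀ r := (convex_ball p₀ r).segment_subset hp hq
    have h := (convex_segment p q).norm_image_sub_le_of_norm_hasFDerivWithin_le' (f := G)
      (f' := fderiv ℝ G) (φ := fderiv ℝ G p) (C := K2 * ‖q - p‖)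
      (fun z hz => by
        have hz' : ContDiffAt ℝ 2 G z := (hsub (hseg hz)).2
        exact (hz'.differentiableAt two_ne_zero).hasFDerivAt.hasFDerivWithinAt)
      (fun z hz => by
        have h := hK2.dist_le_mul z (hsub (hseg hz)).1.2 p (hsub hp).1.2
        rw [dist_eq_norm, dist_eq_norm] at h
        exact h.trans (mul_le_mul_of_nonneg_left (norm_sub_le_of_mem_segment hz) K2.2))
      (left_mem_segment ℝ p q) (right_mem_segment ℝ p q)
    refine h.trans ?_
    rw [mul_assoc, ← sq]
    exact mul_le_mul_of_nonneg_right (le_max_right _ _) (sq_nonneg _)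

/-- Grönwall's inequality on `[0, 1]` for `‖f'‖ ≤ ‖f‖ + ε`, with `e` replaced by `3`. -/
theorem norm_le_of_deriv_le {f f' : ℝ → F} {δ ε : ℝ} (hε : 0 ≤ ε)
    (hf : ∀ t ∈ Set.Icc (0 : ℝ) 1, HasDerivWithinAt f (f' t) (Set.Icc 0 1) t) (h0 : ‖f 0‖ ≤ δ)
    (hb : ∀ t ∈ Set.Icc (0 : ℝ) 1, ‖f' t‖ ≤ ‖f t‖ + ε) :
    ∀ t ∈ Set.Icc (0 : ℝ) 1, ‖f t‖ ≤ 3 * δ + 2 * ε := by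
  intro t ht
  have h := norm_le_gronwallBound_of_norm_deriv_right_le (K := 1) (ε := ε)
    (fun t ht => (hf t ht).continuousWithinAt)
    (fun t ht => (hf t ⟨ht.1, ht.2.le⟩).mono_of_mem_nhdsWithin (Icc_mem_nhdsGE_of_mem ht)) h0
    (fun t ht => by rw [one_mul]; exact hb t ⟨ht.1, ht.2.le⟩) t ht
  simp only [gronwallBound_of_K_ne_0 one_ne_zero, one_mul, sub_zero, div_one] at h
  have he : Real.exp t ≤ 3 :=
    (Real.exp_le_exp.2 ht.2).trans (Real.exp_one_lt_d9.le.trans (by norm_num))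
  have hδ : 0 ≤ δ := (norm_nonneg _).trans h0
  nlinarith [mul_le_mul_of_nonneg_left he hδ, mul_le_mul_of_nonneg_left he hε]

/-- The derivative of the coefficient `(x, h) ↦ L x h` of the transport equation along rays. -/
theorem fderiv_pairing {W : Type*} [NormedAddCommGroup W] [NormedSpace ℝ W] {L : E → E →L[ℝ] W}
    {u : E} (hL : DifferentiableAt ℝ L u) (v a b : E) :
    fderiv ℝ (fun p : E × E => L p.1 p.2) (u, v) (a, b) = fderiv ℝ L u a v + L u b := by
  have h1 : HasFDerivAt (fun p : E × E => L p.1)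
      ((fderiv ℝ L u).comp (ContinuousLinearMap.fst ℝ E E)) (u, v) :=
    HasFDerivAt.comp (g := L) (f := fun p : E × E => p.1) (x := (u, v))
      (f' := ContinuousLinearMap.fst ℝ E E) hL.hasFDerivAt hasFDerivAt_fst
  have h2 : HasFDerivAt (fun p : E × E => p.2) (ContinuousLinearMap.snd ℝ E E) (u, v) :=
    hasFDerivAt_snd
  rw [(h1.clm_apply h2).fderiv]
  simp [add_comm]

/-- The derivative of the expected variation of parallel transport along rays. -/
theorem hasDerivWithinAt_variation {L : E → E →L[ℝ] F →L[ℝ] F} {x h : E} {t : ℝ} {y : ℝ → F}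
    (hL : DifferentiableAt ℝ L (t • x))
    (hy : HasDerivWithinAt y (L (t • x) x (y t)) (Set.Icc 0 1) t)
    (hflat : ∀ u v s, fderiv ℝ L (t • x) u v s + L (t • x) v (L (t • x) u s)
      = fderiv ℝ L (t • x) v u s + L (t • x) u (L (t • x) v s)) :
    HasDerivWithinAt (fun t => t • L (t • x) h (y t))
      (t • (fderiv ℝ L (t • x) h x (y t) + L (t • x) x (L (t • x) h (y t)))
        + L (t • x) h (y t)) (Set.Icc 0 1) t := by
  have h5 : HasDerivAt (fun t : ℝ => t • x) x t := by
    simpa using (hasDerivAt_id t).smul_const x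
  have h6 : HasDerivWithinAt (fun t : ℝ => L (t • x)) (fderiv ℝ L (t • x) x) (Set.Icc 0 1) t :=
    (HasFDerivAt.comp_hasDerivAt (l := L) (f := fun t : ℝ => t • x) t hL.hasFDerivAt
      h5).hasDerivWithinAt
  have h7 : HasDerivWithinAt (fun t : ℝ => L (t • x) h) (fderiv ℝ L (t • x) x h)
      (Set.Icc 0 1) t := by
    simpa using h6.clm_apply (hasDerivWithinAt_const t _ h)
  have h8 := (hasDerivWithinAt_id t (Set.Icc 0 1)).smul (h7.clm_apply hy)
  refine h8.congr_deriv ?_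
  rw [hflat x h (y t), one_smul, id_eq]

/-- Splitting of the derivative of the error `y' - y - t A y` in the variation of parallel transport
along rays: a term linear in the error, and two terms that are quadratically small in the variation
of the direction. The endomorphisms `P`, `Q` are the coefficients along the two rays and `D' + A` is
the first-order variation of `P - Q`. -/
theorem variation_identity (P Q : F →L[ℝ] F) (D A : F →L[ℝ] F) (D' : F →L[ℝ] F) (y' y : F) (t : ℝ)
    (hD : D' = t • D) :
    P y' - Q y - (t • (D y + Q (A y)) + A y)
      = Q (y' - y - t • A y) + ((P - Q) (y' - y) + (P - Q - (D' + A)) y) := by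
  subst hD
  simp only [map_sub, map_smul, sub_apply, add_apply, smul_apply, smul_add]
  abel

variable [CompleteSpace F]

/-- Linear differential equations on `[0, 1]`. With the coefficient bounded by `1 / 4`, a single
application of the Picard–Lindelöf theorem on the ball of radius `1 + ‖s‖` covers the whole
interval. -/
theorem exists_linear_ode {a : ℝ → F →L[ℝ] F} (ha : ContinuousOn a (Set.Icc 0 1))
    (hb : ∀ t ∈ Set.Icc (0 : ℝ) 1, ‖a t‖ ≤ 1 / 4) (s : F) :
    ∃ y : ℝ → F, y 0 = s ∧
      ∀ t ∈ Set.Icc (0 : ℝ) 1, HasDerivWithinAt y (a t (y t)) (Set.Icc 0 1) t := by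
  let R : NNReal := 1 + ‖s‖₊
  have hR : (R : ℝ) = 1 + ‖s‖ := by simp [R]
  have hn : ∀ z ∈ Metric.closedBall s R, ‖z‖ ≤ 1 + 2 * ‖s‖ := by
    intro z hz
    rw [mem_closedBall_iff_norm, hR] at hz
    have := norm_le_norm_add_norm_sub' z s
    linarith
  have h : IsPicardLindelof (fun t z => a t z) (tmin := 0) (tmax := 1) ⟨0, by simp⟩ s R 0 R 1 :=
    { lipschitzOnWith := fun t ht => by
        refine ((a t).lipschitz.weaken ?_).lipschitzOnWith
        have : ‖a t‖ ≤ 1 := (hb t ht).trans (by norm_num)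
        exact_mod_cast this
      continuousOn := fun z _ => ha.clm_apply continuousOn_const
      norm_le := fun t ht z hz => by
        rw [hR]
        have h1 := (a t).le_opNorm z
        have h2 := mul_le_mul (hb t ht) (hn z hz) (norm_nonneg _) (by norm_num)
        have h3 := norm_nonneg s
        linarith
      mul_max_le := by simp }
  obtain ⟨y, h0, hy⟩ := h.exists_eq_forall_mem_Icc_hasDerivWithinAt₀
  exact ⟨y, h0, hy⟩

variable {L : E → E →L[ℝ] F →L[ℝ] F}

/-- Parallel transport along the rays from the origin defines a parallel section of a flat
connection. The variation of the transport with the ray is estimated directly; flatness identifies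
its first-order part. -/
theorem exists_parallel_zero (hL : ∀ᶠ x in 𝓝 (0 : E), ContDiffAt ℝ 2 L x)
    (hflat : ∀ᶠ x in 𝓝 (0 : E), ∀ u v s, fderiv ℝ L x u v s + L x v (L x u s)
      = fderiv ℝ L x v u s + L x u (L x v s)) (s : F) :
    ∃ S : E → F, S 0 = s ∧ ∀ᶠ x in 𝓝 (0 : E), HasFDerivAt S ((L x).flip (S x)) x := by
  let G : E × E → F →L[ℝ] F := fun p => L p.1 p.2
  have hG : ContDiffAt ℝ 2 G (0, 0) := by
    have h1 : ContDiffAt ℝ 2 (fun p : E × E => L p.1) (0, 0) :=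
      ContDiffAt.comp (g := L) (f := Prod.fst) (0, 0) hL.self_of_nhds contDiffAt_fst
    exact h1.clm_apply contDiffAt_snd
  obtain ⟨C, r₁, hC, hr₁, hT⟩ := exists_uniform_taylor hG
  have hG0 : ∀ᶠ p in 𝓝 ((0, 0) : E × E), ‖G p‖ < 1 / 4 := by
    have h1 : Filter.Tendsto (fun p => ‖G p‖) (𝓝 (0, 0)) (𝓝 ‖G (0, 0)‖) := hG.continuousAt.norm
    refine h1.eventually (gt_mem_nhds ?_)
    simp [G]
  obtain ⟨r₂, hr₂, hG0⟩ := Metric.eventually_nhds_iff_ball.1 hG0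
  obtain ⟨r₃, hr₃, hLf⟩ := Metric.eventually_nhds_iff_ball.1 (hL.and hflat)
  let r := min r₁ (min r₂ r₃)
  have hr : 0 < r := lt_min hr₁ (lt_min hr₂ hr₃)
  have hball : ∀ x ∈ Metric.ball (0 : E) r, ∀ t ∈ Set.Icc (0 : ℝ) 1,
      (t • x ∈ Metric.ball (0 : E) r) ∧ ((t • x, x) ∈ Metric.ball ((0, 0) : E × E) r) := by
    intro x hx t ht
    rw [mem_ball_zero_iff] at hx
    have h1 : ‖t • x‖ < r := by
      rw [norm_smul, Real.norm_of_nonneg ht.1]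
      exact (mul_le_of_le_one_left (norm_nonneg x) ht.2).trans_lt hx
    refine ⟨mem_ball_zero_iff.2 h1, ?_⟩
    have h2 : ((0, 0) : E × E) = 0 := rfl
    rw [h2, mem_ball_zero_iff, Prod.norm_def]
    exact max_lt h1 hx
  have hLd : ∀ x ∈ Metric.ball (0 : E) r, ContDiffAt ℝ 2 L x := fun x hx =>
    (hLf x (Metric.ball_subset_ball ((min_le_right _ _).trans (min_le_right _ _)) hx)).1
  have hfl : ∀ x ∈ Metric.ball (0 : E) r, _ := fun x hx =>
    (hLf x (Metric.ball_subset_ball ((min_le_right _ _).trans (min_le_right _ _)) hx)).2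
  have hTr : ∀ p ∈ Metric.ball ((0, 0) : E × E) r, ∀ q ∈ Metric.ball ((0, 0) : E × E) r, _ :=
    fun p hp q hq => hT p (Metric.ball_subset_ball (min_le_left _ _) hp) q
      (Metric.ball_subset_ball (min_le_left _ _) hq)
  have hGs : ∀ p ∈ Metric.ball ((0, 0) : E × E) r, ‖G p‖ ≤ 1 / 4 := fun p hp =>
    (hG0 p (Metric.ball_subset_ball ((min_le_right _ _).trans (min_le_left _ _)) hp)).le
  have hode : ∀ x : E, ∃ y : ℝ → F, x ∈ Metric.ball (0 : E) r → y 0 = s ∧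
      ∀ t ∈ Set.Icc (0 : ℝ) 1, HasDerivWithinAt y (G (t • x, x) (y t)) (Set.Icc 0 1) t := by
    intro x
    by_cases hx : x ∈ Metric.ball (0 : E) r
    · obtain ⟨y, hy⟩ := exists_linear_ode (a := fun t => G (t • x, x)) (fun t ht => by
        have h1 : ContinuousAt L (t • x) := (hLd _ (hball x hx t ht).1).continuousAt
        have h2 : ContinuousAt (fun t : ℝ => L (t • x)) t :=
          ContinuousAt.comp (g := L) (f := fun t : ℝ => t • x) h1
            (continuous_id.smul continuous_const).continuousAt
        exact (h2.clm_apply continuousAt_const).continuousWithinAt)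
        (fun t ht => hGs _ (hball x hx t ht).2) s
      exact ⟨y, fun _ => hy⟩
    · exact ⟨0, fun h => absurd h hx⟩
  -- `Y x` solves the transport equation along the ray `t ↦ t x`
  choose Y hY using hode
  have hYb : ∀ x ∈ Metric.ball (0 : E) r, ∀ t ∈ Set.Icc (0 : ℝ) 1, ‖Y x t‖ ≤ 3 * ‖s‖ := by
    intro x hx t ht
    have h := norm_le_of_deriv_le (le_refl 0) (hY x hx).2 (by rw [(hY x hx).1]) (fun t ht => by
      have h1 := (G (t • x, x)).le_of_opNorm_le (hGs _ (hball x hx t ht).2) (Y x t)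
      have h2 := norm_nonneg (Y x t)
      linarith) t ht
    simpa using h
  refine ⟨fun x => Y x 1, ?_, ?_⟩
  · have h0 := Metric.mem_ball_self (x := (0 : E)) hr
    have h := norm_le_of_deriv_le (f := fun t => Y 0 t - s) (f' := fun _ => 0) (δ := 0) (le_refl 0)
      (fun t ht => by
        have h1 := ((hY 0 h0).2 t ht).sub_const s
        simpa [G] using h1) (by simp [(hY 0 h0).1]) (fun t _ => by simp) 1 (by simp)
    simpa [sub_eq_zero] using h
  · filter_upwards [Metric.ball_mem_nhds (0 : E) hr] with x hx
    -- the second-order estimate for the variation of the initial direction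
    have key : ∀ x' ∈ Metric.ball (0 : E) r,
        ‖Y x' 1 - Y x 1 - L x (x' - x) (Y x 1)‖
          ≤ 2 * ((C * (2 * (C * (3 * ‖s‖))) + C * (3 * ‖s‖)) * ‖x' - x‖ ^ 2) := by
      intro x' hx'
      have hpq : ∀ t ∈ Set.Icc (0 : ℝ) 1,
          ‖((t • x', x') : E × E) - (t • x, x)‖ ≤ ‖x' - x‖ := by
        intro t ht
        rw [Prod.mk_sub_mk, ← smul_sub, Prod.norm_def, norm_smul, Real.norm_of_nonneg ht.1]
        exact max_le (mul_le_of_le_one_left (norm_nonneg _) ht.2) le_rfl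
      have hGd : ∀ t ∈ Set.Icc (0 : ℝ) 1,
          ‖G (t • x', x') - G (t • x, x)‖ ≤ C * ‖x' - x‖ ∧
          ‖G (t • x', x') - G (t • x, x) - (fderiv ℝ L (t • x) (t • (x' - x)) x
            + L (t • x) (x' - x))‖ ≤ C * ‖x' - x‖ ^ 2 := by
        intro t ht
        obtain ⟨h1, h2⟩ := hTr _ (hball x hx t ht).2 _ (hball x' hx' t ht).2
        have h3 : fderiv ℝ G (t • x, x) ((t • x', x') - (t • x, x))
            = fderiv ℝ L (t • x) (t • (x' - x)) x + L (t • x) (x' - x) := by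
          rw [Prod.mk_sub_mk, ← smul_sub]
          exact fderiv_pairing ((hLd _ (hball x hx t ht).1).differentiableAt two_ne_zero) _ _ _
        rw [h3] at h2
        have h8 := pow_le_pow_left₀ (norm_nonneg _) (hpq t ht) 2
        exact ⟨h1.trans (mul_le_mul_of_nonneg_left (hpq t ht) hC),
          h2.trans (mul_le_mul_of_nonneg_left h8 hC)⟩
      -- the first-order estimate: transports along neighbouring rays are `O(‖x' - x‖)`-close
      have hd : ∀ t ∈ Set.Icc (0 : ℝ) 1,
          ‖Y x' t - Y x t‖ ≤ 2 * (C * ‖x' - x‖ * (3 * ‖s‖)) := by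
        intro t ht
        have h := norm_le_of_deriv_le (f := fun t => Y x' t - Y x t) (δ := 0)
          (ε := C * ‖x' - x‖ * (3 * ‖s‖)) (by positivity)
          (fun t ht => ((hY x' hx').2 t ht).sub ((hY x hx).2 t ht))
          (by simp [(hY x' hx').1, (hY x hx).1]) (fun t ht => by
            have e : G (t • x', x') (Y x' t) - G (t • x, x) (Y x t)
                = G (t • x', x') (Y x' t - Y x t)
                  + (G (t • x', x') - G (t • x, x)) (Y x t) := by
              rw [map_sub, sub_apply]; abel
            rw [e]
            have h1 := (G (t • x', x')).le_of_opNorm_le (hGs _ (hball x' hx' t ht).2)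
              (Y x' t - Y x t)
            have h2 := (G (t • x', x') - G (t • x, x)).le_of_opNorm_le_of_le (hGd t ht).1
              (hYb x hx t ht)
            have h3 := norm_nonneg (Y x' t - Y x t)
            exact (norm_add_le _ _).trans (add_le_add (h1.trans (by linarith)) h2)) t ht
        simpa using h
      -- Grönwall's inequality for the error of the linear approximation `t L(t x)(x' - x) Y`, whose
      -- derivative is computed with the flatness
      have hw := norm_le_of_deriv_le (f := fun t => Y x' t - Y x t
          - t • L (t • x) (x' - x) (Y x t)) (δ := 0)
        (f' := fun t => G (t • x, x) (Y x' t - Y x t - t • L (t • x) (x' - x) (Y x t))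
          + ((G (t • x', x') - G (t • x, x)) (Y x' t - Y x t)
          + (G (t • x', x') - G (t • x, x) - (fderiv ℝ L (t • x) (t • (x' - x)) x
            + L (t • x) (x' - x))) (Y x t)))
        (ε := (C * (2 * (C * (3 * ‖s‖))) + C * (3 * ‖s‖)) * ‖x' - x‖ ^ 2) (by positivity)
        (fun t ht => by
          have h8 := (((hY x' hx').2 t ht).sub ((hY x hx).2 t ht)).sub
            (hasDerivWithinAt_variation (h := x' - x)
              ((hLd _ (hball x hx t ht).1).differentiableAt two_ne_zero) ((hY x hx).2 t ht)
              (hfl _ (hball x hx t ht).1))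
          refine h8.congr_deriv (variation_identity (G (t • x', x')) (G (t • x, x)) _ _ _ _ _ _ ?_)
          rw [map_smul, smul_apply])
        (by simp [(hY x' hx').1, (hY x hx).1]) (fun t ht => by
          have h1 := (G (t • x, x)).le_of_opNorm_le (hGs _ (hball x hx t ht).2)
            (Y x' t - Y x t - t • L (t • x) (x' - x) (Y x t))
          have h2 := (G (t • x', x') - G (t • x, x)).le_of_opNorm_le_of_le (hGd t ht).1 (hd t ht)
          have h3 := (G (t • x', x') - G (t • x, x) - (fderiv ℝ L (t • x) (t • (x' - x)) x
            + L (t • x) (x' - x))).le_of_opNorm_le_of_le (hGd t ht).2 (hYb x hx t ht)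
          have h4 := norm_nonneg (Y x' t - Y x t - t • L (t • x) (x' - x) (Y x t))
          refine (norm_add_le _ _).trans (add_le_add (h1.trans (by linarith))
            ((norm_add_le _ _).trans ((add_le_add h2 h3).trans (le_of_eq ?_))))
          ring) 1 (by simp)
      simpa using hw
    have h2 : HasFDerivAt (fun x => Y x 1) ((L x).flip (Y x 1)) x := by
      rw [hasFDerivAt_iff_isLittleO]
      refine Asymptotics.IsBigO.trans_isLittleO ?_ (Asymptotics.isLittleO_pow_sub_sub x one_lt_two)
      refine Asymptotics.IsBigO.of_bound
        (2 * (C * (2 * (C * (3 * ‖s‖))) + C * (3 * ‖s‖))) ?_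
      filter_upwards [Metric.isOpen_ball.mem_nhds hx] with x' hx'
      have h := key x' hx'
      rw [norm_pow, norm_norm, mul_assoc]
      exact h
    exact h2

/-- A parallel section of a smooth connection is smooth: each order of differentiability gives the
next one through the equation `dS = L S`. -/
theorem contDiffOn_of_parallel [FiniteDimensional ℝ E] {U : Set E} (hU : IsOpen U) {S : E → F}
    (hL : ContDiffOn ℝ ∞ L U) (hS : ∀ x ∈ U, HasFDerivAt S ((L x).flip (S x)) x) :
    ContDiffOn ℝ ∞ S U := by
  rw [contDiffOn_infty]
  intro n
  have hd : DifferentiableOn ℝ S U := fun x hx => (hS x hx).differentiableAt.differentiableWithinAt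
  induction n with
  | zero => exact contDiffOn_zero.2 hd.continuousOn
  | succ n ih =>
    rw [Nat.cast_add, Nat.cast_one, contDiffOn_succ_iff_fderiv_of_isOpen hU]
    refine ⟨hd, by simp, ?_⟩
    rw [contDiffOn_clm_apply]
    intro h
    have h1 : ContDiffOn ℝ n (fun x => L x h (S x)) U :=
      ((contDiffOn_infty.1 hL n).clm_apply contDiffOn_const).clm_apply ih
    refine h1.congr fun x hx => ?_
    rw [(hS x hx).fderiv, ContinuousLinearMap.flip_apply]

/-- A flat linear connection on a trivial bundle has a parallel section through each vector. -/
theorem exists_parallel [FiniteDimensional ℝ E] {x₀ : E} (hL : ∀ᶠ x in 𝓝 x₀, ContDiffAt ℝ ∞ L x)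
    (hflat : ∀ᶠ x in 𝓝 x₀, ∀ u v s, fderiv ℝ L x u v s + L x v (L x u s)
      = fderiv ℝ L x v u s + L x u (L x v s)) (s : F) :
    ∃ S : E → F, S x₀ = s ∧
      ∀ᶠ x in 𝓝 x₀, ContDiffAt ℝ ∞ S x ∧ HasFDerivAt S ((L x).flip (S x)) x := by
  have ht : Filter.Tendsto (fun x : E => x + x₀) (𝓝 0) (𝓝 x₀) := by
    have h : ContinuousAt (fun x : E => x + x₀) 0 := by fun_prop
    simpa [ContinuousAt] using h
  have ht' : Filter.Tendsto (fun x : E => x - x₀) (𝓝 x₀) (𝓝 0) := by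
    have h : ContinuousAt (fun x : E => x - x₀) x₀ := by fun_prop
    simpa [ContinuousAt] using h
  have hf : ∀ x, fderiv ℝ (fun x => L (x + x₀)) x = fderiv ℝ L (x + x₀) := fun x =>
    fderiv_comp_add_right (𝕜 := ℝ) (f := L) x₀
  obtain ⟨S, hS0, hS⟩ := exists_parallel_zero (L := fun x => L (x + x₀))
    ((ht.eventually hL).mono fun x hx => by
      have h1 : ContDiffAt ℝ 2 L (x + x₀) := hx.of_le ENat.LEInfty.out
      exact h1.comp x (contDiffAt_id.add contDiffAt_const))
    ((ht.eventually hflat).mono fun x hx u v s => by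
      rw [hf]
      exact hx u v s) s
  have h1 : ∀ᶠ x in 𝓝 x₀, ContDiffAt ℝ ∞ L x ∧
      HasFDerivAt (fun x => S (x - x₀)) ((L x).flip (S (x - x₀))) x := by
    filter_upwards [hL, ht'.eventually hS] with x hx hSx
    refine ⟨hx, ?_⟩
    rw [sub_add_cancel] at hSx
    exact (hasFDerivAt_comp_sub x₀).2 hSx
  refine ⟨fun x => S (x - x₀), by simpa using hS0, ?_⟩
  obtain ⟨U, hU, hUo, hxU⟩ := eventually_nhds_iff.1 h1
  have h2 := contDiffOn_of_parallel hUo (fun x hx => (hU x hx).1.contDiffWithinAt)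
    (fun x hx => (hU x hx).2)
  filter_upwards [hUo.mem_nhds hxU] with x hx
  exact ⟨h2.contDiffAt (hUo.mem_nhds hx), (hU x hx).2⟩

end Frobenius

/-! ### Maurer–Cartan forms -/

section MaurerCartan

variable {E : Type*} [NormedAddCommGroup E] [NormedSpace ℝ E] [FiniteDimensional ℝ E]

/-- The flat connection `r ↦ dr - r A` on row vectors, for a matrix-valued form `A`. -/
def rowConn (A : Fin 3 → Fin 3 → E → E →L[ℝ] ℝ) (y : E) :
    E →L[ℝ] (Fin 3 → ℝ) →L[ℝ] (Fin 3 → ℝ) :=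
  ∑ k, ∑ j, (A k j y).smulRight
    ((ContinuousLinearMap.proj (R := ℝ) (φ := fun _ : Fin 3 => ℝ) k).smulRight
      (Pi.single j (1 : ℝ) : Fin 3 → ℝ))

theorem rowConn_apply (A : Fin 3 → Fin 3 → E → E →L[ℝ] ℝ) (y v : E) (r : Fin 3 → ℝ) (j : Fin 3) :
    rowConn A y v r j = ∑ k, A k j y v * r k := by
  simp [rowConn, sum_apply, Pi.single_apply]

variable {A : Fin 3 → Fin 3 → E → E →L[ℝ] ℝ} {y₀ : E}

theorem contDiffAt_rowConn {y : E} (hA : ∀ i j, ContDiffAt ℝ ∞ (A i j) y) :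
    ContDiffAt ℝ ∞ (rowConn A) y := by
  unfold rowConn
  exact ContDiffAt.sum fun k _ => ContDiffAt.sum fun j _ => (hA k j).smulRight contDiffAt_const

theorem fderiv_rowConn {y : E} (hA : ∀ i j, ContDiffAt ℝ ∞ (A i j) y) (u v : E) (r : Fin 3 → ℝ)
    (j : Fin 3) : fderiv ℝ (rowConn A) y u v r j = ∑ k, fderiv ℝ (A k j) y u v * r k := by
  have h1 : HasFDerivAt (rowConn A) _ y :=
    ((contDiffAt_rowConn hA).differentiableAt (by simp)).hasFDerivAt
  have h2 := ((h1.clm_apply (hasFDerivAt_const v y)).clm_apply (hasFDerivAt_const r y))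
  have h3 := (hasFDerivAt_pi'.1 h2 j)
  have h4 : HasFDerivAt (fun z => ∑ k, A k j z v * r k) _ y :=
    HasFDerivAt.fun_sum (u := Finset.univ) fun k _ =>
      ((((hA k j).differentiableAt (by simp)).hasFDerivAt.clm_apply
        (hasFDerivAt_const v y)).mul_const (r k))
  simp only [rowConn_apply] at h3
  have h5 := DFunLike.congr_fun (h3.unique h4) u
  simpa [mul_comm] using h5

/-- Locally, a matrix-valued form with `dA + A ∧ A = 0` is `S⁻¹ dS`. -/
theorem exists_maurerCartan (hA : ∀ᶠ y in 𝓝 y₀, ∀ i j, ContDiffAt ℝ ∞ (A i j) y)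
    (hflat : ∀ᶠ y in 𝓝 y₀, ∀ i j u v, dVec (A i j) y u v
      = -∑ k, (A i k y u * A k j y v - A i k y v * A k j y u)) (S₀ : Mat 3) :
    ∃ S : E → Mat 3, S y₀ = S₀ ∧ ∀ᶠ y in 𝓝 y₀, ∀ i j, ContDiffAt ℝ ∞ (fun z => S z i j) y ∧
      HasFDerivAt (fun z => S z i j) (∑ k, S y i k • A k j y) y := by
  have h1 : ∀ i, ∃ r : E → Fin 3 → ℝ, r y₀ = S₀ i ∧ ∀ᶠ y in 𝓝 y₀, ContDiffAt ℝ ∞ r y ∧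
      HasFDerivAt r ((rowConn A y).flip (r y)) y := by
    intro i
    -- each row of `S` is a parallel section of the flat connection on row vectors
    refine exists_parallel (hA.mono fun y hy => contDiffAt_rowConn hy) ?_ _
    filter_upwards [hA, hflat] with y hy hf u v r
    funext j
    simp only [Pi.add_apply, fderiv_rowConn hy, rowConn_apply]
    have h2 : ∀ k, fderiv ℝ (A k j) y u v = fderiv ℝ (A k j) y v u
        + -∑ l, (A k l y u * A l j y v - A k l y v * A l j y u) := by
      intro k
      rw [← hf k j u v, dVec]
      ring
    simp only [h2, Fin.sum_univ_three]
    ring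
  choose r hr0 hr using h1
  refine ⟨fun y i => r i y, funext hr0, ?_⟩
  filter_upwards [Filter.eventually_all.2 hr] with y hy i j
  refine ⟨contDiffAt_pi.1 (hy i).1 j, ?_⟩
  refine (hasFDerivAt_pi'.1 (hy i).2 j).congr_fderiv ?_
  ext v
  simp [rowConn_apply, mul_comm]

/-- If `dS = S A`, then `d(S⁻¹) = - A S⁻¹`. -/
theorem hasFDerivAt_maurerCartan_inv {S : E → Mat 3} {y : E} (h0 : (S y).det ≠ 0)
    (hc : ∀ i j, ContDiffAt ℝ ∞ (fun z => S z i j) y)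
    (hS : ∀ i j, HasFDerivAt (fun z => S z i j) (∑ k, S y i k • A k j y) y) (i j : Fin 3) :
    HasFDerivAt (fun z => (S z)⁻¹ i j) (-∑ k, (S y)⁻¹ k j • A i k y) y := by
  have hd : ∀ i j, HasFDerivAt (fun z => (S z)⁻¹ i j) (fderiv ℝ (fun z => (S z)⁻¹ i j) y) y :=
    fun i j => ((contDiffAt_matrix_inv hc h0 i j).differentiableAt (by simp)).hasFDerivAt
  have hTS := Matrix.nonsing_inv_mul (S y) h0.isUnit
  have hST := Matrix.mul_nonsing_inv (S y) h0.isUnit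
  have hdet : ∀ᶠ z in 𝓝 y, (S z).det ≠ 0 := (contDiffAt_det hc).continuousAt.eventually_ne h0
  -- differentiate `S⁻¹ S = 1`
  have key : ∀ i l, (∑ k, (S y k l • fderiv ℝ (fun z => (S z)⁻¹ i k) y
      + (S y)⁻¹ i k • ∑ m, S y k m • A m l y)) = 0 := by
    intro i l
    have h1 : HasFDerivAt (fun z => ∑ k, (S z)⁻¹ i k * S z k l) _ y :=
      HasFDerivAt.fun_sum (u := Finset.univ) fun k _ => (hd i k).mul (hS k l)
    have h2 : (fun z => ∑ k, (S z)⁻¹ i k * S z k l) =ᶠ[𝓝 y] fun _ => (1 : Mat 3) i l := by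
      filter_upwards [hdet] with z hz
      rw [← Matrix.mul_apply, Matrix.nonsing_inv_mul (S z) hz.isUnit]
    have h3 := h1.unique ((hasFDerivAt_const _ y).congr_of_eventuallyEq h2)
    rw [← h3]
    exact Finset.sum_congr rfl fun k _ => add_comm _ _
  have h4 : ∀ i l, ∑ k, S y k l • fderiv ℝ (fun z => (S z)⁻¹ i k) y = - A i l y := by
    intro i l
    have h5 := key i l
    rw [Finset.sum_add_distrib] at h5
    have h6 : ∑ k, (S y)⁻¹ i k • ∑ m, S y k m • A m l y = A i l y := by
      simp only [Finset.smul_sum, smul_smul]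
      rw [Finset.sum_comm]
      simp only [← Finset.sum_smul, ← Matrix.mul_apply, hTS, Matrix.one_apply, ite_smul, one_smul,
        zero_smul, Finset.sum_ite_eq, Finset.mem_univ, if_true]
    rw [h6] at h5
    exact eq_neg_of_add_eq_zero_left h5
  refine (hd i j).congr_fderiv ?_
  have h7 : fderiv ℝ (fun z => (S z)⁻¹ i j) y
      = ∑ l, (S y)⁻¹ l j • ∑ k, S y k l • fderiv ℝ (fun z => (S z)⁻¹ i k) y := by
    simp only [Finset.smul_sum, smul_smul]
    rw [Finset.sum_comm]
    have h8 : ∀ k, ∑ l, (S y)⁻¹ l j * S y k l = (1 : Mat 3) k j := by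
      intro k
      rw [← hST, Matrix.mul_apply]
      exact Finset.sum_congr rfl fun l _ => mul_comm _ _
    simp only [← Finset.sum_smul, h8, Matrix.one_apply, ite_smul, one_smul, zero_smul,
      Finset.sum_ite_eq', Finset.mem_univ, if_true]
  rw [h7]
  simp only [h4, smul_neg, Finset.sum_neg_distrib]

end MaurerCartan

/-! ### Pairs of points and lines in the projective plane -/

section Developing

variable {E : Type*} [NormedAddCommGroup E] [NormedSpace ℝ E] [FiniteDimensional ℝ E]

/-- The affine coordinates `(a, b, x, y)` of the pair of a point `[m]` of the projective plane and
a line `[ℓ]`: `m` is proportional to `(-a, 1, -b)` and `ℓ` to `(x, y, 1)`. -/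
def pairCoord (m l : Fin 3 → ℝ) : E4 :=
  !₂[-(m 0 / m 1), -(m 2 / m 1), l 0 / l 2, l 1 / l 2]

/-- The incidence function `b + a x - y` of a pair normalized by `ℓ m = 1` is `- 1 / (m₁ ℓ₂)`. -/
theorem dancU_pairCoord {m l : Fin 3 → ℝ} (hm : m 1 ≠ 0) (hl : l 2 ≠ 0) (h : ∑ j, l j * m j = 1) :
    dancU (pairCoord m l) * (m 1 * l 2) = -1 := by
  rw [Fin.sum_univ_three] at h
  simp only [dancU, pairCoord, Matrix.cons_val]
  field_simp
  linarith

theorem hasFDerivAt_div' {f g : E → ℝ} {f' g' : E →L[ℝ] ℝ} {y : E} (hf : HasFDerivAt f f' y)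
    (hg : HasFDerivAt g g' y) (h0 : g y ≠ 0) :
    HasFDerivAt (fun z => f z / g z) ((g y ^ 2)⁻¹ • (g y • f' - f y • g')) y := by
  have h1 := hf.mul ((hasDerivAt_inv h0).comp_hasFDerivAt y hg)
  simp only [div_eq_mul_inv]
  refine h1.congr_fderiv ?_
  ext v
  simp only [add_apply, smul_apply, sub_apply, smul_eq_mul, Function.comp]
  field_simp
  ring

/-- The differential of `pairCoord`. -/
def pairDeriv (m l m' l' : Fin 3 → ℝ) : E4 :=
  !₂[-((m 1 ^ 2)⁻¹ * (m 1 * m' 0 - m 0 * m' 1)), -((m 1 ^ 2)⁻¹ * (m 1 * m' 2 - m 2 * m' 1)),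
    (l 2 ^ 2)⁻¹ * (l 2 * l' 0 - l 0 * l' 2), (l 2 ^ 2)⁻¹ * (l 2 * l' 1 - l 1 * l' 2)]

theorem fderiv_pairCoord {m l : E → Fin 3 → ℝ} {m' l' : Fin 3 → E →L[ℝ] ℝ} {y : E}
    (hm : ∀ i, HasFDerivAt (fun z => m z i) (m' i) y)
    (hl : ∀ i, HasFDerivAt (fun z => l z i) (l' i) y) (hm0 : m y 1 ≠ 0) (hl0 : l y 2 ≠ 0) (v : E) :
    fderiv ℝ (fun z => pairCoord (m z) (l z)) y v
      = pairDeriv (m y) (l y) (fun i => m' i v) (fun i => l' i v) := by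
  have h0 := (hasFDerivAt_div' (hm 0) (hm 1) hm0).neg
  have h1 := (hasFDerivAt_div' (hm 2) (hm 1) hm0).neg
  have h2 := hasFDerivAt_div' (hl 0) (hl 2) hl0
  have h3 := hasFDerivAt_div' (hl 1) (hl 2) hl0
  have hd : DifferentiableAt ℝ (fun z => pairCoord (m z) (l z)) y := by
    rw [differentiableAt_euclidean]
    intro i
    fin_cases i
    · exact h0.differentiableAt
    · exact h1.differentiableAt
    · exact h2.differentiableAt
    · exact h3.differentiableAt
  have hi : ∀ i, HasFDerivAt (fun z => pairCoord (m z) (l z) i)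
      ((dcoord i).comp (fderiv ℝ (fun z => pairCoord (m z) (l z)) y)) y := fun i =>
    HasFDerivAt.comp (g := dcoord i) (f := fun z => pairCoord (m z) (l z)) y
      (dcoord i).hasFDerivAt hd.hasFDerivAt
  have h0' := DFunLike.congr_fun ((hi 0).unique h0) v
  have h1' := DFunLike.congr_fun ((hi 1).unique h1) v
  have h2' := DFunLike.congr_fun ((hi 2).unique h2) v
  have h3' := DFunLike.congr_fun ((hi 3).unique h3) v
  ext i
  fin_cases i
  · exact h0'
  · exact h1'
  · exact h2'
  · exact h3'

theorem contDiffAt_pairCoord {m l : E → Fin 3 → ℝ} {y : E}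
    (hm : ∀ i, ContDiffAt ℝ ∞ (fun z => m z i) y) (hl : ∀ i, ContDiffAt ℝ ∞ (fun z => l z i) y)
    (hm0 : m y 1 ≠ 0) (hl0 : l y 2 ≠ 0) :
    ContDiffAt ℝ ∞ (fun z => pairCoord (m z) (l z)) y := by
  rw [contDiffAt_euclidean]
  intro i
  fin_cases i
  · exact ((hm 0).div (hm 1) hm0).neg
  · exact ((hm 2).div (hm 1) hm0).neg
  · exact (hl 0).div (hl 2) hl0
  · exact (hl 1).div (hl 2) hl0

/-- The form `- dℓ(v) dm(w) + (dℓ(v) m) (ℓ dm(w))`, invariant under scaling of the pair `(m, ℓ)`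
with `ℓ m = 1`. -/
def pairForm (m l l' m' : Fin 3 → ℝ) : ℝ :=
  -(∑ j, l' j * m' j) + (∑ j, l' j * m j) * ∑ j, l j * m' j

/-- `pairForm` in terms of the differentials of the affine coordinates. -/
theorem pairForm_eq {m l : Fin 3 → ℝ} (hm : m 1 ≠ 0) (hl : l 2 ≠ 0)
    (h : ∑ j, l j * m j = 1) (m' l' : Fin 3 → ℝ) :
    (m 1 * l 2) ^ 2 * (-((m 1 ^ 2)⁻¹ * (m 1 * m' 0 - m 0 * m' 1))
          * ((l 1 / l 2 - -(m 2 / m 1)) * ((l 2 ^ 2)⁻¹ * (l 2 * l' 0 - l 0 * l' 2))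
            - l 0 / l 2 * ((l 2 ^ 2)⁻¹ * (l 2 * l' 1 - l 1 * l' 2)))
        + -((m 1 ^ 2)⁻¹ * (m 1 * m' 2 - m 2 * m' 1))
          * (-(m 0 / m 1) * ((l 2 ^ 2)⁻¹ * (l 2 * l' 0 - l 0 * l' 2))
            - (l 2 ^ 2)⁻¹ * (l 2 * l' 1 - l 1 * l' 2)))
      = pairForm m l l' m' := by
  simp only [Fin.sum_univ_three, pairForm] at h ⊢
  linear_combination (norm := (field_simp; ring))
    (-(l' 2 * (l 0 * m' 0 + l 1 * m' 1 + l 2 * m' 2) / l 2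
      + m' 1 * (l' 0 * m 0 + l' 1 * m 1 + l' 2 * m 2) / m 1
      - l' 2 * m' 1 * (l 0 * m 0 + l 1 * m 1 + l 2 * m 2) / (m 1 * l 2)
      + m 1 * l 2 * ((m 1 ^ 2)⁻¹ * (m 1 * m' 0 - m 0 * m' 1))
        * ((l 2 ^ 2)⁻¹ * (l 2 * l' 0 - l 0 * l' 2)))) * h

/-- The dancing metric is the symmetrization of `pairForm`. -/
theorem dancForm_pairDeriv {m l : Fin 3 → ℝ} (hm : m 1 ≠ 0) (hl : l 2 ≠ 0)
    (h : ∑ j, l j * m j = 1) (mv lv mw lw : Fin 3 → ℝ) :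
    dancForm (pairCoord m l) (pairDeriv m l mv lv) (pairDeriv m l mw lw)
      = pairForm m l lv mw + pairForm m l lw mv := by
  have hU := dancU_pairCoord hm hl h
  have hU' : ((pairCoord m l 1 + pairCoord m l 0 * pairCoord m l 2 - pairCoord m l 3) ^ 2)⁻¹
      = (m 1 * l 2) ^ 2 := by
    have h1 : (dancU (pairCoord m l))⁻¹ = -(m 1 * l 2) := by
      apply inv_eq_of_mul_eq_one_right
      linarith
    have h2 : ((dancU (pairCoord m l)) ^ 2)⁻¹ = (m 1 * l 2) ^ 2 := by
      rw [← inv_pow, h1, neg_sq]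
    exact h2
  rw [← pairForm_eq hm hl h, ← pairForm_eq hm hl h, dancForm, hU']
  simp only [symProd, smul_apply, add_apply, sub_apply, ContinuousLinearMap.smulRight_apply,
    dcoord_apply, smul_eq_mul, pairDeriv, pairCoord, Matrix.cons_val]
  ring

variable {A : Fin 3 → Fin 3 → E → E →L[ℝ] ℝ} {y₀ : E}

/-- The developing map of a flat `sl₃(ℝ)`-valued form: the pair of a point and a line given by the
last column of `S` and the last row of `S⁻¹`, for `A = S⁻¹ dS`. It pulls the dancing metric back to
`2 Σ αᵏ ᾱₖ`, where `αᵏ = A_{k3}`, `ᾱₖ = A_{3k}`. -/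
theorem exists_developing (hA : ∀ᶠ y in 𝓝 y₀, ∀ i j, ContDiffAt ℝ ∞ (A i j) y)
    (hflat : ∀ᶠ y in 𝓝 y₀, ∀ i j u v, dVec (A i j) y u v
      = -∑ k, (A i k y u * A k j y v - A i k y v * A k j y u)) :
    ∃ Φ : E → E4, ∀ᶠ y in 𝓝 y₀, ContDiffAt ℝ ∞ Φ y ∧ dancU (Φ y) ≠ 0 ∧
      (∀ v w, dancForm (Φ y) (fderiv ℝ Φ y v) (fderiv ℝ Φ y w)
        = ∑ k : Fin 2, (A 2 k.castSucc y v * A k.castSucc 2 y w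
          + A 2 k.castSucc y w * A k.castSucc 2 y v)) ∧
      ∀ v v', (∀ k : Fin 2, A k.castSucc 2 y v' = A k.castSucc 2 y v) →
        (∀ k : Fin 2, A 2 k.castSucc y v' = - A 2 k.castSucc y v) →
        fderiv ℝ Φ y v' = dancEnd (fderiv ℝ Φ y v) := by
  -- at `y₀` the point is `(0, -1, 1)` and the line is `(0, 0, 1)`
  obtain ⟨S, hS0, hS⟩ := exists_maurerCartan hA hflat !![1, 0, 0; 0, 1, -1; 0, 0, 1]
  have hinv0 : (S y₀)⁻¹ = !![1, 0, 0; 0, 1, 1; 0, 0, 1] := by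
    rw [hS0]
    refine Matrix.inv_eq_right_inv ?_
    ext i j
    fin_cases i <;> fin_cases j <;> simp [Matrix.mul_apply, Fin.sum_univ_three]
  have hdet0 : (S y₀).det ≠ 0 := by
    rw [hS0, Matrix.det_fin_three]
    simp
  have hc0 : ∀ i j, ContDiffAt ℝ ∞ (fun z => S z i j) y₀ := fun i j => (hS.self_of_nhds i j).1
  have e1 : ∀ᶠ y in 𝓝 y₀, (S y).det ≠ 0 := (contDiffAt_det hc0).continuousAt.eventually_ne hdet0
  have e2 : ∀ᶠ y in 𝓝 y₀, S y 1 2 ≠ 0 := (hc0 1 2).continuousAt.eventually_ne (by simp [hS0])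
  have e3 : ∀ᶠ y in 𝓝 y₀, (S y)⁻¹ 2 2 ≠ 0 :=
    (contDiffAt_matrix_inv hc0 hdet0 2 2).continuousAt.eventually_ne (by simp [hinv0])
  refine ⟨fun y => pairCoord (fun i => S y i 2) ((S y)⁻¹ 2), ?_⟩
  filter_upwards [hS, e1, e2, e3] with y hy h1 h2 h3
  have hc : ∀ i j, ContDiffAt ℝ ∞ (fun z => S z i j) y := fun i j => (hy i j).1
  have hTS := Matrix.nonsing_inv_mul (S y) h1.isUnit
  have hlm : ∑ j, (S y)⁻¹ 2 j * S y j 2 = 1 := by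
    rw [← Matrix.mul_apply, hTS, Matrix.one_apply_eq]
  have hTS' : ∀ i j, ∑ k, (S y)⁻¹ i k * S y k j = if i = j then 1 else 0 := by
    intro i j
    rw [← Matrix.mul_apply, hTS, Matrix.one_apply]
  -- here `dm = S A` in the last column and `dℓ = - A S⁻¹` in the last row
  have hD : ∀ v, fderiv ℝ (fun y => pairCoord (fun i => S y i 2) ((S y)⁻¹ 2)) y v
      = pairDeriv (fun i => S y i 2) ((S y)⁻¹ 2) (fun i => ∑ k, S y i k * A k 2 y v)
        (fun i => -∑ k, (S y)⁻¹ k i * A 2 k y v) := by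
    intro v
    have h := fderiv_pairCoord (m := fun y i => S y i 2) (l := fun y => (S y)⁻¹ 2)
      (fun i => (hy i 2).2)
      (fun i => hasFDerivAt_maurerCartan_inv h1 hc (fun i j => (hy i j).2) 2 i) h2 h3 v
    simpa [sum_apply] using h
  refine ⟨contDiffAt_pairCoord (m := fun y i => S y i 2) (l := fun y => (S y)⁻¹ 2)
    (fun i => hc i 2) (fun i => contDiffAt_matrix_inv hc h1 2 i) h2 h3, ?_, ?_, ?_⟩
  · intro h0
    have h := dancU_pairCoord (m := fun i => S y i 2) (l := (S y)⁻¹ 2) h2 h3 hlm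
    rw [h0, zero_mul] at h
    norm_num at h
  · have hp : ∀ v w, pairForm (fun i => S y i 2) ((S y)⁻¹ 2)
        (fun i => -∑ k, (S y)⁻¹ k i * A 2 k y v) (fun i => ∑ k, S y i k * A k 2 y w)
          = ∑ k : Fin 2, A 2 k.castSucc y v * A k.castSucc 2 y w := by
      intro v w
      have h00 := hTS' 0 0
      have h01 := hTS' 0 1
      have h02 := hTS' 0 2
      have h10 := hTS' 1 0
      have h11 := hTS' 1 1
      have h12 := hTS' 1 2
      have h20 := hTS' 2 0
      have h21 := hTS' 2 1
      have h22 := hTS' 2 2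
      simp only [Fin.sum_univ_three, Fin.isValue, if_true, Fin.reduceEq, if_false]
        at h00 h01 h02 h10 h11 h12 h20 h21 h22
      -- the contractions are evaluated with `S⁻¹ S = 1`
      have f1 : ∑ j, (-∑ k, (S y)⁻¹ k j * A 2 k y v) * ∑ k, S y j k * A k 2 y w
          = -∑ k, A 2 k y v * A k 2 y w := by
        simp only [Fin.sum_univ_three]
        linear_combination -(A 2 0 y v * A 0 2 y w * h00 + A 2 0 y v * A 1 2 y w * h01
          + A 2 0 y v * A 2 2 y w * h02 + A 2 1 y v * A 0 2 y w * h10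
          + A 2 1 y v * A 1 2 y w * h11 + A 2 1 y v * A 2 2 y w * h12
          + A 2 2 y v * A 0 2 y w * h20 + A 2 2 y v * A 1 2 y w * h21
          + A 2 2 y v * A 2 2 y w * h22)
      have f2 : ∑ j, (-∑ k, (S y)⁻¹ k j * A 2 k y v) * S y j 2 = -A 2 2 y v := by
        simp only [Fin.sum_univ_three]
        linear_combination -(A 2 0 y v * h02 + A 2 1 y v * h12 + A 2 2 y v * h22)
      have f3 : ∑ j, (S y)⁻¹ 2 j * ∑ k, S y j k * A k 2 y w = A 2 2 y w := by
        simp only [Fin.sum_univ_three]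
        linear_combination A 0 2 y w * h20 + A 1 2 y w * h21 + A 2 2 y w * h22
      rw [pairForm, f1, f2, f3, Fin.sum_univ_three, Fin.sum_univ_two]
      simp only [Fin.castSucc_zero, Fin.castSucc_one]
      ring
    intro v w
    rw [hD, hD, dancForm_pairDeriv h2 h3 hlm, hp, hp, ← Finset.sum_add_distrib]
  -- the affine coordinates of the point depend only on `αᵏ`, those of the line only on `ᾱₖ`
  · intro v v' ha hb
    rw [hD, hD]
    have ha0 := ha 0
    have ha1 := ha 1
    have hb0 := hb 0
    have hb1 := hb 1
    simp only [Fin.castSucc_zero, Fin.castSucc_one] at ha0 ha1 hb0 hb1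
    ext i
    rw [dancEnd_apply]
    fin_cases i <;>
      simp only [pairDeriv, Fin.sum_univ_three, Matrix.cons_val, ha0, ha1, hb0, hb1, Fin.zero_eta,
        Fin.mk_one, Fin.reduceFinMk] <;> ring

end Developing

/-! ### The developing map of a flat geometry -/

section Pullback

variable {E : Type*} [NormedAddCommGroup E] [NormedSpace ℝ E]
  {N : Type*} [TopologicalSpace N] [ChartedSpace E N] [IsManifold 𝓘(ℝ, E) ∞ N]
  {E' : Type*} [NormedAddCommGroup E'] [NormedSpace ℝ E']
  {N' : Type*} [TopologicalSpace N'] [ChartedSpace E' N'] [IsManifold 𝓘(ℝ, E') ∞ N']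

/-- The pullback of a `1`-form. -/
def pullbackForm (f : N → N') (θ' : FormField E' N') : FormField E N := fun q =>
  ContinuousLinearMap.comp (M₁ := TangentSpace 𝓘(ℝ, E) q) (M₂ := TangentSpace 𝓘(ℝ, E') (f q))
    (θ' (f q)) (mfderiv 𝓘(ℝ, E) 𝓘(ℝ, E') f q)

theorem smoothFormAt_pullbackForm {f : N → N'} {θ' : FormField E' N'} {p : N}
    (hf : ∀ᶠ q in 𝓝 p, ContMDiffAt 𝓘(ℝ, E) 𝓘(ℝ, E') ∞ f q) (hθ : SmoothFormAt θ' (f p)) :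
    SmoothFormAt (E := E) (N := N) (pullbackForm f θ') p := fun v =>
  ContMDiffAt.comp (⟨p, v⟩ : TangentBundle 𝓘(ℝ, E) N) (hθ _)
    (contMDiffAt_tangentMap (f := fun ξ : TangentBundle 𝓘(ℝ, E) N => ξ)
      (x := (⟨p, v⟩ : TangentBundle 𝓘(ℝ, E) N)) contMDiffAt_id hf)

theorem dOne_pullbackForm [FiniteDimensional ℝ E'] {f : N → N'} {θ' : FormField E' N'} {p : N}
    (hf : ContMDiffAt 𝓘(ℝ, E) 𝓘(ℝ, E') ∞ f p) (hθ : SmoothFormAt θ' (f p))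
    (v w : TangentSpace 𝓘(ℝ, E) p) :
    dOne (pullbackForm f θ') p v w = dOne θ' (f p) (mfderiv 𝓘(ℝ, E) 𝓘(ℝ, E') f p v)
      (mfderiv 𝓘(ℝ, E) 𝓘(ℝ, E') f p w) :=
  dOne_pullback (hf.of_le ENat.LEInfty.out) (hθ.contDiffAt_self.differentiableAt (by simp))
    (Filter.Eventually.of_forall fun _ _ => rfl) v w

end Pullback

section Develop

variable {M : Type u} [TopologicalSpace M] [ChartedSpace E4 M] [IsManifold 𝓘(ℝ, E4) ∞ M]
  {g : BilinField M} {K : EndField M}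
  {𝒢 : CartanGeometry M} {fr : ∀ p : 𝒢.P, AdaptedFrame g K (𝒢.proj p)}

theorem CartanGeometry.IsFlat.dOne_conn (hf : 𝒢.IsFlat) (p : 𝒢.P) (ξ η : TangentSpace 𝓘(ℝ, E8) p)
    (i j : Fin 3) : dOne (𝒢.conn i j) p ξ η
      = -∑ k, (𝒢.conn i k p ξ * 𝒢.conn k j p η - 𝒢.conn i k p η * 𝒢.conn k j p ξ) := by
  have h : dOne (𝒢.conn i j) p ξ η + ((∑ k, 𝒢.conn i k p ξ * 𝒢.conn k j p η)
      - ∑ k, 𝒢.conn i k p η * 𝒢.conn k j p ξ) = 0 := congrFun (congrFun (hf p ξ η) i) j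
  rw [Finset.sum_sub_distrib]
  linarith

/-- The components of `Kv` in an adapted frame. -/
theorem AdaptedFrame.inner_para (hg : IsAlmostParaHermitian g K) {x : M} (f : AdaptedFrame g K x)
    (v : TangentSpace 𝓘(ℝ, E4) x) (i : Fin 2) :
    g x (f.ebar i) (K x v) = g x (f.ebar i) v ∧ g x (f.e i) (K x v) = -g x (f.e i) v := by
  have h1 := hg.compatible x (f.ebar i) v
  have h2 := hg.compatible x (f.e i) v
  rw [f.K_ebar, map_neg] at h1
  rw [f.K_e] at h2
  exact ⟨neg_injective h1, h2⟩

/-- `g = 2 Σ αᵏ ᾱₖ` in the coframe dual to an adapted frame. -/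
theorem bilinAt_eq_frame (hg : IsAlmostParaHermitian g K) {x : M} (f : AdaptedFrame g K x)
    (v w : E4) : bilinAt g x v w
      = ∑ k, (bilinAt g x (f.eVec k) v * bilinAt g x (f.bVec k) w
        + bilinAt g x (f.eVec k) w * bilinAt g x (f.bVec k) v) := by
  have hs : ∀ u v, bilinAt g x u v = bilinAt g x v u := hg.symm x
  have h := congrArg (fun z => bilinAt g x z w)
    (split_frame_expand hs (e := f.eVec) (b := f.bVec) f.g_e_e f.g_ebar_ebar f.g_e_ebar v)
  refine h.trans ?_
  simp only [map_add, map_sum, map_smul, add_apply, sum_apply, smul_apply, smul_eq_mul,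
    ← Finset.sum_add_distrib]
  exact Finset.sum_congr rfl fun k _ => by ring

/-- A flat frame geometry has local maps to the dancing domain preserving the metric and `K`: pull
the Cartan connection back by a local section and develop it. -/
theorem exists_isDancingMapAt_of_isFlat (h : IsFrameGeometry 𝒢 fr)
    (hg : IsAlmostParaHermitian g K) (hflat : 𝒢.IsFlat) (x₀ : M) :
    ∃ Ψ : M → E4, ∀ᶠ x in 𝓝 x₀, IsDancingMapAt g K Ψ x := by
  obtain ⟨U, s, -, hU, hxU, hs, -, hsec, -⟩ := 𝒢.locally_trivial x₀
  have hsm : ∀ x ∈ U, ContMDiffAt 𝓘(ℝ, E4) 𝓘(ℝ, E8) ∞ s x := fun x hx =>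
    (hs x hx).contMDiffAt (hU.mem_nhds hx)
  have hsev : ∀ x ∈ U, ∀ᶠ q in 𝓝 x, ContMDiffAt 𝓘(ℝ, E4) 𝓘(ℝ, E8) ∞ s q := fun x hx =>
    Filter.mem_of_superset (hU.mem_nhds hx) hsm
  let θ : Fin 3 → Fin 3 → FormField E4 M := fun i j => pullbackForm s (𝒢.conn i j)
  have hθ : ∀ i j, ∀ x ∈ U, SmoothFormAt (θ i j) x := fun i j x hx =>
    smoothFormAt_pullbackForm (hsev x hx) (smoothFormAt_conn 𝒢 i j _)
  set κ := extChartAt 𝓘(ℝ, E4) x₀ with hκ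
  have hnear : ∀ᶠ y in 𝓝 (κ x₀), y ∈ κ.target ∧ κ.symm y ∈ U :=
    Filter.Eventually.and (extChartAt_target_mem_nhds (I := 𝓘(ℝ, E4)) x₀)
      ((tendsto_extChartAt_symm_self x₀).eventually (hU.mem_nhds hxU))
  -- the pulled back connection satisfies the Maurer–Cartan equation
  obtain ⟨Φ, hΦ⟩ := exists_developing (A := fun i j => oneFormInChart (θ i j) x₀) (y₀ := κ x₀)
    (hnear.mono fun y hy i j => (hθ i j _ hy.2).contDiffAt_oneFormInChart hy.1)
    (hnear.mono fun y hy i j u v => by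
      rw [dVec_oneFormInChart hy.1 (hθ i j _ hy.2)]
      exact (dOne_pullbackForm (hsm _ hy.2) (smoothFormAt_conn 𝒢 i j _) _ _).trans
        (hflat.dOne_conn _ _ _ i j))
  refine ⟨fun x => Φ (κ x), ?_⟩
  have hκc : Filter.Tendsto κ (𝓝 x₀) (𝓝 (κ x₀)) := continuousAt_extChartAt (I := 𝓘(ℝ, E4)) x₀
  have hsrc : ∀ᶠ x in 𝓝 x₀, x ∈ κ.source := extChartAt_source_mem_nhds (I := 𝓘(ℝ, E4)) x₀
  filter_upwards [hκc.eventually hΦ, hsrc, hU.mem_nhds hxU] with x hx hxs hxU'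
  obtain ⟨h1, h2, h3, h4⟩ := hx
  have hκs : ContMDiffAt 𝓘(ℝ, E4) 𝓘(ℝ, E4) ∞ κ x :=
    contMDiffAt_extChartAt' (by rwa [hκ, extChartAt_source] at hxs)
  have hd : ∀ v : TangentSpace 𝓘(ℝ, E4) x, vecDeriv (fun x => Φ (κ x)) x v
      = fderiv ℝ Φ (κ x) (vecDeriv κ x v) := by
    intro v
    have h5 := mfderiv_comp x (g := Φ) (f := κ) (I := 𝓘(ℝ, E4)) (I' := 𝓘(ℝ, E4))
      (I'' := 𝓘(ℝ, E4)) (h1.contMDiffAt.mdifferentiableAt (by simp))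
      (hκs.mdifferentiableAt (by simp))
    rw [mfderiv_eq_fderiv] at h5
    exact DFunLike.congr_fun h5 v
  have hA : ∀ i j (v : TangentSpace 𝓘(ℝ, E4) x),
      oneFormInChart (θ i j) x₀ (κ x) (vecDeriv κ x v) = θ i j x v := fun i j v =>
    oneFormInChart_mfderiv (θ i j) hxs v
  -- `s` is a section, so the forms `α`, `ᾱ` pull back to the coframe dual to the frame `s`
  have hproj : ∀ v : E4, dproj 𝒢 (s x) (mfderiv 𝓘(ℝ, E4) 𝓘(ℝ, E8) s x v) = v := by
    intro v
    have h5 := mfderiv_comp x (g := 𝒢.proj) (f := s) (I := 𝓘(ℝ, E4)) (I' := 𝓘(ℝ, E8))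
      (I'' := 𝓘(ℝ, E4)) (𝒢.smooth_proj.contMDiffAt.mdifferentiableAt (by simp))
      ((hsm x hxU').mdifferentiableAt (by simp))
    have h6 : 𝒢.proj ∘ s =ᶠ[𝓝 x] id := Filter.mem_of_superset (hU.mem_nhds hxU') hsec
    rw [h6.mfderiv_eq, mfderiv_id] at h5
    exact (DFunLike.congr_fun h5 v).symm
  have hx' : 𝒢.proj (s x) = x := hsec x hxU'
  have hga : ∀ (i : Fin 2) (v : E4), θ i.castSucc 2 x v
      = bilinAt g (𝒢.proj (s x)) ((fr (s x)).bVec i) v := fun i v =>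
    (h.conn_alpha (s x) _ i).trans
      (congrArg (bilinAt g (𝒢.proj (s x)) ((fr (s x)).bVec i)) (hproj v))
  have hgb : ∀ (i : Fin 2) (v : E4), θ 2 i.castSucc x v
      = bilinAt g (𝒢.proj (s x)) ((fr (s x)).eVec i) v := fun i v =>
    (h.conn_alphaBar (s x) _ i).trans
      (congrArg (bilinAt g (𝒢.proj (s x)) ((fr (s x)).eVec i)) (hproj v))
  -- `K` fixes `α` and changes the sign of `ᾱ`
  have hK : ∀ (i : Fin 2) (v : E4), θ i.castSucc 2 x (K x v) = θ i.castSucc 2 x v ∧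
      θ 2 i.castSucc x (K x v) = -θ 2 i.castSucc x v := by
    intro i v
    have key : ∀ (x' : M) (f : AdaptedFrame g K x') (_ : x' = x),
        bilinAt g x' (f.bVec i) (K x v) = bilinAt g x' (f.bVec i) v ∧
        bilinAt g x' (f.eVec i) (K x v) = -bilinAt g x' (f.eVec i) v := by
      rintro x' f rfl
      exact f.inner_para hg v i
    obtain ⟨k1, k2⟩ := key _ (fr (s x)) hx'
    exact ⟨(hga i _).trans (k1.trans (hga i v).symm),
      (hgb i _).trans (k2.trans (congrArg Neg.neg (hgb i v)).symm)⟩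
  refine ⟨h1.contMDiffAt.comp x hκs, h2, fun v w => ?_, fun v => ?_⟩
  · rw [hd, hd, h3]
    have h5 : bilinAt g x v w = bilinAt g (𝒢.proj (s x)) v w := by rw [hx']
    refine (h5.trans (bilinAt_eq_frame hg (fr (s x)) v w)).trans
      (Finset.sum_congr rfl fun k _ => ?_)
    exact (congrArg₂ (· + ·)
      (congrArg₂ (· * ·) ((hA 2 k.castSucc v).trans (hgb k v))
        ((hA k.castSucc 2 w).trans (hga k w)))
      (congrArg₂ (· * ·) ((hA 2 k.castSucc w).trans (hgb k w))
        ((hA k.castSucc 2 v).trans (hga k v)))).symm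
  · rw [hd, hd]
    refine h4 _ _ (fun k => ?_) fun k => ?_
    · exact (hA _ _ _).trans ((hK k v).1.trans (hA _ _ _).symm)
    · exact (hA _ _ _).trans ((hK k v).2.trans (congrArg Neg.neg (hA _ _ _)).symm)

end Develop

/-! ### Flat structures are locally equivalent to the dancing metric -/

section LocalEquivalence

variable {M : Type u} [TopologicalSpace M] [ChartedSpace E4 M] [IsManifold 𝓘(ℝ, E4) ∞ M]
  {g : BilinField M} {K : EndField M}

/-- A map preserving a non-degenerate metric is an immersion. -/
theorem IsDancingMapAt.injective (hg : IsAlmostParaHermitian g K) {Ψ : M → E4} {x : M}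
    (h : IsDancingMapAt g K Ψ x) {v : TangentSpace 𝓘(ℝ, E4) x} (hv : vecDeriv Ψ x v = 0) :
    v = 0 := by
  refine hg.nondegenerate x v fun w => ?_
  rw [h.metric, hv]
  simp

/-- In a chart, a dancing map is a local diffeomorphism. -/
theorem IsDancingMapAt.exists_hasFDerivAt (hg : IsAlmostParaHermitian g K) {Ψ : M → E4} {x₀ x : M}
    (h : IsDancingMapAt g K Ψ x) (hx : x ∈ (extChartAt 𝓘(ℝ, E4) x₀).source) :
    ContDiffAt ℝ ∞ (fun y => Ψ ((extChartAt 𝓘(ℝ, E4) x₀).symm y)) (extChartAt 𝓘(ℝ, E4) x₀ x) ∧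
      ∃ f' : E4 ≃L[ℝ] E4, HasFDerivAt (fun y => Ψ ((extChartAt 𝓘(ℝ, E4) x₀).symm y))
        (f' : E4 →L[ℝ] E4) (extChartAt 𝓘(ℝ, E4) x₀ x) := by
  set κ := extChartAt 𝓘(ℝ, E4) x₀ with hκ
  have hy : κ x ∈ κ.target := κ.map_source hx
  have hinv : κ.symm (κ x) = x := κ.left_inv hx
  have hκs : ContMDiffAt 𝓘(ℝ, E4) 𝓘(ℝ, E4) ∞ κ.symm (κ x) :=
    (contMDiffOn_extChartAt_symm (n := ∞) x₀).contMDiffAt (extChartAt_target_mem_nhds_self x₀ hy)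
  have hΨ : ContMDiffAt 𝓘(ℝ, E4) 𝓘(ℝ, E4) ∞ Ψ (κ.symm (κ x)) := by rw [hinv]; exact h.smooth
  have hsm : ContDiffAt ℝ ∞ (fun y => Ψ (κ.symm y)) (κ x) := (hΨ.comp (κ x) hκs).contDiffAt
  refine ⟨hsm, ?_⟩
  set F' : E4 →L[ℝ] E4 := fderiv ℝ (fun y => Ψ (κ.symm y)) (κ x) with hF'
  have hd : HasFDerivAt (fun y => Ψ (κ.symm y)) F' (κ x) :=
    (hsm.differentiableAt (by simp)).hasFDerivAt
  have hker : ∀ v, F' v = 0 → v = 0 := by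
    intro v hv
    have h5 := mfderiv_comp (κ x) (g := Ψ) (f := κ.symm) (I := 𝓘(ℝ, E4)) (I' := 𝓘(ℝ, E4))
      (I'' := 𝓘(ℝ, E4)) (hΨ.mdifferentiableAt (by simp)) (hκs.mdifferentiableAt (by simp))
    have h6 : F' = mfderiv 𝓘(ℝ, E4) 𝓘(ℝ, E4) (Ψ ∘ κ.symm) (κ x) := mfderiv_eq_fderiv.symm
    have h7 : vecDeriv Ψ (κ.symm (κ x)) (chartInvDeriv x₀ (κ x) v) = 0 :=
      (DFunLike.congr_fun (h6.trans h5) v).symm.trans hv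
    have h' : IsDancingMapAt g K Ψ (κ.symm (κ x)) := by rw [hinv]; exact h
    have h8 := h'.injective hg h7
    have h9 := mfderiv_chartInvDeriv hy v
    rw [h8, map_zero] at h9
    exact h9.symm
  have hinj : Function.Injective F' := (injective_iff_map_eq_zero F').2 hker
  exact ⟨ContinuousLinearEquiv.ofBijective F' (LinearMap.ker_eq_bot.2 hinj)
    (LinearMap.range_eq_top.2 (LinearMap.surjective_of_injective (f := F'.toLinearMap) hinj)), hd⟩

/-- By the inverse function theorem, local maps to the dancing domain that preserve the metric and
`K` are local equivalences. -/
theorem isLocallyEquivalent_of_isDancingMapAt (hg : IsAlmostParaHermitian g K)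
    (h : ∀ x₀ : M, ∃ Ψ : M → E4, ∀ᶠ x in 𝓝 x₀, IsDancingMapAt g K Ψ x) :
    IsLocallyEquivalent g K dancingMetric dancingK := by
  intro x₀
  obtain ⟨Ψ, hΨ⟩ := h x₀
  obtain ⟨W, hW, hWo, hxW⟩ := eventually_nhds_iff.1 hΨ
  set κ := chartAt E4 x₀ with hκ
  have hext : extChartAt 𝓘(ℝ, E4) x₀ = κ.toPartialEquiv := by simp [mfld_simps, hκ]
  have key : ∀ x ∈ W, x ∈ κ.source → ContDiffAt ℝ ∞ (fun y => Ψ (κ.symm y)) (κ x) ∧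
      ∃ f' : E4 ≃L[ℝ] E4, HasFDerivAt (fun y => Ψ (κ.symm y)) (f' : E4 →L[ℝ] E4) (κ x) := by
    intro x hx hxs
    have := (hW x hx).exists_hasFDerivAt hg (x₀ := x₀) (by rwa [hext])
    rw [hext] at this
    exact this
  have hx₀s : x₀ ∈ κ.source := mem_chart_source E4 x₀
  obtain ⟨hs₀, f₀, hf₀⟩ := key x₀ hxW hx₀s
  -- the inverse function theorem for `Ψ` in the chart `κ`
  let e := hs₀.toOpenPartialHomeomorph _ hf₀ (by simp)
  have hex : κ x₀ ∈ e.source := ContDiffAt.mem_toOpenPartialHomeomorph_source hs₀ hf₀ (by simp)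
  have hecoe : ∀ y, e y = Ψ (κ.symm y) := fun y => rfl
  have hne : Nonempty dancingDomain := ⟨⟨Ψ x₀, (hW x₀ hxW).ne_zero⟩⟩
  let ι := dancingDomain.openPartialHomeomorphSubtypeCoe hne
  -- the chart, followed by the local diffeomorphism, as a map to the open subset `dancingDomain`
  let φ : OpenPartialHomeomorph M dancingDomain := ((κ.restrOpen W hWo).trans e).trans ι.symm
  have hφs : ∀ x, x ∈ φ.source ↔ (x ∈ κ.source ∧ x ∈ W) ∧ κ x ∈ e.source := by
    intro x
    have h1 : x ∈ φ.source ↔ ((x ∈ κ.source ∧ x ∈ W) ∧ κ x ∈ e.source) ∧ e (κ x) ∈ ι.target := by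
      simp [φ]
    rw [h1]
    refine ⟨fun h => h.1, fun h => ⟨h, ?_⟩⟩
    rw [TopologicalSpace.Opens.openPartialHomeomorphSubtypeCoe_target, hecoe, κ.left_inv h.1.1]
    exact (hW x h.1.2).ne_zero
  have hφv : ∀ x ∈ φ.source, (φ x : E4) = Ψ x := by
    intro x hx
    have hx' := (hφs x).1 hx
    have h2 : e (κ x) ∈ ι.target := by
      rw [TopologicalSpace.Opens.openPartialHomeomorphSubtypeCoe_target, hecoe,
        κ.left_inv hx'.1.1]
      exact (hW x hx'.1.2).ne_zero
    have h3 : ι (ι.symm (e (κ x))) = e (κ x) := ι.right_inv h2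
    refine h3.trans ?_
    rw [hecoe, κ.left_inv hx'.1.1]
  have hφe : ∀ x ∈ φ.source, (fun y => (φ y : E4)) =ᶠ[𝓝 x] Ψ := fun x hx =>
    Filter.mem_of_superset (φ.open_source.mem_nhds hx) hφv
  have hφsm : ∀ x ∈ φ.source, ContMDiffAt 𝓘(ℝ, E4) 𝓘(ℝ, E4) ∞ φ x := by
    intro x hx
    rw [contMDiffAt_iff_target]
    refine ⟨φ.continuousAt hx, ?_⟩
    rw [coe_extChartAt_danc]
    exact (hW x ((hφs x).1 hx).1.2).smooth.congr_of_eventuallyEq (hφe x hx)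
  refine ⟨φ, (hφs x₀).2 ⟨⟨hx₀s, hxW⟩, hex⟩, fun x hx => (hφsm x hx).contMDiffWithinAt,
    fun z hz => ContMDiffAt.contMDiffWithinAt ?_, fun x hx => ?_⟩
  · obtain ⟨x, hx, rfl⟩ : ∃ x ∈ φ.source, φ x = z := ⟨φ.symm z, φ.map_target hz, φ.right_inv hz⟩
    obtain ⟨⟨hxs, hxW'⟩, hxe⟩ := (hφs x).1 hx
    obtain ⟨hs1, f1, hf1⟩ := key x hxW' hxs
    have hv : (φ x : E4) = e (κ x) := by rw [hφv x hx, hecoe, κ.left_inv hxs]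
    have hinv : e.symm (φ x : E4) = κ x := by rw [hv]; exact e.left_inv hxe
    have h1 : ContDiffAt ℝ ∞ e.symm (φ x : E4) := by
      refine e.contDiffAt_symm (f₀' := f1) (by rw [hv]; exact e.map_source hxe) ?_ ?_
      · rw [hinv]; exact hf1
      · rw [hinv]; exact hs1
    have h2 : ContMDiffAt 𝓘(ℝ, E4) 𝓘(ℝ, E4) ∞ κ.symm (e.symm (φ x : E4)) := by
      rw [hinv]
      exact (contMDiffOn_chart_symm (n := ∞)).contMDiffAt
        (κ.open_target.mem_nhds (κ.map_source hxs))
    exact ContMDiffAt.comp (g := κ.symm) (f := fun z : dancingDomain => e.symm (z : E4)) (φ x) h2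
      (ContMDiffAt.comp (g := e.symm) (f := (Subtype.val : dancingDomain → E4)) (φ x) h1.contMDiffAt
        contMDiff_subtype_val.contMDiffAt)
  · have hd : ∀ v : TangentSpace 𝓘(ℝ, E4) x,
        mfderiv 𝓘(ℝ, E4) 𝓘(ℝ, E4) φ x v = vecDeriv Ψ x v := by
      intro v
      have h1 := vecDeriv_comp_val ((hφsm x hx).mdifferentiableAt (by simp)) v
      refine h1.symm.trans ?_
      exact DFunLike.congr_fun ((hφe x hx).mfderiv_eq (I := 𝓘(ℝ, E4)) (I' := 𝓘(ℝ, E4))) v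
    have hm := (hW x ((hφs x).1 hx).1.2)
    refine ⟨fun v w => ?_, fun v => ?_⟩
    · refine Eq.trans ?_ (hm.metric v w).symm
      have h3 : dancingMetric (φ x) = dancForm (Ψ x) := by rw [← hφv x hx]; rfl
      exact (congrArg₂ (fun a b : E4 => (dancingMetric (φ x) : E4 →L[ℝ] E4 →L[ℝ] ℝ) a b)
        (hd v) (hd w)).trans (congrArg (fun B : E4 →L[ℝ] E4 →L[ℝ] ℝ =>
          B (vecDeriv Ψ x v) (vecDeriv Ψ x w)) h3)
    · exact (hd _).trans ((hm.para v).trans (congrArg dancEnd (hd v).symm))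

variable {𝒢 : CartanGeometry M} {fr : ∀ p : 𝒢.P, AdaptedFrame g K (𝒢.proj p)}

/-- The Cartan geometry is flat if and only if the structure is locally equivalent to the dancing
metric. -/
theorem isFlat_iff_isLocallyEquivalent (h : IsFrameGeometry 𝒢 fr) (hg : IsAlmostParaHermitian g K) :
    𝒢.IsFlat ↔ IsLocallyEquivalent g K dancingMetric dancingK :=
  ⟨fun hflat => isLocallyEquivalent_of_isDancingMapAt hg
    (exists_isDancingMapAt_of_isFlat h hg hflat), isFlat_of_isLocallyEquivalent h⟩

end LocalEquivalence

/-! ### Local adapted frames -/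

section Frames

variable {M : Type u} [TopologicalSpace M] [ChartedSpace E4 M] [IsManifold 𝓘(ℝ, E4) ∞ M]
  {g : BilinField M} {K : EndField M}
  {D : Type*} [NormedAddCommGroup D] [NormedSpace ℝ D]
  {H : Type*} [TopologicalSpace H] {J : ModelWithCorners ℝ D H}
  {X : Type*} [TopologicalSpace X] [ChartedSpace H X]

/-- Linear combinations of smooth families of tangent vectors along a map are smooth. -/
theorem contMDiffAt_tangent_sum_smul {κ : Type*} [Fintype κ] {f : X → M} {z : X} {c : κ → X → ℝ}
    {v : ∀ (_ : κ) (z : X), TangentSpace 𝓘(ℝ, E4) (f z)} (hf : ContMDiffAt J 𝓘(ℝ, E4) ∞ f z)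
    (hc : ∀ k, ContMDiffAt J 𝓘(ℝ, ℝ) ∞ (c k) z)
    (hv : ∀ k, ContMDiffAt J 𝓘(ℝ, E4).tangent ∞
      (fun z => (⟨f z, v k z⟩ : TangentBundle 𝓘(ℝ, E4) M)) z) :
    ContMDiffAt J 𝓘(ℝ, E4).tangent ∞
      (fun z => (⟨f z, ∑ k, c k z • v k z⟩ : TangentBundle 𝓘(ℝ, E4) M)) z := by
  rw [contMDiffAt_totalSpace]
  refine ⟨hf, ?_⟩
  let e := trivializationAt E4 (TangentSpace 𝓘(ℝ, E4)) (f z)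
  have hb : ∀ᶠ q in 𝓝 z, f q ∈ e.baseSet :=
    hf.continuousAt.eventually (e.open_baseSet.mem_nhds (mem_baseSet_trivializationAt E4 _ (f z)))
  have h1 : ContMDiffAt J 𝓘(ℝ, E4) ∞ (fun q => ∑ k, c k q • (e ⟨f q, v k q⟩).2) z :=
    contMDiffAt_finsetSum fun k _ => (hc k).smul (contMDiffAt_totalSpace.1 (hv k)).2
  refine h1.congr_of_eventuallyEq (hb.mono fun q hq => ?_)
  have h2 : ∀ w : TangentSpace 𝓘(ℝ, E4) (f q), (e ⟨f q, w⟩).2 = e.linearMapAt ℝ (f q) w := by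
    intro w
    rw [Trivialization.coe_linearMapAt_of_mem _ hq]
  change (e ⟨f q, ∑ k, c k q • v k q⟩).2 = ∑ k, c k q • (e ⟨f q, v k q⟩).2
  rw [h2, map_sum]
  refine Finset.sum_congr rfl fun k _ => ?_
  rw [map_smul, h2]

/-- Every tangent vector extends to a smooth vector field near its base point. -/
theorem exists_smooth_extension (x₀ : M) (v : TangentSpace 𝓘(ℝ, E4) x₀) :
    ∃ V : ∀ x : M, TangentSpace 𝓘(ℝ, E4) x, V x₀ = v ∧ ∀ᶠ x in 𝓝 x₀,
      ContMDiffAt 𝓘(ℝ, E4) 𝓘(ℝ, E4).tangent ∞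
        (fun q => (⟨q, V q⟩ : TangentBundle 𝓘(ℝ, E4) M)) x := by
  let e := trivializationAt E4 (TangentSpace 𝓘(ℝ, E4) : M → Type _) x₀
  have h0 : x₀ ∈ e.baseSet := mem_baseSet_trivializationAt E4 _ x₀
  refine ⟨fun x => e.symm x (e ⟨x₀, v⟩).2, ?_, ?_⟩
  · exact e.symm_apply_apply_mk h0 v
  · filter_upwards [e.open_baseSet.mem_nhds h0] with x hx
    rw [e.contMDiffAt_section_iff (IB := 𝓘(ℝ, E4)) hx]
    refine (contMDiffAt_const (c := (e ⟨x₀, v⟩).2)).congr_of_eventuallyEq ?_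
    filter_upwards [e.open_baseSet.mem_nhds hx] with q hq
    rw [e.apply_mk_symm hq]

/-- The eigenspaces of `K` are null. -/
theorem IsAlmostParaHermitian.inner_eq_zero (hg : IsAlmostParaHermitian g K) {x : M}
    {v w : TangentSpace 𝓘(ℝ, E4) x} {ε : ℝ} (hε : ε * ε = 1) (hv : K x v = ε • v)
    (hw : K x w = ε • w) : g x v w = 0 := by
  have h := hg.compatible x v w
  rw [hv, hw] at h
  simp only [map_smul, smul_apply, smul_eq_mul, ← mul_assoc, hε, one_mul] at h
  linarith

theorem IsAlmostParaHermitian.para_add (hg : IsAlmostParaHermitian g K) {x : M}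
    (v : TangentSpace 𝓘(ℝ, E4) x) : K x (v + K x v) = v + K x v := by
  rw [map_add, hg.sq_eq_id, add_comm]

theorem IsAlmostParaHermitian.para_sub (hg : IsAlmostParaHermitian g K) {x : M}
    (v : TangentSpace 𝓘(ℝ, E4) x) : K x (v - K x v) = -(v - K x v) := by
  rw [map_sub, hg.sq_eq_id, neg_sub]

/-- The pairing between bases of the two eigenspaces of `K` is non-degenerate. -/
theorem IsAlmostParaHermitian.det_pairing_ne_zero (hg : IsAlmostParaHermitian g K) {x : M}
    (e : Module.Basis (Fin 2) ℝ (eigenDist K 1 x))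
    (b : Module.Basis (Fin 2) ℝ (eigenDist K (-1) x)) :
    Matrix.det (Matrix.of fun i j => g x (e i) (b j)) ≠ 0 := by
  intro hdet
  obtain ⟨c, hc, h0⟩ := Matrix.exists_mulVec_eq_zero_iff.2 hdet
  have heig : ∀ {ε : ℝ} (v : eigenDist K ε x), K x v = ε • (v : TangentSpace 𝓘(ℝ, E4) x) :=
    fun v => Module.End.mem_eigenspace_iff.1 v.2
  let w : eigenDist K (-1) x := ∑ j, c j • b j
  have hw : (w : TangentSpace 𝓘(ℝ, E4) x) = ∑ j, c j • (b j : TangentSpace 𝓘(ℝ, E4) x) := by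
    simp [w]
  have hew : ∀ i, g x (e i) w = 0 := by
    intro i
    have h1 : ∑ j, g x (e i) (b j) * c j = 0 := congrFun h0 i
    rw [hw, map_sum, ← h1]
    refine Finset.sum_congr rfl fun j _ => ?_
    rw [map_smul, smul_eq_mul, mul_comm]
  have hpw : ∀ u : eigenDist K 1 x, g x u w = 0 := by
    intro u
    have h1 : (u : TangentSpace 𝓘(ℝ, E4) x) = ∑ i, e.repr u i • (e i : TangentSpace 𝓘(ℝ, E4) x) :=
      (congrArg Subtype.val (e.sum_repr u).symm).trans (by simp [-Module.Basis.sum_repr])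
    rw [h1, map_sum, sum_apply]
    refine Finset.sum_eq_zero fun i _ => ?_
    rw [map_smul, smul_apply, hew, smul_zero]
  have hmw : ∀ u : eigenDist K (-1) x, g x u w = 0 := fun u =>
    hg.inner_eq_zero (by norm_num) (heig u) (heig w)
  -- `w` is orthogonal to both eigenspaces, which span the tangent space
  have hw0 : (w : TangentSpace 𝓘(ℝ, E4) x) = 0 := by
    refine hg.nondegenerate x _ fun u => ?_
    have h1 := hpw ⟨u + K x u, Module.End.mem_eigenspace_iff.2
      ((hg.para_add u).trans (one_smul ℝ _).symm)⟩
    have h2 := hmw ⟨u - K x u, Module.End.mem_eigenspace_iff.2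
      ((hg.para_sub u).trans (neg_one_smul ℝ _).symm)⟩
    simp only [map_add, map_sub, add_apply, sub_apply] at h1 h2
    rw [hg.symm]
    linarith
  refine hc (funext fun j => ?_)
  have h3 : w = 0 := Subtype.ext hw0
  exact (Fintype.linearIndependent_iff.1 b.linearIndependent) c h3 j

/-- The projections `(1 ± K) / 2` to the eigendistributions preserve smoothness. -/
theorem contMDiffAt_para_proj (hg : IsAlmostParaHermitian g K) (s : ℝ)
    {V : ∀ x : M, TangentSpace 𝓘(ℝ, E4) x} {x : M} (hV : ContMDiffAt 𝓘(ℝ, E4) 𝓘(ℝ, E4).tangent ∞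
      (fun q => (⟨q, V q⟩ : TangentBundle 𝓘(ℝ, E4) M)) x) :
    ContMDiffAt 𝓘(ℝ, E4) 𝓘(ℝ, E4).tangent ∞
      (fun q => (⟨q, (1 / 2 : ℝ) • (V q + s • K q (V q))⟩ : TangentBundle 𝓘(ℝ, E4) M)) x := by
  have hK := ContMDiffAt.comp x hg.smooth_end.contMDiffAt hV
  have h := contMDiffAt_tangent_sum_smul (f := fun q : M => q)
    (c := fun k _ => ![1 / 2, 1 / 2 * s] k) (v := fun k q => ![V q, K q (V q)] k) (z := x)
    contMDiffAt_id (fun k => contMDiffAt_const)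
    (fun k => by fin_cases k; exacts [hV, hK])
  refine h.congr_of_eventuallyEq (Filter.Eventually.of_forall fun q => ?_)
  simp [Fin.sum_univ_two, smul_smul]

/-- Near every point there is a smooth adapted frame: extend bases of the two eigenspaces, project
the extensions to the eigendistributions and dualize. -/
theorem exists_local_frame (hg : IsAlmostParaHermitian g K) (x₀ : M) :
    ∃ U : Set M, IsOpen U ∧ x₀ ∈ U ∧ ∃ e b : Fin 2 → ∀ x : M, TangentSpace 𝓘(ℝ, E4) x, ∀ x ∈ U,
      (∀ i, ContMDiffAt 𝓘(ℝ, E4) 𝓘(ℝ, E4).tangent ∞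
        (fun q => (⟨q, e i q⟩ : TangentBundle 𝓘(ℝ, E4) M)) x) ∧
      (∀ i, ContMDiffAt 𝓘(ℝ, E4) 𝓘(ℝ, E4).tangent ∞
        (fun q => (⟨q, b i q⟩ : TangentBundle 𝓘(ℝ, E4) M)) x) ∧
      ∃ f : AdaptedFrame g K x, (∀ i, f.e i = e i x) ∧ ∀ i, f.ebar i = b i x := by
  have : FiniteDimensional ℝ (TangentSpace 𝓘(ℝ, E4) x₀) := inferInstanceAs (FiniteDimensional ℝ E4)
  let e₀ := Module.finBasisOfFinrankEq ℝ _ (hg.rank_plus x₀)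
  let b₀ := Module.finBasisOfFinrankEq ℝ _ (hg.rank_minus x₀)
  choose V hV₀ hV using fun i => exists_smooth_extension x₀ (e₀ i : TangentSpace 𝓘(ℝ, E4) x₀)
  choose W hW₀ hW using fun i => exists_smooth_extension x₀ (b₀ i : TangentSpace 𝓘(ℝ, E4) x₀)
  -- projections of the extensions to the eigendistributions; at `x₀` they change nothing
  let e : Fin 2 → ∀ x : M, TangentSpace 𝓘(ℝ, E4) x := fun i x =>
    (1 / 2 : ℝ) • (V i x + (1 : ℝ) • K x (V i x))
  let w : Fin 2 → ∀ x : M, TangentSpace 𝓘(ℝ, E4) x := fun i x =>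
    (1 / 2 : ℝ) • (W i x + (-1 : ℝ) • K x (W i x))
  let G : M → Mat 2 := fun x => Matrix.of fun i j => g x (e i x) (w j x)
  -- the dual family, for the matrix `G` of the pairing
  let b : Fin 2 → ∀ x : M, TangentSpace 𝓘(ℝ, E4) x := fun j x => ∑ k, (G x)⁻¹ k j • w k x
  have he₀ : ∀ i, e i x₀ = e₀ i := by
    intro i
    have h1 : K x₀ (e₀ i) = (1 : ℝ) • (e₀ i : TangentSpace 𝓘(ℝ, E4) x₀) :=
      Module.End.mem_eigenspace_iff.1 (e₀ i).2
    simp only [e, hV₀, h1, one_smul]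
    rw [← two_smul ℝ, smul_smul]
    norm_num
  have hw₀ : ∀ i, w i x₀ = b₀ i := by
    intro i
    have h1 : K x₀ (b₀ i) = (-1 : ℝ) • (b₀ i : TangentSpace 𝓘(ℝ, E4) x₀) :=
      Module.End.mem_eigenspace_iff.1 (b₀ i).2
    simp only [w, hW₀, h1, smul_smul]
    rw [show (-1 : ℝ) * -1 = 1 by norm_num, one_smul, ← two_smul ℝ, smul_smul]
    norm_num
  have hKe : ∀ i x, K x (e i x) = e i x := by
    intro i x
    simp only [e, one_smul, map_smul, hg.para_add]
  have hKw : ∀ i x, K x (w i x) = -w i x := by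
    intro i x
    simp only [w, neg_one_smul, ← sub_eq_add_neg, map_smul, hg.para_sub, smul_neg]
  have hG₀ : (G x₀).det ≠ 0 := by
    have h1 := hg.det_pairing_ne_zero e₀ b₀
    simp only [← he₀, ← hw₀] at h1
    exact h1
  have hsm : ∀ᶠ x in 𝓝 x₀, (∀ i, ContMDiffAt 𝓘(ℝ, E4) 𝓘(ℝ, E4).tangent ∞
        (fun q => (⟨q, e i q⟩ : TangentBundle 𝓘(ℝ, E4) M)) x) ∧
      (∀ i, ContMDiffAt 𝓘(ℝ, E4) 𝓘(ℝ, E4).tangent ∞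
        (fun q => (⟨q, w i q⟩ : TangentBundle 𝓘(ℝ, E4) M)) x) := by
    filter_upwards [Filter.eventually_all.2 hV, Filter.eventually_all.2 hW] with x h1 h2
    exact ⟨fun i => contMDiffAt_para_proj hg 1 (h1 i),
      fun i => contMDiffAt_para_proj hg (-1) (h2 i)⟩
  have hGs : ∀ x, ((∀ i, ContMDiffAt 𝓘(ℝ, E4) 𝓘(ℝ, E4).tangent ∞
        (fun q => (⟨q, e i q⟩ : TangentBundle 𝓘(ℝ, E4) M)) x) ∧
      (∀ i, ContMDiffAt 𝓘(ℝ, E4) 𝓘(ℝ, E4).tangent ∞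
        (fun q => (⟨q, w i q⟩ : TangentBundle 𝓘(ℝ, E4) M)) x)) →
      ∀ i j, ContMDiffAt 𝓘(ℝ, E4) 𝓘(ℝ, ℝ) ∞ (fun q => G q i j) x := fun x h i j =>
    SmoothBilinAt.contMDiffAt_apply (f := fun q : M => q) (hg.smooth_metric x) contMDiffAt_id
      (h.1 i) (h.2 j)
  have hdet : ∀ᶠ x in 𝓝 x₀, (G x).det ≠ 0 := by
    have h1 : ContinuousAt (fun x => (G x).det) x₀ := by
      simp only [Matrix.det_fin_two]
      have h2 := fun i j => (hGs x₀ hsm.self_of_nhds i j).continuousAt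
      exact ((h2 0 0).mul (h2 1 1)).sub ((h2 0 1).mul (h2 1 0))
    exact h1.eventually_ne hG₀
  obtain ⟨U, hU, hUo, hxU⟩ := eventually_nhds_iff.1 (hsm.and hdet)
  refine ⟨U, hUo, hxU, e, b, fun x hx => ?_⟩
  obtain ⟨hs, hd⟩ := hU x hx
  have hinv : ∀ i j, ∑ k, G x i k * (G x)⁻¹ k j = if i = j then 1 else 0 := by
    intro i j
    rw [← Matrix.mul_apply, Matrix.mul_nonsing_inv _ (isUnit_iff_ne_zero.2 hd), Matrix.one_apply]
  have hebx : ∀ i j, g x (e i x) (b j x) = if i = j then 1 else 0 := by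
    intro i j
    rw [← hinv i j]
    simp only [b, map_sum, map_smul, smul_eq_mul]
    exact Finset.sum_congr rfl fun k _ => mul_comm _ _
  have hKb : ∀ j, K x (b j x) = -b j x := by
    intro j
    simp only [b, map_sum, map_smul, hKw, smul_neg, Finset.sum_neg_distrib]
  refine ⟨hs.1, fun j => ?_, ⟨fun i => e i x, fun j => b j x, fun i j => ?_, fun i j => ?_, hebx,
    fun i j => ?_, fun i => hKe i x, hKb⟩, fun i => rfl, fun j => rfl⟩
  · refine contMDiffAt_tangent_sum_smul (f := fun q : M => q) (c := fun k q => (G q)⁻¹ k j)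
      contMDiffAt_id (fun k => ?_) hs.2
    have hq := hGs x hs
    have hdt : ContMDiffAt 𝓘(ℝ, E4) 𝓘(ℝ, ℝ) ∞ (fun q => (G q).det) x := by
      simp only [Matrix.det_fin_two]
      exact ((hq 0 0).mul (hq 1 1)).sub ((hq 0 1).mul (hq 1 0))
    have hdi : ContMDiffAt 𝓘(ℝ, E4) 𝓘(ℝ, ℝ) ∞ (fun q => ((G q).det)⁻¹) x :=
      ContMDiffAt.comp (g := fun r : ℝ => r⁻¹) x (contDiffAt_inv ℝ hd).contMDiffAt hdt
    simp only [Matrix.inv_def, Ring.inverse_eq_inv', Matrix.smul_apply, smul_eq_mul,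
      Matrix.adjugate_fin_two]
    refine hdi.mul ?_
    fin_cases k <;> fin_cases j
    exacts [hq 1 1, (hq 0 1).neg, (hq 1 0).neg, hq 0 0]
  · exact hg.inner_eq_zero (ε := 1) (by norm_num) ((hKe i x).trans (one_smul ℝ _).symm)
      ((hKe j x).trans (one_smul ℝ _).symm)
  · exact hg.inner_eq_zero (ε := -1) (by norm_num) ((hKb i).trans (neg_one_smul ℝ _).symm)
      ((hKb j).trans (neg_one_smul ℝ _).symm)
  · rw [hg.symm, hebx j i]
    simp only [eq_comm]

/-- A family of adapted frames is smooth at a point. -/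
structure SmoothFrameAt (σ : ∀ x : M, AdaptedFrame g K x) (x : M) : Prop where
  e : ∀ i, ContMDiffAt 𝓘(ℝ, E4) 𝓘(ℝ, E4).tangent ∞
    (fun q => (⟨q, (σ q).e i⟩ : TangentBundle 𝓘(ℝ, E4) M)) x
  ebar : ∀ i, ContMDiffAt 𝓘(ℝ, E4) 𝓘(ℝ, E4).tangent ∞
    (fun q => (⟨q, (σ q).ebar i⟩ : TangentBundle 𝓘(ℝ, E4) M)) x

/-- Smooth local adapted frames exist. The family is extended by arbitrary adapted frames outside of
the neighbourhood. -/
theorem exists_smoothFrameAt (hg : IsAlmostParaHermitian g K) (x₀ : M) :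
    ∃ U : Set M, IsOpen U ∧ x₀ ∈ U ∧ ∃ σ : ∀ x : M, AdaptedFrame g K x,
      ∀ x ∈ U, SmoothFrameAt σ x := by
  have hpt : ∀ x : M, Nonempty (AdaptedFrame g K x) := by
    intro x
    obtain ⟨U, -, hx, e, b, h⟩ := exists_local_frame hg x
    obtain ⟨-, -, f, -⟩ := h x hx
    exact ⟨f⟩
  obtain ⟨U, hU, hx₀, e, b, h⟩ := exists_local_frame hg x₀
  have hσ : ∀ x : M, ∃ f : AdaptedFrame g K x, x ∈ U →
      (∀ i, f.e i = e i x) ∧ ∀ i, f.ebar i = b i x := by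
    intro x
    by_cases hx : x ∈ U
    · obtain ⟨-, -, f, hf⟩ := h x hx
      exact ⟨f, fun _ => hf⟩
    · exact ⟨(hpt x).some, fun hx' => absurd hx' hx⟩
  choose σ hσ using hσ
  refine ⟨U, hU, hx₀, σ, fun x hx => ⟨fun i => ?_, fun i => ?_⟩⟩
  · refine ((h x hx).1 i).congr_of_eventuallyEq ?_
    filter_upwards [hU.mem_nhds hx] with q hq
    rw [(hσ q hq).1 i]
  · refine ((h x hx).2.1 i).congr_of_eventuallyEq ?_
    filter_upwards [hU.mem_nhds hx] with q hq
    rw [(hσ q hq).2 i]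

end Frames

/-! ### The Levi-Civita connection form of a local adapted frame -/

section LinearAlgebra

/-- The connection form of a para-Kähler structure in a local adapted frame `(e, b)` with dual
coframe `(A, B)`, in terms of the exterior derivatives `dA`, `dB` of the coframe: its coefficients
are those forced by the mixed components `(e, b)` of the structure equations. -/
def splitConn (e b : Fin 2 → E4) (A B : Fin 2 → E4 →L[ℝ] ℝ)
    (dA dB : Fin 2 → E4 →ₗ[ℝ] E4 →ₗ[ℝ] ℝ) (k j : Fin 2) : E4 →L[ℝ] ℝ :=
  ∑ m, (dB j (e m) (b k) • A m - dA k (b m) (e j) • B m)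

variable {e b : Fin 2 → E4} {A B : Fin 2 → E4 →L[ℝ] ℝ} {dA dB : Fin 2 → E4 →ₗ[ℝ] E4 →ₗ[ℝ] ℝ}

/-- An alternating form in terms of its components in the frame `(e, b)`. -/
theorem alternating_expand (hexp : ∀ v : E4, v = (∑ i, A i v • e i) + ∑ i, B i v • b i)
    (T : E4 →ₗ[ℝ] E4 →ₗ[ℝ] ℝ) (hT : ∀ v w, T v w = -T w v) (v w : E4) :
    T v w = (∑ m, ∑ n, A m v * A n w * T (e m) (e n))
      + (∑ m, ∑ n, B m v * B n w * T (b m) (b n))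
      + ∑ m, ∑ n, (A m v * B n w - A m w * B n v) * T (e m) (b n) := by
  conv_lhs => rw [hexp v, hexp w]
  have h1 : ∀ m n, T (b m) (e n) = -T (e n) (b m) := fun m n => hT _ _
  simp only [Fin.sum_univ_two, map_add, map_smul, LinearMap.add_apply, LinearMap.smul_apply,
    smul_eq_mul, h1]
  ring

/-- The first structure equation `dA = - Γ ∧ A`. The mixed components hold by the choice of
`splitConn`; the hypothesis `h0` expresses the integrability of the span of `b`, and `h1` the
closedness of `Σ Aᵏ ∧ Bₖ`. -/
theorem splitConn_torsion (hexp : ∀ v : E4, v = (∑ i, A i v • e i) + ∑ i, B i v • b i)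
    (hA : ∀ k v w, dA k v w = -dA k w v) (h0 : ∀ k m n, dA k (b m) (b n) = 0)
    (h1 : ∀ k m n, dA k (e m) (e n) = dB m (e n) (b k) - dB n (e m) (b k)) (k : Fin 2) (v w : E4) :
    dA k v w
      = -∑ l, (splitConn e b A B dA dB k l v * A l w - splitConn e b A B dA dB k l w * A l v) := by
  rw [alternating_expand hexp _ (hA k)]
  have h2 : ∀ m n, dA k (b m) (e n) = -dA k (e n) (b m) := fun m n => hA _ _ _
  simp only [splitConn, h0, h1, h2, Fin.sum_univ_two, add_apply, sub_apply, smul_apply,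
    smul_eq_mul]
  ring

/-- The structure equation `dB = Γᵀ ∧ B` of the conjugate coframe. -/
theorem splitConn_torsion_bar (hexp : ∀ v : E4, v = (∑ i, A i v • e i) + ∑ i, B i v • b i)
    (hB : ∀ k v w, dB k v w = -dB k w v) (h0 : ∀ k m n, dB k (e m) (e n) = 0)
    (h1 : ∀ j m n, dB j (b m) (b n) = dA m (b n) (e j) - dA n (b m) (e j)) (j : Fin 2) (v w : E4) :
    dB j v w
      = ∑ k, (splitConn e b A B dA dB k j v * B k w - splitConn e b A B dA dB k j w * B k v) := by
  rw [alternating_expand hexp _ (hB j)]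
  simp only [splitConn, h0, h1, Fin.sum_univ_two, add_apply, sub_apply, smul_apply, smul_eq_mul]
  ring

end LinearAlgebra

section Forms

variable {E : Type*} [NormedAddCommGroup E] [NormedSpace ℝ E]
  {N : Type*} [TopologicalSpace N] [ChartedSpace E N] [IsManifold 𝓘(ℝ, E) ∞ N]

/-- The exterior derivative at a point, as a bilinear map on the model space. -/
def dBilin (θ : FormField E N) (x : N) : E →ₗ[ℝ] E →ₗ[ℝ] ℝ :=
  LinearMap.mk₂ ℝ (fun v w => dOne θ x v w)
    (fun v v' w => by simp only [dOne, map_add, add_apply]; ring)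
    (fun c v w => by simp only [dOne, map_smul, smul_apply, smul_eq_mul]; ring)
    (fun v w w' => by simp only [dOne, map_add, add_apply]; ring)
    (fun c v w => by simp only [dOne, map_smul, smul_apply, smul_eq_mul]; ring)

theorem dOne_swap (θ : FormField E N) (x : N) (v w : E) : dOne θ x v w = -dOne θ x w v := by
  simp [dOne]

theorem dOne_congr_point (θ : FormField E N) {p q : N} (h : p = q) (v w : E) :
    dOne θ p v w = dOne θ q v w := by
  subst h; rfl

/-- The exterior derivative of a smooth form is smooth. -/
theorem contMDiffAt_dOne_apply [FiniteDimensional ℝ E] {θ : FormField E N} {x : N}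
    {X Y : ∀ q : N, TangentSpace 𝓘(ℝ, E) q} (hθ : ∀ᶠ q in 𝓝 x, SmoothFormAt θ q)
    (hX : ContMDiffAt 𝓘(ℝ, E) 𝓘(ℝ, E).tangent ∞ (fun q => (⟨q, X q⟩ : TangentBundle 𝓘(ℝ, E) N)) x)
    (hY : ContMDiffAt 𝓘(ℝ, E) 𝓘(ℝ, E).tangent ∞ (fun q => (⟨q, Y q⟩ : TangentBundle 𝓘(ℝ, E) N)) x) :
    ContMDiffAt 𝓘(ℝ, E) 𝓘(ℝ, ℝ) ∞ (fun q => dOne θ q (X q) (Y q)) x := by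
  set κ := extChartAt 𝓘(ℝ, E) x with hκ
  have hsrc : ∀ᶠ q in 𝓝 x, q ∈ κ.source := extChartAt_source_mem_nhds (I := 𝓘(ℝ, E)) x
  have hκs : ∀ q ∈ κ.source, ContMDiffAt 𝓘(ℝ, E) 𝓘(ℝ, E) ∞ κ q := fun q hq =>
    contMDiffAt_extChartAt' (by rwa [hκ, extChartAt_source] at hq)
  have hκx : ContMDiffAt 𝓘(ℝ, E) 𝓘(ℝ, E) ∞ κ x := hκs x hsrc.self_of_nhds
  have hd : ∀ {Z : ∀ q : N, TangentSpace 𝓘(ℝ, E) q},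
      ContMDiffAt 𝓘(ℝ, E) 𝓘(ℝ, E).tangent ∞ (fun q => (⟨q, Z q⟩ : TangentBundle 𝓘(ℝ, E) N)) x →
      ContMDiffAt 𝓘(ℝ, E) 𝓘(ℝ, E) ∞ (fun q => vecDeriv κ q (Z q)) x := fun hZ =>
    contMDiffAt_vecDeriv_apply hZ (hsrc.mono hκs)
  have hform : ContMDiffAt 𝓘(ℝ, E) 𝓘(ℝ, E →L[ℝ] E →L[ℝ] ℝ) ∞
      (fun q => fderiv ℝ (oneFormInChart θ x) (κ q)) x := by
    have h1 : ContDiffAt ℝ ∞ (fderiv ℝ (oneFormInChart θ x)) (κ x) :=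
      hθ.self_of_nhds.contDiffAt_self.fderiv_right (m := ∞) (by simp)
    exact ContMDiffAt.comp (g := fderiv ℝ (oneFormInChart θ x)) x h1.contMDiffAt hκx
  have key : ContMDiffAt 𝓘(ℝ, E) 𝓘(ℝ, ℝ) ∞ (fun q =>
      dVec (oneFormInChart θ x) (κ q) (vecDeriv κ q (X q)) (vecDeriv κ q (Y q))) x :=
    ((hform.clm_apply (hd hX)).clm_apply (hd hY)).sub ((hform.clm_apply (hd hY)).clm_apply (hd hX))
  refine key.congr_of_eventuallyEq ?_
  filter_upwards [hsrc, hθ] with q hq hθq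
  have hinv : κ.symm (κ q) = q := κ.left_inv hq
  rw [dVec_oneFormInChart (κ.map_source hq) (by rw [hinv]; exact hθq)]
  refine Eq.trans ?_ (congrArg₂ (fun a b : E => dOne θ (κ.symm (κ q)) a b)
    (chartInvDeriv_mfderiv hq (X q)) (chartInvDeriv_mfderiv hq (Y q))).symm
  exact (dOne_congr_point θ hinv _ _).symm

/-- A linear combination of smooth forms with smooth coefficients is smooth. -/
theorem SmoothFormAt.sum_smul {κ : Type*} [Fintype κ] {θ : FormField E N}
    {h : κ → N → ℝ} {β : κ → FormField E N} {p : N}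
    (hh : ∀ k, ContMDiffAt 𝓘(ℝ, E) 𝓘(ℝ, ℝ) ∞ (h k) p) (hβ : ∀ k, SmoothFormAt (β k) p)
    (heq : ∀ᶠ q in 𝓝 p, ∀ v, θ q v = ∑ k, h k q * β k q v) : SmoothFormAt θ p := by
  intro v
  have hπ : ContMDiffAt 𝓘(ℝ, E).tangent 𝓘(ℝ, E) ∞
      (fun ξ : TangentBundle 𝓘(ℝ, E) N => ξ.1) ⟨p, v⟩ :=
    (contMDiff_proj (TangentSpace 𝓘(ℝ, E))).contMDiffAt
  have h1 : ContMDiffAt 𝓘(ℝ, E).tangent 𝓘(ℝ, ℝ) ∞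
      (fun ξ : TangentBundle 𝓘(ℝ, E) N => ∑ k, h k ξ.1 * β k ξ.1 ξ.2) ⟨p, v⟩ :=
    contMDiffAt_finsetSum fun k _ => (ContMDiffAt.comp (⟨p, v⟩ : TangentBundle 𝓘(ℝ, E) N)
      (hh k) hπ).mul (hβ k v)
  refine h1.congr_of_eventuallyEq ?_
  filter_upwards [hπ.continuousAt.eventually heq] with ξ hξ
  exact hξ ξ.2

end Forms

section LocalConnection

variable {M : Type u} [TopologicalSpace M] [ChartedSpace E4 M] [IsManifold 𝓘(ℝ, E4) ∞ M]
  {g : BilinField M} {K : EndField M}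

/-- The forms `αⁱ` of the coframe dual to a family of adapted frames. -/
def frameForm (σ : ∀ x : M, AdaptedFrame g K x) (i : Fin 2) : FormField E4 M := fun x =>
  g x ((σ x).ebar i)

/-- The forms `ᾱⁱ` of the coframe dual to a family of adapted frames. -/
def frameFormBar (σ : ∀ x : M, AdaptedFrame g K x) (i : Fin 2) : FormField E4 M := fun x =>
  g x ((σ x).e i)

/-- The connection form of a family of adapted frames. -/
def localConn (σ : ∀ x : M, AdaptedFrame g K x) (k j : Fin 2) : FormField E4 M := fun x =>
  splitConn (σ x).eVec (σ x).bVec (fun i => frameForm σ i x) (fun i => frameFormBar σ i x)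
    (fun i => dBilin (frameForm σ i) x) (fun i => dBilin (frameFormBar σ i) x) k j

variable {σ : ∀ x : M, AdaptedFrame g K x} {x : M}

theorem smoothFormAt_frameForm (hg : IsAlmostParaHermitian g K) (hσ : SmoothFrameAt σ x)
    (i : Fin 2) : SmoothFormAt (frameForm σ i) x := fun v =>
  SmoothBilinAt.contMDiffAt_apply (f := fun ξ : TangentBundle 𝓘(ℝ, E4) M => ξ.1)
    (v := fun ξ => (σ ξ.1).ebar i) (w := fun ξ => ξ.2) (z := ⟨x, v⟩) (hg.smooth_metric x)
    (contMDiff_proj (TangentSpace 𝓘(ℝ, E4))).contMDiffAt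
    (ContMDiffAt.comp (⟨x, v⟩ : TangentBundle 𝓘(ℝ, E4) M) (hσ.ebar i)
      (contMDiff_proj (TangentSpace 𝓘(ℝ, E4))).contMDiffAt) contMDiffAt_id

theorem smoothFormAt_frameFormBar (hg : IsAlmostParaHermitian g K) (hσ : SmoothFrameAt σ x)
    (i : Fin 2) : SmoothFormAt (frameFormBar σ i) x := fun v =>
  SmoothBilinAt.contMDiffAt_apply (f := fun ξ : TangentBundle 𝓘(ℝ, E4) M => ξ.1)
    (v := fun ξ => (σ ξ.1).e i) (w := fun ξ => ξ.2) (z := ⟨x, v⟩) (hg.smooth_metric x)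
    (contMDiff_proj (TangentSpace 𝓘(ℝ, E4))).contMDiffAt
    (ContMDiffAt.comp (⟨x, v⟩ : TangentBundle 𝓘(ℝ, E4) M) (hσ.e i)
      (contMDiff_proj (TangentSpace 𝓘(ℝ, E4))).contMDiffAt) contMDiffAt_id

theorem smoothFormAt_localConn (hg : IsAlmostParaHermitian g K)
    (hσ : ∀ᶠ q in 𝓝 x, SmoothFrameAt σ q) (k j : Fin 2) : SmoothFormAt (localConn σ k j) x := by
  have h0 := hσ.self_of_nhds
  let c : Fin 2 ⊕ Fin 2 → M → ℝ := Sum.elim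
    (fun m q => dOne (frameFormBar σ j) q ((σ q).e m) ((σ q).ebar k))
    (fun m q => -dOne (frameForm σ k) q ((σ q).ebar m) ((σ q).e j))
  let β : Fin 2 ⊕ Fin 2 → FormField E4 M := Sum.elim (frameForm σ) (frameFormBar σ)
  refine SmoothFormAt.sum_smul (h := c) (β := β) (fun m => ?_) (fun m => ?_)
    (Filter.Eventually.of_forall fun q v => ?_)
  · rcases m with m | m
    · exact contMDiffAt_dOne_apply (hσ.mono fun q hq => smoothFormAt_frameFormBar hg hq j)
        (h0.e m) (h0.ebar k)
    · exact (contMDiffAt_dOne_apply (hσ.mono fun q hq => smoothFormAt_frameForm hg hq k)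
        (h0.ebar m) (h0.e j)).neg
  · rcases m with m | m
    · exact smoothFormAt_frameForm hg h0 m
    · exact smoothFormAt_frameFormBar hg h0 m
  · rw [Fintype.sum_sum_type]
    change (∑ m, (dBilin (frameFormBar σ j) q ((σ q).eVec m) ((σ q).bVec k) • frameForm σ m q
      - dBilin (frameForm σ k) q ((σ q).bVec m) ((σ q).eVec j) • frameFormBar σ m q :
        E4 →L[ℝ] ℝ)) v = _
    rw [sum_apply, ← Finset.sum_add_distrib]
    refine Finset.sum_congr rfl fun m _ => ?_
    rw [sub_apply, smul_apply, smul_apply, sub_eq_add_neg, smul_eq_mul, smul_eq_mul, ← neg_mul]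
    rfl

/-- Expansion of a vector in an adapted frame. -/
theorem frame_expand (hg : IsAlmostParaHermitian g K) (f : AdaptedFrame g K x) (v : E4) :
    v = (∑ i, bilinAt g x (f.bVec i) v • f.eVec i) + ∑ i, bilinAt g x (f.eVec i) v • f.bVec i :=
  split_frame_expand (B := bilinAt g x) (hg.symm x) f.g_e_e f.g_ebar_ebar f.g_e_ebar v

/-- `ρ = Σ αᵏ ∧ ᾱₖ`. -/
theorem fundForm_eq_frame (hg : IsAlmostParaHermitian g K) (q : M)
    (v w : TangentSpace 𝓘(ℝ, E4) q) : fundForm g K q v w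
      = ∑ k, (frameForm σ k q v * frameFormBar σ k q w
        - frameFormBar σ k q v * frameForm σ k q w) := by
  refine (bilinAt_eq_frame hg (σ q) (K q v) w).trans (Finset.sum_congr rfl fun k _ => ?_)
  obtain ⟨h1, h2⟩ := (σ q).inner_para hg v k
  refine (congrArg₂ (fun a b : ℝ => a * bilinAt g q ((σ q).bVec k) w
    + bilinAt g q ((σ q).eVec k) w * b) h2 h1).trans ?_
  change -(frameFormBar σ k q v) * frameForm σ k q w + frameFormBar σ k q w * frameForm σ k q v = _
  ring

/-- Integrability of the eigendistribution for `-1`. -/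
theorem dOne_frameForm_ebar (hg : IsParaKahler g K) (hσ : ∀ᶠ q in 𝓝 x, SmoothFrameAt σ q)
    (k m n : Fin 2) : dOne (frameForm σ k) x ((σ x).ebar m) ((σ x).ebar n) = 0 := by
  obtain ⟨U, hU, hUo, hx⟩ := eventually_nhds_iff.1 hσ
  have h0 := hσ.self_of_nhds
  rw [dOne_eq_neg_mlieBracket (X := fun q => (σ q).ebar m) (Y := fun q => (σ q).ebar n)
    (smoothFormAt_frameForm hg.toIsAlmostParaHermitian h0 k) (h0.ebar m) (h0.ebar n)
    (Filter.Eventually.of_forall fun q => ⟨(σ q).g_ebar_ebar k m, (σ q).g_ebar_ebar k n⟩)]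
  have hmem : ∀ q i, (σ q).ebar i ∈ eigenDist K (-1) q := fun q i =>
    Module.End.mem_eigenspace_iff.2 (((σ q).K_ebar i).trans (neg_one_smul ℝ _).symm)
  have h1 := hg.involutive_minus U _ _ hUo
    (fun q hq => ((hU q hq).ebar m).contMDiffWithinAt)
    (fun q hq => ((hU q hq).ebar n).contMDiffWithinAt)
    (fun q _ => ⟨hmem q m, hmem q n⟩) x hx
  refine neg_eq_zero.2 ?_
  exact hg.toIsAlmostParaHermitian.inner_eq_zero (ε := -1) (by norm_num)
    (Module.End.mem_eigenspace_iff.1 (hmem x k)) (Module.End.mem_eigenspace_iff.1 h1)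

/-- Integrability of the eigendistribution for `1`. -/
theorem dOne_frameFormBar_e (hg : IsParaKahler g K) (hσ : ∀ᶠ q in 𝓝 x, SmoothFrameAt σ q)
    (k m n : Fin 2) : dOne (frameFormBar σ k) x ((σ x).e m) ((σ x).e n) = 0 := by
  obtain ⟨U, hU, hUo, hx⟩ := eventually_nhds_iff.1 hσ
  have h0 := hσ.self_of_nhds
  rw [dOne_eq_neg_mlieBracket (X := fun q => (σ q).e m) (Y := fun q => (σ q).e n)
    (smoothFormAt_frameFormBar hg.toIsAlmostParaHermitian h0 k) (h0.e m) (h0.e n)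
    (Filter.Eventually.of_forall fun q => ⟨(σ q).g_e_e k m, (σ q).g_e_e k n⟩)]
  have hmem : ∀ q i, (σ q).e i ∈ eigenDist K 1 q := fun q i =>
    Module.End.mem_eigenspace_iff.2 (((σ q).K_e i).trans (one_smul ℝ _).symm)
  have h1 := hg.involutive_plus U _ _ hUo
    (fun q hq => ((hU q hq).e m).contMDiffWithinAt)
    (fun q hq => ((hU q hq).e n).contMDiffWithinAt)
    (fun q _ => ⟨hmem q m, hmem q n⟩) x hx
  refine neg_eq_zero.2 ?_
  exact hg.toIsAlmostParaHermitian.inner_eq_zero (ε := 1) (by norm_num)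
    (Module.End.mem_eigenspace_iff.1 (hmem x k)) (Module.End.mem_eigenspace_iff.1 h1)

/-- The closedness of `ρ`, expressed in an adapted frame. -/
theorem closed_frame (hg : IsParaKahler g K) (hσ : SmoothFrameAt σ x)
    (v₁ v₂ v₃ : TangentSpace 𝓘(ℝ, E4) x) :
    ∑ k, (dOne (frameForm σ k) x v₁ v₂ * frameFormBar σ k x v₃
      - dOne (frameForm σ k) x v₁ v₃ * frameFormBar σ k x v₂
      + dOne (frameForm σ k) x v₂ v₃ * frameFormBar σ k x v₁
      - (frameForm σ k x v₁ * dOne (frameFormBar σ k) x v₂ v₃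
        - frameForm σ k x v₂ * dOne (frameFormBar σ k) x v₁ v₃
        + frameForm σ k x v₃ * dOne (frameFormBar σ k) x v₁ v₂)) = 0 := by
  rw [← hg.closed x v₁ v₂ v₃]
  exact (dTwo_sum_wedge
    (fun k => smoothFormAt_frameForm hg.toIsAlmostParaHermitian hσ k)
    (fun k => smoothFormAt_frameFormBar hg.toIsAlmostParaHermitian hσ k)
    (Filter.Eventually.of_forall fun q v w => fundForm_eq_frame hg.toIsAlmostParaHermitian q v w)
    v₁ v₂ v₃).symm

theorem frameForm_e (k m : Fin 2) : frameForm σ k x ((σ x).e m) = if k = m then 1 else 0 :=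
  (σ x).g_ebar_e k m

theorem frameForm_ebar (k m : Fin 2) : frameForm σ k x ((σ x).ebar m) = 0 :=
  (σ x).g_ebar_ebar k m

theorem frameFormBar_e (k m : Fin 2) : frameFormBar σ k x ((σ x).e m) = 0 :=
  (σ x).g_e_e k m

theorem frameFormBar_ebar (k m : Fin 2) :
    frameFormBar σ k x ((σ x).ebar m) = if k = m then 1 else 0 :=
  (σ x).g_e_ebar k m

/-- The component of `dρ = 0` on two vectors `e` and one vector `ē`. -/
theorem dOne_frameForm_e (hg : IsParaKahler g K) (hσ : SmoothFrameAt σ x) (k m n : Fin 2) :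
    dOne (frameForm σ k) x ((σ x).e m) ((σ x).e n)
      = dOne (frameFormBar σ m) x ((σ x).e n) ((σ x).ebar k)
        - dOne (frameFormBar σ n) x ((σ x).e m) ((σ x).ebar k) := by
  have h := closed_frame hg hσ ((σ x).e m) ((σ x).e n) ((σ x).ebar k)
  simp only [frameForm_e, frameForm_ebar, frameFormBar_e, frameFormBar_ebar, mul_ite, mul_one,
    mul_zero, ite_mul, one_mul, zero_mul, sub_zero, add_zero, Finset.sum_sub_distrib,
    Finset.sum_ite_eq', Finset.mem_univ, if_true] at h
  linarith

/-- The component of `dρ = 0` on two vectors `ē` and one vector `e`. -/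
theorem dOne_frameFormBar_ebar (hg : IsParaKahler g K) (hσ : SmoothFrameAt σ x) (j m n : Fin 2) :
    dOne (frameFormBar σ j) x ((σ x).ebar m) ((σ x).ebar n)
      = dOne (frameForm σ m) x ((σ x).ebar n) ((σ x).e j)
        - dOne (frameForm σ n) x ((σ x).ebar m) ((σ x).e j) := by
  have h := closed_frame hg hσ ((σ x).ebar m) ((σ x).ebar n) ((σ x).e j)
  simp only [frameForm_e, frameForm_ebar, frameFormBar_e, frameFormBar_ebar, mul_ite, mul_one,
    mul_zero, ite_mul, one_mul, zero_mul, sub_zero, zero_sub, zero_add, Finset.sum_sub_distrib,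
    Finset.sum_add_distrib, Finset.sum_neg_distrib, Finset.sum_ite_eq', Finset.mem_univ,
    if_true] at h
  linarith

theorem localConn_torsion (hg : IsParaKahler g K) (hσ : ∀ᶠ q in 𝓝 x, SmoothFrameAt σ q)
    (k : Fin 2) (v w : TangentSpace 𝓘(ℝ, E4) x) : dOne (frameForm σ k) x v w
      = -∑ l, (localConn σ k l x v * frameForm σ l x w - localConn σ k l x w * frameForm σ l x v) :=
  splitConn_torsion (A := fun i => frameForm σ i x) (B := fun i => frameFormBar σ i x)
    (dA := fun i => dBilin (frameForm σ i) x) (dB := fun i => dBilin (frameFormBar σ i) x)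
    (frame_expand hg.toIsAlmostParaHermitian (σ x)) (fun i => dOne_swap (frameForm σ i) x)
    (dOne_frameForm_ebar hg hσ) (dOne_frameForm_e hg hσ.self_of_nhds) k v w

theorem localConn_torsion_bar (hg : IsParaKahler g K) (hσ : ∀ᶠ q in 𝓝 x, SmoothFrameAt σ q)
    (j : Fin 2) (v w : TangentSpace 𝓘(ℝ, E4) x) : dOne (frameFormBar σ j) x v w
      = ∑ k, (localConn σ k j x v * frameFormBar σ k x w
        - localConn σ k j x w * frameFormBar σ k x v) :=
  splitConn_torsion_bar (A := fun i => frameForm σ i x) (B := fun i => frameFormBar σ i x)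
    (dA := fun i => dBilin (frameForm σ i) x) (dB := fun i => dBilin (frameFormBar σ i) x)
    (frame_expand hg.toIsAlmostParaHermitian (σ x)) (fun i => dOne_swap (frameFormBar σ i) x)
    (dOne_frameFormBar_e hg hσ) (dOne_frameFormBar_ebar hg hσ.self_of_nhds) j v w

end LocalConnection

/-! ### The manifold of adapted frames -/

section GeneralLinear

/-- The invertible matrix with given entries. -/
def gl2Of : E22 → GL2 := (isOpenEmbedding_gl2Entries.toOpenPartialHomeomorph gl2Entries).symm

theorem gl2Of_gl2Entries (a : GL2) : gl2Of (gl2Entries a) = a :=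
  isOpenEmbedding_gl2Entries.toOpenPartialHomeomorph_left_inv

theorem gl2Entries_gl2Of {z : E22} (hz : z ∈ Set.range gl2Entries) : gl2Entries (gl2Of z) = z := by
  obtain ⟨a, rfl⟩ := hz
  rw [gl2Of_gl2Entries]

theorem contMDiff_gl2Entries : ContMDiff 𝓘(ℝ, E22) 𝓘(ℝ, E22) ∞ gl2Entries :=
  contMDiff_isOpenEmbedding isOpenEmbedding_gl2Entries

theorem contMDiffAt_gl2Of {z : E22} (hz : z ∈ Set.range gl2Entries) :
    ContMDiffAt 𝓘(ℝ, E22) 𝓘(ℝ, E22) ∞ gl2Of z :=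
  (contMDiffOn_isOpenEmbedding_symm isOpenEmbedding_gl2Entries).contMDiffAt
    (isOpenEmbedding_gl2Entries.isOpen_range.mem_nhds hz)

theorem contMDiffAt_entries_iff {D H X : Type*} [NormedAddCommGroup D] [NormedSpace ℝ D]
    [TopologicalSpace H] {J : ModelWithCorners ℝ D H} [TopologicalSpace X] [ChartedSpace H X]
    {f : X → E22} {x : X} : ContMDiffAt J 𝓘(ℝ, E22) ∞ f x
      ↔ ∀ i j, ContMDiffAt J 𝓘(ℝ, ℝ) ∞ (fun z => f z i j) x := by
  rw [contMDiffAt_pi_space]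
  exact forall_congr' fun i => contMDiffAt_pi_space

end GeneralLinear

section Coordinates

variable {M : Type u} [TopologicalSpace M] [ChartedSpace E4 M] [IsManifold 𝓘(ℝ, E4) ∞ M]
  {g : BilinField M} {K : EndField M} {x : M}

/-- The vectors of an adapted frame in terms of another adapted frame at the same point. -/
theorem AdaptedFrame.e_expand (hg : IsAlmostParaHermitian g K) (σ f : AdaptedFrame g K x)
    (j : Fin 2) : f.e j = ∑ i, g x (σ.ebar i) (f.e j) • σ.e i := by
  have h1 := frame_expand hg σ (f.eVec j)
  have h2 : ∀ i, bilinAt g x (σ.eVec i) (f.eVec j) = 0 := fun i =>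
    hg.inner_eq_zero (ε := 1) (by norm_num) ((σ.K_e i).trans (one_smul ℝ _).symm)
      ((f.K_e j).trans (one_smul ℝ _).symm)
  simp only [h2, zero_smul, Finset.sum_const_zero, add_zero] at h1
  exact h1

theorem AdaptedFrame.ebar_expand (hg : IsAlmostParaHermitian g K) (σ f : AdaptedFrame g K x)
    (j : Fin 2) : f.ebar j = ∑ i, g x (f.ebar j) (σ.e i) • σ.ebar i := by
  have h1 := frame_expand hg σ (f.bVec j)
  have h2 : ∀ i, bilinAt g x (σ.bVec i) (f.bVec j) = 0 := fun i =>
    hg.inner_eq_zero (ε := -1) (by norm_num) ((σ.K_ebar i).trans (neg_one_smul ℝ _).symm)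
      ((f.K_ebar j).trans (neg_one_smul ℝ _).symm)
  simp only [h2, zero_smul, Finset.sum_const_zero, zero_add] at h1
  refine h1.trans (Finset.sum_congr rfl fun i _ => ?_)
  exact congrArg (· • σ.bVec i) (hg.symm x (σ.e i) (f.ebar j))

/-- The comparison matrices of two adapted frames in the two orders are inverse to each other. -/
theorem AdaptedFrame.coord_mul_coord (hg : IsAlmostParaHermitian g K) (σ f : AdaptedFrame g K x) :
    (Matrix.of fun i j => g x (σ.ebar i) (f.e j) : Mat 2)
      * (Matrix.of fun i j => g x (f.ebar i) (σ.e j) : Mat 2) = 1 := by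
  ext i j
  rw [Matrix.mul_apply, Matrix.one_apply]
  refine Eq.trans ?_ (σ.g_ebar_e i j)
  conv_rhs => rw [f.e_expand hg σ j]
  rw [map_sum]
  refine Finset.sum_congr rfl fun k _ => ?_
  rw [map_smul, smul_eq_mul, mul_comm]
  rfl

/-- The matrix `ψ` with `f = σ · ψ`, for two adapted frames `σ`, `f` at the same point. -/
def AdaptedFrame.coord (hg : IsAlmostParaHermitian g K) (σ f : AdaptedFrame g K x) : GL2 where
  val := Matrix.of fun i j => g x (σ.ebar i) (f.e j)
  inv := Matrix.of fun i j => g x (f.ebar i) (σ.e j)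
  val_inv := AdaptedFrame.coord_mul_coord hg σ f
  inv_val := AdaptedFrame.coord_mul_coord hg f σ

theorem AdaptedFrame.act_coord (hg : IsAlmostParaHermitian g K) (σ f : AdaptedFrame g K x) :
    σ.act (σ.coord hg f) = f :=
  AdaptedFrame.ext (funext fun j => (AdaptedFrame.e_expand hg σ f j).symm)
    (funext fun j => (AdaptedFrame.ebar_expand hg σ f j).symm)

theorem AdaptedFrame.coord_act (hg : IsAlmostParaHermitian g K) (σ f : AdaptedFrame g K x)
    (a : GL2) : σ.coord hg (f.act a) = σ.coord hg f * a := by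
  refine Units.ext (Matrix.ext fun i j => ?_)
  rw [Units.val_mul, Matrix.mul_apply]
  change g x (σ.ebar i) (∑ k, (a : Mat 2) k j • f.e k) = _
  rw [map_sum]
  refine Finset.sum_congr rfl fun k _ => ?_
  rw [map_smul, smul_eq_mul, mul_comm]
  rfl

theorem AdaptedFrame.coord_self (hg : IsAlmostParaHermitian g K) (σ : AdaptedFrame g K x) :
    σ.coord hg σ = 1 :=
  Units.ext (Matrix.ext fun i j => (σ.g_ebar_e i j).trans (Matrix.one_apply).symm)

theorem AdaptedFrame.coord_act_self (hg : IsAlmostParaHermitian g K) (σ : AdaptedFrame g K x)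
    (a : GL2) : σ.coord hg (σ.act a) = a := by
  rw [coord_act, coord_self, one_mul]

end Coordinates

section Bundle

variable {M : Type u} [TopologicalSpace M] [ChartedSpace E4 M] [IsManifold 𝓘(ℝ, E4) ∞ M]
  {g : BilinField M} {K : EndField M}

/-- A choice of smooth adapted frames `frame x₀` on neighbourhoods `dom x₀` of all points `x₀`. The
frames `frame x₀` are defined everywhere, but only their values on `dom x₀` matter. -/
structure FrameAtlas (hg : IsAlmostParaHermitian g K) where
  dom : M → Set M
  isOpen_dom : ∀ x₀, IsOpen (dom x₀)
  mem_dom : ∀ x₀, x₀ ∈ dom x₀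
  dom_subset : ∀ x₀, dom x₀ ⊆ (chartAt E4 x₀).source
  frame : M → ∀ x : M, AdaptedFrame g K x
  smooth : ∀ x₀, ∀ x ∈ dom x₀, SmoothFrameAt (frame x₀) x

theorem exists_frameAtlas (hg : IsAlmostParaHermitian g K) : Nonempty (FrameAtlas hg) := by
  choose U hU hx σ hσ using exists_smoothFrameAt hg
  exact ⟨{
    dom := fun x => U x ∩ (chartAt E4 x).source
    isOpen_dom := fun x => (hU x).inter (chartAt E4 x).open_source
    mem_dom := fun x => ⟨hx x, mem_chart_source E4 x⟩
    dom_subset := fun x => Set.inter_subset_right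
    frame := σ
    smooth := fun x₀ x h => hσ x₀ x h.1 }⟩

variable {hg : IsAlmostParaHermitian g K}

/-- The set of adapted frames, with the smooth structure defined by a frame atlas. -/
def FrameAtlas.Total (_ : FrameAtlas hg) : Type u := AdaptedFrames g K

variable (L : FrameAtlas hg)

theorem AdaptedFrame.act_congr (σ : ∀ x : M, AdaptedFrame g K x) (a : GL2) {x y : M}
    (h : x = y) : (⟨x, (σ x).act a⟩ : AdaptedFrames g K) = ⟨y, (σ y).act a⟩ := by
  subst h; rfl

/-- The chart of the manifold of adapted frames over `dom x₀`: the coordinates of the base point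
and the matrix of the frame with respect to `frame x₀`. -/
def FrameAtlas.chart (x₀ : M) : PartialEquiv L.Total E8 where
  toFun p := (chartAt E4 x₀ p.1, gl2Entries ((L.frame x₀ p.1).coord hg p.2))
  invFun z := ⟨(chartAt E4 x₀).symm z.1, (L.frame x₀ _).act (gl2Of z.2)⟩
  source := {p | p.1 ∈ L.dom x₀}
  target := ((chartAt E4 x₀).target ∩ (chartAt E4 x₀).symm ⁻¹' L.dom x₀) ×ˢ Set.range gl2Entries
  map_source' p hp := by
    have hs := L.dom_subset x₀ hp
    refine ⟨⟨(chartAt E4 x₀).map_source hs, ?_⟩,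
      ⟨(L.frame x₀ p.1).coord hg p.2, rfl⟩⟩
    rw [Set.mem_preimage, (chartAt E4 x₀).left_inv hs]
    exact hp
  map_target' z hz := hz.1.2
  left_inv' p hp := by
    have hs := L.dom_subset x₀ hp
    dsimp only
    rw [gl2Of_gl2Entries]
    refine (AdaptedFrame.act_congr (L.frame x₀) _ ((chartAt E4 x₀).left_inv hs)).trans ?_
    rw [AdaptedFrame.act_coord]
    rfl
  right_inv' z hz := by
    dsimp only
    rw [(chartAt E4 x₀).right_inv hz.1.1, AdaptedFrame.coord_act_self, gl2Entries_gl2Of hz.2]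

/-- Change of charts: the transition map of the base, together with left multiplication by the
matrix comparing the two local frames. -/
theorem FrameAtlas.contDiffAt_transition (x₀ x₁ : M) {z : E8}
    (hz : z ∈ ((L.chart x₀).symm.trans (L.chart x₁)).source) :
    ContDiffAt ℝ ∞ ((L.chart x₀).symm.trans (L.chart x₁)) z := by
  obtain ⟨⟨⟨h1, h2⟩, h3⟩, h4⟩ := hz
  set κ₀ := chartAt E4 x₀
  set κ₁ := chartAt E4 x₁
  have hs₀ : ContMDiffAt 𝓘(ℝ, E4) 𝓘(ℝ, E4) ∞ κ₀.symm z.1 :=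
    (contMDiffOn_chart_symm (n := ∞)).contMDiffAt (κ₀.open_target.mem_nhds h1)
  have hs₀' : ContMDiffAt 𝓘(ℝ, E8) 𝓘(ℝ, E4) ∞ (fun z : E8 => κ₀.symm z.1) z :=
    ContMDiffAt.comp (g := κ₀.symm) (f := fun z : E8 => z.1) z hs₀ contDiffAt_fst.contMDiffAt
  have hs₁ : ContMDiffAt 𝓘(ℝ, E8) 𝓘(ℝ, E4) ∞ (fun z : E8 => κ₁ (κ₀.symm z.1)) z :=
    ContMDiffAt.comp (g := κ₁) z ((contMDiffOn_chart (n := ∞)).contMDiffAt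
      (κ₁.open_source.mem_nhds (L.dom_subset x₁ h4))) hs₀'
  have hc : ∀ i k, ContMDiffAt 𝓘(ℝ, E8) 𝓘(ℝ, ℝ) ∞ (fun z : E8 =>
      g (κ₀.symm z.1) ((L.frame x₁ (κ₀.symm z.1)).ebar i) ((L.frame x₀ (κ₀.symm z.1)).e k)) z := by
    intro i k
    exact SmoothBilinAt.contMDiffAt_apply (f := fun z : E8 => κ₀.symm z.1)
      (v := fun z => (L.frame x₁ (κ₀.symm z.1)).ebar i)
      (w := fun z => (L.frame x₀ (κ₀.symm z.1)).e k) (hg.smooth_metric _) hs₀'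
      (ContMDiffAt.comp z ((L.smooth x₁ _ h4).ebar i) hs₀')
      (ContMDiffAt.comp z ((L.smooth x₀ _ h2).e k) hs₀')
  have hm : ∀ i j, ContDiffAt ℝ ∞ (fun z : E8 => ∑ k,
      g (κ₀.symm z.1) ((L.frame x₁ (κ₀.symm z.1)).ebar i) ((L.frame x₀ (κ₀.symm z.1)).e k)
        * z.2 k j) z := fun i j =>
    ContDiffAt.sum fun k _ => (hc i k).contDiffAt.mul (by fun_prop)
  have key : ContDiffAt ℝ ∞ (fun z : E8 => ((κ₁ (κ₀.symm z.1), fun (i j : Fin 2) => ∑ k : Fin 2,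
      g (κ₀.symm z.1) ((L.frame x₁ (κ₀.symm z.1)).ebar i) ((L.frame x₀ (κ₀.symm z.1)).e k)
        * z.2 k j) : E4 × E22)) z :=
    hs₁.contDiffAt.prodMk (contDiffAt_pi.2 fun i => contDiffAt_pi.2 fun j => hm i j)
  have hr : ∀ᶠ w : E8 in 𝓝 z, w.2 ∈ Set.range gl2Entries :=
    continuousAt_snd.eventually (isOpenEmbedding_gl2Entries.isOpen_range.mem_nhds h3)
  refine key.congr_of_eventuallyEq (hr.mono fun w hw => Prod.ext rfl ?_)
  funext i j
  change ((L.frame x₁ _).coord hg ((L.frame x₀ _).act (gl2Of w.2)) : Mat 2) i j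
    = ∑ k : Fin 2, g (κ₀.symm w.1) ((L.frame x₁ (κ₀.symm w.1)).ebar i)
      ((L.frame x₀ (κ₀.symm w.1)).e k) * w.2 k j
  rw [AdaptedFrame.coord_act, Units.val_mul, Matrix.mul_apply]
  refine Finset.sum_congr rfl fun k _ => ?_
  exact congrArg₂ (· * ·) rfl (congrFun (congrFun (gl2Entries_gl2Of hw) k) j)

theorem FrameAtlas.isOpen_transition (x₀ x₁ : M) :
    IsOpen ((L.chart x₀).symm.trans (L.chart x₁)).source := by
  have h : ((L.chart x₀).symm.trans (L.chart x₁)).source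
      = ((chartAt E4 x₀).target ∩ (chartAt E4 x₀).symm ⁻¹' (L.dom x₀ ∩ L.dom x₁))
        ×ˢ Set.range gl2Entries := by
    ext z
    constructor
    · rintro ⟨⟨⟨h1, h2⟩, h3⟩, h4⟩
      exact ⟨⟨h1, h2, h4⟩, h3⟩
    · rintro ⟨⟨h1, h2, h4⟩, h3⟩
      exact ⟨⟨⟨h1, h2⟩, h3⟩, h4⟩
  rw [h]
  exact ((chartAt E4 x₀).isOpen_inter_preimage_symm
    ((L.isOpen_dom x₀).inter (L.isOpen_dom x₁))).prod isOpenEmbedding_gl2Entries.isOpen_range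

/-- The smooth structure of the manifold of adapted frames. -/
def FrameAtlas.core : ChartedSpaceCore E8 L.Total where
  atlas := Set.range L.chart
  chartAt p := L.chart p.1
  mem_chart_source p := L.mem_dom p.1
  chart_mem_atlas p := Set.mem_range_self _
  open_source := by
    rintro _ _ ⟨x₀, rfl⟩ ⟨x₁, rfl⟩
    exact L.isOpen_transition x₀ x₁
  continuousOn_toFun := by
    rintro _ _ ⟨x₀, rfl⟩ ⟨x₁, rfl⟩
    exact fun z hz => (L.contDiffAt_transition x₀ x₁ hz).continuousAt.continuousWithinAt

instance : TopologicalSpace L.Total := L.core.toTopologicalSpace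

instance : ChartedSpace E8 L.Total := L.core.toChartedSpace

/-- The charts, as open partial homeomorphisms. -/
def FrameAtlas.chartHomeo (x₀ : M) : OpenPartialHomeomorph L.Total E8 :=
  L.core.openPartialHomeomorph (L.chart x₀) (Set.mem_range_self _)

theorem FrameAtlas.mem_atlas_iff {e : OpenPartialHomeomorph L.Total E8} :
    e ∈ atlas E8 L.Total ↔ ∃ x₀, e = L.chartHomeo x₀ := by
  constructor
  · intro he
    obtain ⟨_, he⟩ := Set.mem_iUnion.1 he
    obtain ⟨⟨x₀, rfl⟩, h⟩ := Set.mem_iUnion.1 he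
    exact ⟨x₀, h⟩
  · rintro ⟨x₀, rfl⟩
    exact Set.mem_iUnion.2 ⟨_, Set.mem_iUnion.2 ⟨Set.mem_range_self x₀, rfl⟩⟩

instance : IsManifold 𝓘(ℝ, E8) ∞ L.Total := by
  refine isManifold_of_contDiffOn _ _ _ fun e e' he he' => ?_
  obtain ⟨x₀, rfl⟩ := L.mem_atlas_iff.1 he
  obtain ⟨x₁, rfl⟩ := L.mem_atlas_iff.1 he'
  intro z hz
  exact (L.contDiffAt_transition x₀ x₁ hz.1).contDiffWithinAt

theorem FrameAtlas.contMDiffAt_chart {x₀ : M} {p : L.Total} (hp : p.1 ∈ L.dom x₀) :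
    ContMDiffAt 𝓘(ℝ, E8) 𝓘(ℝ, E8) ∞ (L.chart x₀) p := by
  have hmem : L.chartHomeo x₀ ∈ IsManifold.maximalAtlas 𝓘(ℝ, E8) ∞ L.Total :=
    IsManifold.subset_maximalAtlas (L.mem_atlas_iff.2 ⟨x₀, rfl⟩)
  exact (contMDiffOn_of_mem_maximalAtlas hmem).contMDiffAt
    ((L.chartHomeo x₀).open_source.mem_nhds hp)

theorem FrameAtlas.contMDiffAt_chart_symm {x₀ : M} {z : E8} (hz : z ∈ (L.chart x₀).target) :
    ContMDiffAt 𝓘(ℝ, E8) 𝓘(ℝ, E8) ∞ (L.chart x₀).symm z := by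
  have hmem : L.chartHomeo x₀ ∈ IsManifold.maximalAtlas 𝓘(ℝ, E8) ∞ L.Total :=
    IsManifold.subset_maximalAtlas (L.mem_atlas_iff.2 ⟨x₀, rfl⟩)
  exact (contMDiffOn_symm_of_mem_maximalAtlas hmem).contMDiffAt
    ((L.chartHomeo x₀).open_target.mem_nhds hz)

end Bundle

/-! ### The principal bundle of adapted frames -/

section Bundle

variable {M : Type u} [TopologicalSpace M] [ChartedSpace E4 M] [IsManifold 𝓘(ℝ, E4) ∞ M]
  {g : BilinField M} {K : EndField M} {hg : IsAlmostParaHermitian g K} (L : FrameAtlas hg)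
  {D : Type*} [NormedAddCommGroup D] [NormedSpace ℝ D]
  {H : Type*} [TopologicalSpace H] {J : ModelWithCorners ℝ D H}
  {X : Type*} [TopologicalSpace X] [ChartedSpace H X]

/-- The base point of an adapted frame. -/
def FrameAtlas.proj (p : L.Total) : M := p.1

/-- The matrix of an adapted frame with respect to the frame `frame x₀`. -/
def FrameAtlas.coord (x₀ : M) (p : L.Total) : GL2 := (L.frame x₀ p.1).coord hg p.2

/-- The right action of `GL₂(ℝ)`. -/
def FrameAtlas.act (p : L.Total) (a : GL2) : L.Total := ⟨p.1, p.2.act a⟩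

theorem FrameAtlas.coord_act (x₀ : M) (p : L.Total) (a : GL2) :
    L.coord x₀ (L.act p a) = L.coord x₀ p * a :=
  AdaptedFrame.coord_act hg _ _ a

theorem FrameAtlas.dom_mem_nhds {x₀ : M} {p : L.Total} (hp : p.1 ∈ L.dom x₀) :
    ∀ᶠ q : L.Total in 𝓝 p, q.1 ∈ L.dom x₀ :=
  (L.chartHomeo x₀).open_source.mem_nhds hp

theorem FrameAtlas.contMDiff_proj : ContMDiff 𝓘(ℝ, E8) 𝓘(ℝ, E4) ∞ L.proj := by
  intro p
  have hp := L.mem_dom p.1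
  have h1 : ContMDiffAt 𝓘(ℝ, E8) 𝓘(ℝ, E4) ∞ (fun q => (L.chart p.1 q).1) p :=
    ContMDiffAt.comp (g := fun z : E8 => z.1) p contDiffAt_fst.contMDiffAt (L.contMDiffAt_chart hp)
  have h2 : ContMDiffAt 𝓘(ℝ, E4) 𝓘(ℝ, E4) ∞ (chartAt E4 p.1).symm (L.chart p.1 p).1 :=
    (contMDiffOn_chart_symm (n := ∞)).contMDiffAt
      ((chartAt E4 p.1).open_target.mem_nhds ((L.chart p.1).map_source hp).1.1)
  refine (ContMDiffAt.comp p h2 h1).congr_of_eventuallyEq ((L.dom_mem_nhds hp).mono fun q hq => ?_)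
  exact ((chartAt E4 p.1).left_inv (L.dom_subset _ hq)).symm

theorem FrameAtlas.contMDiffAt_coord_entries {x₀ : M} {p : L.Total} (hp : p.1 ∈ L.dom x₀) :
    ContMDiffAt 𝓘(ℝ, E8) 𝓘(ℝ, E22) ∞ (fun q => gl2Entries (L.coord x₀ q)) p :=
  ContMDiffAt.comp (g := fun z : E8 => z.2) p contDiffAt_snd.contMDiffAt (L.contMDiffAt_chart hp)

theorem FrameAtlas.contMDiffAt_coord {x₀ : M} {p : L.Total} (hp : p.1 ∈ L.dom x₀) :
    ContMDiffAt 𝓘(ℝ, E8) 𝓘(ℝ, E22) ∞ (L.coord x₀) p := by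
  have h := ContMDiffAt.comp p (g := gl2Of) (contMDiffAt_gl2Of ⟨L.coord x₀ p, rfl⟩)
    (L.contMDiffAt_coord_entries hp)
  refine h.congr_of_eventuallyEq (Filter.Eventually.of_forall fun q => ?_)
  exact (gl2Of_gl2Entries _).symm

theorem FrameAtlas.contMDiffAt_coord_apply {x₀ : M} {p : L.Total} (hp : p.1 ∈ L.dom x₀)
    (i j : Fin 2) : ContMDiffAt 𝓘(ℝ, E8) 𝓘(ℝ, ℝ) ∞ (fun q => (L.coord x₀ q : Mat 2) i j) p :=
  contMDiffAt_entries_iff.1 (L.contMDiffAt_coord_entries hp) i j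

theorem FrameAtlas.contMDiffAt_coord_inv_apply {x₀ : M} {p : L.Total} (hp : p.1 ∈ L.dom x₀)
    (i j : Fin 2) :
    ContMDiffAt 𝓘(ℝ, E8) 𝓘(ℝ, ℝ) ∞ (fun q => ((L.coord x₀ q)⁻¹ : GL2).val i j) p := by
  have h0 : ∀ z₀ : E22, Matrix.det (Matrix.of z₀) ≠ 0 →
      ContDiffAt ℝ ∞ (fun z : E22 => (Matrix.of z)⁻¹ i j) z₀ := fun z₀ hz =>
    contDiffAt_matrix_inv (A := fun z : E22 => Matrix.of z) (p := z₀) (fun k l => by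
      change ContDiffAt ℝ ∞ (fun z : E22 => z k l) z₀
      fun_prop) hz i j
  have h1 := h0 (gl2Entries (L.coord x₀ p))
    ((Matrix.isUnit_iff_isUnit_det _).1 (L.coord x₀ p).isUnit).ne_zero
  refine (ContMDiffAt.comp p h1.contMDiffAt (L.contMDiffAt_coord_entries hp)).congr_of_eventuallyEq
    (Filter.Eventually.of_forall fun q => ?_)
  exact congrFun (congrFun (Matrix.coe_units_inv (L.coord x₀ q)) i) j

theorem FrameAtlas.contMDiff_e (j : Fin 2) : ContMDiff 𝓘(ℝ, E8) 𝓘(ℝ, E4).tangent ∞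
    (fun p : L.Total => (⟨p.1, p.2.e j⟩ : TangentBundle 𝓘(ℝ, E4) M)) := by
  intro p
  have hp := L.mem_dom p.1
  have h := contMDiffAt_tangent_sum_smul (f := L.proj) (z := p)
    (c := fun i q => (L.coord p.1 q : Mat 2) i j) (v := fun i q => (L.frame p.1 q.1).e i)
    L.contMDiff_proj.contMDiffAt (fun i => L.contMDiffAt_coord_apply hp i j)
    (fun i => ContMDiffAt.comp (f := L.proj) p ((L.smooth p.1 _ hp).e i)
      L.contMDiff_proj.contMDiffAt)
  refine h.congr_of_eventuallyEq (Filter.Eventually.of_forall fun q => ?_)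
  exact congrArg (fun v => (⟨q.1, v⟩ : TangentBundle 𝓘(ℝ, E4) M))
    (AdaptedFrame.e_expand hg (L.frame p.1 q.1) q.2 j)

theorem FrameAtlas.contMDiff_ebar (j : Fin 2) : ContMDiff 𝓘(ℝ, E8) 𝓘(ℝ, E4).tangent ∞
    (fun p : L.Total => (⟨p.1, p.2.ebar j⟩ : TangentBundle 𝓘(ℝ, E4) M)) := by
  intro p
  have hp := L.mem_dom p.1
  have h := contMDiffAt_tangent_sum_smul (f := L.proj) (z := p)
    (c := fun i q => ((L.coord p.1 q)⁻¹ : GL2).val j i) (v := fun i q => (L.frame p.1 q.1).ebar i)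
    L.contMDiff_proj.contMDiffAt (fun i => L.contMDiffAt_coord_inv_apply hp j i)
    (fun i => ContMDiffAt.comp (f := L.proj) p ((L.smooth p.1 _ hp).ebar i)
      L.contMDiff_proj.contMDiffAt)
  refine h.congr_of_eventuallyEq (Filter.Eventually.of_forall fun q => ?_)
  exact congrArg (fun v => (⟨q.1, v⟩ : TangentBundle 𝓘(ℝ, E4) M))
    (AdaptedFrame.ebar_expand hg (L.frame p.1 q.1) q.2 j)

/-- A map into the manifold of adapted frames is smooth if the vectors `eⱼ` depend smoothly on the
parameter. -/
theorem FrameAtlas.contMDiffAt_of_e {F : X → L.Total} {z : X}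
    (hF : ∀ j, ContMDiffAt J 𝓘(ℝ, E4).tangent ∞
      (fun q => (⟨(F q).1, (F q).2.e j⟩ : TangentBundle 𝓘(ℝ, E4) M)) z) :
    ContMDiffAt J 𝓘(ℝ, E8) ∞ F z := by
  have hπ : ContMDiffAt J 𝓘(ℝ, E4) ∞ (fun q => L.proj (F q)) z :=
    (contMDiffAt_totalSpace.1 (hF 0)).1
  have h0 := L.mem_dom (F z).1
  have hc : ∀ᶠ q in 𝓝 z, (F q).1 ∈ L.dom (F z).1 :=
    hπ.continuousAt.eventually ((L.isOpen_dom _).mem_nhds h0)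
  have h1 : ContMDiffAt J 𝓘(ℝ, E4) ∞ (fun q => chartAt E4 (F z).1 (L.proj (F q))) z :=
    ContMDiffAt.comp z ((contMDiffOn_chart (n := ∞)).contMDiffAt
      ((chartAt E4 (F z).1).open_source.mem_nhds (mem_chart_source E4 _))) hπ
  have h2 : ContMDiffAt J 𝓘(ℝ, E22) ∞ (fun q => gl2Entries (L.coord (F z).1 (F q))) z :=
    contMDiffAt_entries_iff.2 fun i j =>
      SmoothBilinAt.contMDiffAt_apply (f := fun q => L.proj (F q))
        (v := fun q => (L.frame (F z).1 (F q).1).ebar i) (w := fun q => (F q).2.e j)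
        (hg.smooth_metric _) hπ
        (ContMDiffAt.comp (f := fun q => L.proj (F q)) z ((L.smooth _ _ h0).ebar i) hπ) (hF j)
  have h3 : ContMDiffAt J 𝓘(ℝ, E8) ∞ (fun q => L.chart (F z).1 (F q)) z := h1.prodMk_space h2
  have h4 := ContMDiffAt.comp z (L.contMDiffAt_chart_symm ((L.chart (F z).1).map_source h0)) h3
  refine h4.congr_of_eventuallyEq (hc.mono fun q hq => ?_)
  exact ((L.chart (F z).1).left_inv hq).symm

theorem AdaptedFrame.act_one {x : M} (f : AdaptedFrame g K x) : f.act 1 = f := by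
  refine AdaptedFrame.ext (funext fun j => ?_) (funext fun j => ?_)
  · simp [AdaptedFrame.act, Matrix.one_apply]
  · simp [AdaptedFrame.act, Matrix.one_apply]

theorem AdaptedFrame.act_mul (hg : IsAlmostParaHermitian g K) {x : M} (f : AdaptedFrame g K x)
    (a b : GL2) : f.act (a * b) = (f.act a).act b := by
  rw [← f.act_coord hg ((f.act a).act b), coord_act, coord_act_self]

/-- The principal `GL₂(ℝ)`-bundle of adapted frames. -/
def FrameAtlas.bundle : PrincipalGL2Bundle M where
  P := L.Total
  proj := L.proj
  smooth_proj := L.contMDiff_proj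
  act := L.act
  smooth_act := by
    intro q
    refine L.contMDiffAt_of_e fun j => ?_
    exact contMDiffAt_tangent_sum_smul (f := fun q : L.Total × GL2 => L.proj q.1)
      (c := fun i q => gl2Entries q.2 i j) (v := fun i q => q.1.2.e i)
      (ContMDiffAt.comp q L.contMDiff_proj.contMDiffAt contMDiffAt_fst)
      (fun i => contMDiffAt_entries_iff.1
        (ContMDiffAt.comp q contMDiff_gl2Entries.contMDiffAt contMDiffAt_snd) i j)
      (fun i => ContMDiffAt.comp (f := fun q : L.Total × GL2 => q.1) q
        (L.contMDiff_e i).contMDiffAt contMDiffAt_fst)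
  act_one p := congrArg (Sigma.mk p.1) p.2.act_one
  act_mul p a b := congrArg (Sigma.mk p.1) (p.2.act_mul hg a b)
  proj_act p a := rfl
  act_free p a h := by
    have h1 : p.2.act a = p.2 := eq_of_heq (Sigma.mk.inj h).2
    rw [← p.2.coord_act_self hg a, h1, AdaptedFrame.coord_self]
  locally_trivial x := by
    refine ⟨L.dom x, fun y => ⟨y, L.frame x y⟩, L.coord x, L.isOpen_dom x, L.mem_dom x,
      fun y hy => (L.contMDiffAt_of_e fun j => (L.smooth x y hy).e j).contMDiffWithinAt,
      fun p hp => (L.contMDiffAt_coord hp).contMDiffWithinAt, fun y _ => rfl, fun p _ => ?_⟩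
    exact congrArg (Sigma.mk p.1) (AdaptedFrame.act_coord hg _ _)

end Bundle

/-! ### The Levi-Civita connection form on the bundle of adapted frames -/

section Gauge

open Matrix

/-- The first structure equation under a change of frame `ψ = χ⁻¹`, with `dχ = -χ δ χ`, evaluated on
two vectors. -/
theorem torsion_gauge {ψ χ τ τ' δ δ' c c' : Mat 2} (A A' : Fin 2 → ℝ) (h : ψ * χ = 1)
    (hc : c * ψ = -(χ * δ)) (hc' : c' * ψ = -(χ * δ')) :
    c *ᵥ A' - c' *ᵥ A + χ *ᵥ (-(τ *ᵥ A' - τ' *ᵥ A))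
      = -((χ * (τ * ψ + δ)) *ᵥ (χ *ᵥ A') - (χ * (τ' * ψ + δ')) *ᵥ (χ *ᵥ A)) := by
  have key : ∀ {c τ δ : Mat 2} (A : Fin 2 → ℝ), c * ψ = -(χ * δ) →
      (χ * (τ * ψ + δ)) *ᵥ (χ *ᵥ A) = χ *ᵥ (τ *ᵥ A) - c *ᵥ A := by
    intro c τ δ A hc
    have h1 : c = -(χ * δ) * χ := by rw [← hc, mul_assoc, h, mul_one]
    rw [h1, mulVec_mulVec, mulVec_mulVec, ← sub_mulVec]
    congr 1
    rw [mul_add, add_mul, ← mul_assoc, mul_assoc (χ * τ) ψ χ, h, mul_one, neg_mul, sub_neg_eq_add]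
  rw [key A' hc, key A hc', mulVec_neg, mulVec_sub]
  abel

/-- The structure equation of the conjugate coframe under a change of frame. -/
theorem torsion_bar_gauge {ψ χ τ τ' δ δ' : Mat 2} (B B' : Fin 2 → ℝ) (h : ψ * χ = 1) :
    B' ᵥ* δ - B ᵥ* δ' + (B' ᵥ* τ - B ᵥ* τ') ᵥ* ψ
      = (B' ᵥ* ψ) ᵥ* (χ * (τ * ψ + δ)) - (B ᵥ* ψ) ᵥ* (χ * (τ' * ψ + δ')) := by
  rw [vecMul_vecMul, vecMul_vecMul, ← mul_assoc, ← mul_assoc, h, one_mul, one_mul, sub_vecMul,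
    vecMul_vecMul, vecMul_vecMul, vecMul_add, vecMul_add]
  abel

end Gauge

section Forms

variable {E : Type*} [NormedAddCommGroup E] [NormedSpace ℝ E]
  {N : Type*} [TopologicalSpace N] [ChartedSpace E N] [IsManifold 𝓘(ℝ, E) ∞ N]

theorem SmoothFormAt.add {θ θ' : FormField E N} {p : N} (h : SmoothFormAt θ p)
    (h' : SmoothFormAt θ' p) : SmoothFormAt (E := E) (N := N) (fun q => θ q + θ' q) p :=
  fun v => (h v).add (h' v)

theorem smoothFormAt_dFun {f : N → ℝ} {p : N}
    (hf : ∀ᶠ q in 𝓝 p, ContMDiffAt 𝓘(ℝ, E) 𝓘(ℝ, ℝ) ∞ f q) :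
    SmoothFormAt (E := E) (N := N) (dFun f) p := fun v =>
  contMDiffAt_vecDeriv_apply (f := fun ξ : TangentBundle 𝓘(ℝ, E) N => ξ) (x := ⟨p, v⟩)
    contMDiffAt_id hf

theorem dFun_mul {f h : N → ℝ} {p : N} (hf : MDifferentiableAt 𝓘(ℝ, E) 𝓘(ℝ, ℝ) f p)
    (hh : MDifferentiableAt 𝓘(ℝ, E) 𝓘(ℝ, ℝ) h p) (v : TangentSpace 𝓘(ℝ, E) p) :
    dFun (fun q => f q * h q) p v = f p * dFun h p v + h p * dFun f p v := by
  have h1 := (hf.hasMFDerivAt.mul hh.hasMFDerivAt).mfderiv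
  exact DFunLike.congr_fun h1 v

theorem dFun_add {f h : N → ℝ} {p : N} (hf : MDifferentiableAt 𝓘(ℝ, E) 𝓘(ℝ, ℝ) f p)
    (hh : MDifferentiableAt 𝓘(ℝ, E) 𝓘(ℝ, ℝ) h p) (v : TangentSpace 𝓘(ℝ, E) p) :
    dFun (fun q => f q + h q) p v = dFun f p v + dFun h p v := by
  have h1 := (hf.hasMFDerivAt.add hh.hasMFDerivAt).mfderiv
  exact DFunLike.congr_fun h1 v

theorem dFun_sum_two {f : Fin 2 → N → ℝ} {p : N}
    (hf : ∀ k, MDifferentiableAt 𝓘(ℝ, E) 𝓘(ℝ, ℝ) (f k) p) (v : TangentSpace 𝓘(ℝ, E) p) :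
    dFun (fun q => ∑ k, f k q) p v = ∑ k, dFun (f k) p v := by
  simp only [Fin.sum_univ_two]
  exact dFun_add (hf 0) (hf 1) v

theorem dFun_const (c : ℝ) (p : N) (v : TangentSpace 𝓘(ℝ, E) p) : dFun (fun _ : N => c) p v = 0 :=
  DFunLike.congr_fun (mfderiv_const (I := 𝓘(ℝ, E)) (I' := 𝓘(ℝ, ℝ))) v

end Forms

theorem clm_sum_smul_apply {E κ : Type*} [NormedAddCommGroup E] [NormedSpace ℝ E] [Fintype κ]
    (c : κ → ℝ) (f : κ → E →L[ℝ] ℝ) (v : E) : (∑ k, c k • f k) v = ∑ k, c k * f k v := by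
  simp

section Connection

open scoped Matrix

variable {M : Type u} [TopologicalSpace M] [ChartedSpace E4 M] [IsManifold 𝓘(ℝ, E4) ∞ M]
  {g : BilinField M} {K : EndField M} {hg : IsAlmostParaHermitian g K} (L : FrameAtlas hg)

theorem clm_sum_smul_left (B : E4 →L[ℝ] E4 →L[ℝ] ℝ) (c : Fin 2 → ℝ) (w : Fin 2 → E4) (v : E4) :
    B (∑ k, c k • w k) v = ∑ k, c k * B (w k) v := by
  simp

theorem AdaptedFrame.inner_ebar_expand (hg : IsAlmostParaHermitian g K) {x : M}
    (σ f : AdaptedFrame g K x) (i : Fin 2) (v : E4) : bilinAt g x (f.bVec i) v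
      = ∑ k, bilinAt g x (f.bVec i) (σ.eVec k) * bilinAt g x (σ.bVec k) v :=
  (congrArg (fun w : E4 => bilinAt g x w v) (AdaptedFrame.ebar_expand hg σ f i)).trans
    (clm_sum_smul_left _ _ _ _)

theorem AdaptedFrame.inner_e_expand (hg : IsAlmostParaHermitian g K) {x : M}
    (σ f : AdaptedFrame g K x) (i : Fin 2) (v : E4) : bilinAt g x (f.eVec i) v
      = ∑ k, bilinAt g x (σ.bVec k) (f.eVec i) * bilinAt g x (σ.eVec k) v :=
  (congrArg (fun w : E4 => bilinAt g x w v) (AdaptedFrame.e_expand hg σ f i)).trans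
    (clm_sum_smul_left _ _ _ _)

/-- The differential of the projection, between the model spaces. -/
def FrameAtlas.dProj (p : L.Total) : E8 →L[ℝ] E4 := mfderiv 𝓘(ℝ, E8) 𝓘(ℝ, E4) L.proj p

/-- The entries of the matrix `ψ` of an adapted frame with respect to `frame x₀`. -/
def FrameAtlas.psi (x₀ : M) (i j : Fin 2) (p : L.Total) : ℝ := (L.coord x₀ p : Mat 2) i j

/-- The entries of `ψ⁻¹`. -/
def FrameAtlas.chi (x₀ : M) (i j : Fin 2) (p : L.Total) : ℝ := ((L.coord x₀ p)⁻¹ : GL2).val i j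

/-- The entries of `π^* Γ_σ ψ + dψ`, where `Γ_σ` is the connection form of `σ = frame x₀`. -/
def FrameAtlas.preGam (x₀ : M) (k j : Fin 2) : FormField E8 L.Total := fun p =>
  (∑ l, L.psi x₀ l j p • pullbackForm L.proj (localConn (L.frame x₀) k l) p : E8 →L[ℝ] ℝ)
    + (show E8 →L[ℝ] ℝ from dFun (L.psi x₀ k j) p)

/-- The connection form `ψ⁻¹ (π^* Γ_σ) ψ + ψ⁻¹ dψ` over `dom x₀`, where `Γ_σ` is the connection form
of `σ = frame x₀`. -/
def FrameAtlas.gam (x₀ : M) (i j : Fin 2) : FormField E8 L.Total := fun p =>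
  (∑ k, L.chi x₀ i k p • L.preGam x₀ k j p : E8 →L[ℝ] ℝ)

/-- The tautological forms `αⁱ`. -/
def FrameAtlas.alpha (i : Fin 2) : FormField E8 L.Total := fun p =>
  (g p.1 (p.2.ebar i)).comp (mfderiv 𝓘(ℝ, E8) 𝓘(ℝ, E4) L.proj p)

/-- The tautological forms `ᾱⁱ`. -/
def FrameAtlas.alphaBar (i : Fin 2) : FormField E8 L.Total := fun p =>
  (g p.1 (p.2.e i)).comp (mfderiv 𝓘(ℝ, E8) 𝓘(ℝ, E4) L.proj p)

theorem FrameAtlas.alpha_apply (x₀ : M) (i : Fin 2) (p : L.Total) (ξ : TangentSpace 𝓘(ℝ, E8) p) :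
    L.alpha i p ξ = ∑ k, L.chi x₀ i k p * pullbackForm L.proj (frameForm (L.frame x₀) k) p ξ :=
  AdaptedFrame.inner_ebar_expand hg (L.frame x₀ p.1) p.2 i (L.dProj p ξ)

theorem FrameAtlas.alphaBar_apply (x₀ : M) (i : Fin 2) (p : L.Total)
    (ξ : TangentSpace 𝓘(ℝ, E8) p) : L.alphaBar i p ξ
      = ∑ k, L.psi x₀ k i p * pullbackForm L.proj (frameFormBar (L.frame x₀) k) p ξ :=
  AdaptedFrame.inner_e_expand hg (L.frame x₀ p.1) p.2 i (L.dProj p ξ)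

/-- The matrix `ψ`. -/
def FrameAtlas.psiMat (x₀ : M) (p : L.Total) : Mat 2 := Matrix.of fun i j => L.psi x₀ i j p

/-- The matrix `ψ⁻¹`. -/
def FrameAtlas.chiMat (x₀ : M) (p : L.Total) : Mat 2 := Matrix.of fun i j => L.chi x₀ i j p

/-- The values of `π^* Γ_σ`. -/
def FrameAtlas.omegaMat (x₀ : M) (p : L.Total) (ξ : TangentSpace 𝓘(ℝ, E8) p) : Mat 2 :=
  Matrix.of fun k l => pullbackForm L.proj (localConn (L.frame x₀) k l) p ξ

/-- The values of `dψ`. -/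
def FrameAtlas.deltaMat (x₀ : M) (p : L.Total) (ξ : TangentSpace 𝓘(ℝ, E8) p) : Mat 2 :=
  Matrix.of fun k l => dFun (L.psi x₀ k l) p ξ

theorem FrameAtlas.psi_mul_chi (x₀ : M) (p : L.Total) : L.psiMat x₀ p * L.chiMat x₀ p = 1 :=
  (L.coord x₀ p).val_inv

theorem FrameAtlas.chi_mul_psi (x₀ : M) (p : L.Total) : L.chiMat x₀ p * L.psiMat x₀ p = 1 :=
  (L.coord x₀ p).inv_val

theorem FrameAtlas.gam_apply (x₀ : M) (i j : Fin 2) (p : L.Total) (ξ : TangentSpace 𝓘(ℝ, E8) p) :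
    L.gam x₀ i j p ξ
      = (L.chiMat x₀ p * (L.omegaMat x₀ p ξ * L.psiMat x₀ p + L.deltaMat x₀ p ξ)) i j := by
  have h1 : ∀ k, L.preGam x₀ k j p ξ
      = (L.omegaMat x₀ p ξ * L.psiMat x₀ p + L.deltaMat x₀ p ξ) k j := by
    intro k
    rw [Matrix.add_apply, Matrix.mul_apply]
    refine congrArg (· + dFun (L.psi x₀ k j) p ξ) ((clm_sum_smul_apply (E := E8) _ _ ξ).trans
      (Finset.sum_congr rfl fun l _ => ?_))
    exact mul_comm _ _
  rw [Matrix.mul_apply]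
  refine (clm_sum_smul_apply (E := E8) _ _ ξ).trans (Finset.sum_congr rfl fun k _ => ?_)
  exact congrArg (L.chi x₀ i k p * ·) (h1 k)

variable {x₀ : M} {p : L.Total} (hp : p.1 ∈ L.dom x₀)
include hp

theorem FrameAtlas.contMDiffAt_psi (i j : Fin 2) :
    ContMDiffAt 𝓘(ℝ, E8) 𝓘(ℝ, ℝ) ∞ (L.psi x₀ i j) p := L.contMDiffAt_coord_apply hp i j

theorem FrameAtlas.contMDiffAt_chi (i j : Fin 2) :
    ContMDiffAt 𝓘(ℝ, E8) 𝓘(ℝ, ℝ) ∞ (L.chi x₀ i j) p := L.contMDiffAt_coord_inv_apply hp i j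

theorem FrameAtlas.smoothFrameAt_eventually : ∀ᶠ q in 𝓝 p.1, SmoothFrameAt (L.frame x₀) q :=
  Filter.mem_of_superset ((L.isOpen_dom x₀).mem_nhds hp) (L.smooth x₀)

theorem FrameAtlas.smoothFormAt_pullback {θ : FormField E4 M} (hθ : SmoothFormAt θ p.1) :
    SmoothFormAt (E := E8) (N := L.Total) (pullbackForm L.proj θ) p :=
  smoothFormAt_pullbackForm (f := L.proj)
    (Filter.Eventually.of_forall fun _ => L.contMDiff_proj.contMDiffAt) hθ

theorem FrameAtlas.smoothFormAt_gam (i j : Fin 2) : SmoothFormAt (L.gam x₀ i j) p := by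
  have h1 : ∀ k, SmoothFormAt (L.preGam x₀ k j) p := by
    intro k
    refine SmoothFormAt.add (θ := fun q : L.Total => (∑ l, L.psi x₀ l j q •
      pullbackForm L.proj (localConn (L.frame x₀) k l) q : E8 →L[ℝ] ℝ))
      (SmoothFormAt.sum_smul (h := fun l => L.psi x₀ l j) (fun l => L.contMDiffAt_psi hp l j)
        (fun l => L.smoothFormAt_pullback hp
          (smoothFormAt_localConn hg (L.smoothFrameAt_eventually hp) k l))
        (Filter.Eventually.of_forall fun q v => clm_sum_smul_apply (E := E8) _ _ v))
      (smoothFormAt_dFun ((L.dom_mem_nhds hp).mono fun q hq => L.contMDiffAt_psi hq k j))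
  exact SmoothFormAt.sum_smul (h := fun k => L.chi x₀ i k) (fun k => L.contMDiffAt_chi hp i k) h1
    (Filter.Eventually.of_forall fun q v => clm_sum_smul_apply (E := E8) _ _ v)

theorem FrameAtlas.smoothFormAt_alpha (i : Fin 2) : SmoothFormAt (L.alpha i) p :=
  SmoothFormAt.sum_smul (h := fun k => L.chi x₀ i k) (fun k => L.contMDiffAt_chi hp i k)
    (fun k => L.smoothFormAt_pullback hp (smoothFormAt_frameForm hg (L.smooth x₀ _ hp) k))
    (Filter.Eventually.of_forall fun q v => L.alpha_apply x₀ i q v)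

theorem FrameAtlas.smoothFormAt_alphaBar (i : Fin 2) : SmoothFormAt (L.alphaBar i) p :=
  SmoothFormAt.sum_smul (h := fun k => L.psi x₀ k i) (fun k => L.contMDiffAt_psi hp k i)
    (fun k => L.smoothFormAt_pullback hp (smoothFormAt_frameFormBar hg (L.smooth x₀ _ hp) k))
    (Filter.Eventually.of_forall fun q v => L.alphaBar_apply x₀ i q v)

/-- The derivative of `ψ⁻¹ ψ = 1`. -/
theorem FrameAtlas.dFun_chi (ξ : TangentSpace 𝓘(ℝ, E8) p) :
    (Matrix.of fun i k => dFun (L.chi x₀ i k) p ξ : Mat 2) * L.psiMat x₀ p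
      = -(L.chiMat x₀ p * L.deltaMat x₀ p ξ) := by
  have hψ := fun i j => (L.contMDiffAt_psi hp i j).mdifferentiableAt (by simp : (∞ : ℕ∞ω) ≠ 0)
  have hχ := fun i j => (L.contMDiffAt_chi hp i j).mdifferentiableAt (by simp : (∞ : ℕ∞ω) ≠ 0)
  refine eq_neg_of_add_eq_zero_left ?_
  ext i j
  have h1 : (fun q : L.Total => ∑ k, L.chi x₀ i k q * L.psi x₀ k j q)
      = fun _ => (1 : Mat 2) i j := by
    funext q
    rw [← L.chi_mul_psi x₀ q, Matrix.mul_apply]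
    rfl
  have h2 := dFun_sum_two (f := fun k q => L.chi x₀ i k q * L.psi x₀ k j q)
    (fun k => (hχ i k).mul (hψ k j)) ξ
  rw [h1, dFun_const] at h2
  rw [Matrix.add_apply, Matrix.mul_apply, Matrix.mul_apply, ← Finset.sum_add_distrib]
  refine Eq.trans (Finset.sum_congr rfl fun k _ => ?_) h2.symm
  rw [dFun_mul (hχ i k) (hψ k j)]
  change dFun (L.chi x₀ i k) p ξ * L.psi x₀ k j p + L.chi x₀ i k p * dFun (L.psi x₀ k j) p ξ = _
  ring

omit hp in
theorem FrameAtlas.dOne_pullback_proj {θ : FormField E4 M} (hθ : SmoothFormAt θ p.1)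
    (ξ η : TangentSpace 𝓘(ℝ, E8) p) : dOne (E := E8) (N := L.Total) (pullbackForm L.proj θ) p ξ η
      = dOne θ p.1 (L.dProj p ξ) (L.dProj p η) :=
  dOne_pullbackForm (f := L.proj) L.contMDiff_proj.contMDiffAt hθ ξ η

/-- The structure equation `dαⁱ = - Γⁱⱼ ∧ αʲ` on the bundle of adapted frames. -/
theorem FrameAtlas.gam_torsion (hK : IsParaKahler g K) (i : Fin 2) (ξ η : TangentSpace 𝓘(ℝ, E8) p) :
    dOne (L.alpha i) p ξ η
      = -∑ j, (L.gam x₀ i j p ξ * L.alpha j p η - L.gam x₀ i j p η * L.alpha j p ξ) := by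
  let A : TangentSpace 𝓘(ℝ, E8) p → Fin 2 → ℝ := fun ζ k =>
    pullbackForm L.proj (frameForm (L.frame x₀) k) p ζ
  have h1 := dOne_sum_smul (h := fun k => L.chi x₀ i k)
    (fun k => (L.contMDiffAt_chi hp i k).mdifferentiableAt (by simp))
    (fun k => L.smoothFormAt_pullback hp (smoothFormAt_frameForm hg (L.smooth x₀ _ hp) k))
    (Filter.Eventually.of_forall fun q v => L.alpha_apply x₀ i q v) ξ η
  have h2 : ∀ k, dOne (E := E8) (N := L.Total)
      (pullbackForm L.proj (frameForm (L.frame x₀) k)) p ξ η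
      = (-(L.omegaMat x₀ p ξ *ᵥ A η - L.omegaMat x₀ p η *ᵥ A ξ)) k := by
    intro k
    refine (L.dOne_pullback_proj (smoothFormAt_frameForm hg (L.smooth x₀ _ hp) k) ξ η).trans
      ((localConn_torsion hK (L.smoothFrameAt_eventually hp) k _ _).trans ?_)
    exact congrArg Neg.neg (Finset.sum_sub_distrib _ _)
  have h3 := congrFun (torsion_gauge (τ := L.omegaMat x₀ p ξ) (τ' := L.omegaMat x₀ p η) (A ξ) (A η)
    (L.psi_mul_chi x₀ p) (L.dFun_chi hp ξ) (L.dFun_chi hp η)) i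
  have h4 : ∀ ζ, L.chiMat x₀ p *ᵥ A ζ = fun j => L.alpha j p ζ := fun ζ =>
    funext fun j => (L.alpha_apply x₀ j p ζ).symm
  rw [h1]
  simp only [h2]
  rw [h4, h4] at h3
  simp only [L.gam_apply]
  rw [Finset.sum_sub_distrib]
  refine Eq.trans ?_ h3
  rw [Finset.sum_add_distrib, Finset.sum_sub_distrib]
  rfl

/-- The structure equation `dᾱⱼ = Γⁱⱼ ∧ ᾱᵢ` on the bundle of adapted frames. -/
theorem FrameAtlas.gam_torsion_bar (hK : IsParaKahler g K) (j : Fin 2)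
    (ξ η : TangentSpace 𝓘(ℝ, E8) p) : dOne (L.alphaBar j) p ξ η
      = ∑ i, (L.gam x₀ i j p ξ * L.alphaBar i p η - L.gam x₀ i j p η * L.alphaBar i p ξ) := by
  let B : TangentSpace 𝓘(ℝ, E8) p → Fin 2 → ℝ := fun ζ k =>
    pullbackForm L.proj (frameFormBar (L.frame x₀) k) p ζ
  have h1 := dOne_sum_smul (h := fun k => L.psi x₀ k j)
    (fun k => (L.contMDiffAt_psi hp k j).mdifferentiableAt (by simp))
    (fun k => L.smoothFormAt_pullback hp (smoothFormAt_frameFormBar hg (L.smooth x₀ _ hp) k))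
    (Filter.Eventually.of_forall fun q v => L.alphaBar_apply x₀ j q v) ξ η
  have h2 : ∀ k, dOne (E := E8) (N := L.Total)
      (pullbackForm L.proj (frameFormBar (L.frame x₀) k)) p ξ η
      = (B η ᵥ* L.omegaMat x₀ p ξ - B ξ ᵥ* L.omegaMat x₀ p η) k := by
    intro k
    refine (L.dOne_pullback_proj (smoothFormAt_frameFormBar hg (L.smooth x₀ _ hp) k) ξ η).trans
      ((localConn_torsion_bar hK (L.smoothFrameAt_eventually hp) k _ _).trans
        ((Finset.sum_sub_distrib _ _).trans ?_))
    exact congrArg₂ (· - ·) (Finset.sum_congr rfl fun _ _ => mul_comm _ _)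
      (Finset.sum_congr rfl fun _ _ => mul_comm _ _)
  have h3 := congrFun (torsion_bar_gauge (τ := L.omegaMat x₀ p ξ) (τ' := L.omegaMat x₀ p η)
    (δ := L.deltaMat x₀ p ξ) (δ' := L.deltaMat x₀ p η) (B ξ) (B η) (L.psi_mul_chi x₀ p)) j
  have h4 : ∀ ζ, B ζ ᵥ* L.psiMat x₀ p = fun j => L.alphaBar j p ζ := fun ζ =>
    funext fun j => ((L.alphaBar_apply x₀ j p ζ).trans
      (Finset.sum_congr rfl fun _ _ => mul_comm _ _)).symm
  rw [h1]
  simp only [h2]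
  rw [h4, h4] at h3
  simp only [L.gam_apply]
  rw [Finset.sum_sub_distrib]
  have hv : ∀ (v : Fin 2 → ℝ) (A : Mat 2) (j : Fin 2), (v ᵥ* A) j = ∑ i, A i j * v i :=
    fun v A j => (Finset.sum_congr rfl fun i _ => mul_comm (v i) (A i j) :
      ∑ i, v i * A i j = ∑ i, A i j * v i)
  rw [Pi.add_apply, Pi.sub_apply, Pi.sub_apply, hv, hv, hv, hv, hv] at h3
  refine Eq.trans ?_ h3
  rw [Finset.sum_add_distrib, Finset.sum_sub_distrib]
  rfl

end Connection

/-! ### The inclusion of `GL₂(ℝ)` in `SL₃(ℝ)` and block matrices -/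

section Blocks

open scoped Matrix

/-- The block matrix `[[Γ - (tr Γ / 3) id, α], [ᾱ, - tr Γ / 3]]`, with entries in any real vector
space. -/
def cartanEntries {V : Type*} [AddCommGroup V] [Module ℝ V] (Γ : Fin 2 → Fin 2 → V)
    (α β : Fin 2 → V) : Fin 3 → Fin 3 → V :=
  ![![Γ 0 0 - (1 / 3 : ℝ) • (Γ 0 0 + Γ 1 1), Γ 0 1, α 0],
    ![Γ 1 0, Γ 1 1 - (1 / 3 : ℝ) • (Γ 0 0 + Γ 1 1), α 1],
    ![β 0, β 1, -((1 / 3 : ℝ) • (Γ 0 0 + Γ 1 1))]]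

theorem map_cartanEntries {V W : Type*} [AddCommGroup V] [Module ℝ V] [AddCommGroup W] [Module ℝ W]
    (φ : V →ₗ[ℝ] W) (Γ : Fin 2 → Fin 2 → V) (α β : Fin 2 → V) (i j : Fin 3) :
    φ (cartanEntries Γ α β i j)
      = cartanEntries (fun i j => φ (Γ i j)) (fun i => φ (α i)) (fun i => φ (β i)) i j := by
  fin_cases i <;> fin_cases j <;> simp [cartanEntries]

theorem cartanEntries_trace {V : Type*} [AddCommGroup V] [Module ℝ V] (Γ : Fin 2 → Fin 2 → V)
    (α β : Fin 2 → V) : ∑ i, cartanEntries Γ α β i i = 0 := by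
  simp only [Fin.sum_univ_three, cartanEntries, Matrix.cons_val_zero, Matrix.cons_val_one,
    Matrix.cons_val]
  module

theorem cartanEntries_col {V : Type*} [AddCommGroup V] [Module ℝ V] (Γ : Fin 2 → Fin 2 → V)
    (α β : Fin 2 → V) (i : Fin 2) : cartanEntries Γ α β i.castSucc 2 = α i := by
  fin_cases i <;> rfl

theorem cartanEntries_row {V : Type*} [AddCommGroup V] [Module ℝ V] (Γ : Fin 2 → Fin 2 → V)
    (α β : Fin 2 → V) (i : Fin 2) : cartanEntries Γ α β 2 i.castSucc = β i := by
  fin_cases i <;> rfl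

theorem cartanEntries_block {V : Type*} [AddCommGroup V] [Module ℝ V] (Γ : Fin 2 → Fin 2 → V)
    (α β : Fin 2 → V) (i j : Fin 2) : cartanEntries Γ α β i.castSucc j.castSucc
      - (if i = j then cartanEntries Γ α β 2 2 else 0) = Γ i j := by
  fin_cases i <;> fin_cases j <;> simp [cartanEntries] <;> module

/-- Conjugation of a matrix in block form by `diag(a, 1)`. -/
theorem blockOne_conj {a b Γ : Mat 2} (α β : Fin 2 → ℝ) (hba : b * a = 1) :
    blockOne b * Matrix.of (cartanEntries Γ α β) * blockOne a
      = Matrix.of (cartanEntries (b * Γ * a) (b *ᵥ α) (β ᵥ* a)) := by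
  have htr : (b * Γ * a) 0 0 + (b * Γ * a) 1 1 = Γ 0 0 + Γ 1 1 := by
    have h : Matrix.trace (b * Γ * a) = Matrix.trace Γ := by
      rw [Matrix.trace_mul_comm, ← mul_assoc, mul_eq_one_comm.1 hba, one_mul]
    rwa [Matrix.trace_fin_two, Matrix.trace_fin_two] at h
  have h : ∀ i j, b i 0 * a 0 j + b i 1 * a 1 j = if i = j then 1 else 0 := by
    intro i j
    rw [← Matrix.one_apply, ← hba, Matrix.mul_apply, Fin.sum_univ_two]
  have hm : ∀ i j, (b * Γ * a) i j
      = (b i 0 * Γ 0 0 + b i 1 * Γ 1 0) * a 0 j + (b i 0 * Γ 0 1 + b i 1 * Γ 1 1) * a 1 j := by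
    intro i j
    simp [Matrix.mul_apply, Fin.sum_univ_two]
  have h00 := h 0 0
  have h01 := h 0 1
  have h10 := h 1 0
  have h11 := h 1 1
  simp only [Fin.isValue, if_true, zero_ne_one, one_ne_zero, if_false] at h00 h01 h10 h11
  ext i j
  simp only [cartanEntries, htr]
  fin_cases i <;> fin_cases j <;>
    simp [blockOne, Matrix.mul_apply, Fin.sum_univ_three, Matrix.mulVec, Matrix.vecMul,
      dotProduct, Fin.sum_univ_two, hm]
  · linear_combination (-(1 / 3) * (Γ 0 0 + Γ 1 1)) * h00
  · linear_combination (-(1 / 3) * (Γ 0 0 + Γ 1 1)) * h01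
  · linear_combination (-(1 / 3) * (Γ 0 0 + Γ 1 1)) * h10
  · linear_combination (-(1 / 3) * (Γ 0 0 + Γ 1 1)) * h11

theorem iota_apply (a : GL2) :
    (iota a).1 = (cbrt (Matrix.det (a : Mat 2)))⁻¹ • blockOne (a : Mat 2) := rfl

theorem cbrt_one : cbrt 1 = 1 := by simp [cbrt]

/-- The adjoint action of `GL₂(ℝ)` on `sl₃(ℝ)`, in blocks. -/
theorem iota_conj (a : GL2) (Γ : Mat 2) (α β : Fin 2 → ℝ) :
    ((iota a)⁻¹ : Matrix.SpecialLinearGroup (Fin 3) ℝ).1 * Matrix.of (cartanEntries Γ α β)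
        * (iota a).1
      = Matrix.of (cartanEntries ((a⁻¹ : GL2).val * Γ * a.val)
        ((a⁻¹ : GL2).val *ᵥ α) (β ᵥ* a.val)) := by
  have hinv : (a⁻¹ : GL2).val * a.val = 1 := a.inv_val
  have hc : (cbrt (Matrix.det (a⁻¹ : GL2).val))⁻¹ * (cbrt (Matrix.det a.val))⁻¹ = 1 := by
    rw [← mul_inv, ← cbrt_mul, ← Matrix.det_mul, hinv, Matrix.det_one, cbrt_one, inv_one]
  rw [← map_inv, iota_apply, iota_apply, Matrix.smul_mul, Matrix.mul_smul, Matrix.smul_mul,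
    smul_smul, mul_comm (cbrt _)⁻¹, hc, one_smul]
  exact blockOne_conj α β hinv

/-- The cube root is differentiable at `1`, the only point where its derivative is needed. -/
theorem hasDerivAt_cbrt_one : HasDerivAt cbrt (1 / 3) 1 := by
  have h := Real.hasDerivAt_rpow_const (x := 1) (p := 1 / 3) (Or.inl one_ne_zero)
  rw [Real.one_rpow, mul_one] at h
  refine h.congr_of_eventuallyEq ?_
  filter_upwards [lt_mem_nhds (zero_lt_one' ℝ)] with t ht
  simp [cbrt, sign_pos ht, abs_of_pos ht]

open scoped Matrix.Norms.Operator in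
theorem hasDerivAt_gexp (v : Mat 2) (i j : Fin 2) :
    HasDerivAt (fun t : ℝ => (gexp (t • v) : Mat 2) i j) (v i j) 0 := by
  have h := hasDerivAt_exp_smul_const (𝕂 := ℝ) v 0
  rw [zero_smul, NormedSpace.exp_zero, one_mul] at h
  have h1 := (hasDerivAt_pi.1 (hasDerivAt_pi.1 h i) j)
  exact h1

theorem gexp_zero_smul (v : Mat 2) : gexp ((0 : ℝ) • v) = 1 := by
  refine Units.ext ?_
  change NormedSpace.exp ((0 : ℝ) • v) = 1
  rw [zero_smul, NormedSpace.exp_zero]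

/-- The differential of the inclusion of `GL₂(ℝ)` in `SL₃(ℝ)` at the identity. -/
theorem hasDerivAt_iota_gexp (v : Mat 2) (i j : Fin 3) :
    HasDerivAt (fun t : ℝ => (iota (gexp (t • v))).1 i j) (cartanEntries v 0 0 i j) 0 := by
  have h := hasDerivAt_gexp v
  have h0 : ∀ i j, (gexp ((0 : ℝ) • v) : Mat 2) i j = (1 : Mat 2) i j := by
    intro i j
    rw [gexp_zero_smul, Units.val_one]
  have hdet : HasDerivAt (fun t : ℝ => Matrix.det (gexp (t • v) : Mat 2)) (v 0 0 + v 1 1) 0 := by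
    simp only [Matrix.det_fin_two]
    refine (((h 0 0).mul (h 1 1)).sub ((h 0 1).mul (h 1 0))).congr_deriv ?_
    rw [h0, h0, h0, h0]
    simp
  have hdet0 : Matrix.det (gexp ((0 : ℝ) • v) : Mat 2) = 1 := by
    rw [gexp_zero_smul, Units.val_one, Matrix.det_one]
  have hc : HasDerivAt (fun t : ℝ => (cbrt (Matrix.det (gexp (t • v) : Mat 2)))⁻¹)
      (-((1 / 3) * (v 0 0 + v 1 1))) 0 := by
    have h1 : HasDerivAt cbrt (1 / 3) (Matrix.det (gexp ((0 : ℝ) • v) : Mat 2)) := by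
      rw [hdet0]; exact hasDerivAt_cbrt_one
    have h2 := HasDerivAt.comp (h₂ := cbrt)
      (h := fun t : ℝ => Matrix.det (gexp (t • v) : Mat 2)) 0 h1 hdet
    have hcb : cbrt (Matrix.det (gexp ((0 : ℝ) • v) : Mat 2)) = 1 := by rw [hdet0, cbrt_one]
    refine (h2.inv (hcb.trans_ne one_ne_zero)).congr_deriv ?_
    change -(1 / 3 * (v 0 0 + v 1 1)) / cbrt (Matrix.det (gexp ((0 : ℝ) • v) : Mat 2)) ^ 2 = _
    rw [hcb, one_pow, div_one]
  have hb : HasDerivAt (fun t : ℝ => blockOne (gexp (t • v) : Mat 2) i j)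
      (!![v 0 0, v 0 1, 0; v 1 0, v 1 1, 0; 0, 0, 0] i j) 0 := by
    fin_cases i <;> fin_cases j
    exacts [h 0 0, h 0 1, hasDerivAt_const _ _, h 1 0, h 1 1, hasDerivAt_const _ _,
      hasDerivAt_const _ _, hasDerivAt_const _ _, hasDerivAt_const _ _]
  refine (hc.mul hb).congr_deriv ?_
  rw [hdet0, cbrt_one, gexp_zero_smul, Units.val_one]
  fin_cases i <;> fin_cases j <;> simp [blockOne, cartanEntries] <;> ring

end Blocks

/-! ### Uniqueness and equivariance of the connection form -/

section Connection

open scoped Matrix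

variable {M : Type u} [TopologicalSpace M] [ChartedSpace E4 M] [IsManifold 𝓘(ℝ, E4) ∞ M]
  {g : BilinField M} {K : EndField M} {hg : IsAlmostParaHermitian g K} (L : FrameAtlas hg)

/-- The projection is a submersion: the local section with constant matrix passes through `p`. -/
theorem FrameAtlas.exists_dProj_eq (p : L.Total) (v : E4) : ∃ ξ : E8, L.dProj p ξ = v := by
  let s : M → L.Total := fun x => ⟨x, (L.frame p.1 x).act (L.coord p.1 p)⟩
  have hs : s p.1 = p := congrArg (Sigma.mk p.1) (AdaptedFrame.act_coord hg _ _)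
  have hsm : ContMDiffAt 𝓘(ℝ, E4) 𝓘(ℝ, E8) ∞ s p.1 := L.contMDiffAt_of_e fun j =>
    contMDiffAt_tangent_sum_smul (f := fun x => x) (c := fun i _ => (L.coord p.1 p : Mat 2) i j)
      (v := fun i x => (L.frame p.1 x).e i) contMDiffAt_id (fun _ => contMDiffAt_const)
      (fun i => (L.smooth p.1 _ (L.mem_dom _)).e i)
  have h1 : mfderiv 𝓘(ℝ, E4) 𝓘(ℝ, E4) (fun x => L.proj (s x)) p.1 = _ :=
    mfderiv_comp (I' := 𝓘(ℝ, E8)) (g := L.proj) (f := s) p.1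
      (L.contMDiff_proj.mdifferentiableAt (by simp)) (hsm.mdifferentiableAt (by simp))
  have h2 : mfderiv 𝓘(ℝ, E4) 𝓘(ℝ, E4) (fun x => L.proj (s x)) p.1 = _ :=
    mfderiv_id (I := 𝓘(ℝ, E4)) (x := p.1)
  have h3 : ∃ ξ : E8, L.dProj (s p.1) ξ = v :=
    ⟨mfderiv 𝓘(ℝ, E4) 𝓘(ℝ, E8) s p.1 v, DFunLike.congr_fun (h1.symm.trans h2) v⟩
  exact Eq.subst (motive := fun q => ∃ ξ : E8, L.dProj q ξ = v) hs h3

/-- The first structure equations determine the connection form. -/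
theorem FrameAtlas.gam_eq_gam (hK : IsParaKahler g K) {x₀ x₁ : M} {p : L.Total}
    (h₀ : p.1 ∈ L.dom x₀) (h₁ : p.1 ∈ L.dom x₁) (i j : Fin 2) (ξ : TangentSpace 𝓘(ℝ, E8) p) :
    L.gam x₀ i j p ξ = L.gam x₁ i j p ξ := by
  choose X hX using fun v : E4 => L.exists_dProj_eq p v
  let D : Fin 2 → Fin 2 → E8 → ℝ := fun i j ξ => L.gam x₀ i j p ξ - L.gam x₁ i j p ξ
  -- the difference of the two forms, arranged as `diag(D, - Dᵀ)`, is skew for the metric that pairs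
  -- the two copies of `Fin 2`
  let δ : Fin 2 ⊕ Fin 2 → Fin 2 ⊕ Fin 2 → E8 → ℝ := fun a b ξ =>
    Sum.elim (fun i => Sum.elim (fun j => D i j ξ) (fun _ => 0) b)
      (fun i => Sum.elim (fun _ => 0) (fun j => -D j i ξ) b) a
  have key := cartan_lemma (ι := Fin 2 ⊕ Fin 2) (τ := Sum.swap) Sum.swap_swap (δ := δ)
    (θ := Sum.elim (fun i (ξ : E8) => L.alpha i p ξ) (fun i (ξ : E8) => L.alphaBar i p ξ))
    (Sum.elim (fun i => X (p.2.e i)) (fun i => X (p.2.ebar i))) ?_ ?_ ?_ (Sum.inl i) (Sum.inl j) ξ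
  · exact sub_eq_zero.1 key
  · have hα : ∀ i (v : E4), L.alpha i p (X v) = bilinAt g p.1 (p.2.bVec i) v := fun i v =>
      congrArg (bilinAt g p.1 (p.2.bVec i)) (hX v)
    have hβ : ∀ i (v : E4), L.alphaBar i p (X v) = bilinAt g p.1 (p.2.eVec i) v := fun i v =>
      congrArg (bilinAt g p.1 (p.2.eVec i)) (hX v)
    rintro (i | i) (j | j)
    · exact ((hα i _).trans (p.2.g_ebar_e i j)).trans (by simp)
    · exact ((hα i _).trans (p.2.g_ebar_ebar i j)).trans (by simp)
    · exact ((hβ i _).trans (p.2.g_e_e i j)).trans (by simp)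
    · exact ((hβ i _).trans (p.2.g_e_ebar i j)).trans (by simp)
  · rintro (i | i) (j | j) ζ <;> simp [δ]
  · rintro (i | i) ζ η
    · have h := (L.gam_torsion h₀ hK i ζ η).symm.trans (L.gam_torsion h₁ hK i ζ η)
      rw [neg_inj, ← sub_eq_zero, ← Finset.sum_sub_distrib] at h
      rw [Fintype.sum_sum_type]
      simp only [δ, Sum.elim_inl, Sum.elim_inr, zero_mul, sub_self, Finset.sum_const_zero, add_zero]
      refine Eq.trans (Finset.sum_congr rfl fun k _ => ?_) h
      simp only [D]
      ring
    · have h := (L.gam_torsion_bar h₁ hK i ζ η).symm.trans (L.gam_torsion_bar h₀ hK i ζ η)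
      rw [← sub_eq_zero, ← Finset.sum_sub_distrib] at h
      rw [Fintype.sum_sum_type]
      simp only [δ, Sum.elim_inl, Sum.elim_inr, zero_mul, sub_self, Finset.sum_const_zero, zero_add]
      refine Eq.trans (Finset.sum_congr rfl fun k _ => ?_) h
      simp only [D]
      ring

/-- The Levi-Civita connection form on the bundle of adapted frames. -/
def FrameAtlas.Gam (i j : Fin 2) : FormField E8 L.Total := fun p => L.gam p.1 i j p

theorem FrameAtlas.smoothFormAt_Gam (hK : IsParaKahler g K) (i j : Fin 2) (p : L.Total) :
    SmoothFormAt (L.Gam i j) p := by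
  intro v
  have hc : ∀ᶠ ξ : TangentBundle 𝓘(ℝ, E8) L.Total in 𝓝 ⟨p, v⟩, ξ.1.1 ∈ L.dom p.1 :=
    (FiberBundle.continuous_proj E8 (TangentSpace 𝓘(ℝ, E8))).continuousAt.eventually
      (L.dom_mem_nhds (L.mem_dom p.1))
  refine (L.smoothFormAt_gam (L.mem_dom p.1) i j v).congr_of_eventuallyEq (hc.mono fun ξ hξ => ?_)
  exact L.gam_eq_gam hK (L.mem_dom _) hξ i j ξ.2

/-- The values of `Γ`. -/
def FrameAtlas.GamMat (p : L.Total) (ξ : TangentSpace 𝓘(ℝ, E8) p) : Mat 2 :=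
  Matrix.of fun i j => L.Gam i j p ξ

theorem FrameAtlas.GamMat_eq (p : L.Total) (ξ : TangentSpace 𝓘(ℝ, E8) p) : L.GamMat p ξ
    = L.chiMat p.1 p * (L.omegaMat p.1 p ξ * L.psiMat p.1 p + L.deltaMat p.1 p ξ) := by
  ext i j
  exact L.gam_apply p.1 i j p ξ

theorem FrameAtlas.psiMat_act (x₀ : M) (p : L.Total) (a : GL2) :
    L.psiMat x₀ (L.act p a) = L.psiMat x₀ p * a.val := congrArg Units.val (L.coord_act x₀ p a)

theorem FrameAtlas.chiMat_act (x₀ : M) (p : L.Total) (a : GL2) :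
    L.chiMat x₀ (L.act p a) = (a⁻¹ : GL2).val * L.chiMat x₀ p :=
  congrArg Units.val ((congrArg (·⁻¹) (L.coord_act x₀ p a)).trans (mul_inv_rev _ _))

theorem FrameAtlas.contMDiff_act (a : GL2) :
    ContMDiff 𝓘(ℝ, E8) 𝓘(ℝ, E8) ∞ (fun q => L.act q a) :=
  ContMDiff.comp (g := fun q : L.Total × GL2 => L.act q.1 q.2) (f := fun q => (q, a))
    L.bundle.smooth_act (contMDiff_id.prodMk contMDiff_const)

/-- The differential of the action of an element of `GL₂(ℝ)`. -/
def FrameAtlas.dAct (a : GL2) (p : L.Total) : E8 →L[ℝ] E8 :=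
  mfderiv 𝓘(ℝ, E8) 𝓘(ℝ, E8) (fun q => L.act q a) p

theorem FrameAtlas.dProj_dAct (a : GL2) (p : L.Total) (ξ : E8) :
    L.dProj (L.act p a) (L.dAct a p ξ) = L.dProj p ξ := by
  have h : mfderiv 𝓘(ℝ, E8) 𝓘(ℝ, E4) L.proj p = _ :=
    mfderiv_comp (I' := 𝓘(ℝ, E8)) (g := L.proj) (f := fun q => L.act q a) p
      (L.contMDiff_proj.mdifferentiableAt (by simp))
      ((L.contMDiff_act a).mdifferentiableAt (by simp))
  exact (DFunLike.congr_fun h ξ).symm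

/-- `R_a^* dψ = dψ a`. -/
theorem FrameAtlas.deltaMat_dAct {x₀ : M} (a : GL2) {p : L.Total} (hp : p.1 ∈ L.dom x₀) (ξ : E8) :
    L.deltaMat x₀ (L.act p a) (L.dAct a p ξ) = L.deltaMat x₀ p ξ * a.val := by
  ext i j
  have hψ := fun i j => (L.contMDiffAt_psi hp i j).mdifferentiableAt (by simp : (∞ : ℕ∞ω) ≠ 0)
  have h1 : mfderiv 𝓘(ℝ, E8) 𝓘(ℝ, ℝ) (fun q => L.psi x₀ i j (L.act q a)) p = _ :=
    mfderiv_comp (I' := 𝓘(ℝ, E8)) (g := L.psi x₀ i j) (f := fun q => L.act q a) p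
      ((L.contMDiffAt_psi (p := L.act p a) hp i j).mdifferentiableAt (by simp))
      ((L.contMDiff_act a).mdifferentiableAt (by simp))
  have h2 : (fun q => L.psi x₀ i j (L.act q a)) = fun q => ∑ k, L.psi x₀ i k q * a.val k j := by
    funext q
    exact (congrFun (congrFun (L.psiMat_act x₀ q a) i) j).trans (Matrix.mul_apply ..)
  rw [Matrix.mul_apply]
  refine (DFunLike.congr_fun h1 ξ).symm.trans ?_
  change dFun (fun q => L.psi x₀ i j (L.act q a)) p ξ = _
  rw [h2]
  refine (dFun_sum_two (f := fun k q => L.psi x₀ i k q * a.val k j)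
    (fun k => (hψ i k).mul mdifferentiableAt_const) ξ).trans
      (Finset.sum_congr rfl fun k _ => ?_)
  refine (dFun_mul (hψ i k) mdifferentiableAt_const ξ).trans ?_
  refine (congrArg (fun t : ℝ => L.psi x₀ i k p * t + _) (dFun_const (a.val k j) p ξ)).trans ?_
  rw [mul_zero, zero_add]
  exact mul_comm _ _

/-- Equivariance of the connection form: `R_a^* Γ = a⁻¹ Γ a`. -/
theorem FrameAtlas.GamMat_dAct (a : GL2) (p : L.Total) (ξ : E8) :
    L.GamMat (L.act p a) (L.dAct a p ξ) = (a⁻¹ : GL2).val * L.GamMat p ξ * a.val := by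
  have hω : L.omegaMat p.1 (L.act p a) (L.dAct a p ξ) = L.omegaMat p.1 p ξ := by
    ext i j
    exact congrArg (fun v : E4 => localConn (L.frame p.1) i j p.1 v) (L.dProj_dAct a p ξ)
  refine (L.GamMat_eq _ _).trans ?_
  change L.chiMat p.1 (L.act p a) * (L.omegaMat p.1 (L.act p a) (L.dAct a p ξ)
    * L.psiMat p.1 (L.act p a) + L.deltaMat p.1 (L.act p a) (L.dAct a p ξ)) = _
  rw [hω, L.deltaMat_dAct a (L.mem_dom p.1), L.psiMat_act, L.chiMat_act]
  refine Eq.trans ?_ (congrArg (fun A : Mat 2 => (a⁻¹ : GL2).val * A * a.val)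
    (L.GamMat_eq p ξ).symm)
  noncomm_ring

theorem FrameAtlas.alpha_dAct (a : GL2) (p : L.Total) (ξ : E8) :
    (fun i => L.alpha i (L.act p a) (L.dAct a p ξ))
      = (a⁻¹ : GL2).val *ᵥ fun i => L.alpha i p ξ := by
  funext i
  refine (congrArg (fun v : E4 => bilinAt g p.1 ((p.2.act a).bVec i) v)
    (L.dProj_dAct a p ξ)).trans ?_
  exact clm_sum_smul_left _ _ _ _

theorem FrameAtlas.alphaBar_dAct (a : GL2) (p : L.Total) (ξ : E8) :
    (fun i => L.alphaBar i (L.act p a) (L.dAct a p ξ)) = (fun i => L.alphaBar i p ξ) ᵥ* a.val := by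
  funext i
  refine (congrArg (fun v : E4 => bilinAt g p.1 ((p.2.act a).eVec i) v)
    (L.dProj_dAct a p ξ)).trans ?_
  exact (clm_sum_smul_left (bilinAt g p.1) (fun k => a.val k i) p.2.eVec (L.dProj p ξ)).trans
    (Finset.sum_congr rfl fun k _ => mul_comm _ _)

end Connection

/-! ### The Cartan geometry of a para-Kähler structure -/

open scoped Matrix.Norms.Operator in
theorem contDiff_gexp (v : Mat 2) (i j : Fin 2) :
    ContDiff ℝ ∞ (fun t : ℝ => (gexp (t • v) : Mat 2) i j) := by
  rw [contDiff_iff_contDiffAt]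
  intro t
  have h1 : ContDiffAt ℝ ∞ (fun t : ℝ => NormedSpace.exp (t • v)) t :=
    ((NormedSpace.exp_analytic (𝕂 := ℝ) (t • v)).contDiffAt).comp t (by fun_prop)
  have h2 : ContDiffAt ℝ ∞ (fun A : Mat 2 => A i j) (NormedSpace.exp (t • v)) :=
    ((Matrix.entryLinearMap ℝ ℝ i j).toContinuousLinearMap).contDiff.contDiffAt
  exact h2.comp t h1

section Connection

open scoped Matrix

variable {M : Type u} [TopologicalSpace M] [ChartedSpace E4 M] [IsManifold 𝓘(ℝ, E4) ∞ M]
  {g : BilinField M} {K : EndField M} {hg : IsAlmostParaHermitian g K} (L : FrameAtlas hg)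

theorem FrameAtlas.contMDiff_orbit (v : Mat 2) (p : L.Total) :
    ContMDiff 𝓘(ℝ, ℝ) 𝓘(ℝ, E8) ∞ (fun t : ℝ => L.act p (gexp (t • v))) := fun _ =>
  L.contMDiffAt_of_e fun j =>
    contMDiffAt_tangent_sum_smul (f := fun _ : ℝ => p.1)
      (c := fun i t => (gexp (t • v) : Mat 2) i j) (v := fun i _ => p.2.e i) contMDiffAt_const
      (fun i => (contDiff_gexp v i j).contDiffAt.contMDiffAt) (fun _ => contMDiffAt_const)

/-- The velocity at `0` of the orbit `t ↦ p · exp(t v)`. -/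
def FrameAtlas.orbitVec (v : Mat 2) (p : L.Total) : E8 :=
  mfderiv 𝓘(ℝ, ℝ) 𝓘(ℝ, E8) (fun t : ℝ => L.act p (gexp (t • v))) 0 (1 : ℝ)

/-- The orbits are vertical. -/
theorem FrameAtlas.dProj_orbitVec (v : Mat 2) (p : L.Total) :
    L.dProj (L.act p (gexp ((0 : ℝ) • v))) (L.orbitVec v p) = 0 := by
  have h : mfderiv 𝓘(ℝ, ℝ) 𝓘(ℝ, E4) (fun _ : ℝ => p.1) 0 = _ :=
    mfderiv_comp (I' := 𝓘(ℝ, E8)) (g := L.proj) (f := fun t : ℝ => L.act p (gexp (t • v))) (0 : ℝ)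
      (L.contMDiff_proj.mdifferentiableAt (by simp))
      ((L.contMDiff_orbit v p).mdifferentiableAt (by simp))
  exact (DFunLike.congr_fun (h.symm.trans mfderiv_const) (1 : ℝ))

/-- `dψ` on the fundamental vector field of `v` is `ψ v`. -/
theorem FrameAtlas.deltaMat_orbitVec (v : Mat 2) {x₀ : M} {p : L.Total} (hp : p.1 ∈ L.dom x₀) :
    L.deltaMat x₀ (L.act p (gexp ((0 : ℝ) • v))) (L.orbitVec v p) = L.psiMat x₀ p * v := by
  ext i j
  have h1 : mfderiv 𝓘(ℝ, ℝ) 𝓘(ℝ, ℝ) (fun t : ℝ => L.psi x₀ i j (L.act p (gexp (t • v)))) 0 = _ :=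
    mfderiv_comp (I' := 𝓘(ℝ, E8)) (g := L.psi x₀ i j)
      (f := fun t : ℝ => L.act p (gexp (t • v))) (0 : ℝ)
      ((L.contMDiffAt_psi (p := L.act p (gexp ((0 : ℝ) • v))) hp i j).mdifferentiableAt (by simp))
      ((L.contMDiff_orbit v p).mdifferentiableAt (by simp))
  have h2 : (fun t : ℝ => L.psi x₀ i j (L.act p (gexp (t • v))))
      = fun t => L.psi x₀ i 0 p * (gexp (t • v) : Mat 2) 0 j
        + L.psi x₀ i 1 p * (gexp (t • v) : Mat 2) 1 j := by
    funext t
    refine (congrFun (congrFun (L.psiMat_act x₀ p (gexp (t • v))) i) j).trans ?_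
    rw [Matrix.mul_apply, Fin.sum_univ_two]
    rfl
  have h3 : HasDerivAt (fun t : ℝ => L.psi x₀ i j (L.act p (gexp (t • v))))
      ((L.psiMat x₀ p * v) i j) 0 := by
    rw [h2, Matrix.mul_apply, Fin.sum_univ_two]
    exact ((hasDerivAt_gexp v 0 j).const_mul _).add ((hasDerivAt_gexp v 1 j).const_mul _)
  have h4 : mfderiv 𝓘(ℝ, ℝ) 𝓘(ℝ, ℝ) (fun t : ℝ => L.psi x₀ i j (L.act p (gexp (t • v)))) 0 = _ :=
    mfderiv_eq_fderiv
  refine (DFunLike.congr_fun h1 (1 : ℝ)).symm.trans ((DFunLike.congr_fun h4 (1 : ℝ)).trans ?_)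
  exact h3.deriv

/-- The connection form reproduces the generators of the fundamental vector fields. -/
theorem FrameAtlas.GamMat_orbitVec (v : Mat 2) (p : L.Total) :
    L.GamMat (L.act p (gexp ((0 : ℝ) • v))) (L.orbitVec v p) = v := by
  have hω : L.omegaMat p.1 (L.act p (gexp ((0 : ℝ) • v))) (L.orbitVec v p) = 0 := by
    ext i j
    exact (congrArg (fun w : E4 => localConn (L.frame p.1) i j p.1 w)
      (L.dProj_orbitVec v p)).trans (map_zero (localConn (L.frame p.1) i j p.1))
  refine (L.GamMat_eq _ _).trans ?_
  change L.chiMat p.1 (L.act p (gexp ((0 : ℝ) • v)))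
    * (L.omegaMat p.1 (L.act p (gexp ((0 : ℝ) • v))) (L.orbitVec v p)
      * L.psiMat p.1 (L.act p (gexp ((0 : ℝ) • v)))
      + L.deltaMat p.1 (L.act p (gexp ((0 : ℝ) • v))) (L.orbitVec v p)) = _
  rw [hω, L.deltaMat_orbitVec v (L.mem_dom p.1), L.chiMat_act, gexp_zero_smul, inv_one,
    Units.val_one, zero_mul, zero_add, one_mul, ← mul_assoc, L.chi_mul_psi, one_mul]

/-- A tangent vector on which `α`, `ᾱ` and `Γ` vanish is zero. -/
theorem FrameAtlas.eq_zero_of_coframe {p : L.Total} {ξ : E8} (hα : ∀ i, L.alpha i p ξ = 0)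
    (hβ : ∀ i, L.alphaBar i p ξ = 0) (hΓ : ∀ i j, L.Gam i j p ξ = 0) : ξ = 0 := by
  have hp := L.mem_dom p.1
  -- `α`, `ᾱ` vanish on `ξ`, so `dπ ξ = 0`; then `Γ = ψ⁻¹ dψ` on `ξ`, so `dψ ξ = 0`
  have h0 : L.dProj p ξ = 0 :=
    eq_of_inner_frame (B := bilinAt g p.1) (e := p.2.eVec) (b := p.2.bVec)
      (hg.symm _) p.2.g_e_e p.2.g_ebar_ebar p.2.g_e_ebar
      (fun i => (hα i).trans (map_zero _).symm) (fun i => (hβ i).trans (map_zero _).symm)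
  have hω : L.omegaMat p.1 p ξ = 0 := by
    ext i j
    exact (congrArg (fun w : E4 => localConn (L.frame p.1) i j p.1 w) h0).trans
      (map_zero (localConn (L.frame p.1) i j p.1))
  have hδ : L.deltaMat p.1 p ξ = 0 := by
    have h1 : L.chiMat p.1 p * L.deltaMat p.1 p ξ = 0 := by
      have h2 : L.GamMat p ξ = 0 := by
        ext i j
        exact hΓ i j
      have h3 := (L.GamMat_eq p ξ).symm.trans h2
      rwa [hω, zero_mul, zero_add] at h3
    have h4 := congrArg (L.psiMat p.1 p * ·) h1
    simpa only [← mul_assoc, L.psi_mul_chi, one_mul, mul_zero] using h4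
  have hF := L.contMDiffAt_chart hp
  have hFd : MDifferentiableAt 𝓘(ℝ, E8) 𝓘(ℝ, E8) (L.chart p.1) p := hF.mdifferentiableAt (by simp)
  -- the chart consists of the coordinates of the base point and the matrix `ψ`
  have hz : mfderiv 𝓘(ℝ, E8) 𝓘(ℝ, E8) (L.chart p.1) p ξ = (0 : E8) := by
    refine Prod.ext ?_ (funext fun i => funext fun j => ?_)
    · let ℓ : E8 →L[ℝ] E4 := ContinuousLinearMap.fst ℝ E4 E22
      have h1 : mfderiv 𝓘(ℝ, E8) 𝓘(ℝ, E4) (fun q => (L.chart p.1 q).1) p = _ :=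
        mfderiv_comp (I' := 𝓘(ℝ, E8)) (g := ℓ) (f := L.chart p.1) p
          ℓ.differentiableAt.mdifferentiableAt hFd
      have h2 : mfderiv 𝓘(ℝ, E8) 𝓘(ℝ, E4) (fun q => (L.chart p.1 q).1) p = _ :=
        mfderiv_comp (I' := 𝓘(ℝ, E4)) (g := chartAt E4 p.1) (f := L.proj) p
          (mdifferentiableAt_atlas (chart_mem_atlas E4 _) (mem_chart_source E4 _))
          (L.contMDiff_proj.mdifferentiableAt (by simp))
      have h3 : mfderiv 𝓘(ℝ, E8) 𝓘(ℝ, E4) ℓ (L.chart p.1 p) = ℓ :=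
        mfderiv_eq_fderiv.trans ℓ.fderiv
      rw [h3] at h1
      refine (DFunLike.congr_fun (h1.symm.trans h2) ξ).trans ?_
      exact (congrArg (fun w : E4 => mfderiv 𝓘(ℝ, E4) 𝓘(ℝ, E4) (chartAt E4 p.1) p.1 w) h0).trans
        (map_zero _)
    · let ℓ : E8 →L[ℝ] ℝ := (ContinuousLinearMap.proj (R := ℝ) (φ := fun _ : Fin 2 => ℝ) j).comp
        ((ContinuousLinearMap.proj (R := ℝ) (φ := fun _ : Fin 2 => Fin 2 → ℝ) i).comp
          (ContinuousLinearMap.snd ℝ E4 E22))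
      have h1 : mfderiv 𝓘(ℝ, E8) 𝓘(ℝ, ℝ) (L.psi p.1 i j) p = _ :=
        mfderiv_comp (I' := 𝓘(ℝ, E8)) (g := ℓ) (f := L.chart p.1) p
          ℓ.differentiableAt.mdifferentiableAt hFd
      have h3 : mfderiv 𝓘(ℝ, E8) 𝓘(ℝ, ℝ) ℓ (L.chart p.1 p) = ℓ :=
        mfderiv_eq_fderiv.trans ℓ.fderiv
      rw [h3] at h1
      exact (DFunLike.congr_fun h1 ξ).symm.trans (congrFun (congrFun hδ i) j)
  have hs := L.contMDiffAt_chart_symm ((L.chart p.1).map_source hp)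
  have h1 : mfderiv 𝓘(ℝ, E8) 𝓘(ℝ, E8) (fun q => (L.chart p.1).symm (L.chart p.1 q)) p = _ :=
    mfderiv_comp (I' := 𝓘(ℝ, E8)) (g := (L.chart p.1).symm) (f := L.chart p.1) p
      (hs.mdifferentiableAt (by simp)) hFd
  have h2 : (fun q => (L.chart p.1).symm (L.chart p.1 q)) =ᶠ[𝓝 p] fun q => q :=
    (L.dom_mem_nhds hp).mono fun q hq => (L.chart p.1).left_inv hq
  have h3 := h2.mfderiv_eq (I := 𝓘(ℝ, E8)) (I' := 𝓘(ℝ, E8))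
  have h4 : mfderiv 𝓘(ℝ, E8) 𝓘(ℝ, E8) (fun q : L.Total => q) p = _ := mfderiv_id
  refine (DFunLike.congr_fun (h4.symm.trans (h3.symm.trans h1)) ξ).trans ?_
  exact (congrArg (fun w : E8 => (mfderiv 𝓘(ℝ, E8) 𝓘(ℝ, E8) (L.chart p.1).symm
    (L.chart p.1 p) : E8 →L[ℝ] E8) w) hz).trans (map_zero _)

/-- The forms `α`, `ᾱ`, `Γ` form a coframe. -/
theorem FrameAtlas.existsUnique_coframe (p : L.Total) (a b : Fin 2 → ℝ) (c : Fin 2 → Fin 2 → ℝ) :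
    ∃! ξ : E8, (∀ i, L.alpha i p ξ = a i) ∧ (∀ i, L.alphaBar i p ξ = b i)
      ∧ ∀ i j, L.Gam i j p ξ = c i j := by
  let α : Fin 2 → E8 →L[ℝ] ℝ := fun i => L.alpha i p
  let β : Fin 2 → E8 →L[ℝ] ℝ := fun i => L.alphaBar i p
  let Γ : Fin 2 → Fin 2 → E8 →L[ℝ] ℝ := fun i j => L.Gam i j p
  let Φ : E8 →ₗ[ℝ] ((Fin 2 → ℝ) × (Fin 2 → ℝ)) × (Fin 2 → Fin 2 → ℝ) :=
    ((LinearMap.pi fun i => (α i).toLinearMap).prod (LinearMap.pi fun i => (β i).toLinearMap)).prod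
      (LinearMap.pi fun i => LinearMap.pi fun j => (Γ i j).toLinearMap)
  have hinj : Function.Injective Φ := by
    rw [injective_iff_map_eq_zero]
    intro ξ h
    exact L.eq_zero_of_coframe (p := p) (fun i => congrFun (congrArg (·.1.1) h) i)
      (fun i => congrFun (congrArg (·.1.2) h) i)
      (fun i j => congrFun (congrFun (congrArg (·.2) h) i) j)
  have hsurj : Function.Surjective Φ :=
    (LinearMap.injective_iff_surjective_of_finrank_eq_finrank (by
      simp [Module.finrank_prod, Module.finrank_pi_fintype])).1 hinj
  obtain ⟨ξ, hξ⟩ := hsurj ((a, b), c)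
  refine ⟨ξ, ⟨fun i => congrFun (congrArg (·.1.1) hξ) i, fun i => congrFun (congrArg (·.1.2) hξ) i,
    fun i j => congrFun (congrFun (congrArg (·.2) hξ) i) j⟩, fun η hη => hinj ?_⟩
  rw [hξ]
  exact Prod.ext (Prod.ext (funext hη.1) (funext hη.2.1)) (funext fun i => funext (hη.2.2 i))

end Connection

section Connection

open scoped Matrix

variable {M : Type u} [TopologicalSpace M] [ChartedSpace E4 M] [IsManifold 𝓘(ℝ, E4) ∞ M]
  {g : BilinField M} {K : EndField M} {hg : IsAlmostParaHermitian g K} (L : FrameAtlas hg)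

/-- The entries of the Cartan connection. -/
def FrameAtlas.conn (i j : Fin 3) : FormField E8 L.Total := fun p =>
  cartanEntries (V := E8 →L[ℝ] ℝ) (fun k l => L.Gam k l p) (fun k => L.alpha k p)
    (fun k => L.alphaBar k p) i j

theorem FrameAtlas.conn_apply (i j : Fin 3) (p : L.Total) (ξ : E8) : L.conn i j p ξ
    = cartanEntries (fun k l => L.Gam k l p ξ) (fun k => L.alpha k p ξ)
      (fun k => L.alphaBar k p ξ) i j :=
  map_cartanEntries (V := E8 →L[ℝ] ℝ) (ContinuousLinearMap.apply ℝ ℝ ξ).toLinearMap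
    (fun k l => L.Gam k l p) (fun k => L.alpha k p) (fun k => L.alphaBar k p) i j

theorem contMDiffAt_cartanEntries {D : Type*} [NormedAddCommGroup D] [NormedSpace ℝ D]
    {H : Type*} [TopologicalSpace H] {J : ModelWithCorners ℝ D H} {X : Type*} [TopologicalSpace X]
    [ChartedSpace H X] {Γ : Fin 2 → Fin 2 → X → ℝ} {α β : Fin 2 → X → ℝ} {x : X}
    (hΓ : ∀ i j, ContMDiffAt J 𝓘(ℝ, ℝ) ∞ (Γ i j) x) (hα : ∀ i, ContMDiffAt J 𝓘(ℝ, ℝ) ∞ (α i) x)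
    (hβ : ∀ i, ContMDiffAt J 𝓘(ℝ, ℝ) ∞ (β i) x) (i j : Fin 3) :
    ContMDiffAt J 𝓘(ℝ, ℝ) ∞ (fun q =>
      cartanEntries (fun k l => Γ k l q) (fun k => α k q) (fun k => β k q) i j) x := by
  have ht : ContMDiffAt J 𝓘(ℝ, ℝ) ∞ (fun q => (1 / 3 : ℝ) • (Γ 0 0 q + Γ 1 1 q)) x :=
    contMDiffAt_const.mul ((hΓ 0 0).add (hΓ 1 1))
  have ht' : ContMDiffAt J 𝓘(ℝ, ℝ) ∞ (fun q => -((1 / 3 : ℝ) • (Γ 0 0 q + Γ 1 1 q))) x := ht.neg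
  fin_cases i <;> fin_cases j
  exacts [(hΓ 0 0).sub ht, hΓ 0 1, hα 0, hΓ 1 0, (hΓ 1 1).sub ht, hα 1, hβ 0, hβ 1, ht']

/-- Every trace-free matrix is in block form; the lower right entry determines `tr Γ`. -/
theorem cartanEntries_surj {X : Mat 3} (hX : X.trace = 0) :
    cartanEntries (fun i j : Fin 2 => X i.castSucc j.castSucc - if i = j then X 2 2 else 0)
      (fun i => X i.castSucc 2) (fun i => X 2 i.castSucc) = X := by
  have h : X 0 0 + X 1 1 + X 2 2 = 0 := by rwa [Matrix.trace_fin_three] at hX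
  funext i j
  fin_cases i <;> fin_cases j <;> simp [cartanEntries] <;> linarith

theorem cartanEntries_inj {V : Type*} [AddCommGroup V] [Module ℝ V] {Γ Γ' : Fin 2 → Fin 2 → V}
    {α α' β β' : Fin 2 → V} (h : ∀ i j, cartanEntries Γ α β i j = cartanEntries Γ' α' β' i j) :
    (∀ i, α i = α' i) ∧ (∀ i, β i = β' i) ∧ ∀ i j, Γ i j = Γ' i j := by
  refine ⟨fun i => ?_, fun i => ?_, fun i j => ?_⟩
  · rw [← cartanEntries_col Γ α β, h, cartanEntries_col]
  · rw [← cartanEntries_row Γ α β, h, cartanEntries_row]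
  · rw [← cartanEntries_block Γ α β, h, h, cartanEntries_block]

/-- Equivariance of the Cartan connection. -/
theorem FrameAtlas.conn_dAct (a : GL2) (p : L.Total) (ξ : E8) :
    Matrix.of (fun i j => L.conn i j (L.act p a) (L.dAct a p ξ))
      = ((iota a)⁻¹ : Matrix.SpecialLinearGroup (Fin 3) ℝ).1
        * Matrix.of (fun i j => L.conn i j p ξ) * (iota a).1 := by
  have h1 : Matrix.of (fun i j => L.conn i j p ξ) = Matrix.of (cartanEntries (L.GamMat p ξ)
      (fun i => L.alpha i p ξ) (fun i => L.alphaBar i p ξ)) := by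
    ext i j
    exact L.conn_apply i j p ξ
  rw [h1]
  refine Eq.trans ?_ (iota_conj a (L.GamMat p ξ) _ _).symm
  rw [← L.GamMat_dAct, ← L.alpha_dAct, ← L.alphaBar_dAct]
  ext i j
  exact L.conn_apply i j (L.act p a) (L.dAct a p ξ)

/-- The Cartan geometry of a para-Kähler structure. -/
def FrameAtlas.cartanGeometry (hK : IsParaKahler g K) : CartanGeometry M where
  toPrincipalGL2Bundle := L.bundle
  conn := L.conn
  smooth_conn i j ξ := by
    refine (contMDiffAt_cartanEntries (fun k l => L.smoothFormAt_Gam hK k l ξ.1 ξ.2)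
      (fun k => L.smoothFormAt_alpha (L.mem_dom ξ.1.1) k ξ.2)
      (fun k => L.smoothFormAt_alphaBar (L.mem_dom ξ.1.1) k ξ.2) i j).congr_of_eventuallyEq
      (Filter.Eventually.of_forall fun η => ?_)
    exact L.conn_apply i j η.1 η.2
  trace_zero p ξ := by
    refine (Finset.sum_congr rfl fun i _ => L.conn_apply i i p ξ).trans (cartanEntries_trace _ _ _)
  iso p X hX := by
    obtain ⟨ξ, ⟨h1, h2, h3⟩, hu⟩ := L.existsUnique_coframe p (fun i => X i.castSucc 2)
      (fun i => X 2 i.castSucc) (fun i j => X i.castSucc j.castSucc - if i = j then X 2 2 else 0)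
    refine ⟨ξ, fun i j => ?_, fun η hη => hu η ?_⟩
    · refine (L.conn_apply i j p ξ).trans ?_
      rw [funext h1, funext h2, funext fun i => funext (h3 i), cartanEntries_surj hX]
    · exact cartanEntries_inj fun i j => ((L.conn_apply i j p η).symm.trans (hη i j)).trans
        (congrFun (congrFun (cartanEntries_surj hX) i) j).symm
  equivariant a p ξ := L.conn_dAct a p ξ
  reproduces v p i j := by
    refine (hasDerivAt_iota_gexp v i j).congr_deriv ?_
    refine Eq.trans ?_ (L.conn_apply i j (L.act p (gexp ((0 : ℝ) • v))) (L.orbitVec v p)).symm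
    have h1 : (fun k => L.alpha k (L.act p (gexp ((0 : ℝ) • v))) (L.orbitVec v p)) = 0 :=
      funext fun k => (congrArg (bilinAt g p.1 ((p.2.act (gexp ((0 : ℝ) • v))).bVec k))
        (L.dProj_orbitVec v p)).trans (map_zero _)
    have h2 : (fun k => L.alphaBar k (L.act p (gexp ((0 : ℝ) • v))) (L.orbitVec v p)) = 0 :=
      funext fun k => (congrArg (bilinAt g p.1 ((p.2.act (gexp ((0 : ℝ) • v))).eVec k))
        (L.dProj_orbitVec v p)).trans (map_zero _)
    rw [h1, h2]
    exact congrArg (fun Γ : Fin 2 → Fin 2 → ℝ => cartanEntries Γ 0 0 i j)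
      (L.GamMat_orbitVec v p).symm

theorem FrameAtlas.gam_cartanGeometry (hK : IsParaKahler g K) (p : L.Total) (ξ : E8)
    (i j : Fin 2) : (L.cartanGeometry hK).Gam p ξ i j = L.Gam i j p ξ := by
  refine Eq.trans ?_ (cartanEntries_block (fun k l => L.Gam k l p ξ) (fun k => L.alpha k p ξ)
    (fun k => L.alphaBar k p ξ) i j)
  exact congrArg₂ (fun s t : ℝ => s - if i = j then t else 0) (L.conn_apply _ _ p ξ)
    (L.conn_apply _ _ p ξ)

theorem FrameAtlas.isFrameGeometry (hK : IsParaKahler g K) :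
    IsFrameGeometry (g := g) (K := K) (L.cartanGeometry hK) (fun p : L.Total => p.2) where
  bijective := Function.bijective_id
  equivariant _ _ := rfl
  smooth_e := L.contMDiff_e
  smooth_ebar := L.contMDiff_ebar
  conn_alpha p ξ i := (L.conn_apply i.castSucc 2 p ξ).trans (cartanEntries_col _ _ _ i)
  conn_alphaBar p ξ i := (L.conn_apply 2 i.castSucc p ξ).trans (cartanEntries_row _ _ _ i)
  torsion_free i p ξ η := by
    refine (L.gam_torsion (L.mem_dom p.1) hK i ξ η).trans (congrArg Neg.neg
      (Finset.sum_congr rfl fun j _ => ?_))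
    exact congrArg₂ (fun s t : ℝ => s * L.alpha j p η - t * L.alpha j p ξ)
      (L.gam_cartanGeometry hK p ξ i j).symm (L.gam_cartanGeometry hK p η i j).symm
  torsion_free_bar j p ξ η := by
    refine (L.gam_torsion_bar (L.mem_dom p.1) hK j ξ η).trans (Finset.sum_congr rfl fun i _ => ?_)
    exact congrArg₂ (fun s t : ℝ => s * L.alphaBar i p η - t * L.alphaBar i p ξ)
      (L.gam_cartanGeometry hK p ξ i j).symm (L.gam_cartanGeometry hK p η i j).symm

end Connection

/-- The bundle of adapted null frames of a para-Kähler structure, with its Cartan connection. -/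
theorem exists_isFrameGeometry {M : Type u} [TopologicalSpace M] [ChartedSpace E4 M]
    [IsManifold 𝓘(ℝ, E4) ∞ M] {g : BilinField M} {K : EndField M} (hK : IsParaKahler g K) :
    ∃ (𝒢 : CartanGeometry M) (fr : ∀ p : 𝒢.P, AdaptedFrame g K (𝒢.proj p)),
      IsFrameGeometry 𝒢 fr :=
  (exists_frameAtlas hK.toIsAlmostParaHermitian).elim fun L => ⟨_, _, L.isFrameGeometry hK⟩

end PKE

end

theorem mainTheorem4 :
    (∀ (M : Type u) [TopologicalSpace M] [ChartedSpace PKE.E4 M]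
        [IsManifold 𝓘(ℝ, PKE.E4) ∞ M] (g : PKE.BilinField M) (K : PKE.EndField M),
        PKE.IsParaKahlerEinstein g K →
        (∃ (𝒢 : PKE.CartanGeometry M) (fr : ∀ p : 𝒢.P, PKE.AdaptedFrame g K (𝒢.proj p)),
            PKE.IsFrameGeometry 𝒢 fr) ∧
        (∀ (𝒢 : PKE.CartanGeometry M) (fr : ∀ p : 𝒢.P, PKE.AdaptedFrame g K (𝒢.proj p)),
            PKE.IsFrameGeometry 𝒢 fr →
              (𝒢.IsFlat ↔ PKE.PsiTwoPrimeEqOne g K ∧ PKE.WeylMinusVanishes g K) ∧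
              (𝒢.IsFlat ↔ PKE.HasEinsteinConstant g (-3) ∧ PKE.WeylMinusVanishes g K) ∧
              (𝒢.IsFlat ↔
                PKE.IsLocallyEquivalent g K PKE.dancingMetric PKE.dancingK))) ∧
    PKE.IsParaKahlerEinstein PKE.dancingMetric PKE.dancingK := by
  refine ⟨fun M _ _ _ g K hg => ⟨PKE.exists_isFrameGeometry hg.toIsParaKahler,
    fun 𝒢 fr h => ⟨PKE.isFlat_iff_psi h hg, PKE.isFlat_iff_einstein h hg,
      PKE.isFlat_iff_isLocallyEquivalent h hg.toIsAlmostParaHermitian⟩⟩,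
    PKE.isParaKahlerEinstein_dancing⟩
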